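/- **Setting.** Let $d\ge 2$ and let $P\in\mathbb{C}[z,w]$ be a polynomial of degree $d$ such that $C=\{P=0\}\subset\mathbb{C}^2$ is a smooth complex curve (that is, $dP\neq 0$ along $C$) and the zero locus $L=\{P_d=0\}$ of the homogeneous degree $d$ part $P_d$ of $P$ consists of $d$ distinct complex lines. Let $\frac{d-2}{d}<\beta<1$ and put $c=2+d\beta-d\in(0,2)$. *The flat metric.* Let $g$ be a compatible metric on $\mathbb{CP}^1$ of constant Gaussian curvature $4$ with cone angle $2\pi\beta$ at the $d$ points corresponding to the lines of $L$; i.e. $g$ is conformal and smooth away from these points, where it is locally $|d\eta|^2/(1+|\eta|^2)^2$ in a holomorphic coordinate $\eta$, and at each of the $d$ points there is a centred holomorphic coordinate $\eta$ with $g=\beta^2|\eta|^{2\beta-2}|d\eta|^2/(1+|\eta|^{2\beta})^2$. Write $g=|w\,dz-z\,dw|^2/h^2$ with $h>0$ on $\mathbb{C}^2\setminus L$, $h(\lambda x)=|\lambda|^2h(x)$. Let $\omega_F=\frac{i}{2}\partial\overline{\partial}\left(\frac{2}{c}|P_d|^{\beta-1}h\right)$ be the Kähler form of the associated flat metric $g_F$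 on $\mathbb{C}^2\setminus L$, and let $r$ be the intrinsic distance to $0$ in $g_F$. *The class $\mathcal{D}$.* $\mathcal{D}$ is the set of diffeomorphisms $F$ of $\mathbb{C}^2$ for which there are a compact set $K$ with $F(C\setminus K)\subset L$ and constants $A_j$ with $|F(x)-x|\le A_0$, $|DF(x)-\mathrm{Id}|\le A_1|x|^{-1}$ and $|D^{j}F(x)|\le A_j|x|^{-j}$ for all $x$ and all $j\ge 2$ (at $x=0$ only the first bound is a condition). *Cone singularities.* A Kähler metric with cone singularities of angle $\beta$ along $C$ is a smooth Kähler metric $\omega$ on $\mathbb{C}^2\setminus C$ such that, for every $0<\alpha<\min(1,\beta^{-1}-1)$ and every $p\in C$, there are holomorphic coordinates $(z_1,z_2)$ centred at $p$ with $C=\{z_1=0\}$ in which $\omega=\omega_{(\beta)}+\eta$, where $\omega_{(\beta)}=\beta^2|z_1|^{2\beta-2}\,i\,dz_1\wedge d\overline{z}_1+i\,dz_2\wedge d\overline{z}_2$, and $\eta$ is of class $C^\alpha$ with $\eta(p)=0$. Here $\eta\in C^\alpha$ means: with $\epsilon_1=\beta|z_1|^{\beta-1}dz_1$ and $\epsilon_2=dz_2$,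 one has $\eta=\sum_{j,k} f_{j\bar k}\,i\,\epsilon_j\wedge\overline{\epsilon}_k$ with $f_{j\bar k}$ Hölder continuous of exponent $\alpha$ as functions of $(|z_1|^{\beta-1}z_1,\,z_2)$, and $f_{1\bar 2},f_{2\bar 1}$ vanish on $\{z_1=0\}$; $\eta(p)=0$ means that all $f_{j\bar k}$ vanish at $p$. **Proposition (Reference metrics).** In this setting there exist $H\in\mathcal{D}$ and Kähler metrics $\omega,\omega_{ref}$ with cone singularities of angle $\beta$ along $C$ and positive constants $B,Q$ such that 1. $|(H^{-1})^*\omega-\omega_F|_{g_F}=O(r^{-2/c})$, i.e. it is bounded by a constant times $r^{-2/c}$ on the complement of $L$ and of a compact set; 2. $\mathrm{Bisec}(\omega_{ref})\le B$ on $\mathbb{C}^2\setminus C$, where for $\omega_{ref}=\sum g_{i\bar j}\,i\,dz_i\wedge d\overline{z}_j$ and $(1,0)$-vectors $v,u$ with $|v|_{\omega_{ref}}=|u|_{\omega_{ref}}=1$ (that is, $\sum g_{i\bar j}v_i\overline{v_j}=\sum g_{i\bar j}u_i\overline{u_j}=1$) one sets $\mathrm{Bisec}(v,u)=\sum R_{i\bar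 jk\bar l}v_i\overline{v_j}u_k\overline{u_l}$, $R_{i\bar jk\bar l}=-\partial_k\partial_{\bar l}g_{i\bar j}+\sum_{s,t}g^{s\bar t}\,\partial_kg_{i\bar t}\,\partial_{\bar l}g_{s\bar j}$; 3. $Q^{-1}\omega_{ref}\le\omega\le Q\,\omega_{ref}$ on $\mathbb{C}^2\setminus C$. -/

import Mathlib

open scoped ContDiff Manifold Topology NNReal ENNReal

noncomputable section

namespace ConeMetrics

/-- The complex plane `ℂ²` with its Euclidean norm. The standard coordinates are `z = x 0` and
`w = x 1`; the complex structure is `v ↦ Complex.I • v`. -/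
abbrev Plane : Type := EuclideanSpace ℂ (Fin 2)

/-- Real alternating two-forms on the real vector space underlying `ℂ²`. -/
abbrev TwoForm : Type := Plane [⋀^Fin 2]→L[ℝ] ℝ

/-- The standard basis vectors of `ℂ²`. -/
def stdVec (i : Fin 2) : Plane := EuclideanSpace.single i 1

/-- The complex structure as a real linear map. -/
def complexStr : Plane →L[ℝ] Plane :=
  (Complex.I • ContinuousLinearMap.id ℂ Plane).restrictScalars ℝ

/-! ### The curve and its asymptotic lines -/

/-- The affine curve `C = {P = 0}`. -/
def curve (P : MvPolynomial (Fin 2) ℂ) : Set Plane :=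
  {x | MvPolynomial.eval (fun i => x i) P = 0}

/-- The zero locus `L = {P_d = 0}` of the homogeneous part of degree `d` of `P`. -/
def asymptoticLines (P : MvPolynomial (Fin 2) ℂ) (d : ℕ) : Set Plane :=
  curve (MvPolynomial.homogeneousComponent d P)

/-- `C = {P = 0}` is smooth: `dP` has no zero on `C`. -/
def IsSmoothCurve (P : MvPolynomial (Fin 2) ℂ) : Prop :=
  ∀ x ∈ curve P, ∃ i, MvPolynomial.eval (fun k => x k) (MvPolynomial.pderiv i P) ≠ 0

/-- The determinant of two vectors of `ℂ²`. -/
def wedge (q e : Plane) : ℂ := q 0 * e 1 - q 1 * e 0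

/-- The zero locus of the degree `d` part of `P` consists of `d` distinct complex lines
(spanned by the pairwise independent vectors `ℓ k`). -/
def HasDistinctAsymptoticLines (P : MvPolynomial (Fin 2) ℂ) (d : ℕ) : Prop :=
  ∃ ℓ : Fin d → Plane, (∀ j k, j ≠ k → wedge (ℓ j) (ℓ k) ≠ 0) ∧
    asymptoticLines P d = ⋃ k, {x | ∃ a : ℂ, x = a • ℓ k}

/-! ### Forms and Kähler metrics -/

/-- The real two-form `i ∂∂̄ f = -(1/2) d (df ∘ I)`. -/
def iddbar (f : Plane → ℝ) (x : Plane) : TwoForm :=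
  -(1 / 2 : ℝ) • extDeriv
    (fun y => ContinuousAlternatingMap.ofSubsingleton ℝ Plane ℝ (0 : Fin 1)
      ((fderiv ℝ f y).comp complexStr)) x

/-- The pull-back `F^* κ` of a two-form. -/
def pullback (F : Plane → Plane) (κ : Plane → TwoForm) (y : Plane) : TwoForm :=
  (κ (F y)).compContinuousLinearMap (fderiv ℝ F y)

/-- The length `|v|_g` of a tangent vector, where `g (v, w) = σ (v, I w)` is the metric associated
to the `(1,1)`-form `σ`. -/
def vecNorm (σ : TwoForm) (v : Plane) : ℝ := √(σ ![v, Complex.I • v])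

/-- `κ` is (the Kähler form of) a smooth Kähler metric on the open set `U`. -/
structure IsKahlerOn (κ : Plane → TwoForm) (U : Set Plane) : Prop where
  smooth : ContDiffOn ℝ ∞ κ U
  closed : ∀ x ∈ U, extDeriv κ x = 0
  invariant : ∀ x ∈ U, ∀ v w : Plane, κ x ![Complex.I • v, Complex.I • w] = κ x ![v, w]
  positive : ∀ x ∈ U, ∀ v : Plane, v ≠ 0 → 0 < κ x ![v, Complex.I • v]

/-- The coefficients `g_{i j̄}` of a `(1,1)`-form `σ = ∑ g_{i j̄} i dz_i ∧ dz̄_j`. -/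
def hermCoeff (σ : TwoForm) (i j : Fin 2) : ℂ :=
  ((σ ![stdVec i, Complex.I • stdVec j] : ℂ) - Complex.I * (σ ![stdVec i, stdVec j] : ℂ)) / 2

/-! ### Bisectional curvature -/

/-- The Wirtinger derivative `∂ f / ∂ z_k`. -/
def dHol (k : Fin 2) (f : Plane → ℂ) (x : Plane) : ℂ :=
  (fderiv ℝ f x (stdVec k) - Complex.I * fderiv ℝ f x (Complex.I • stdVec k)) / 2

/-- The Wirtinger derivative `∂ f / ∂ z̄_k`. -/
def dAntihol (k : Fin 2) (f : Plane → ℂ) (x : Plane) : ℂ :=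
  (fderiv ℝ f x (stdVec k) + Complex.I * fderiv ℝ f x (Complex.I • stdVec k)) / 2

/-- `R_{i j̄ k l̄} = - g_{i j̄, k l̄} + ∑ g^{s t̄} g_{i t̄, k} g_{s j̄, l̄}`, where `(g^{s t̄})` is the
inverse transpose of `(g_{i j̄})`. -/
def curvature (κ : Plane → TwoForm) (x : Plane) (i j k l : Fin 2) : ℂ :=
  -dHol k (dAntihol l (fun y => hermCoeff (κ y) i j)) x +
    ∑ s, ∑ t, (Matrix.of (hermCoeff (κ x)))⁻¹ t s *
      dHol k (fun y => hermCoeff (κ y) i t) x * dAntihol l (fun y => hermCoeff (κ y) s j) x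

/-- `|v|²_κ = ∑ g_{i j̄} v_i v̄_j` for `v = ∑ v_i ∂/∂z_i` of type `(1,0)`. -/
def hermNormSq (σ : TwoForm) (v : Plane) : ℝ :=
  (∑ i, ∑ j, hermCoeff σ i j * v i * (starRingEnd ℂ) (v j)).re

/-- `R (v, v̄, w, w̄) = ∑ R_{i j̄ k l̄} v_i v̄_j w_k w̄_l` (a real number for a Kähler metric). -/
def bisec (κ : Plane → TwoForm) (x v w : Plane) : ℝ :=
  (∑ i, ∑ j, ∑ k, ∑ l, curvature κ x i j k l *
    v i * (starRingEnd ℂ) (v j) * w k * (starRingEnd ℂ) (w l)).re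

/-- `Bisec (κ) ≤ B` on `U`. -/
def BisecLE (κ : Plane → TwoForm) (U : Set Plane) (B : ℝ) : Prop :=
  ∀ x ∈ U, ∀ v w : Plane, hermNormSq (κ x) v = 1 → hermNormSq (κ x) w = 1 → bisec κ x v w ≤ B

/-! ### Cone singularities along a curve -/

/-- The map `(z_1, z_2) ↦ (r_1 e^{iθ_1}, z_2)` with `z_1 = r_1^{1/β} e^{iθ_1}`, that is
`r_1 = |z_1|^β`. -/
def coneChart (β : ℝ) (y : Plane) : Plane := !₂[((‖y 0‖ ^ (β - 1) : ℝ) : ℂ) * y 0, y 1]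

/-- The coframe `ε₁ = β |z_1|^{β-1} dz_1`, `ε₂ = dz_2` is `frameFactor β y i • dz_i`. -/
def frameFactor (β : ℝ) (y : Plane) : Fin 2 → ℝ := ![β * ‖y 0‖ ^ (β - 1), 1]

/-- `κ` has, at the point `p` of the curve `C`, the form `κ = κ_(β) + η` with `η ∈ C^α` and
`η (p) = 0`, in holomorphic coordinates `(z_1, z_2)` centred at `p` in which `C = {z_1 = 0}`. Here
`κ_(β) = β² |z_1|^{2β-2} i dz_1 ∧ dz̄_1 + i dz_2 ∧ dz̄_2 = ∑ i ε_k ∧ ε̄_k`, and `η ∈ C^α` means that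
`η = ∑ f_{i j̄} i ε_i ∧ ε̄_j` where the `f_{i j̄}` are `α`-Hölder functions of `(r_1 e^{iθ_1}, z_2)` and
the mixed components `f_{1 2̄}`, `f_{2 1̄}` vanish on `{z_1 = 0}`. -/
def HasConeFormAt (C : Set Plane) (β : ℝ) (α : ℝ≥0) (κ : Plane → TwoForm) (p : Plane) : Prop :=
  ∃ φ : OpenPartialHomeomorph Plane Plane,
    p ∈ φ.source ∧ φ p = 0 ∧
    DifferentiableOn ℂ φ φ.source ∧ DifferentiableOn ℂ φ.symm φ.target ∧
    (∀ x ∈ φ.source, x ∈ C ↔ φ x 0 = 0) ∧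
    ∃ (N : ℝ≥0) (f : Fin 2 → Fin 2 → Plane → ℂ),
      (∀ i j, HolderOnWith N α (f i j) (coneChart β '' φ.target)) ∧
      (∀ i j, f i j 0 = 0) ∧
      (∀ i j, i ≠ j → ∀ u ∈ coneChart β '' φ.target, u 0 = 0 → f i j u = 0) ∧
      ∀ y ∈ φ.target, y 0 ≠ 0 → ∀ i j,
        hermCoeff (pullback φ.symm κ y) i j =
          ((if i = j then 1 else 0) + f i j (coneChart β y)) *
            (frameFactor β y i : ℂ) * (frameFactor β y j : ℂ)

/-- `κ` is a Kähler metric on `ℂ²` with cone singularities of angle `β` (total angle `2πβ`) along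
the curve `C`; the Hölder exponent `α` runs over the range `0 < α < 1`, `α < 1/β - 1`. -/
def IsKahlerWithConeSingularities (C : Set Plane) (β : ℝ) (κ : Plane → TwoForm) : Prop :=
  IsKahlerOn κ Cᶜ ∧
    ∀ α : ℝ≥0, 0 < α → α < 1 → (α : ℝ) < β⁻¹ - 1 → ∀ p ∈ C, HasConeFormAt C β α κ p

/-! ### The spherical metric on the projective line and the flat metric -/

/-- Compatible metrics on an open subset of `ℂℙ¹` are written homogeneously as
`g = |w dz - z dw|² / h²`, with a positive function `h` on the cone over this subset such that
`h (λ x) = |λ|² h (x)`; in the affine coordinate `ζ ↦ [q + ζ e]` with `det (q, e) = 1` this is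
`g = |dζ|² / h (q + ζ e)²`. The predicate says that `g` is a compatible metric on the complement of
the points `[L]`, of constant Gaussian curvature `4` (locally isometric to the round sphere
`|dη|² / (1 + |η|²)²`), with cone angle `2πβ` at each point of `[L]`: there is a holomorphic
coordinate `η` centred at that point in which
`g = β² |η|^{2β-2} |dη|² / (1 + |η|^{2β})²`. -/
structure IsSphericalConeMetric (L : Set Plane) (β : ℝ) (h : Plane → ℝ) : Prop where
  smooth : ContDiffOn ℝ ∞ h Lᶜ
  positive : ∀ x, x ∉ L → 0 < h x
  homogeneous : ∀ (a : ℂ) (x : Plane), a ≠ 0 → x ∉ L → h (a • x) = ‖a‖ ^ 2 * h x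
  round : ∀ q e : Plane, wedge q e = 1 → q ∉ L →
    ∃ η : ℂ → ℂ, AnalyticAt ℂ η 0 ∧
      ∀ᶠ ζ in 𝓝 (0 : ℂ), 1 / h (q + ζ • e) = ‖deriv η ζ‖ / (1 + ‖η ζ‖ ^ 2)
  cone : ∀ q e : Plane, wedge q e = 1 → q ∈ L →
    ∃ η : ℂ → ℂ, AnalyticAt ℂ η 0 ∧ η 0 = 0 ∧ deriv η 0 ≠ 0 ∧
      ∀ᶠ ζ in 𝓝[≠] (0 : ℂ), 1 / h (q + ζ • e) =
        β * ‖η ζ‖ ^ (β - 1) * ‖deriv η ζ‖ / (1 + ‖η ζ‖ ^ (2 * β))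

/-- The exponent `c = 2 + dβ - d`. -/
def coneExp (d : ℕ) (β : ℝ) : ℝ := 2 + d * β - d

/-- The Kähler potential `(2/c) |P_d|^{β-1} h` of the flat metric. If `P_d = w ∏ (z - a_j w)` and
`g = e^{2φ} |dξ|²` with `ξ = z / w`, it equals `(2/c) |w|^c e^{-u}`,
`u = φ - (β-1) ∑ log |ξ - a_j|`. -/
def flatPotential (P : MvPolynomial (Fin 2) ℂ) (d : ℕ) (β : ℝ) (h : Plane → ℝ) (x : Plane) : ℝ :=
  2 / coneExp d β *
    ‖MvPolynomial.eval (fun i => x i) (MvPolynomial.homogeneousComponent d P)‖ ^ (β - 1) * h x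

/-- The Kähler form `κ_F = (i/2) ∂∂̄ ((2/c) |P_d|^{β-1} h)` of the flat metric `g_F` on `ℂ² \ L`
obtained from the spherical metric. -/
def flatForm (P : MvPolynomial (Fin 2) ℂ) (d : ℕ) (β : ℝ) (h : Plane → ℝ) (x : Plane) : TwoForm :=
  (1 / 2 : ℝ) • iddbar (flatPotential P d β h) x

/-- Curves from `0` to `p`, continuous on `[0,1]`, and continuously differentiable with values in
`U` after time `0`. -/
def IsCurveFromZero (U : Set Plane) (p : Plane) (γ : ℝ → Plane) : Prop :=
  ContinuousOn γ (Set.Icc 0 1) ∧ γ 0 = 0 ∧ γ 1 = p ∧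
    ContDiffOn ℝ 1 γ (Set.Ioc 0 1) ∧ ∀ t ∈ Set.Ioc (0 : ℝ) 1, γ t ∈ U

/-- The intrinsic distance from `0` to `p` in the metric of `κ` on `U`: the infimum of the lengths of
curves from `0` to `p`. -/
def distZero (κ : Plane → TwoForm) (U : Set Plane) (p : Plane) : ℝ :=
  (⨅ γ : {γ : ℝ → Plane // IsCurveFromZero U p γ},
    ∫⁻ t in Set.Ioo (0 : ℝ) 1, ENNReal.ofReal (vecNorm (κ (γ.1 t)) (deriv γ.1 t))).toReal

/-! ### Diffeomorphisms asymptotic to the identity -/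

/-- The class `𝒟` of diffeomorphisms `F` of `ℂ²` with `F (C \ K) ⊆ L` for some compact `K` and
`|F (x) - x| ≤ A₀`, `|DF (x) - Id| ≤ A₁ |x|⁻¹`, `|D^j F (x)| ≤ A_j |x|^{-j}` for `j ≥ 2`. -/
structure IsAsymptoticDiffeo (C L : Set Plane)
    (F : Plane ≃ₘ^∞⟮𝓘(ℝ, Plane), 𝓘(ℝ, Plane)⟯ Plane) : Prop where
  maps_curve : ∃ K : Set Plane, IsCompact K ∧ ∀ x ∈ C \ K, F x ∈ L
  decay : ∃ A : ℕ → ℝ, ∀ x : Plane, ‖F x - x‖ ≤ A 0 ∧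
    ‖x‖ * ‖fderiv ℝ F x - ContinuousLinearMap.id ℝ Plane‖ ≤ A 1 ∧
    ∀ j, 2 ≤ j → ‖x‖ ^ j * ‖iteratedFDeriv ℝ j F x‖ ≤ A j

end ConeMetrics

end

open ConeMetrics

open scoped ContDiff Manifold Topology NNReal ENNReal

noncomputable section

set_option linter.unusedSectionVars false

namespace ConeMetrics

/-! ### Calculus of Hessians and Levi forms of complex-valued functions -/

section

section Real

variable {E : Type*} [NormedAddCommGroup E] [NormedSpace ℝ E]

/-! A single metric serves both as ω and as the reference metric, so the comparison of the two holds
with `Q = 1`. What has to be found is a strictly plurisubharmonic potential φ off the curve C = {P =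
0} such that `(1/2) • iddbar φ` has cone singularities along C, is asymptotic to the flat metric,
and has bisectional curvature bounded above.

The flat potential F is written with the local coordinate η of the spherical metric. Off the lines F
= |W|² + |Z|² with W, Z holomorphic; at a line with linear equation w, F = |W|² + |b|²|w|^{2β}
(`flatModel_of_spherical`). Since F is homogeneous of degree c, compactness of the unit sphere
bounds its Levi form below by a multiple of |x|^{c-2}, and the distance to the vertex is √F
(`FlatModel.distZero_eq`).

The diffeomorphism is H(x) = x + shift(1, x) for large |x|. In a cone around the k-th line H is
holomorphic and the linear form w of that line satisfies w(H x) = P(x) / cofactor(x), so H carries C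
to the line (`AsymCurve.wedge_add_shift`). The shift is homogeneous of degree 0 in a homogenizing
parameter and the point. Hence at scale r it is a smooth function of (1/r, x/r), and its derivatives
decay as required.

Near infinity the potential is F∘H + T∘H, where T (`AsymCurve.transv`) has degree c - 1 and makes
the smooth part of the potential nondegenerate transversally to the curve. In the interior it is
log(1 + |x|² + |P|^{2β}) plus a constant. A smooth regularized maximum joins the two
(`Straightening.exists_potential`), because |x|^c outgrows the logarithm.

The curvature bound comes from one principle: a metric induced by a holomorphic immersion has
bisectional curvature at most that of the ambient metric (`bisec_le_of_pullback`), and a smooth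
ambient Kähler metric has locally bounded curvature (`StrictPsh.eventually_curvLE`). Near a point of
C the immersion is x ↦ (x, P^β), and the ambient potential G(x, |y|²) is smooth across y = 0. Near
the lines at infinity the potential is a sum of three squares, so the ambient space is flat ℂ³. Far
from the lines x ↦ (1/r, x/r) with fixed r maps into a family of potentials which is smooth down to
parameter 0, and compactness gives a uniform bound.

The same family gives the decay: the Levi form of the potential and the pulled-back flat one agree
at parameter 0, hence differ by O(r^{c-3}). This is O(1/r) relative to the flat metric, and 1/r is
comparable to the distance to the power -2/c. -/

theorem _root_.ContDiffAt.fderiv_one {G : Type*} [NormedAddCommGroup G] [NormedSpace ℝ G]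
    {f : E → G} {x : E} (hf : ContDiffAt ℝ 2 f x) : ContDiffAt ℝ 1 (fderiv ℝ f) x :=
  hf.fderiv_right (m := 1) (by norm_num)

theorem _root_.ContDiffAt.hasFDerivAt_two {G : Type*} [NormedAddCommGroup G] [NormedSpace ℝ G]
    {f : E → G} {x : E} (hf : ContDiffAt ℝ 2 f x) : HasFDerivAt f (fderiv ℝ f x) x :=
  (hf.differentiableAt (by simp)).hasFDerivAt

theorem _root_.ContDiffAt.eventually_hasFDerivAt {G : Type*} [NormedAddCommGroup G]
    [NormedSpace ℝ G] {f : E → G} {x : E} (hf : ContDiffAt ℝ 2 f x) :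
    ∀ᶠ y in 𝓝 x, HasFDerivAt f (fderiv ℝ f y) y := by
  filter_upwards [hf.eventually (by simp)] with y hy using hy.hasFDerivAt_two

theorem _root_.ContDiffAt.hasFDerivAt_fderiv {G : Type*} [NormedAddCommGroup G] [NormedSpace ℝ G]
    {f : E → G} {x : E} (hf : ContDiffAt ℝ 2 f x) :
    HasFDerivAt (fderiv ℝ f) (fderiv ℝ (fderiv ℝ f) x) x :=
  (hf.fderiv_one.differentiableAt (by simp)).hasFDerivAt

end Real

section Levi

variable {E : Type*} [NormedAddCommGroup E] [NormedSpace ℝ E] [NormedSpace ℂ E]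
  [IsScalarTower ℝ ℂ E]
variable {F : Type*} [NormedAddCommGroup F] [NormedSpace ℝ F] [NormedSpace ℂ F]
  [IsScalarTower ℝ ℂ F] [CompleteSpace F]

/-- The second derivative as a bilinear form. -/
def hess (f : E → ℂ) (x v w : E) : ℂ := fderiv ℝ (fderiv ℝ f) x v w

/-- The Levi form `∑ f_{i j̄} v_i w̄_j`. -/
def lev (f : E → ℂ) (x v w : E) : ℂ :=
  (hess f x v w + hess f x (Complex.I • v) (Complex.I • w) +
    Complex.I * (hess f x v (Complex.I • w) - hess f x (Complex.I • v) w)) / 4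

/-- The derivative `∂_v f` of type `(1,0)`. -/
def del (f : E → ℂ) (x v : E) : ℂ :=
  (fderiv ℝ f x v - Complex.I * fderiv ℝ f x (Complex.I • v)) / 2

/-- The derivative `∂̄_v f` of type `(0,1)`. -/
def delBar (f : E → ℂ) (x v : E) : ℂ :=
  (fderiv ℝ f x v + Complex.I * fderiv ℝ f x (Complex.I • v)) / 2

theorem hess_eventuallyEq {f g : E → ℂ} {x : E} (h : f =ᶠ[𝓝 x] g) : hess f x = hess g x := by
  ext v w
  simp only [hess]
  rw [(Filter.EventuallyEq.fderiv h).fderiv_eq]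

theorem lev_eventuallyEq {f g : E → ℂ} {x : E} (h : f =ᶠ[𝓝 x] g) : lev f x = lev g x := by
  ext v w
  simp only [lev, hess_eventuallyEq h]

theorem I_smul_I_smul (v : E) : Complex.I • Complex.I • v = -v := by
  rw [smul_smul, Complex.I_mul_I, neg_one_smul]

theorem complex_smul_eq (a : ℂ) (v : E) : a • v = a.re • v + a.im • (Complex.I • v) := by
  conv_lhs => rw [← Complex.re_add_im a]
  rw [add_smul, mul_smul]
  congr 1
  · exact algebraMap_smul ℂ a.re v
  · exact algebraMap_smul ℂ a.im _

theorem hess_add_left (f : E → ℂ) (x v v' w : E) :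
    hess f x (v + v') w = hess f x v w + hess f x v' w := by simp [hess]

theorem hess_add_right (f : E → ℂ) (x v w w' : E) :
    hess f x v (w + w') = hess f x v w + hess f x v w' := by simp [hess]

theorem hess_smul_left (f : E → ℂ) (x v w : E) (a : ℝ) :
    hess f x (a • v) w = a * hess f x v w := by simp [hess]

theorem hess_smul_right (f : E → ℂ) (x v w : E) (a : ℝ) :
    hess f x v (a • w) = a * hess f x v w := by simp [hess]

theorem hess_neg_left (f : E → ℂ) (x v w : E) : hess f x (-v) w = -hess f x v w := by simp [hess]

theorem hess_neg_right (f : E → ℂ) (x v w : E) : hess f x v (-w) = -hess f x v w := by simp [hess]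

theorem lev_add_left (f : E → ℂ) (x v v' w : E) :
    lev f x (v + v') w = lev f x v w + lev f x v' w := by
  simp only [lev, smul_add, hess_add_left]; ring

theorem lev_add_right (f : E → ℂ) (x v w w' : E) :
    lev f x v (w + w') = lev f x v w + lev f x v w' := by
  simp only [lev, smul_add, hess_add_right]; ring

theorem lev_real_smul_left (f : E → ℂ) (x v w : E) (a : ℝ) :
    lev f x (a • v) w = a * lev f x v w := by
  simp only [lev, smul_comm Complex.I a, hess_smul_left]; ring

theorem lev_real_smul_right (f : E → ℂ) (x v w : E) (a : ℝ) :
    lev f x v (a • w) = a * lev f x v w := by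
  simp only [lev, smul_comm Complex.I a, hess_smul_right]; ring

theorem lev_I_smul_left (f : E → ℂ) (x v w : E) :
    lev f x (Complex.I • v) w = Complex.I * lev f x v w := by
  simp only [lev, I_smul_I_smul, hess_neg_left]
  linear_combination ((hess f x v (Complex.I • w) - hess f x (Complex.I • v) w) / 4) * -Complex.I_sq

theorem lev_I_smul_right (f : E → ℂ) (x v w : E) :
    lev f x v (Complex.I • w) = -Complex.I * lev f x v w := by
  simp only [lev, I_smul_I_smul, hess_neg_right]
  linear_combination ((hess f x v (Complex.I • w) - hess f x (Complex.I • v) w) / 4) * Complex.I_sq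

theorem lev_smul_left (f : E → ℂ) (x v w : E) (a : ℂ) :
    lev f x (a • v) w = a * lev f x v w := by
  rw [complex_smul_eq a v, lev_add_left, lev_real_smul_left, lev_real_smul_left, lev_I_smul_left]
  conv_rhs => rw [← Complex.re_add_im a]
  ring

theorem lev_smul_right (f : E → ℂ) (x v w : E) (a : ℂ) :
    lev f x v (a • w) = (starRingEnd ℂ) a * lev f x v w := by
  rw [complex_smul_eq a w, lev_add_right, lev_real_smul_right, lev_real_smul_right,
    lev_I_smul_right]
  conv_rhs => rw [← Complex.re_add_im a]
  simp only [map_add, map_mul, Complex.conj_ofReal, Complex.conj_I]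
  ring

theorem hess_symm {f : E → ℂ} {x : E} (hf : ContDiffAt ℝ 2 f x) (v w : E) :
    hess f x v w = hess f x w v :=
  (hf.isSymmSndFDerivAt (by simp)) v w

theorem hasFDerivAt_fderiv_apply {f : E → ℂ} {x : E} (hf : ContDiffAt ℝ 2 f x) (w : E) :
    HasFDerivAt (fun y => fderiv ℝ f y w)
      ((fderiv ℝ (fderiv ℝ f) x).flip w) x := by
  have := hf.hasFDerivAt_fderiv.clm_apply (hasFDerivAt_const w x)
  convert! this using 1
  ext v; simp

/-- If `fderiv f y w = g y` near `x`, then `hess f x v w = fderiv g x v`. -/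
theorem hess_eq_of_eventually {f g : E → ℂ} {x : E} (hf : ContDiffAt ℝ 2 f x) {v w : E}
    {g' : E →L[ℝ] ℂ} (h : ∀ᶠ y in 𝓝 x, fderiv ℝ f y w = g y) (hg : HasFDerivAt g g' x) :
    hess f x v w = g' v := by
  have h1 := (hasFDerivAt_fderiv_apply hf w).congr_of_eventuallyEq
    (h.mono fun y hy => hy.symm)
  have h2 := h1.unique hg
  rw [← h2]; rfl

theorem _root_.AnalyticAt.smoothAt {ι : E → F} {x : E} (h : AnalyticAt ℂ ι x) {n : ℕ∞ω} :
    ContDiffAt ℝ n ι x :=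
  (h.contDiffAt (n := n)).restrict_scalars ℝ

theorem _root_.AnalyticAt.fderiv_real {ι : E → F} {x : E} (h : AnalyticAt ℂ ι x) :
    fderiv ℝ ι x = (fderiv ℂ ι x).restrictScalars ℝ :=
  h.differentiableAt.fderiv_restrictScalars ℝ

theorem _root_.AnalyticAt.hasFDerivAt_real {ι : E → F} {x : E} (h : AnalyticAt ℂ ι x) :
    HasFDerivAt ι ((fderiv ℂ ι x).restrictScalars ℝ) x :=
  h.differentiableAt.hasFDerivAt.restrictScalars ℝ

theorem fderiv_comp_analytic {f : F → ℂ} {ι : E → F} {x : E} (hι : AnalyticAt ℂ ι x)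
    (hf : DifferentiableAt ℝ f (ι x)) (v : E) :
    fderiv ℝ (fun y => f (ι y)) x v = fderiv ℝ f (ι x) (fderiv ℂ ι x v) := by
  rw [HasFDerivAt.fderiv (f := fun y => f (ι y)) (hf.hasFDerivAt.comp x hι.hasFDerivAt_real)]
  rfl

theorem del_comp {f : F → ℂ} {ι : E → F} {x : E} (hι : AnalyticAt ℂ ι x)
    (hf : DifferentiableAt ℝ f (ι x)) (v : E) :
    del (fun y => f (ι y)) x v = del f (ι x) (fderiv ℂ ι x v) := by
  simp only [del, fderiv_comp_analytic hι hf, map_smul]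

theorem delBar_comp {f : F → ℂ} {ι : E → F} {x : E} (hι : AnalyticAt ℂ ι x)
    (hf : DifferentiableAt ℝ f (ι x)) (v : E) :
    delBar (fun y => f (ι y)) x v = delBar f (ι x) (fderiv ℂ ι x v) := by
  simp only [delBar, fderiv_comp_analytic hι hf, map_smul]

/-- The last term contains the complex bilinear second derivative of `ι`. It changes sign when both
vectors are multiplied by `I`, and is unchanged when `I` moves from one slot to the other, so it
drops out of the Levi form; `lev_comp` rests on this. -/
theorem hess_comp {f : F → ℂ} {ι : E → F} {x : E} (hι : AnalyticAt ℂ ι x)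
    (hf : ContDiffAt ℝ 2 f (ι x)) (v w : E) :
    hess (fun y => f (ι y)) x v w = hess f (ι x) (fderiv ℂ ι x v) (fderiv ℂ ι x w) +
      fderiv ℝ f (ι x) (fderiv ℂ (fderiv ℂ ι) x v w) := by
  have hcomp : ContDiffAt ℝ 2 (fun y => f (ι y)) x := hf.comp x hι.smoothAt
  have h1 : ∀ᶠ y in 𝓝 x, fderiv ℝ (fun y => f (ι y)) y w
      = fderiv ℝ f (ι y) (fderiv ℂ ι y w) := by
    filter_upwards [hι.eventually_analyticAt,
      hι.continuousAt.eventually (hf.eventually (by simp))] with y hy hy'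
    exact fderiv_comp_analytic hy (hy'.differentiableAt (by simp)) w
  have h2 : HasFDerivAt (fun y => fderiv ℂ ι y w)
      (((fderiv ℂ (fderiv ℂ ι) x).flip w).restrictScalars ℝ) x := by
    have := (hι.fderiv.differentiableAt.hasFDerivAt.clm_apply
      (hasFDerivAt_const (𝕜 := ℂ) w x)).restrictScalars ℝ
    convert this using 1
    ext v; simp
  have h3 := (hf.hasFDerivAt_fderiv.comp x hι.hasFDerivAt_real).clm_apply h2
  rw [hess_eq_of_eventually hcomp h1 h3]
  simp [hess, add_comm]

/-- The Levi form is natural under holomorphic maps. -/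
theorem lev_comp {f : F → ℂ} {ι : E → F} {x : E} (hι : AnalyticAt ℂ ι x)
    (hf : ContDiffAt ℝ 2 f (ι x)) (v w : E) :
    lev (fun y => f (ι y)) x v w = lev f (ι x) (fderiv ℂ ι x v) (fderiv ℂ ι x w) := by
  simp only [lev, hess_comp hι hf, map_smul, smul_apply, I_smul_I_smul,
    map_neg]
  ring

theorem hess_add {f g : E → ℂ} {x : E} (hf : ContDiffAt ℝ 2 f x) (hg : ContDiffAt ℝ 2 g x)
    (v w : E) : hess (fun y => f y + g y) x v w = hess f x v w + hess g x v w := by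
  have h1 : ∀ᶠ y in 𝓝 x, fderiv ℝ (fun y => f y + g y) y w = fderiv ℝ f y w + fderiv ℝ g y w := by
    filter_upwards [hf.eventually_hasFDerivAt, hg.eventually_hasFDerivAt] with y h1 h2
    rw [(h1.fun_add h2).fderiv]; simp
  rw [hess_eq_of_eventually (hf.add hg) h1
    ((hasFDerivAt_fderiv_apply hf w).fun_add (hasFDerivAt_fderiv_apply hg w))]
  simp [hess]

theorem lev_add {f g : E → ℂ} {x : E} (hf : ContDiffAt ℝ 2 f x) (hg : ContDiffAt ℝ 2 g x)
    (v w : E) : lev (fun y => f y + g y) x v w = lev f x v w + lev g x v w := by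
  simp only [lev, hess_add hf hg]; ring

theorem hess_mul {f g : E → ℂ} {x : E} (hf : ContDiffAt ℝ 2 f x) (hg : ContDiffAt ℝ 2 g x)
    (v w : E) : hess (fun y => f y * g y) x v w = hess f x v w * g x + f x * hess g x v w +
      fderiv ℝ f x v * fderiv ℝ g x w + fderiv ℝ f x w * fderiv ℝ g x v := by
  have h1 : ∀ᶠ y in 𝓝 x, fderiv ℝ (fun y => f y * g y) y w =
      f y * fderiv ℝ g y w + g y * fderiv ℝ f y w := by
    filter_upwards [hf.eventually_hasFDerivAt, hg.eventually_hasFDerivAt] with y h1 h2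
    rw [(h1.fun_mul h2).fderiv]; simp
  rw [hess_eq_of_eventually (hf.mul hg) h1
    ((hf.hasFDerivAt_two.fun_mul (hasFDerivAt_fderiv_apply hg w)).fun_add
      (hg.hasFDerivAt_two.fun_mul (hasFDerivAt_fderiv_apply hf w)))]
  simp [hess]; ring

theorem lev_mul {f g : E → ℂ} {x : E} (hf : ContDiffAt ℝ 2 f x) (hg : ContDiffAt ℝ 2 g x)
    (v w : E) : lev (fun y => f y * g y) x v w = lev f x v w * g x + f x * lev g x v w +
      del f x v * delBar g x w + delBar f x w * del g x v := by
  simp only [lev, del, delBar, hess_mul hf hg]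
  linear_combination (1 / 4 * (fderiv ℝ f x (Complex.I • v) * fderiv ℝ g x (Complex.I • w) +
    fderiv ℝ f x (Complex.I • w) * fderiv ℝ g x (Complex.I • v))) * Complex.I_sq

@[simp] theorem lev_const (a : ℂ) (x v w : E) : lev (fun _ => a) x v w = 0 := by
  have : fderiv ℝ (fun _ : E => a) = 0 := by ext1; simp
  simp [lev, hess, this]

@[simp] theorem del_const (a : ℂ) (x v : E) : del (fun _ => a) x v = 0 := by simp [del]

@[simp] theorem delBar_const (a : ℂ) (x v : E) : delBar (fun _ => a) x v = 0 := by simp [delBar]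

theorem lev_const_mul {f : E → ℂ} {x : E} (hf : ContDiffAt ℝ 2 f x) (a : ℂ)
    (v w : E) : lev (fun y => a * f y) x v w = a * lev f x v w := by
  rw [lev_mul contDiffAt_const hf]; simp

theorem lev_sum {ι : Type*} (s : Finset ι) {f : ι → E → ℂ} {x : E}
    (hf : ∀ i ∈ s, ContDiffAt ℝ 2 (f i) x) (v w : E) :
    lev (fun y => ∑ i ∈ s, f i y) x v w = ∑ i ∈ s, lev (f i) x v w := by
  classical
  induction s using Finset.induction_on with
  | empty => simp
  | insert a s ha ih =>
    simp only [Finset.sum_insert ha]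
    rw [lev_add (hf a (Finset.mem_insert_self a s))
      (ContDiffAt.sum fun i hi => hf i (Finset.mem_insert_of_mem hi)),
      ih fun i hi => hf i (Finset.mem_insert_of_mem hi)]

theorem del_analytic {g : E → ℂ} {x : E} (hg : AnalyticAt ℂ g x) (v : E) :
    del g x v = fderiv ℂ g x v := by
  simp only [del, hg.fderiv_real, ContinuousLinearMap.coe_restrictScalars', map_smul, smul_eq_mul]
  linear_combination (-1 / 2 * fderiv ℂ g x v) * Complex.I_sq

theorem delBar_analytic {g : E → ℂ} {x : E} (hg : AnalyticAt ℂ g x) (v : E) :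
    delBar g x v = 0 := by
  simp only [delBar, hg.fderiv_real, ContinuousLinearMap.coe_restrictScalars', map_smul,
    smul_eq_mul]
  linear_combination (1 / 2 * fderiv ℂ g x v) * Complex.I_sq

theorem fderiv_conj {g : E → ℂ} {x : E} (hg : DifferentiableAt ℝ g x) (v : E) :
    fderiv ℝ (fun y => (starRingEnd ℂ) (g y)) x v = (starRingEnd ℂ) (fderiv ℝ g x v) := by
  have := (Complex.conjCLE.toContinuousLinearMap.hasFDerivAt (x := g x)).comp x hg.hasFDerivAt
  rw [HasFDerivAt.fderiv (f := fun y => (starRingEnd ℂ) (g y)) this]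
  simp

theorem _root_.ContDiffAt.conj {g : E → ℂ} {x : E} {n : ℕ∞ω} (hg : ContDiffAt ℝ n g x) :
    ContDiffAt ℝ n (fun y => (starRingEnd ℂ) (g y)) x :=
  Complex.conjCLE.contDiff.contDiffAt.comp x hg

theorem del_conj {g : E → ℂ} {x : E} (hg : DifferentiableAt ℝ g x) (v : E) :
    del (fun y => (starRingEnd ℂ) (g y)) x v = (starRingEnd ℂ) (delBar g x v) := by
  simp only [del, delBar, fderiv_conj hg, map_add, map_div₀, map_mul, Complex.conj_I, map_ofNat]
  ring

theorem delBar_conj {g : E → ℂ} {x : E} (hg : DifferentiableAt ℝ g x) (v : E) :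
    delBar (fun y => (starRingEnd ℂ) (g y)) x v = (starRingEnd ℂ) (del g x v) := by
  simp only [del, delBar, fderiv_conj hg, map_sub, map_div₀, map_mul, Complex.conj_I, map_ofNat]
  ring

theorem hess_conj {g : E → ℂ} {x : E} (hg : ContDiffAt ℝ 2 g x) (v w : E) :
    hess (fun y => (starRingEnd ℂ) (g y)) x v w = (starRingEnd ℂ) (hess g x v w) := by
  have h1 : ∀ᶠ y in 𝓝 x, fderiv ℝ (fun y => (starRingEnd ℂ) (g y)) y w =
      (starRingEnd ℂ) (fderiv ℝ g y w) := by
    filter_upwards [hg.eventually_hasFDerivAt] with y h1 using fderiv_conj h1.differentiableAt w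
  rw [hess_eq_of_eventually hg.conj h1
    ((Complex.conjCLE.toContinuousLinearMap.hasFDerivAt).comp x (hasFDerivAt_fderiv_apply hg w))]
  simp [hess]

theorem lev_conj {g : E → ℂ} {x : E} (hg : ContDiffAt ℝ 2 g x) (v w : E) :
    lev (fun y => (starRingEnd ℂ) (g y)) x v w = (starRingEnd ℂ) (lev g x w v) := by
  simp only [lev, hess_conj hg, map_add, map_div₀, map_mul, map_sub, Complex.conj_I, map_ofNat]
  rw [hess_symm hg w v, hess_symm hg (Complex.I • w) (Complex.I • v),
    hess_symm hg w (Complex.I • v), hess_symm hg (Complex.I • w) v]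
  ring

theorem lev_analytic {g : E → ℂ} {x : E} (hg : AnalyticAt ℂ g x) (v w : E) :
    lev g x v w = 0 := by
  -- By naturality it is enough to treat the identity of ℂ, whose second derivative is zero.
  rw [lev_comp (f := fun z : ℂ => z) hg contDiffAt_id]
  have : fderiv ℝ (fun z : ℂ => z) = fun _ => ContinuousLinearMap.id ℝ ℂ := by ext1; simp
  simp [lev, hess, this]

/-- The Levi form of `|g|²` for holomorphic `g`. -/
theorem lev_norm_sq {g : E → ℂ} {x : E} (hg : AnalyticAt ℂ g x) (v w : E) :
    lev (fun y => ((‖g y‖ ^ 2 : ℝ) : ℂ)) x v w =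
      fderiv ℂ g x v * (starRingEnd ℂ) (fderiv ℂ g x w) := by
  have h0 : (fun y => ((‖g y‖ ^ 2 : ℝ) : ℂ)) = fun y => g y * (starRingEnd ℂ) (g y) := by
    ext y; rw [Complex.mul_conj, Complex.normSq_eq_norm_sq]
  rw [h0, lev_mul hg.smoothAt hg.smoothAt.conj, lev_conj hg.smoothAt, lev_analytic hg,
    lev_analytic hg, delBar_conj hg.hasFDerivAt_real.differentiableAt, del_analytic hg,
    del_analytic hg, delBar_analytic hg]
  simp

end Levi

end

/-! ### Levi forms of real functions and the two-form i∂∂̄φ -/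

section

section Levi

variable {E : Type*} [NormedAddCommGroup E] [NormedSpace ℝ E] [NormedSpace ℂ E]
  [IsScalarTower ℝ ℂ E]

/-- The Levi form of a real function. -/
def rlev (φ : E → ℝ) (x v w : E) : ℂ := lev (fun y => (φ y : ℂ)) x v w

theorem _root_.ContDiffAt.ofReal {φ : E → ℝ} {x : E} {n : ℕ∞ω} (h : ContDiffAt ℝ n φ x) :
    ContDiffAt ℝ n (fun y => (φ y : ℂ)) x :=
  Complex.ofRealCLM.contDiff.contDiffAt.comp x h

theorem fderiv_ofReal {φ : E → ℝ} {x : E} (h : DifferentiableAt ℝ φ x) (v : E) :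
    fderiv ℝ (fun y => (φ y : ℂ)) x v = (fderiv ℝ φ x v : ℝ) := by
  rw [HasFDerivAt.fderiv (f := fun y => (φ y : ℂ))
    ((Complex.ofRealCLM.hasFDerivAt (x := φ x)).comp x h.hasFDerivAt)]
  rfl

theorem hess_ofReal {φ : E → ℝ} {x : E} (h : ContDiffAt ℝ 2 φ x) (v w : E) :
    hess (fun y => (φ y : ℂ)) x v w = (fderiv ℝ (fderiv ℝ φ) x v w : ℝ) := by
  have h1 : ∀ᶠ y in 𝓝 x, fderiv ℝ (fun y => (φ y : ℂ)) y w = ((fderiv ℝ φ y w : ℝ) : ℂ) := by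
    filter_upwards [h.eventually_hasFDerivAt] with y hy using fderiv_ofReal hy.differentiableAt w
  have h2 := h.hasFDerivAt_fderiv.clm_apply (hasFDerivAt_const w x)
  rw [hess_eq_of_eventually h.ofReal h1
    ((Complex.ofRealCLM.hasFDerivAt (x := fderiv ℝ φ x w)).comp x h2)]
  simp

theorem rlev_eventuallyEq {f g : E → ℝ} {x : E} (h : f =ᶠ[𝓝 x] g) : rlev f x = rlev g x := by
  ext v w
  exact congrFun (congrFun (lev_eventuallyEq (h.fun_comp (fun t : ℝ => (t : ℂ)))) v) w

theorem rlev_conj_symm {φ : E → ℝ} {x : E} (h : ContDiffAt ℝ 2 φ x) (v w : E) :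
    (starRingEnd ℂ) (rlev φ x v w) = rlev φ x w v := by
  rw [rlev, ← lev_conj h.ofReal w v]
  simp [rlev]

theorem rlev_self_im {φ : E → ℝ} {x : E} (h : ContDiffAt ℝ 2 φ x) (v : E) :
    (rlev φ x v v).im = 0 :=
  Complex.conj_eq_iff_im.1 (rlev_conj_symm h v v)

theorem delBar_ofReal {φ : E → ℝ} {x : E} (h : DifferentiableAt ℝ φ x) (v : E) :
    delBar (fun y => (φ y : ℂ)) x v = (starRingEnd ℂ) (del (fun y => (φ y : ℂ)) x v) := by
  have h' : DifferentiableAt ℝ (fun y => (φ y : ℂ)) x :=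
    Complex.ofRealCLM.differentiableAt.comp x h
  rw [← delBar_conj h']
  simp

/-- The Levi form of a function of a real function. -/
theorem rlev_comp_real {φ : E → ℝ} {θ : ℝ → ℝ} {x : E} (h : ContDiffAt ℝ 2 φ x)
    (hθ : ContDiffAt ℝ 2 θ (φ x)) (v w : E) :
    rlev (fun y => θ (φ y)) x v w = (deriv θ (φ x) : ℝ) * rlev φ x v w +
      (deriv (deriv θ) (φ x) : ℝ) * (del (fun y => (φ y : ℂ)) x v *
        delBar (fun y => (φ y : ℂ)) x w) := by
  have hc : ContDiffAt ℝ 2 (fun y => θ (φ y)) x := hθ.comp x h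
  have hd : ContDiffAt ℝ 1 (deriv θ) (φ x) := by
    have := hθ.fderiv_one.clm_apply (contDiffAt_const (c := (1 : ℝ)))
    simpa using this
  have key : ∀ v w : E, fderiv ℝ (fderiv ℝ (fun y => θ (φ y))) x v w =
      deriv θ (φ x) * fderiv ℝ (fderiv ℝ φ) x v w +
      deriv (deriv θ) (φ x) * (fderiv ℝ φ x v * fderiv ℝ φ x w) := by
    intro v w
    have h1 : ∀ᶠ y in 𝓝 x, fderiv ℝ (fun y => θ (φ y)) y w = deriv θ (φ y) * fderiv ℝ φ y w := by
      filter_upwards [h.eventually_hasFDerivAt,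
        h.continuousAt.eventually hθ.eventually_hasFDerivAt] with y h1 h2
      rw [HasFDerivAt.fderiv (f := fun y => θ (φ y)) (h2.comp y h1)]
      simp [mul_comm]
    have h2 := (((hd.differentiableAt (by simp)).hasDerivAt).comp_hasFDerivAt x
      h.hasFDerivAt_two).fun_mul (h.hasFDerivAt_fderiv.clm_apply (hasFDerivAt_const w x))
    have h3 := hc.hasFDerivAt_fderiv.clm_apply (hasFDerivAt_const w x)
    have h4 := (h3.congr_of_eventuallyEq (h1.mono fun y hy => hy.symm)).unique h2
    have h5 := DFunLike.congr_fun h4 v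
    simp at h5
    rw [h5]; ring
  have hφ := h.hasFDerivAt_two.differentiableAt
  simp only [rlev, lev, hess_ofReal hc, hess_ofReal h, key, del, delBar, fderiv_ofReal hφ]
  push_cast
  linear_combination (-(1 / 4) * ((deriv (deriv θ) (φ x) : ℝ) : ℂ) *
    ((fderiv ℝ φ x (Complex.I • v) : ℝ) : ℂ) * ((fderiv ℝ φ x (Complex.I • w) : ℝ) : ℂ)) * -Complex.I_sq

end Levi

section Forms

theorem dcForm_smooth {φ : Plane → ℝ} {x : Plane} {m n : ℕ∞ω} (h : ContDiffAt ℝ n φ x)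
    (hmn : m + 1 ≤ n) :
    ContDiffAt ℝ m (fun y => ContinuousAlternatingMap.ofSubsingleton ℝ Plane ℝ (0 : Fin 1)
      ((fderiv ℝ φ y).comp complexStr)) x := by
  have h1 : ContDiffAt ℝ m (fun y => (fderiv ℝ φ y).comp complexStr) x :=
    (h.fderiv_right hmn).clm_comp contDiffAt_const
  exact ((ContinuousAlternatingMap.ofSubsingletonLIE (𝕜 := ℝ) (E := Plane) (F := ℝ) (0 : Fin 1)).contDiff.contDiffAt).comp x h1

theorem iddbar_apply {φ : Plane → ℝ} {x : Plane} (h : ContDiffAt ℝ 2 φ x) (v w : Plane) :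
    iddbar φ x ![v, w] = (fderiv ℝ (fderiv ℝ φ) x w (Complex.I • v) -
      fderiv ℝ (fderiv ℝ φ) x v (Complex.I • w)) / 2 := by
  have hd := (dcForm_smooth (m := 1) h (by norm_num)).differentiableAt (by simp)
  have : ∀ w : Plane, HasFDerivAt (fun y => fderiv ℝ φ y w) ((fderiv ℝ (fderiv ℝ φ) x).flip w) x := by
    intro w
    convert! h.hasFDerivAt_fderiv.clm_apply (hasFDerivAt_const w x) using 1
    ext v; simp
  rw [iddbar, ContinuousAlternatingMap.smul_apply, extDeriv_apply hd]
  simp [Fin.sum_univ_two, complexStr, Fin.removeNth, (this _).fderiv]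
  ring

/-- This and `iddbar_I_eq_re` translate exterior calculus into Hermitian algebra: the two-form is
read off from the imaginary part of the Levi form and the metric from its real part. From here on
only Levi forms are computed. -/
theorem iddbar_eq_im {φ : Plane → ℝ} {x : Plane} (h : ContDiffAt ℝ 2 φ x) (v w : Plane) :
    iddbar φ x ![v, w] = -2 * (rlev φ x v w).im := by
  have hs : fderiv ℝ (fderiv ℝ φ) x w (Complex.I • v) =
    fderiv ℝ (fderiv ℝ φ) x (Complex.I • v) w := h.isSymmSndFDerivAt (by simp) _ _
  rw [iddbar_apply h, hs]
  simp only [rlev, lev, hess_ofReal h]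
  simp
  ring

theorem iddbar_I_eq_re {φ : Plane → ℝ} {x : Plane} (h : ContDiffAt ℝ 2 φ x) (v w : Plane) :
    iddbar φ x ![v, Complex.I • w] = 2 * (rlev φ x v w).re := by
  rw [iddbar_eq_im h, rlev, rlev, lev_I_smul_right]
  simp

theorem hermCoeff_iddbar {φ : Plane → ℝ} {x : Plane} (h : ContDiffAt ℝ 2 φ x) (i j : Fin 2) :
    hermCoeff (iddbar φ x) i j = rlev φ x (stdVec i) (stdVec j) := by
  rw [hermCoeff, iddbar_I_eq_re h, iddbar_eq_im h]
  apply Complex.ext <;> simp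

theorem hermCoeff_smul (σ : TwoForm) (a : ℝ) (i j : Fin 2) :
    hermCoeff (a • σ) i j = a * hermCoeff σ i j := by
  have h : ∀ v : Fin 2 → Plane, (a • σ) v = a * σ v := fun v => rfl
  simp only [hermCoeff, h]; push_cast; ring

theorem iddbar_eventuallyEq {f g : Plane → ℝ} {x : Plane} (h : f =ᶠ[𝓝 x] g) :
    iddbar f =ᶠ[𝓝 x] iddbar g := by
  have h1 : (fun y => ContinuousAlternatingMap.ofSubsingleton ℝ Plane ℝ (0 : Fin 1)
      ((fderiv ℝ f y).comp complexStr)) =ᶠ[𝓝 x]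
      (fun y => ContinuousAlternatingMap.ofSubsingleton ℝ Plane ℝ (0 : Fin 1)
      ((fderiv ℝ g y).comp complexStr)) := by
    filter_upwards [Filter.EventuallyEq.fderiv (𝕜 := ℝ) h] with y hy
    rw [hy]
  filter_upwards [Filter.EventuallyEq.extDeriv (𝕜 := ℝ) h1] with y hy
  rw [iddbar, iddbar, hy]

theorem contDiffAt_iddbar {φ : Plane → ℝ} {x : Plane} (h : ContDiffAt ℝ ∞ φ x) :
    ContDiffAt ℝ ∞ (iddbar φ) x := by
  have h1 := (dcForm_smooth (m := ∞) h (by simp)).fderiv_right (m := ∞) (by simp)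
  have h2 : ContDiffAt ℝ ∞ (extDeriv (fun y =>
      ContinuousAlternatingMap.ofSubsingleton ℝ Plane ℝ (0 : Fin 1)
      ((fderiv ℝ φ y).comp complexStr))) x :=
    ContDiffAt.comp x (g := fun A : Plane →L[ℝ] Plane [⋀^Fin 1]→L[ℝ] ℝ =>
      ContinuousAlternatingMap.alternatizeUncurryFinCLM ℝ Plane ℝ A)
      (ContinuousLinearMap.contDiff _).contDiffAt h1
  exact h2.const_smul (-(1 / 2 : ℝ))

theorem extDeriv_iddbar {φ : Plane → ℝ} {x : Plane} (h : ContDiffAt ℝ ∞ φ x) :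
    extDeriv (iddbar φ) x = 0 := by
  have h1 := dcForm_smooth (m := ∞) h (by simp)
  have : iddbar φ = (-(1 / 2 : ℝ)) • extDeriv (fun y =>
      ContinuousAlternatingMap.ofSubsingleton ℝ Plane ℝ (0 : Fin 1)
      ((fderiv ℝ φ y).comp complexStr)) := rfl
  rw [this, extDeriv_smul, extDeriv_extDeriv_apply h1 (by simp [ENat.LEInfty.out]), smul_zero]

theorem pullback_apply (F : Plane → Plane) (κ : Plane → TwoForm) (y v w : Plane) :
    pullback F κ y ![v, w] = κ (F y) ![fderiv ℝ F y v, fderiv ℝ F y w] := by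
  simp only [pullback, ContinuousAlternatingMap.compContinuousLinearMap_apply]
  congr 1
  ext i; fin_cases i <;> rfl

theorem iddbar_comp {φ : Plane → ℝ} {ι : Plane → Plane} {x : Plane} (hι : AnalyticAt ℂ ι x)
    (h : ContDiffAt ℝ 2 φ (ι x)) (v w : Plane) :
    iddbar (fun y => φ (ι y)) x ![v, w] =
      iddbar φ (ι x) ![fderiv ℂ ι x v, fderiv ℂ ι x w] := by
  have hc : ContDiffAt ℝ 2 (fun y => φ (ι y)) x := h.comp x hι.smoothAt
  rw [iddbar_eq_im hc, iddbar_eq_im h, rlev, rlev, ← lev_comp hι h.ofReal]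

theorem twoForm_ext {σ τ : TwoForm} (h : ∀ v w : Plane, σ ![v, w] = τ ![v, w]) : σ = τ := by
  ext v
  convert h (v 0) (v 1) using 2 <;> ext i <;> fin_cases i <;> rfl

theorem pullback_iddbar {φ : Plane → ℝ} {ι : Plane → Plane} {x : Plane} (hι : AnalyticAt ℂ ι x)
    (h : ContDiffAt ℝ 2 φ (ι x)) :
    pullback ι (iddbar φ) x = iddbar (fun y => φ (ι y)) x := by
  refine twoForm_ext fun v w => ?_
  rw [pullback_apply, iddbar_comp hι h, hι.fderiv_real]
  rfl

/-- Closedness is d² = 0 and invariance is sesquilinearity of the Levi form, so a Kähler metric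
amounts to a strictly plurisubharmonic potential. The factor 1/2 is the normalization of the flat
form. -/
theorem isKahlerOn_iddbar {φ : Plane → ℝ} {U : Set Plane}
    (h : ∀ x ∈ U, ContDiffAt ℝ ∞ φ x)
    (hpos : ∀ x ∈ U, ∀ v, v ≠ 0 → 0 < (rlev φ x v v).re) :
    IsKahlerOn (fun x => (1 / 2 : ℝ) • iddbar φ x) U where
  smooth := fun x hx => ((contDiffAt_iddbar (h x hx)).const_smul (1 / 2 : ℝ)).contDiffWithinAt
  closed := fun x hx => by
    have : (fun x => (1 / 2 : ℝ) • iddbar φ x) = (1 / 2 : ℝ) • iddbar φ := rfl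
    rw [this, extDeriv_smul, extDeriv_iddbar (h x hx), smul_zero]
  invariant := fun x hx v w => by
    have h2 : ContDiffAt ℝ 2 φ x := (h x hx).of_le ENat.LEInfty.out
    simp only [ContinuousAlternatingMap.smul_apply, iddbar_eq_im h2, rlev, lev_I_smul_left,
      lev_I_smul_right]
    congr 3
    linear_combination (-lev (fun y => (φ y : ℂ)) x v w) * Complex.I_sq
  positive := fun x hx v hv => by
    have h2 : ContDiffAt ℝ 2 φ x := (h x hx).of_le ENat.LEInfty.out
    rw [ContinuousAlternatingMap.smul_apply, iddbar_I_eq_re h2, smul_eq_mul]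
    linarith [hpos x hx v hv]

end Forms

end

/-! ### Bisectional curvature as a Levi form along a complex line -/

section

section Levi

variable {E : Type*} [NormedAddCommGroup E] [NormedSpace ℝ E] [NormedSpace ℂ E]
  [IsScalarTower ℝ ℂ E]

theorem del_add_right (f : E → ℂ) (x v w : E) : del f x (v + w) = del f x v + del f x w := by
  simp only [del, smul_add, map_add]; ring

theorem delBar_add_right (f : E → ℂ) (x v w : E) :
    delBar f x (v + w) = delBar f x v + delBar f x w := by
  simp only [delBar, smul_add, map_add]; ring

theorem del_I_smul (f : E → ℂ) (x v : E) : del f x (Complex.I • v) = Complex.I * del f x v := by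
  simp only [del, I_smul_I_smul, map_neg]
  linear_combination (1 / 2 * fderiv ℝ f x (Complex.I • v)) * Complex.I_sq

theorem delBar_I_smul (f : E → ℂ) (x v : E) :
    delBar f x (Complex.I • v) = -Complex.I * delBar f x v := by
  simp only [delBar, I_smul_I_smul, map_neg]
  linear_combination (1 / 2 * fderiv ℝ f x (Complex.I • v)) * Complex.I_sq

theorem del_real_smul (f : E → ℂ) (x v : E) (a : ℝ) : del f x (a • v) = a * del f x v := by
  simp only [del, smul_comm Complex.I a, map_smul, Complex.real_smul]; ring

theorem delBar_real_smul (f : E → ℂ) (x v : E) (a : ℝ) :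
    delBar f x (a • v) = a * delBar f x v := by
  simp only [delBar, smul_comm Complex.I a, map_smul, Complex.real_smul]; ring

theorem del_smul (f : E → ℂ) (x v : E) (a : ℂ) : del f x (a • v) = a * del f x v := by
  rw [complex_smul_eq a v, del_add_right, del_real_smul, del_real_smul, del_I_smul]
  conv_rhs => rw [← Complex.re_add_im a]
  ring

theorem delBar_smul (f : E → ℂ) (x v : E) (a : ℂ) :
    delBar f x (a • v) = (starRingEnd ℂ) a * delBar f x v := by
  rw [complex_smul_eq a v, delBar_add_right, delBar_real_smul, delBar_real_smul, delBar_I_smul]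
  conv_rhs => rw [← Complex.re_add_im a]
  simp only [map_add, map_mul, Complex.conj_ofReal, Complex.conj_I]
  ring

/-- This identifies the iterated Wirtinger derivatives in `curvature` with the Levi form, for which
naturality is available. -/
theorem del_delBar {f : E → ℂ} {x : E} (hf : ContDiffAt ℝ 2 f x) (v w : E) :
    del (fun y => delBar f y w) x v = lev f x v w := by
  have h : HasFDerivAt (fun y => delBar f y w)
      ((2 : ℂ)⁻¹ • ((fderiv ℝ (fderiv ℝ f) x).flip w +
        Complex.I • (fderiv ℝ (fderiv ℝ f) x).flip (Complex.I • w))) x := by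
    have := ((hasFDerivAt_fderiv_apply hf w).fun_add
      ((hasFDerivAt_fderiv_apply hf (Complex.I • w)).const_mul Complex.I)).const_mul (2 : ℂ)⁻¹
    refine this.congr_of_eventuallyEq (Filter.Eventually.of_forall fun y => ?_)
    simp only [delBar]; ring
  simp only [del, lev, h.fderiv, hess]
  simp
  linear_combination (-(1 / 4) * fderiv ℝ (fderiv ℝ f) x (Complex.I • v) (Complex.I • w)) *
    Complex.I_sq

end Levi

theorem plane_eq (v : Plane) : v = v 0 • stdVec 0 + v 1 • stdVec 1 := by
  ext i; fin_cases i <;> simp [stdVec]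

theorem lev_plane (f : Plane → ℂ) (x w : Plane) :
    lev f x w w = ∑ k, ∑ l, lev f x (stdVec k) (stdVec l) * w k * (starRingEnd ℂ) (w l) := by
  conv_lhs => rw [plane_eq w]
  simp only [lev_add_left, lev_add_right, lev_smul_left, lev_smul_right, Fin.sum_univ_two]
  ring

theorem del_plane (f : Plane → ℂ) (x w : Plane) :
    del f x w = ∑ k, del f x (stdVec k) * w k := by
  conv_lhs => rw [plane_eq w]
  simp only [del_add_right, del_smul, Fin.sum_univ_two]
  ring

theorem delBar_plane (f : Plane → ℂ) (x w : Plane) :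
    delBar f x w = ∑ k, delBar f x (stdVec k) * (starRingEnd ℂ) (w k) := by
  conv_lhs => rw [plane_eq w]
  simp only [delBar_add_right, delBar_smul, Fin.sum_univ_two]
  ring

section Line

variable {E : Type*} [NormedAddCommGroup E] [NormedSpace ℝ E] [NormedSpace ℂ E]
  [IsScalarTower ℝ ℂ E] [CompleteSpace E]

theorem analyticAt_line (x w : E) (ζ : ℂ) : AnalyticAt ℂ (fun ζ : ℂ => x + ζ • w) ζ := by
  fun_prop

theorem fderiv_line (x w : E) (ζ a : ℂ) : fderiv ℂ (fun ζ : ℂ => x + ζ • w) ζ a = a • w := by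
  have : HasFDerivAt (fun ζ : ℂ => x + ζ • w)
    ((ContinuousLinearMap.id ℂ ℂ).smulRight w) ζ :=
    ((hasFDerivAt_id (𝕜 := ℂ) ζ).smul_const w).const_add x
  rw [this.fderiv]; simp

/-- The Levi form of `f (x + ζ w) p(ζ) q̄(ζ)` with affine `p`, `q` along a complex line. -/
theorem lev_line_mul {f : E → ℂ} {x : E} (hf : ContDiffAt ℝ 2 f x) (w : E) (p p' q q' : ℂ) :
    lev (fun ζ : ℂ => f (x + ζ • w) * ((p + ζ * p') * (starRingEnd ℂ) (q + ζ * q'))) 0 1 1 =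
      lev f x w w * (p * (starRingEnd ℂ) q) + f x * (p' * (starRingEnd ℂ) q') +
      del f x w * (p * (starRingEnd ℂ) q') + delBar f x w * (p' * (starRingEnd ℂ) q) := by
  have hx : x + (0 : ℂ) • w = x := by simp
  have hf' : ContDiffAt ℝ 2 f ((fun ζ : ℂ => x + ζ • w) 0) := by simpa using hf
  have hd : DifferentiableAt ℝ f ((fun ζ : ℂ => x + ζ • w) 0) := hf'.hasFDerivAt_two.differentiableAt
  have h1 : ContDiffAt ℝ 2 (fun ζ : ℂ => f (x + ζ • w)) 0 :=
    hf'.comp 0 (analyticAt_line x w 0).smoothAt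
  have ha : ∀ a b : ℂ, AnalyticAt ℂ (fun ζ : ℂ => a + ζ * b) 0 := fun a b => by fun_prop
  have hda : ∀ a b : ℂ, fderiv ℂ (fun ζ : ℂ => a + ζ * b) 0 1 = b := fun a b => by
    have := fderiv_line a b 0 1
    simpa using this
  have hq := (ha q q').smoothAt (n := 2)
  have hp := (ha p p').smoothAt (n := 2)
  rw [lev_mul h1 (hp.mul hq.conj), lev_comp (analyticAt_line x w 0) hf',
    del_comp (analyticAt_line x w 0) hd, delBar_comp (analyticAt_line x w 0) hd, fderiv_line,
    lev_mul hp hq.conj]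
  have e1 : del (fun ζ : ℂ => (p + ζ * p') * (starRingEnd ℂ) (q + ζ * q')) 0 1 =
      p' * (starRingEnd ℂ) q := by
    have : HasFDerivAt (fun ζ : ℂ => (p + ζ * p') * (starRingEnd ℂ) (q + ζ * q')) _ 0 :=
      hp.hasFDerivAt_two.fun_mul hq.conj.hasFDerivAt_two
    rw [del, this.fderiv]
    have := del_analytic (ha p p') 1
    have h3 := delBar_analytic (ha q q') 1
    have h4 := del_conj (hq.hasFDerivAt_two.differentiableAt) (1 : ℂ)
    rw [h3] at h4
    rw [hda] at this
    simp only [del] at this h4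
    simp at this h4 ⊢
    linear_combination (starRingEnd ℂ) q * this + p / 2 * h4
  have e2 : delBar (fun ζ : ℂ => (p + ζ * p') * (starRingEnd ℂ) (q + ζ * q')) 0 1 =
      p * (starRingEnd ℂ) q' := by
    have : HasFDerivAt (fun ζ : ℂ => (p + ζ * p') * (starRingEnd ℂ) (q + ζ * q')) _ 0 :=
      hp.hasFDerivAt_two.fun_mul hq.conj.hasFDerivAt_two
    rw [delBar, this.fderiv]
    have := del_analytic (ha q q') 1
    have h3 := delBar_analytic (ha p p') 1
    have h4 := delBar_conj (hq.hasFDerivAt_two.differentiableAt) (1 : ℂ)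
    rw [this, hda] at h4
    simp only [delBar] at h3 h4
    simp at h3 h4 ⊢
    linear_combination (starRingEnd ℂ) q / 2 * h3 + p * h4
  rw [e1, e2, lev_analytic (ha p p'), lev_conj hq, lev_analytic (ha q q'),
    del_analytic (ha p p'), delBar_analytic (ha p p'), delBar_conj hq.hasFDerivAt_two.differentiableAt,
    del_analytic (ha q q'), hda, hda]
  simp

end Line

/-- The bisectional curvature `R (v, v̄, w, w̄)` is minus the Laplacian at `0` of
`ζ ↦ |v + ζ a|²` at `x + ζ w` for a suitable vector `a`. -/
theorem bisec_eq_neg_lev {κ : Plane → TwoForm} {x : Plane}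
    (hκ : ∀ i j, ContDiffAt ℝ 2 (fun y => hermCoeff (κ y) i j) x)
    (hdet : (Matrix.of (hermCoeff (κ x))).det ≠ 0) (v w : Plane) :
    ∃ a : Plane, bisec κ x v w = -(lev (fun ζ : ℂ => ∑ i, ∑ j, hermCoeff (κ (x + ζ • w)) i j *
      ((v i + ζ * a i) * (starRingEnd ℂ) (v j + ζ * a j))) 0 1 1).re := by
  set g : Fin 2 → Fin 2 → Plane → ℂ := fun i j y => hermCoeff (κ y) i j with hg
  set G := (Matrix.of (hermCoeff (κ x)))⁻¹ with hG
  set τ : Fin 2 → ℂ := fun t => ∑ i, del (g i t) x w * v i with hτ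
  -- The vector `b` is the Christoffel term: it solves `b g = ∂_w g (v, ·)`. With `a = -b` the
  -- (1,0)-derivative of `g (v + ζ a, ·)` vanishes at `ζ = 0`, so the first-order terms combine into
  -- the quadratic term of the curvature.
  set b : Fin 2 → ℂ := fun s => ∑ t, τ t * G t s with hb
  have hbg : ∀ j, ∑ i, b i * g i j x = τ j := by
    intro j
    have h1 : G * Matrix.of (hermCoeff (κ x)) = 1 :=
      Matrix.nonsing_inv_mul _ (isUnit_iff_ne_zero.2 hdet)
    have h2 : Matrix.vecMul b (Matrix.of (hermCoeff (κ x))) = τ := by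
      have : b = Matrix.vecMul τ G := by ext s; simp [hb, Matrix.vecMul, dotProduct]
      rw [this, Matrix.vecMul_vecMul, h1, Matrix.vecMul_one]
    have := congrFun h2 j
    simpa [Matrix.vecMul, dotProduct] using this
  refine ⟨!₂[-b 0, -b 1], ?_⟩
  have hline : ∀ i j, ContDiffAt ℝ 2 (fun ζ : ℂ => hermCoeff (κ (x + ζ • w)) i j *
      ((v i + ζ * (!₂[-b 0, -b 1] : Plane) i) *
        (starRingEnd ℂ) (v j + ζ * (!₂[-b 0, -b 1] : Plane) j))) 0 := by
    intro i j
    have h0 : ContDiffAt ℝ 2 (fun y => hermCoeff (κ y) i j) ((fun ζ : ℂ => x + ζ • w) 0) := by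
      simpa using hκ i j
    have ha : ∀ a b : ℂ, AnalyticAt ℂ (fun ζ : ℂ => a + ζ * b) 0 := fun a b => by fun_prop
    exact (h0.comp (0 : ℂ) (analyticAt_line x w 0).smoothAt).mul
      ((ha _ _).smoothAt.mul (ha _ _).smoothAt.conj)
  rw [lev_sum _ fun i _ => ContDiffAt.sum fun j _ => hline i j]
  have : ∀ i, lev (fun ζ : ℂ => ∑ j, hermCoeff (κ (x + ζ • w)) i j *
      ((v i + ζ * (!₂[-b 0, -b 1] : Plane) i) *
        (starRingEnd ℂ) (v j + ζ * (!₂[-b 0, -b 1] : Plane) j))) 0 1 1 = ∑ j,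
      (lev (g i j) x w w * (v i * (starRingEnd ℂ) (v j)) + g i j x * (b i * (starRingEnd ℂ) (b j))
        - del (g i j) x w * (v i * (starRingEnd ℂ) (b j))
        - delBar (g i j) x w * (b i * (starRingEnd ℂ) (v j))) := by
    intro i
    rw [lev_sum _ fun j _ => hline i j]
    refine Finset.sum_congr rfl fun j _ => ?_
    rw [lev_line_mul (hκ i j)]
    fin_cases i <;> fin_cases j <;> simp [hg] <;> ring
  simp only [this]
  rw [bisec, ← Complex.neg_re]
  congr 1
  have hcurv : ∀ i j k l, curvature κ x i j k l = -lev (g i j) x (stdVec k) (stdVec l) +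
      ∑ s, ∑ t, G t s * del (g i t) x (stdVec k) * delBar (g s j) x (stdVec l) := by
    intro i j k l
    rw [← del_delBar (hκ i j)]
    rfl
  simp only [hcurv, lev_plane _ x w]
  have h0 := hbg 0
  have h1 := hbg 1
  have hd : ∀ i t, del (g i t) x w = ∑ k, del (g i t) x (stdVec k) * w k := fun i t => del_plane _ _ _
  have hdb : ∀ i t, delBar (g i t) x w = ∑ k, delBar (g i t) x (stdVec k) * (starRingEnd ℂ) (w k) :=
    fun i t => delBar_plane _ _ _
  have hb0 : b 0 = τ 0 * G 0 0 + τ 1 * G 1 0 := by simp [hb]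
  have hb1 : b 1 = τ 0 * G 0 1 + τ 1 * G 1 1 := by simp [hb]
  have ht0 : τ 0 = del (g 0 0) x w * v 0 + del (g 1 0) x w * v 1 := by simp [hτ]
  have ht1 : τ 1 = del (g 0 1) x w * v 0 + del (g 1 1) x w * v 1 := by simp [hτ]
  clear_value b τ g G
  simp only [Fin.sum_univ_two] at h0 h1 hd hdb ⊢
  have key : ∀ s, (b s = τ 0 * G 0 s + τ 1 * G 1 s) := by
    intro s; fin_cases s
    exacts [hb0, hb1]
  -- the two sides differ by the defining relations of `b`
  have e0 : (starRingEnd ℂ) (b 0) * (b 0 * g 0 0 x + b 1 * g 1 0 x - τ 0) = 0 := by rw [h0]; ring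
  have e1 : (starRingEnd ℂ) (b 1) * (b 0 * g 0 1 x + b 1 * g 1 1 x - τ 1) = 0 := by rw [h1]; ring
  have e2 : b 0 * (delBar (g 0 0) x w * (starRingEnd ℂ) (v 0) + delBar (g 0 1) x w * (starRingEnd ℂ) (v 1)) +
      b 1 * (delBar (g 1 0) x w * (starRingEnd ℂ) (v 0) + delBar (g 1 1) x w * (starRingEnd ℂ) (v 1)) =
      (τ 0 * G 0 0 + τ 1 * G 1 0) * (delBar (g 0 0) x w * (starRingEnd ℂ) (v 0) + delBar (g 0 1) x w * (starRingEnd ℂ) (v 1)) +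
      (τ 0 * G 0 1 + τ 1 * G 1 1) * (delBar (g 1 0) x w * (starRingEnd ℂ) (v 0) + delBar (g 1 1) x w * (starRingEnd ℂ) (v 1)) := by
    rw [hb0, hb1]
  rw [ht0, ht1] at e2
  rw [ht0] at e0
  rw [ht1] at e1
  simp only [hd, hdb] at e0 e1 e2 ⊢
  linear_combination e0 + e1 - e2

end

/-! ### Strictly plurisubharmonic potentials and local curvature bounds -/

section

/-- A continuous function that is positive on `{x₀} × K`, `K` compact, is bounded below near `x₀`. -/
theorem eventually_pos_bound {X Y : Type*} [TopologicalSpace X] [TopologicalSpace Y]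
    {K : Set Y} (hK : IsCompact K) {x₀ : X} {q : X → Y → ℝ}
    (hq : ∀ y ∈ K, ContinuousAt (fun p : X × Y => q p.1 p.2) (x₀, y))
    (hpos : ∀ y ∈ K, 0 < q x₀ y) :
    ∃ c > 0, ∀ᶠ x in 𝓝 x₀, ∀ y ∈ K, c ≤ q x y := by
  refine hK.induction_on (p := fun S => ∃ c > 0, ∀ᶠ x in 𝓝 x₀, ∀ y ∈ S, c ≤ q x y)
    ⟨1, one_pos, by simp⟩ ?_ ?_ ?_
  · rintro s t hst ⟨c, hc, h⟩
    exact ⟨c, hc, h.mono fun x hx y hy => hx y (hst hy)⟩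
  · rintro s t ⟨c, hc, h⟩ ⟨c', hc', h'⟩
    refine ⟨min c c', lt_min hc hc', ?_⟩
    filter_upwards [h, h'] with x hx hx' y hy
    rcases hy with hy | hy
    exacts [(min_le_left _ _).trans (hx y hy), (min_le_right _ _).trans (hx' y hy)]
  · intro y hy
    have h := (hq y hy).eventually (lt_mem_nhds (half_lt_self (hpos y hy)))
    rw [nhds_prod_eq] at h
    obtain ⟨u, hu, v, hv, huv⟩ := Filter.eventually_prod_iff.1 h
    refine ⟨{y | v y}, mem_nhdsWithin_of_mem_nhds hv, q x₀ y / 2, half_pos (hpos y hy), ?_⟩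
    filter_upwards [hu] with x hx y' hy'
    exact (huv hx hy').le

/-- A continuous function is locally bounded above uniformly over a compact set. -/
theorem eventually_le_bound {X Y : Type*} [TopologicalSpace X] [TopologicalSpace Y]
    {K : Set Y} (hK : IsCompact K) {x₀ : X} {q : X → Y → ℝ}
    (hq : ∀ y ∈ K, ContinuousAt (fun p : X × Y => q p.1 p.2) (x₀, y)) :
    ∃ C > 0, ∀ᶠ x in 𝓝 x₀, ∀ y ∈ K, q x y ≤ C := by
  -- An upper bound for `q` is a positive lower bound for `exp (-q)`.
  obtain ⟨c, hc, h⟩ := eventually_pos_bound hK (x₀ := x₀)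
    (q := fun x y => Real.exp (-q x y)) (fun y hy => ((hq y hy).neg).rexp)
    (fun y _ => Real.exp_pos _)
  refine ⟨max 1 (-Real.log c), lt_max_of_lt_left one_pos, ?_⟩
  filter_upwards [h] with x hx y hy
  have := (Real.log_le_iff_le_exp hc).2 (hx y hy)
  exact le_max_of_le_right (by linarith)

section Levi

variable {E : Type*} [NormedAddCommGroup E] [NormedSpace ℝ E] [NormedSpace ℂ E]
  [IsScalarTower ℝ ℂ E]

/-- Every tangent vector has positive length for `i ∂∂̄ A`. -/
def StrictPsh (A : E → ℝ) (e : E) : Prop := ∀ ξ, ξ ≠ 0 → 0 < (rlev A e ξ ξ).re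

/-- The squared length of tangent vectors, as a function on the tangent bundle. -/
def tangentNorm (A : E → ℝ) (p : E × E) : ℂ := rlev A p.1 p.2 p.2

/-- The bound `R ≤ B` for the bisectional curvature of `i ∂∂̄ A` at `e`, in terms of the Levi form
of the squared norm on the tangent bundle. -/
def CurvLE (A : E → ℝ) (e : E) (B : ℝ) : Prop :=
  ∀ ξ τ σ : E, -(B * (rlev A e ξ ξ).re * (rlev A e τ τ).re) ≤
    (lev (tangentNorm A) (e, ξ) (τ, σ) (τ, σ)).re

/-- Substitution of linear maps into the two arguments of a bilinear map. -/
def substCLM (L M : E →L[ℝ] E) (D : E →L[ℝ] E →L[ℝ] ℂ) : E →L[ℝ] E →L[ℝ] ℂ :=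
  ((ContinuousLinearMap.compL ℝ E E ℂ).flip M).comp (D.comp L)

/-- The Levi form as a continuous bilinear map. -/
def levCLM (A : E → ℝ) (e : E) : E →L[ℝ] E →L[ℝ] ℂ :=
  let D := fderiv ℝ (fderiv ℝ fun y => (A y : ℂ)) e
  let J : E →L[ℝ] E := (Complex.I • ContinuousLinearMap.id ℂ E).restrictScalars ℝ
  (4 : ℂ)⁻¹ • (D + substCLM J J D + Complex.I • (substCLM (.id ℝ E) J D - substCLM J (.id ℝ E) D))

theorem levCLM_apply (A : E → ℝ) (e v w : E) : levCLM A e v w = rlev A e v w := by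
  simp [levCLM, rlev, lev, hess, substCLM]
  ring

theorem contDiffAt_levCLM {A : E → ℝ} {e : E} {n m : ℕ∞ω} (h : ContDiffAt ℝ n A e)
    (hnm : m + 1 + 1 ≤ n) : ContDiffAt ℝ m (levCLM A) e := by
  have hD : ContDiffAt ℝ m (fun e => fderiv ℝ (fderiv ℝ fun y => (A y : ℂ)) e) e :=
    (h.ofReal.fderiv_right (m := m + 1) hnm).fderiv_right le_rfl
  let J : E →L[ℝ] E := (Complex.I • ContinuousLinearMap.id ℂ E).restrictScalars ℝ
  have hb : ∀ L M : E →L[ℝ] E, ContDiffAt ℝ m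
      (fun e => substCLM L M (fderiv ℝ (fderiv ℝ fun y => (A y : ℂ)) e)) e := fun L M =>
    contDiffAt_const.clm_comp (hD.clm_comp contDiffAt_const)
  exact ((hD.add (hb J J)).add (((hb _ J).sub (hb J _)).const_smul Complex.I)).const_smul (4 : ℂ)⁻¹

theorem contDiffAt_tangentNorm {A : E → ℝ} {e : E} {n m : ℕ∞ω} (h : ContDiffAt ℝ n A e)
    (hnm : m + 1 + 1 ≤ n) (ξ : E) : ContDiffAt ℝ m (tangentNorm A) (e, ξ) := by
  have h1 : ContDiffAt ℝ m (fun p : E × E => levCLM A p.1) (e, ξ) :=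
    ContDiffAt.comp (e, ξ) (contDiffAt_levCLM h hnm) contDiffAt_fst
  have h2 := (h1.clm_apply contDiffAt_snd).clm_apply contDiffAt_snd
  simpa only [levCLM_apply] using! h2

/-- On a fibre of the tangent bundle the squared length is a Hermitian quadratic form. This
evaluates the vertical part of the Levi form of `tangentNorm`. -/
theorem lev_quadratic (A : E → ℝ) (e ξ v w : E) :
    lev (fun ξ => rlev A e ξ ξ) ξ v w = rlev A e v w := by
  set b := levCLM A e with hb
  have hfun : (fun ξ => rlev A e ξ ξ) = fun ξ => b ξ ξ := by ext ξ; rw [hb, levCLM_apply]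
  have h0 : ContDiffAt ℝ 2 (fun ξ => b ξ ξ) ξ := by fun_prop
  have h1 : ∀ v w, hess (fun ξ => b ξ ξ) ξ v w = b v w + b w v := by
    intro v w
    have : ∀ y, fderiv ℝ (fun ξ => b ξ ξ) y w = b y w + b w y := by
      intro y
      have := ((b.hasFDerivAt (x := y)).clm_apply (hasFDerivAt_id y))
      rw [HasFDerivAt.fderiv (f := fun ξ => b ξ ξ) this]
      simp
    rw [hess_eq_of_eventually h0 (Filter.Eventually.of_forall this) (g' := b.flip w + b w)
      (((b.flip w).hasFDerivAt).add (b w).hasFDerivAt)]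
    simp
  rw [hfun, lev]
  simp only [h1]
  simp only [hb, levCLM_apply]
  simp only [rlev, lev_I_smul_left, lev_I_smul_right]
  linear_combination ((-3 * lev (fun y => (A y : ℂ)) e v w + lev (fun y => (A y : ℂ)) e w v) / 4) *
    Complex.I_sq

theorem norm_lev_le (f : E → ℂ) (x v w : E) :
    ‖lev f x v w‖ ≤ ‖fderiv ℝ (fderiv ℝ f) x‖ * ‖v‖ * ‖w‖ := by
  have h : ∀ v w, ‖hess f x v w‖ ≤ ‖fderiv ℝ (fderiv ℝ f) x‖ * ‖v‖ * ‖w‖ :=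
    fun v w => ContinuousLinearMap.le_opNorm₂ _ _ _
  have hI : ∀ v : E, ‖Complex.I • v‖ = ‖v‖ := fun v => by simp [norm_smul]
  have h1 := h v w
  have h2 := h (Complex.I • v) (Complex.I • w)
  have h3 := h v (Complex.I • w)
  have h4 := h (Complex.I • v) w
  rw [hI] at h2 h3 h4
  rw [hI] at h2
  rw [lev, norm_div]
  have h5 := norm_add_le (hess f x v w + hess f x (Complex.I • v) (Complex.I • w))
    (Complex.I * (hess f x v (Complex.I • w) - hess f x (Complex.I • v) w))
  have h6 := norm_add_le (hess f x v w) (hess f x (Complex.I • v) (Complex.I • w))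
  have h7 := norm_sub_le (hess f x v (Complex.I • w)) (hess f x (Complex.I • v) w)
  rw [norm_mul, Complex.norm_I, one_mul] at h5
  rw [show ‖(4 : ℂ)‖ = 4 by simp, div_le_iff₀ (by norm_num)]
  linarith

variable [FiniteDimensional ℝ E]

theorem StrictPsh.eventually_bound {A : E → ℝ} {e : E} (hA : ContDiffAt ℝ 2 A e)
    (h : StrictPsh A e) : ∃ c > 0, ∀ᶠ e' in 𝓝 e, ∀ ξ, c * ‖ξ‖ ^ 2 ≤ (rlev A e' ξ ξ).re := by
  have hcont : ContinuousAt (levCLM A) e := (contDiffAt_levCLM (m := 0) hA (by norm_num)).continuousAt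
  obtain ⟨c, hc, hc'⟩ := eventually_pos_bound (isCompact_sphere (0 : E) 1) (x₀ := e)
    (q := fun e' ξ => (rlev A e' ξ ξ).re) (fun ξ _ => by
      simp only [← levCLM_apply]
      have h1 : ContinuousAt (fun p : E × E => levCLM A p.1) (e, ξ) :=
        ContinuousAt.comp (f := Prod.fst) (x := (e, ξ)) hcont continuousAt_fst
      exact Complex.continuous_re.continuousAt.comp
        ((h1.clm_apply continuousAt_snd).clm_apply continuousAt_snd))
    (fun ξ hξ => h ξ (by rintro rfl; simp at hξ))
  refine ⟨c, hc, hc'.mono fun e' he' ξ => ?_⟩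
  rcases eq_or_ne ξ 0 with rfl | hξ
  · simp [rlev, lev, hess]
  have hn : ‖ξ‖ ≠ 0 := norm_ne_zero_iff.2 hξ
  have h1 := he' (‖ξ‖⁻¹ • ξ) (by simp [norm_smul, hn])
  rw [rlev, lev_real_smul_left, lev_real_smul_right] at h1
  have h2 : (((‖ξ‖⁻¹ : ℝ) : ℂ) * (((‖ξ‖⁻¹ : ℝ) : ℂ) * lev (fun y => (A y : ℂ)) e' ξ ξ)).re =
      (‖ξ‖⁻¹) ^ 2 * (rlev A e' ξ ξ).re := by
    rw [← mul_assoc, ← Complex.ofReal_mul, Complex.re_ofReal_mul, rlev]; ring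
  rw [h2] at h1
  have h3 : 0 < ‖ξ‖ ^ 2 := by positivity
  rw [inv_pow] at h1
  calc c * ‖ξ‖ ^ 2 ≤ ((‖ξ‖ ^ 2)⁻¹ * (rlev A e' ξ ξ).re) * ‖ξ‖ ^ 2 := by gcongr
    _ = _ := by field_simp

theorem StrictPsh.eventually {A : E → ℝ} {e : E} (hA : ContDiffAt ℝ 2 A e)
    (h : StrictPsh A e) : ∀ᶠ e' in 𝓝 e, StrictPsh A e' := by
  obtain ⟨c, hc, h⟩ := h.eventually_bound hA
  refine h.mono fun e' he' ξ hξ => lt_of_lt_of_le ?_ (he' ξ)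
  have := norm_pos_iff.2 hξ
  positivity

/-- Strictly plurisubharmonic potentials have bisectional curvature locally bounded above. -/
theorem StrictPsh.eventually_curvLE {A : E → ℝ} {e : E} (hA : ContDiffAt ℝ 4 A e)
    (h : StrictPsh A e) : ∃ B > 0, ∀ᶠ e' in 𝓝 e, CurvLE A e' B := by
  obtain ⟨c, hc, hlow⟩ := h.eventually_bound (hA.of_le (by norm_num))
  obtain ⟨C, hC, hup⟩ := eventually_le_bound (isCompact_sphere (0 : E) 1) (x₀ := e)
    (q := fun e' ξ => ‖fderiv ℝ (fderiv ℝ (tangentNorm A)) (e', ξ)‖) (fun ξ _ => by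
      have h1 : ContDiffAt ℝ 2 (tangentNorm A) (e, ξ) :=
        contDiffAt_tangentNorm hA (by norm_num) ξ
      exact (h1.fderiv_one.fderiv_right (m := 0) (by norm_num)).continuousAt.norm)
  -- For a unit vector ξ the horizontal part is at least -C|τ|², the mixed part at least -2C|τ||σ|
  -- and the vertical part at least c|σ|². Completing the square in |σ| leaves -(C + C²/c)|τ|²; the
  -- division by c² replaces Euclidean lengths of ξ and τ by lengths in the metric.
  refine ⟨(C + C ^ 2 / c) / c ^ 2, by positivity, ?_⟩
  filter_upwards [hlow, hup, hA.eventually (by simp)] with e' hl hu hA'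
  have hT : ∀ ξ, ContDiffAt ℝ 2 (tangentNorm A) (e', ξ) := fun ξ =>
    contDiffAt_tangentNorm hA' (by norm_num) ξ
  have hA2 : ContDiffAt ℝ 2 A e' := hA'.of_le (by norm_num)
  have hvert : ∀ ξ σ, lev (tangentNorm A) (e', ξ) (0, σ) (0, σ) = rlev A e' σ σ := by
    intro ξ σ
    have han : AnalyticAt ℂ (fun ξ : E => ((e', ξ) : E × E)) ξ := analyticAt_const.prod analyticAt_id
    have hfd : HasFDerivAt (𝕜 := ℂ) (fun ξ : E => ((e', ξ) : E × E)) (.inr ℂ E E) ξ :=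
      hasFDerivAt_prodMk_right e' ξ
    have hcomp : CompleteSpace E := FiniteDimensional.complete ℝ E
    have := lev_comp (f := tangentNorm A) han (hT ξ) σ σ
    rw [hfd.fderiv] at this
    simp only [ContinuousLinearMap.inr_apply] at this
    rw [← this]
    exact lev_quadratic A e' ξ σ σ
  -- unit vectors `ξ`
  have hunit : ∀ ξ τ σ, ‖ξ‖ = 1 → -((C + C ^ 2 / c) * ‖τ‖ ^ 2) ≤
      (lev (tangentNorm A) (e', ξ) (τ, σ) (τ, σ)).re := by
    intro ξ τ σ hξ
    have hb := hu ξ (by simpa using hξ)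
    have hsplit : ((τ, σ) : E × E) = (τ, 0) + (0, σ) := by simp
    rw [hsplit, lev_add_left, lev_add_right, lev_add_right, hvert]
    have hn : ∀ v w : E × E, -(C * ‖v‖ * ‖w‖) ≤ (lev (tangentNorm A) (e', ξ) v w).re := by
      intro v w
      have h1 := norm_lev_le (tangentNorm A) (e', ξ) v w
      have h2 := (abs_le.1 (Complex.abs_re_le_norm (lev (tangentNorm A) (e', ξ) v w))).1
      have h3 : ‖fderiv ℝ (fderiv ℝ (tangentNorm A)) (e', ξ)‖ * ‖v‖ * ‖w‖ ≤ C * ‖v‖ * ‖w‖ := by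
        gcongr
      linarith
    have h1 := hn (τ, 0) (τ, 0)
    have h2 := hn (τ, 0) (0, σ)
    have h3 := hn (0, σ) (τ, 0)
    have h4 := hl σ
    simp only [Prod.norm_mk, norm_zero, norm_nonneg, sup_of_le_left, sup_of_le_right] at h1 h2 h3
    simp only [Complex.add_re]
    have h5 : 0 ≤ c * (‖σ‖ - C / c * ‖τ‖) ^ 2 := by positivity
    have h6 : c * (‖σ‖ - C / c * ‖τ‖) ^ 2 =
      c * ‖σ‖ ^ 2 - 2 * C * ‖τ‖ * ‖σ‖ + C ^ 2 / c * ‖τ‖ ^ 2 := by field_simp; ring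
    nlinarith
  intro ξ τ σ
  have hc2 : (C + C ^ 2 / c) * (‖ξ‖ ^ 2 * ‖τ‖ ^ 2) ≤
      (C + C ^ 2 / c) / c ^ 2 * (rlev A e' ξ ξ).re * (rlev A e' τ τ).re := by
    calc (C + C ^ 2 / c) * (‖ξ‖ ^ 2 * ‖τ‖ ^ 2) =
        (C + C ^ 2 / c) / c ^ 2 * (c * ‖ξ‖ ^ 2) * (c * ‖τ‖ ^ 2) := by field_simp
      _ ≤ _ := by
        have h1 := hl ξ
        have h2 := hl τ
        have h3 : 0 ≤ c * ‖ξ‖ ^ 2 := by positivity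
        have h4 : 0 ≤ c * ‖τ‖ ^ 2 := by positivity
        have h5 : 0 ≤ (rlev A e' ξ ξ).re := h3.trans h1
        gcongr
  refine (neg_le_neg hc2).trans ?_
  have hscale : ∀ (ξ σ : E) (a : ℝ), lev (tangentNorm A) (e', a • ξ) (τ, a • σ) (τ, a • σ) =
      a ^ 2 * lev (tangentNorm A) (e', ξ) (τ, σ) (τ, σ) := by
    intro ξ σ a
    have hcomp : CompleteSpace E := FiniteDimensional.complete ℝ E
    let S : E × E →L[ℂ] E × E := (ContinuousLinearMap.id ℂ E).prodMap ((a : ℂ) • ContinuousLinearMap.id ℂ E)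
    have hS : ∀ p : E × E, S p = (p.1, a • p.2) := fun p => by
      rw [show S p = (p.1, (a : ℂ) • p.2) from rfl, complex_smul_eq]
      simp
    have h1 := lev_comp (f := tangentNorm A) (S.analyticAt (e', ξ)) (by rw [hS]; exact hT _) (τ, σ) (τ, σ)
    rw [S.fderiv] at h1
    simp only [hS] at h1
    rw [← h1, ← lev_const_mul (hT ξ)]
    congr 1
    ext p
    simp only [tangentNorm, rlev, lev_real_smul_left, lev_real_smul_right]
    ring
  -- The vector ξ = 0 cannot be rescaled to a unit vector. There, invariance under multiplication of
  -- the fibre by -1 makes the mixed terms cancel, multiplication by 0 kills the horizontal term,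
  -- and the nonnegative vertical term remains.
  rcases eq_or_ne ξ 0 with rfl | hξ
  · have h1 := hscale 0 σ (-1)
    simp only [smul_zero, neg_smul, one_smul] at h1
    have h2 : ∀ σ' : E, ((τ, σ') : E × E) = (τ, 0) + (0, σ') := fun σ' => by simp
    have h3 := hscale 0 0 0
    simp only [smul_zero] at h3
    have h4 : ((0 : E), -σ) = -((0 : E), σ) := by simp
    have h5 := lev_real_smul_left (tangentNorm A) (e', (0 : E)) ((0 : E), σ)
    rw [h2 (-σ), h2 σ, h4] at h1
    have h6 : -((0 : E), σ) = (-1 : ℝ) • ((0 : E), σ) := by simp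
    rw [h6] at h1
    simp only [lev_add_left, lev_add_right, lev_real_smul_left, lev_real_smul_right, hvert] at h1
    rw [h2 σ]
    simp only [lev_add_left, lev_add_right, hvert]
    have h7 := hl σ
    have h8 : 0 ≤ c * ‖σ‖ ^ 2 := by positivity
    have h9 : lev (tangentNorm A) (e', 0) (τ, 0) (τ, 0) = 0 := by
      simpa using h3
    rw [h9] at h1 ⊢
    have h10 : lev (tangentNorm A) (e', 0) (0, σ) (τ, 0) + lev (tangentNorm A) (e', 0) (τ, 0) (0, σ) = 0 := by
      push_cast at h1
      linear_combination (-1 / 2) * h1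
    have h11 : 0 + lev (tangentNorm A) (e', 0) (0, σ) (τ, 0) +
        (lev (tangentNorm A) (e', 0) (τ, 0) (0, σ) + rlev A e' σ σ) = rlev A e' σ σ := by
      linear_combination h10
    rw [h11]
    simp only [norm_zero]
    linarith
  · have hn : ‖ξ‖ ≠ 0 := norm_ne_zero_iff.2 hξ
    have h1 := hscale (‖ξ‖⁻¹ • ξ) (‖ξ‖⁻¹ • σ) ‖ξ‖
    simp only [smul_smul, mul_inv_cancel₀ hn, one_smul] at h1
    have h2 := hunit (‖ξ‖⁻¹ • ξ) τ (‖ξ‖⁻¹ • σ) (by simp [norm_smul, hn])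
    rw [h1, ← Complex.ofReal_pow, Complex.re_ofReal_mul]
    have h3 : 0 ≤ ‖ξ‖ ^ 2 := by positivity
    nlinarith [mul_le_mul_of_nonneg_left h2 h3]

end Levi

end

/-! ### Curvature of metrics induced by holomorphic maps -/

section

theorem sum_rlev_plane (φ : Plane → ℝ) (x v : Plane) :
    ∑ i, ∑ j, rlev φ x (stdVec i) (stdVec j) * (v i * (starRingEnd ℂ) (v j)) = rlev φ x v v := by
  rw [rlev, lev_plane]
  simp only [rlev, mul_assoc]

theorem hermNormSq_half_iddbar {φ : Plane → ℝ} {x : Plane} (h : ContDiffAt ℝ 2 φ x) (v : Plane) :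
    hermNormSq ((1 / 2 : ℝ) • iddbar φ x) v = (rlev φ x v v).re / 2 := by
  rw [hermNormSq, ← sum_rlev_plane]
  simp only [hermCoeff_smul, hermCoeff_iddbar h, mul_assoc, ← Finset.mul_sum]
  rw [Complex.re_ofReal_mul]
  ring

theorem det_ne_zero_of_strictPsh {φ : Plane → ℝ} {x : Plane} (h : ContDiffAt ℝ 2 φ x)
    (hpsh : StrictPsh φ x) : (Matrix.of (hermCoeff ((1 / 2 : ℝ) • iddbar φ x))).det ≠ 0 := by
  intro h0
  obtain ⟨c, hc, hc0⟩ := Matrix.exists_mulVec_eq_zero_iff.2 h0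
  set v : Plane := !₂[(starRingEnd ℂ) (c 0), (starRingEnd ℂ) (c 1)] with hv
  have hv0 : v ≠ 0 := by
    intro h1
    apply hc
    have h2 : v 0 = 0 := by rw [h1]; rfl
    have h3 : v 1 = 0 := by rw [h1]; rfl
    ext i; fin_cases i
    · simpa [hv] using h2
    · simpa [hv] using h3
  have h1 := hpsh v hv0
  have e0 := congrFun hc0 0
  have e1 := congrFun hc0 1
  simp [Matrix.mulVec, dotProduct, Fin.sum_univ_two, hermCoeff_smul, hermCoeff_iddbar h] at e0 e1
  rw [← sum_rlev_plane] at h1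
  have : ∑ i, ∑ j, rlev φ x (stdVec i) (stdVec j) * (v i * (starRingEnd ℂ) (v j)) = 0 := by
    simp [Fin.sum_univ_two, hv]
    linear_combination (2 * (starRingEnd ℂ) (c 0)) * e0 + (2 * (starRingEnd ℂ) (c 1)) * e1
  rw [this] at h1
  simp at h1

variable {E : Type*} [NormedAddCommGroup E] [NormedSpace ℝ E] [NormedSpace ℂ E]
  [IsScalarTower ℝ ℂ E] [CompleteSpace E]

theorem strictPsh_of_pullback {F : Type*} [NormedAddCommGroup F] [NormedSpace ℝ F]
    [NormedSpace ℂ F] [IsScalarTower ℝ ℂ F] {φ : F → ℝ} {x : F} {ι : F → E} {A : E → ℝ}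
    (hφ : φ =ᶠ[𝓝 x] fun y => A (ι y)) (hι : AnalyticAt ℂ ι x)
    (hA : ContDiffAt ℝ 2 A (ι x)) (hpsh : StrictPsh A (ι x))
    (hinj : ∀ v, fderiv ℂ ι x v = 0 → v = 0) : StrictPsh φ x := by
  intro v hv
  rw [rlev_eventuallyEq hφ]
  have : rlev (fun y => A (ι y)) x v v = rlev A (ι x) (fderiv ℂ ι x v) (fderiv ℂ ι x v) :=
    lev_comp hι hA.ofReal v v
  rw [this]
  exact hpsh _ fun h => hv (hinj v h)

/-- A metric induced by a holomorphic map has bisectional curvature bounded above by that of the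
ambient metric. -/
theorem bisec_le_of_pullback {φ : Plane → ℝ} {κ : Plane → TwoForm} {x : Plane} {ι : Plane → E}
    {A : E → ℝ} {r m B : ℝ} (hκ : κ =ᶠ[𝓝 x] fun y => (1 / 2 : ℝ) • iddbar φ y)
    (hφ : φ =ᶠ[𝓝 x] fun y => r * A (ι y) + m) (hι : AnalyticAt ℂ ι x)
    (hA : ContDiffAt ℝ 4 A (ι x)) (hpsh : StrictPsh φ x) (hcurv : CurvLE A (ι x) B)
    (hr : 1 ≤ r) (hB : 0 ≤ B) (v w : Plane) (hv : hermNormSq (κ x) v = 1)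
    (hw : hermNormSq (κ x) w = 1) : bisec κ x v w ≤ 2 * B := by
  have hφ4 : ContDiffAt ℝ 4 φ x := by
    refine ContDiffAt.congr_of_eventuallyEq ?_ hφ
    exact (contDiffAt_const.mul (hA.comp x hι.smoothAt)).add contDiffAt_const
  have hφ2 : ∀ᶠ y in 𝓝 x, ContDiffAt ℝ 2 φ y :=
    (hφ4.eventually (by simp)).mono fun y hy => hy.of_le (by norm_num)
  have hx2 := hφ2.self_of_nhds
  have hg : ∀ i j, (fun y => hermCoeff (κ y) i j) =ᶠ[𝓝 x]
      fun y => (1 / 2 : ℝ) * levCLM φ y (stdVec i) (stdVec j) := by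
    intro i j
    filter_upwards [hκ, hφ2] with y h1 h2
    rw [h1, hermCoeff_smul, hermCoeff_iddbar h2, levCLM_apply]
  have hgs : ∀ i j, ContDiffAt ℝ 2 (fun y => hermCoeff (κ y) i j) x := by
    intro i j
    refine ContDiffAt.congr_of_eventuallyEq ?_ (hg i j)
    exact contDiffAt_const.mul (((contDiffAt_levCLM hφ4 (by norm_num)).clm_apply
      contDiffAt_const).clm_apply contDiffAt_const)
  rw [hκ.self_of_nhds, hermNormSq_half_iddbar hx2] at hv hw
  have hdet := det_ne_zero_of_strictPsh hx2 hpsh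
  rw [← show κ x = (1 / 2 : ℝ) • iddbar φ x from hκ.self_of_nhds] at hdet
  obtain ⟨a, ha⟩ := bisec_eq_neg_lev hgs hdet v w
  rw [ha]
  -- the tangent lift of the complex line
  set γ : ℂ → E × E := fun ζ => (ι (x + ζ • w), fderiv ℂ ι (x + ζ • w) (v + ζ • a)) with hγ
  have hlift : ∀ y p : Plane, φ =ᶠ[𝓝 y] (fun y => r * A (ι y) + m) → AnalyticAt ℂ ι y →
      ContDiffAt ℝ 4 A (ι y) → rlev φ y p p = r * tangentNorm A (ι y, fderiv ℂ ι y p) := by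
    intro y p h1 h2 h3
    have h3' : ContDiffAt ℝ 2 A (ι y) := h3.of_le (by norm_num)
    rw [rlev_eventuallyEq h1, rlev]
    have hc : ContDiffAt ℝ 2 (fun y => ((A (ι y) : ℝ) : ℂ)) y := h3'.ofReal.comp y h2.smoothAt
    have : (fun y => ((r * A (ι y) + m : ℝ) : ℂ)) = fun y => (r : ℂ) * ((A (ι y) : ℝ) : ℂ) + (m : ℂ) := by
      ext y; push_cast; ring
    rw [this, lev_add (contDiffAt_const.mul hc) contDiffAt_const, lev_const, add_zero,
      lev_const_mul hc, tangentNorm, rlev, ← lev_comp h2 h3'.ofReal]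
  have hline : Filter.Tendsto (fun ζ : ℂ => x + ζ • w) (𝓝 0) (𝓝 x) := by
    simpa using (analyticAt_line x w 0).continuousAt.tendsto
  have hx0 : x + (0 : ℂ) • w = x := by simp
  have hev : ∀ᶠ y in 𝓝 x, (φ =ᶠ[𝓝 y] fun y => r * A (ι y) + m) ∧ AnalyticAt ℂ ι y ∧
      ContDiffAt ℝ 4 A (ι y) ∧ ContDiffAt ℝ 2 φ y ∧ κ y = (1 / 2 : ℝ) • iddbar φ y := by
    filter_upwards [hφ.eventuallyEq_nhds, hι.eventually_analyticAt,
      hι.continuousAt.eventually (hA.eventually (by simp)), hφ2, hκ] with y h1 h2 h3 h4 h5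
    exact ⟨h1, h2, h3, h4, h5⟩
  have hΨ : (fun ζ : ℂ => ∑ i, ∑ j, hermCoeff (κ (x + ζ • w)) i j *
      ((v i + ζ * a i) * (starRingEnd ℂ) (v j + ζ * a j))) =ᶠ[𝓝 0]
      fun ζ => ((r / 2 : ℝ) : ℂ) * tangentNorm A (γ ζ) := by
    filter_upwards [hline.eventually hev] with ζ hζ
    obtain ⟨h1, h2, h3, h4, h5⟩ := hζ
    have h6 := hlift (x + ζ • w) (v + ζ • a) h1 h2 h3
    rw [← sum_rlev_plane] at h6
    rw [h5]
    simp only [hermCoeff_smul, hermCoeff_iddbar h4, mul_assoc, ← Finset.mul_sum]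
    have h7 : ∀ i, (v + ζ • a) i = v i + ζ * a i := fun i => by simp
    simp only [h7] at h6
    rw [h6]
    push_cast
    ring
  rw [lev_eventuallyEq hΨ]
  have hγan : AnalyticAt ℂ γ 0 := by
    have hι' : AnalyticAt ℂ ι (x + (0 : ℂ) • w) := by rwa [hx0]
    refine (AnalyticAt.comp (g := ι) (f := fun ζ : ℂ => x + ζ • w) (x := 0) hι'
      (analyticAt_line x w 0)).prod ?_
    have h1 : AnalyticAt ℂ (fun ζ : ℂ => fderiv ℂ ι (x + ζ • w)) 0 :=
      AnalyticAt.comp (g := fderiv ℂ ι) (f := fun ζ : ℂ => x + ζ • w) (x := 0) hι'.fderiv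
        (analyticAt_line x w 0)
    exact (h1.contDiffAt (n := ω) |>.clm_apply (analyticAt_line v a 0).contDiffAt).analyticAt
  have hγ0 : γ 0 = (ι x, fderiv ℂ ι x v) := by simp [hγ]
  have hT : ContDiffAt ℝ 2 (tangentNorm A) (γ 0) := by
    rw [hγ0]; exact contDiffAt_tangentNorm hA (by norm_num) _
  rw [lev_const_mul (f := fun ζ => tangentNorm A (γ ζ)) (hT.comp 0 hγan.smoothAt), lev_comp hγan hT, hγ0]
  -- Only the horizontal component of the derivative of the lift is computed. The vertical component
  -- σ contains the contribution of the second fundamental form, and need not be known because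
  -- `CurvLE` holds for every σ.
  obtain ⟨σ, hσ⟩ : ∃ σ, fderiv ℂ γ 0 1 = (fderiv ℂ ι x w, σ) := by
    refine ⟨(fderiv ℂ γ 0 1).2, Prod.ext ?_ rfl⟩
    have h1 : HasFDerivAt (fun ζ => (γ ζ).1) ((ContinuousLinearMap.fst ℂ E E).comp (fderiv ℂ γ 0)) 0 :=
      (ContinuousLinearMap.fst ℂ E E).hasFDerivAt.comp 0 hγan.differentiableAt.hasFDerivAt
    have hι' : HasFDerivAt ι (fderiv ℂ ι x) (x + (0 : ℂ) • w) := by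
      rw [hx0]; exact hι.differentiableAt.hasFDerivAt
    have h2 : HasFDerivAt (fun ζ : ℂ => ι (x + ζ • w)) ((fderiv ℂ ι x).comp
        (fderiv ℂ (fun ζ : ℂ => x + ζ • w) 0)) 0 :=
      hι'.comp 0 (analyticAt_line x w 0).differentiableAt.hasFDerivAt
    have h3 := DFunLike.congr_fun (h1.unique h2) 1
    simp only [ContinuousLinearMap.comp_apply, fderiv_line, one_smul] at h3
    exact h3
  rw [hσ, Complex.re_ofReal_mul]
  have h1 := hcurv (fderiv ℂ ι x v) (fderiv ℂ ι x w) σ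
  have h2 := hlift x v hφ hι hA
  have h3 := hlift x w hφ hι hA
  rw [tangentNorm] at h2 h3
  rw [h2, Complex.re_ofReal_mul] at hv
  rw [h3, Complex.re_ofReal_mul] at hw
  simp only at hv hw
  set a1 := (rlev A (ι x) (fderiv ℂ ι x v) (fderiv ℂ ι x v)).re
  set a2 := (rlev A (ι x) (fderiv ℂ ι x w) (fderiv ℂ ι x w)).re
  -- A unit vector of `κ` has squared ambient length 2/r, so the bound obtained is 2B/r, and r ≥ 1
  -- turns this into 2B.
  have e1 : a1 = 2 / r := by field_simp; linarith
  have e2 : a2 = 2 / r := by field_simp; linarith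
  rw [e1, e2] at h1
  have h4 : r / 2 * -(B * (2 / r) * (2 / r)) = -(2 * B / r) := by field_simp
  have h5 := mul_le_mul_of_nonneg_left h1 (show 0 ≤ r / 2 by linarith)
  rw [h4] at h5
  have h6 : 2 * B / r ≤ 2 * B := div_le_self (by linarith) hr
  linarith

end

/-! ### Branches of real powers, and potentials depending on |y|² -/

section

section Branch

variable {E : Type*} [NormedAddCommGroup E] [NormedSpace ℂ E]

/-- A local branch of a real power of a holomorphic function. -/
theorem exists_branch {f : E → ℂ} {x : E} (hf : AnalyticAt ℂ f x) (h0 : f x ≠ 0) (α : ℝ) :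
    ∃ g : E → ℂ, AnalyticAt ℂ g x ∧ g x ≠ 0 ∧ (∀ᶠ y in 𝓝 x, ‖g y‖ = ‖f y‖ ^ α) ∧
      ∀ v, fderiv ℂ g x v = α * g x / f x * fderiv ℂ f x v := by
  -- Dividing by `f x` moves the value at `x` to 1, away from the cut of the principal power.
  have hq : AnalyticAt ℂ (fun y => f y / f x) x := hf.div analyticAt_const h0
  have hslit : f x / f x ∈ Complex.slitPlane := by rw [div_self h0]; simp
  have hpos : 0 < ‖f x‖ ^ α := Real.rpow_pos_of_pos (norm_pos_iff.2 h0) α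
  refine ⟨fun y => ((‖f x‖ ^ α : ℝ) : ℂ) * (f y / f x) ^ (α : ℂ),
    analyticAt_const.mul (hq.cpow analyticAt_const hslit), ?_, ?_, ?_⟩
  · simp [div_self h0, hpos.ne']
  · filter_upwards [hf.continuousAt.eventually_ne h0] with y hy
    rw [norm_mul, Complex.norm_real, Real.norm_of_nonneg hpos.le,
      Complex.norm_cpow_real, norm_div, ← Real.mul_rpow (norm_nonneg _) (by positivity),
      mul_div_cancel₀ _ (norm_ne_zero_iff.2 h0)]
  · intro v
    have h1 : HasFDerivAt (fun y => f y / f x) ((f x)⁻¹ • fderiv ℂ f x) x := by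
      simpa [div_eq_inv_mul] using hf.differentiableAt.hasFDerivAt.const_mul (f x)⁻¹
    have h2 := ((((hasDerivAt_id (f x / f x)).cpow_const (c := (α : ℂ)) hslit).comp_hasFDerivAt x
      h1).const_mul ((‖f x‖ ^ α : ℝ) : ℂ))
    rw [HasFDerivAt.fderiv (f := fun y => ((‖f x‖ ^ α : ℝ) : ℂ) * (f y / f x) ^ (α : ℂ)) h2]
    simp [div_self h0]
    ring

end Branch

section ConePotential

variable {E : Type*} [NormedAddCommGroup E] [NormedSpace ℝ E] [NormedSpace ℂ E]
  [IsScalarTower ℝ ℂ E]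

/-- The function `(z, y) ↦ G (z, |y|²)`. -/
def conePot (G : E × ℝ → ℝ) (p : E × ℂ) : ℝ := G (p.1, ‖p.2‖ ^ 2)

/-- The Levi form in the first variables. -/
def horLev (G : E × ℝ → ℝ) (v w : E) (q : E × ℝ) : ℂ :=
  let D := fderiv ℝ (fderiv ℝ G) q
  ((D (v, 0) (w, 0) + D (Complex.I • v, 0) (Complex.I • w, 0) : ℝ) + Complex.I *
    (D (v, 0) (Complex.I • w, 0) - D (Complex.I • v, 0) (w, 0) : ℝ)) / 4

/-- The mixed derivative `∂_v ∂_ρ G`. -/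
def mixDel (G : E × ℝ → ℝ) (v : E) (q : E × ℝ) : ℂ :=
  let D := fderiv ℝ (fderiv ℝ G) q
  (D (v, 0) (0, 1) - Complex.I * D (Complex.I • v, 0) (0, 1)) / 2

/-- The dependence through |y|² keeps the ambient potential smooth across y = 0. The singularity of
the cone metric lies entirely in the substitution of a branch of f^β for y. -/
theorem conePot_smooth {G : E × ℝ → ℝ} {z : E} {y : ℂ} {n : ℕ∞ω}
    (hG : ContDiffAt ℝ n G (z, ‖y‖ ^ 2)) : ContDiffAt ℝ n (conePot G) (z, y) :=
  ContDiffAt.comp (z, y) (f := fun p : E × ℂ => (p.1, ‖p.2‖ ^ 2)) hG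
    (contDiffAt_fst.prodMk (contDiffAt_snd.norm_sq ℝ))

/-- At y = 0 the mixed terms disappear and the form splits into a horizontal block and a multiple of
`b * conj b'`, which gives strict plurisubharmonicity on the curve. At a branch of z₁^β the same
formula yields the components in the cone coframe. -/
theorem rlev_conePot {G : E × ℝ → ℝ} {z : E} {y : ℂ} (hG : ContDiffAt ℝ 2 G (z, ‖y‖ ^ 2))
    (a a' : E) (b b' : ℂ) :
    rlev (conePot G) (z, y) (a, b) (a', b') = horLev G a a' (z, ‖y‖ ^ 2) +
      mixDel G a (z, ‖y‖ ^ 2) * (y * (starRingEnd ℂ) b') +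
      (starRingEnd ℂ) (mixDel G a' (z, ‖y‖ ^ 2)) * ((starRingEnd ℂ) y * b) +
      (fderiv ℝ (fderiv ℝ G) (z, ‖y‖ ^ 2) (0, 1) (0, 1) * ‖y‖ ^ 2 +
        fderiv ℝ G (z, ‖y‖ ^ 2) (0, 1) : ℝ) * (b * (starRingEnd ℂ) b') := by
  set q : E × ℝ := (z, ‖y‖ ^ 2) with hq
  have hσ : ∀ p : E × ℂ, HasFDerivAt (fun p : E × ℂ => (p.1, ‖p.2‖ ^ 2))
      ((ContinuousLinearMap.fst ℝ E ℂ).prod ((2 • innerSL ℝ p.2).comp (.snd ℝ E ℂ))) p := by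
    intro p
    exact hasFDerivAt_fst.prodMk ((hasStrictFDerivAt_norm_sq p.2).hasFDerivAt.comp p hasFDerivAt_snd)
  have hev : ∀ᶠ p in 𝓝 ((z, y) : E × ℂ), HasFDerivAt G (fderiv ℝ G (p.1, ‖p.2‖ ^ 2)) (p.1, ‖p.2‖ ^ 2) :=
    (hσ (z, y)).continuousAt.eventually hG.eventually_hasFDerivAt
  have hess_eq : ∀ (a a' : E) (b b' : ℂ),
      fderiv ℝ (fderiv ℝ (conePot G)) (z, y) (a, b) (a', b') =
      fderiv ℝ (fderiv ℝ G) q (a, 2 * inner ℝ y b) (a', 2 * inner ℝ y b') +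
      fderiv ℝ G q (0, 2 * inner ℝ b b') := by
    intro a a' b b'
    have h1 : ∀ᶠ p in 𝓝 ((z, y) : E × ℂ), fderiv ℝ (conePot G) p (a', b') =
        fderiv ℝ G (p.1, ‖p.2‖ ^ 2) (a', 2 * innerSL ℝ b' p.2) := by
      filter_upwards [hev] with p hp
      rw [HasFDerivAt.fderiv (f := conePot G) (hp.comp p (hσ p))]
      simp [real_inner_comm, mul_add]
    have h2 : HasFDerivAt (fun p : E × ℂ => (a', 2 * innerSL ℝ b' p.2))
        ((0 : E × ℂ →L[ℝ] E).prod ((2 : ℝ) • (innerSL ℝ b').comp (.snd ℝ E ℂ))) (z, y) :=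
      (hasFDerivAt_const a' _).prodMk
        (((innerSL ℝ b').hasFDerivAt.comp (z, y) hasFDerivAt_snd).const_mul 2)
    have h3 := (HasFDerivAt.comp (z, y) (f := fun p : E × ℂ => (p.1, ‖p.2‖ ^ 2))
      (hG.hasFDerivAt_fderiv) (hσ (z, y))).clm_apply h2
    have h4 := (conePot_smooth hG).hasFDerivAt_fderiv.clm_apply (hasFDerivAt_const (a', b') (z, y))
    have h5 := DFunLike.congr_fun ((h4.congr_of_eventuallyEq (h1.mono fun p hp => hp.symm)).unique h3) (a, b)
    simp [real_inner_comm, mul_add] at h5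
    rw [h5, add_comm]
    simp [hq, mul_add]
  have hsplit : ∀ (a : E) (r : ℝ), ((a, r) : E × ℝ) = (a, 0) + r • ((0 : E), (1 : ℝ)) := by
    intro a r; simp
  have hD : ∀ (a a' : E) (r r' : ℝ), fderiv ℝ (fderiv ℝ G) q (a, r) (a', r') =
      fderiv ℝ (fderiv ℝ G) q (a, 0) (a', 0) + r' * fderiv ℝ (fderiv ℝ G) q (a, 0) (0, 1) +
      r * fderiv ℝ (fderiv ℝ G) q (a', 0) (0, 1) +
      r * r' * fderiv ℝ (fderiv ℝ G) q (0, 1) (0, 1) := by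
    intro a a' r r'
    have hs : fderiv ℝ (fderiv ℝ G) q (0, 1) (a', 0) = fderiv ℝ (fderiv ℝ G) q (a', 0) (0, 1) :=
      hG.isSymmSndFDerivAt (by simp) _ _
    rw [hsplit a r, hsplit a' r']
    simp only [map_add, map_smul, _root_.add_apply, smul_apply, hs, smul_eq_mul]
    ring
  have hg : ∀ r : ℝ, fderiv ℝ G q (0, r) = r * fderiv ℝ G q (0, 1) := by
    intro r
    have : ((0 : E), r) = r • ((0 : E), (1 : ℝ)) := by simp
    rw [this, map_smul, smul_eq_mul]
  have hfull : ∀ (a a' : E) (b b' : ℂ),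
      fderiv ℝ (fderiv ℝ (conePot G)) (z, y) (a, b) (a', b') =
      fderiv ℝ (fderiv ℝ G) q (a, 0) (a', 0) +
      2 * inner ℝ y b' * fderiv ℝ (fderiv ℝ G) q (a, 0) (0, 1) +
      2 * inner ℝ y b * fderiv ℝ (fderiv ℝ G) q (a', 0) (0, 1) +
      2 * inner ℝ y b * (2 * inner ℝ y b') * fderiv ℝ (fderiv ℝ G) q (0, 1) (0, 1) +
      2 * inner ℝ b b' * fderiv ℝ G q (0, 1) := by
    intro a a' b b'
    rw [hess_eq, hD, hg]
  simp only [rlev, lev, hess_ofReal (conePot_smooth hG), Prod.smul_mk, hfull]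
  simp only [horLev, mixDel, Complex.inner, map_div₀, map_sub, map_mul, Complex.conj_ofReal,
    Complex.conj_I, map_ofNat]
  have hn : (‖y‖ : ℝ) ^ 2 = y.re * y.re + y.im * y.im := by
    rw [← Complex.normSq_eq_norm_sq, Complex.normSq_apply]
  rw [hn]
  generalize fderiv ℝ (fderiv ℝ G) q = D
  generalize fderiv ℝ G q (0, 1) = g
  generalize D (0, 1) (0, 1) = n
  generalize D (a, 0) (a', 0) = s₁
  generalize D (a, 0) (Complex.I • a', 0) = s₂
  generalize D (Complex.I • a, 0) (a', 0) = s₃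
  generalize D (Complex.I • a, 0) (Complex.I • a', 0) = s₄
  generalize D (a, 0) (0, 1) = m₁
  generalize D (a', 0) (0, 1) = m₂
  generalize D (Complex.I • a, 0) (0, 1) = m₃
  generalize D (Complex.I • a', 0) (0, 1) = m₄
  apply Complex.ext <;> simp <;> ring

end ConePotential

end

/-! ### Hölder functions near the origin -/

section

section Holder

variable {X Y Z : Type*} [NormedAddCommGroup X] [NormedAddCommGroup Y] [NormedAddCommGroup Z]

/-- `f` is Hölder continuous of exponent `α` near the origin. -/
def HolderNear (α : ℝ≥0) (f : X → Y) : Prop :=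
  ∃ C : ℝ, 0 ≤ C ∧ ∃ U ∈ 𝓝 (0 : X), ∀ u ∈ U, ∀ u' ∈ U, ‖f u - f u'‖ ≤ C * ‖u - u'‖ ^ (α : ℝ)

variable {α : ℝ≥0}

theorem HolderNear.exists_holderOnWith {f : X → Y} (hf : HolderNear α f) :
    ∃ N : ℝ≥0, ∃ U ∈ 𝓝 (0 : X), HolderOnWith N α f U := by
  obtain ⟨C, hC, U, hU, h⟩ := hf
  lift C to ℝ≥0 using hC
  refine ⟨C, U, hU, fun u hu u' hu' => ?_⟩
  have h1 := h u hu u' hu'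
  rw [edist_dist, edist_dist, dist_eq_norm, dist_eq_norm,
    ENNReal.ofReal_rpow_of_nonneg (norm_nonneg (u - u')) α.coe_nonneg,
    ← ENNReal.ofReal_coe_nnreal, ← ENNReal.ofReal_mul (by positivity)]
  exact ENNReal.ofReal_le_ofReal h1

theorem HolderNear.continuousAt {f : X → Y} (hf : HolderNear α f) (hα : 0 < α) :
    ContinuousAt f 0 := by
  obtain ⟨N, U, hU, h⟩ := hf.exists_holderOnWith
  exact (h.continuousOn hα).continuousAt hU

/-- Composition with a locally Lipschitz map. -/
theorem HolderNear.comp_lipschitz {f : X → Y} {g : Y → Z} (hf : HolderNear α f) (hα : 0 < α)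
    {K : ℝ≥0} {t : Set Y} (ht : t ∈ 𝓝 (f 0)) (hg : LipschitzOnWith K g t) :
    HolderNear α (fun u => g (f u)) := by
  have hc := hf.continuousAt hα
  obtain ⟨C, hC, U, hU, h⟩ := hf
  refine ⟨K * C, by positivity, U ∩ f ⁻¹' t, Filter.inter_mem hU (hc ht), fun u hu u' hu' => ?_⟩
  have h1 := hg.dist_le_mul _ hu.2 _ hu'.2
  rw [dist_eq_norm, dist_eq_norm] at h1
  rw [mul_assoc]
  exact h1.trans (mul_le_mul_of_nonneg_left (h u hu.1 u' hu'.1) K.2)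

theorem HolderNear.comp_contDiffAt [NormedSpace ℝ Y] [NormedSpace ℝ Z] {f : X → Y} {g : Y → Z}
    (hf : HolderNear α f) (hα : 0 < α) (hg : ContDiffAt ℝ 1 g (f 0)) :
    HolderNear α (fun u => g (f u)) := by
  obtain ⟨K, t, ht, hK⟩ := hg.exists_lipschitzOnWith
  exact hf.comp_lipschitz hα ht hK

theorem HolderNear.prodMk {f : X → Y} {g : X → Z} (hf : HolderNear α f) (hg : HolderNear α g) :
    HolderNear α (fun u => (f u, g u)) := by
  obtain ⟨C, hC, U, hU, h⟩ := hf
  obtain ⟨C', hC', U', hU', h'⟩ := hg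
  refine ⟨max C C', le_max_of_le_left hC, U ∩ U', Filter.inter_mem hU hU', fun u hu u' hu' => ?_⟩
  rw [Prod.mk_sub_mk, Prod.norm_mk, max_mul_of_nonneg _ _ (by positivity)]
  exact max_le_max (h u hu.1 u' hu'.1) (h' u hu.2 u' hu'.2)

theorem holderNear_clm [NormedSpace ℝ X] [NormedSpace ℝ Y] (L : X →L[ℝ] Y) (hα : α ≤ 1) :
    HolderNear α L := by
  -- In a ball of radius 1/2 distances are at most 1, where t ≤ t^α.
  refine ⟨‖L‖, norm_nonneg _, Metric.ball 0 2⁻¹, Metric.ball_mem_nhds _ (by norm_num),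
    fun u hu u' hu' => ?_⟩
  rw [← map_sub]
  refine (L.le_opNorm _).trans (mul_le_mul_of_nonneg_left ?_ (norm_nonneg _))
  rw [mem_ball_zero_iff] at hu hu'
  have h1 : ‖u - u'‖ ≤ 1 := (norm_sub_le _ _).trans (by linarith)
  calc ‖u - u'‖ = ‖u - u'‖ ^ (1 : ℝ) := (Real.rpow_one _).symm
    _ ≤ _ := Real.rpow_le_rpow_of_exponent_ge' (norm_nonneg _) h1 α.2 (by exact_mod_cast hα)

/-- Subadditivity of t ↦ t^p for exponents between 0 and 1. -/
theorem abs_rpow_sub_rpow_le {a b p : ℝ} (ha : 0 ≤ a) (hb : 0 ≤ b) (hp : 0 ≤ p) (hp1 : p ≤ 1) :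
    |a ^ p - b ^ p| ≤ |a - b| ^ p := by
  wlog h : b ≤ a generalizing a b
  · rw [abs_sub_comm, abs_sub_comm a b]
    exact this hb ha (not_le.1 h).le
  rw [abs_of_nonneg (sub_nonneg.2 (Real.rpow_le_rpow hb h hp)), abs_of_nonneg (sub_nonneg.2 h)]
  have := Real.rpow_add_le_add_rpow hb (sub_nonneg.2 h) hp hp1
  rw [add_sub_cancel] at this
  linarith

/-- `|ℓ u|^γ` is Hölder of every exponent `α ≤ 1`, `α ≤ γ` near the origin. -/
theorem holderNear_norm_rpow [NormedSpace ℝ X] [NormedSpace ℝ Y] (L : X →L[ℝ] Y) (hα0 : 0 < α)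
    (hα : α ≤ 1) {γ : ℝ} (hγ : (α : ℝ) ≤ γ) :
    HolderNear α (fun u => ‖L u‖ ^ γ) := by
  have h1 : HolderNear α (fun u => ‖L u‖ ^ (α : ℝ)) := by
    refine ⟨‖L‖ ^ (α : ℝ), by positivity, Set.univ, Filter.univ_mem, fun u _ u' _ => ?_⟩
    rw [Real.norm_eq_abs]
    refine (abs_rpow_sub_rpow_le (norm_nonneg _) (norm_nonneg _) α.2 (by exact_mod_cast hα)).trans ?_
    rw [← Real.mul_rpow (norm_nonneg _) (norm_nonneg _)]
    refine Real.rpow_le_rpow (abs_nonneg _) ?_ α.2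
    refine (abs_norm_sub_norm_le _ _).trans ?_
    rw [← map_sub]
    exact L.le_opNorm _
  have hα0' : (0 : ℝ) < α := by exact_mod_cast hα0
  -- Since γ/α ≥ 1, the outer power is continuously differentiable and preserves the exponent α.
  have h2 : (fun u => ‖L u‖ ^ γ) = fun u => (‖L u‖ ^ (α : ℝ)) ^ (γ / α) := by
    ext u
    rw [← Real.rpow_mul (norm_nonneg _), mul_div_cancel₀ _ hα0'.ne']
  rw [h2]
  exact h1.comp_contDiffAt (g := fun t : ℝ => t ^ (γ / α)) hα0
    (Real.contDiff_rpow_const_of_le (n := 1) (by rw [Nat.cast_one]; exact (one_le_div hα0').2 hγ)).contDiffAt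

end Holder

end

/-! ### Holomorphic coordinates adapted to a smooth hypersurface -/

section

/-- A nonzero functional on the plane is a coordinate of a linear coordinate system. -/
theorem exists_dual_frame {D : Plane →L[ℂ] ℂ} (hD : D ≠ 0) :
    ∃ (m : Plane →L[ℂ] ℂ) (n k : Plane), D n = 1 ∧ D k = 0 ∧ m n = 0 ∧ m k = 1 ∧
      ∀ v, v = D v • n + m v • k := by
  set a := D (stdVec 0) with ha
  set b := D (stdVec 1) with hb
  have hDv : ∀ v, D v = v 0 * a + v 1 * b := by
    intro v
    conv_lhs => rw [plane_eq v]
    simp [ha, hb]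
  have hN : a * (starRingEnd ℂ) a + b * (starRingEnd ℂ) b ≠ 0 := by
    intro h0
    rw [Complex.mul_conj', Complex.mul_conj'] at h0
    have h1 : ‖a‖ ^ 2 + ‖b‖ ^ 2 = 0 := by exact_mod_cast h0
    have h2 : a = 0 := by
      rw [← norm_eq_zero]; nlinarith [sq_nonneg ‖a‖, sq_nonneg ‖b‖]
    have h3 : b = 0 := by
      rw [← norm_eq_zero]; nlinarith [sq_nonneg ‖a‖, sq_nonneg ‖b‖]
    apply hD
    ext v
    simp [hDv, h2, h3]
  set N := a * (starRingEnd ℂ) a + b * (starRingEnd ℂ) b with hNd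
  refine ⟨N⁻¹ • ((starRingEnd ℂ) a • EuclideanSpace.proj (1 : Fin 2) -
      (starRingEnd ℂ) b • EuclideanSpace.proj (0 : Fin 2)),
    !₂[N⁻¹ * (starRingEnd ℂ) a, N⁻¹ * (starRingEnd ℂ) b], !₂[-b, a], ?_, ?_, ?_, ?_, ?_⟩
  · rw [hDv]; simp; field_simp; rw [hNd]; ring
  · rw [hDv]; simp; ring
  · simp; field_simp; simp
  · simp; field_simp; rw [hNd]; ring
  · intro v
    ext i
    rw [hDv]
    fin_cases i <;> simp <;> field_simp <;> rw [hNd] <;> ring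

/-- Holomorphic coordinates in which a holomorphic function is a multiple of the first one. -/
theorem exists_adapted_coordinates {f : Plane → ℂ} {p : Plane} (hf : AnalyticAt ℂ f p)
    (h0 : f p = 0) (hD : fderiv ℂ f p ≠ 0) :
    ∃ k : Plane, k ≠ 0 ∧ ∀ l μ : ℝ, 0 < l → 0 < μ → ∃ ψ : Plane → Plane, AnalyticAt ℂ ψ 0 ∧ ψ 0 = p ∧
      fderiv ℂ ψ 0 (stdVec 1) = (μ⁻¹ : ℂ) • k ∧
      (∀ᶠ y in 𝓝 0, f (ψ y) = y 0 / l) ∧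
      ∀ S ∈ 𝓝 (0 : Plane), ∃ φ : OpenPartialHomeomorph Plane Plane, p ∈ φ.source ∧ φ p = 0 ∧
        DifferentiableOn ℂ φ φ.source ∧ DifferentiableOn ℂ φ.symm φ.target ∧
        (∀ x, φ x 0 = l * f x) ∧ φ.target ⊆ S ∧ ⇑φ.symm = ψ := by
  obtain ⟨m, n, k, hDn, hDk, hmn, hmk, hv⟩ := exists_dual_frame hD
  refine ⟨k, fun h => by simp [h] at hmk, fun l μ hl hμ => ?_⟩
  have hl' : (l : ℂ) ≠ 0 := by exact_mod_cast hl.ne'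
  have hμ' : (μ : ℂ) ≠ 0 := by exact_mod_cast hμ.ne'
  set D := fderiv ℂ f p with hDdef
  let T : Plane →L[ℂ] Plane := ((l : ℂ) • D).smulRight (stdVec 0) + ((μ : ℂ) • m).smulRight (stdVec 1)
  let S : Plane →L[ℂ] Plane := ((l⁻¹ : ℂ) • EuclideanSpace.proj (0 : Fin 2)).smulRight n +
    ((μ⁻¹ : ℂ) • EuclideanSpace.proj (1 : Fin 2)).smulRight k
  have hST : Function.LeftInverse S T := by
    intro v
    conv_rhs => rw [hv v]
    simp [S, T, stdVec, hl', hμ']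
  have hTS : Function.RightInverse S T := by
    intro v
    conv_rhs => rw [plane_eq v]
    simp [S, T, stdVec, hl', hμ', hDn, hDk, hmn, hmk]
  let e : Plane ≃L[ℂ] Plane := ContinuousLinearEquiv.equivOfInverse T S hST hTS
  -- The equation `f` is the first coordinate and a complementary linear function the second. The
  -- free scalings `l` and `μ` will normalize the leading coefficients of a cone metric to 1.
  let Ψ : Plane → Plane := fun x => ((l : ℂ) * f x) • stdVec 0 + ((μ : ℂ) * m (x - p)) • stdVec 1
  have hΨ : AnalyticAt ℂ Ψ p :=
    ((analyticAt_const.mul hf).smul analyticAt_const).add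
      ((analyticAt_const.mul ((m.analyticAt _).comp (analyticAt_id.sub analyticAt_const))).smul
        analyticAt_const)
  have hΨ' : HasFDerivAt Ψ (e : Plane →L[ℂ] Plane) p := by
    have h1 := (hf.differentiableAt.hasFDerivAt.const_mul (l : ℂ)).smul_const (stdVec 0)
    have h2 := ((HasFDerivAt.comp p (f := fun x => x - p) (m.hasFDerivAt (x := p - p))
      ((hasFDerivAt_id p).sub_const p)).const_mul (μ : ℂ)).smul_const (stdVec 1)
    convert! h1.add h2 using 1
  have hΨp : Ψ p = 0 := by simp [Ψ, h0]
  let φ := hΨ.contDiffAt.toOpenPartialHomeomorph Ψ hΨ' (n := ω) (by simp)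
  have hφ : ∀ x, φ x = Ψ x := fun x => rfl
  have hps : p ∈ φ.source := hΨ.contDiffAt.mem_toOpenPartialHomeomorph_source hΨ' (n := ω) (by simp)
  have hφp : φ p = 0 := by rw [hφ, hΨp]
  have h0t : (0 : Plane) ∈ φ.target := by rw [← hφp]; exact φ.map_source hps
  have hs0 : φ.symm 0 = p := by rw [← hφp]; exact φ.left_inv hps
  have hψ : AnalyticAt ℂ φ.symm 0 := by
    apply ContDiffAt.analyticAt
    refine φ.contDiffAt_symm (f₀' := e) h0t ?_ ?_
    · rw [hs0]; exact hΨ'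
    · rw [hs0]; exact hΨ.contDiffAt
  have hψ' : HasFDerivAt φ.symm (e.symm : Plane →L[ℂ] Plane) 0 := by
    refine φ.hasFDerivAt_symm h0t ?_
    rw [hs0]; exact hΨ'
  have hΨ0 : ∀ x, Ψ x 0 = l * f x := by intro x; simp [Ψ, stdVec]
  refine ⟨φ.symm, hψ, hs0, ?_, ?_, ?_⟩
  · rw [hψ'.fderiv]
    change S (stdVec 1) = _
    simp [S, stdVec]
  · filter_upwards [φ.open_target.mem_nhds h0t] with y hy
    have h1 := hΨ0 (φ.symm y)
    rw [← hφ, φ.right_inv hy] at h1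
    rw [h1, mul_div_cancel_left₀ _ hl']
  · intro S hS
    -- The chart is restricted to a neighbourhood on which it and its inverse are holomorphic and
    -- whose image lies in `S`; the restriction is made on the source, so conditions on the target
    -- are imposed at `Ψ x`.
    have hV : {x | AnalyticAt ℂ Ψ x ∧ AnalyticAt ℂ φ.symm (Ψ x) ∧ Ψ x ∈ S} ∈ 𝓝 p := by
      have hc : Filter.Tendsto Ψ (𝓝 p) (𝓝 0) := by simpa [hΨp] using hΨ.continuousAt.tendsto
      filter_upwards [hΨ.eventually_analyticAt, hc hψ.eventually_analyticAt, hc hS] with x h1 h2 h3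
      exact ⟨h1, h2, h3⟩
    obtain ⟨V, hVs, hVo, hpV⟩ := mem_nhds_iff.1 hV
    refine ⟨φ.restrOpen V hVo, ⟨hps, hpV⟩, hφp, ?_, ?_, ?_, ?_, rfl⟩
    · rintro x ⟨-, hx⟩
      exact (hVs hx).1.differentiableAt.differentiableWithinAt
    · rintro y ⟨hy, hy'⟩
      have h1 := (hVs hy').2.1
      have h2 : Ψ (φ.symm y) = y := φ.right_inv hy
      have h1' : AnalyticAt ℂ φ.symm (Ψ (φ.symm y)) := h1
      rw [h2] at h1'
      exact h1'.differentiableAt.differentiableWithinAt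
    · exact hΨ0
    · rintro y ⟨hy, hy'⟩
      have h1 : Ψ (φ.symm y) ∈ S := (hVs hy').2.2
      have h2 : Ψ (φ.symm y) = y := φ.right_inv hy
      rwa [h2] at h1

end

/-! ### Components of a potential metric in the cone coframe -/

section

theorem contDiffAt_ofReal_comp {X : Type*} [NormedAddCommGroup X] [NormedSpace ℝ X] {φ : X → ℝ}
    {x : X} {n : ℕ∞ω} (h : ContDiffAt ℝ n φ x) : ContDiffAt ℝ n (fun y => (φ y : ℂ)) x :=
  Complex.ofRealCLM.contDiff.contDiffAt.comp x h

theorem contDiffAt_conj_comp {X : Type*} [NormedAddCommGroup X] [NormedSpace ℝ X] {g : X → ℂ}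
    {x : X} {n : ℕ∞ω} (h : ContDiffAt ℝ n g x) :
    ContDiffAt ℝ n (fun y => (starRingEnd ℂ) (g y)) x :=
  Complex.conjCLE.contDiff.contDiffAt.comp x h

/-- The point of `Plane × ℝ` with cone chart coordinates `u`, where `s = |u 0| ^ (β⁻¹ - 1)`. -/
def unchart (p : Plane × ℝ) : Plane × ℝ := (!₂[p.1 0 * p.2, p.1 1], ‖p.1 0‖ ^ 2)

/-- The components, in the cone coframe, of the form with potential `G (z, |z_1| ^ (2 β))` minus
those of the model form. -/
def coneCoeff (β : ℝ) (G : Plane × ℝ → ℝ) (i j : Fin 2) (p : Plane × ℝ) : ℂ :=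
  1 / 2 * (horLev G (stdVec i) (stdVec j) (unchart p) *
      ((![p.2 / β, 1] : Fin 2 → ℂ) i * (![p.2 / β, 1] : Fin 2 → ℂ) j) +
    mixDel G (stdVec i) (unchart p) *
      ((![p.2 / β, 1] : Fin 2 → ℂ) i * p.1 0 * (![1, 0] : Fin 2 → ℂ) j) +
    (starRingEnd ℂ) (mixDel G (stdVec j) (unchart p)) *
      ((![p.2 / β, 1] : Fin 2 → ℂ) j * (starRingEnd ℂ) (p.1 0) * (![1, 0] : Fin 2 → ℂ) i) +
    (fderiv ℝ (fderiv ℝ G) (unchart p) (0, 1) (0, 1) * ‖p.1 0‖ ^ 2 +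
      fderiv ℝ G (unchart p) (0, 1) : ℝ) * ((![1, 0] : Fin 2 → ℂ) i * (![1, 0] : Fin 2 → ℂ) j)) -
  (if i = j then 1 else 0)

theorem contDiff_unchart {n : ℕ∞ω} : ContDiff ℝ n unchart := by
  unfold unchart
  refine ContDiff.prodMk ?_ ?_
  · refine (contDiff_piLp 2).2 ?_
    intro i
    fin_cases i
    · simp
      refine ContDiff.mul ?_ ?_
      · exact ((EuclideanSpace.proj (0 : Fin 2) : Plane →L[ℂ] ℂ).restrictScalars ℝ).contDiff.comp
          contDiff_fst
      · exact Complex.ofRealCLM.contDiff.comp contDiff_snd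
    · exact ((EuclideanSpace.proj (1 : Fin 2) : Plane →L[ℂ] ℂ).restrictScalars ℝ).contDiff.comp
          contDiff_fst
  · exact (((EuclideanSpace.proj (0 : Fin 2) : Plane →L[ℂ] ℂ).restrictScalars ℝ).contDiff.comp
          contDiff_fst).norm_sq ℝ

theorem contDiffAt_horLev {G : Plane × ℝ → ℝ} {q : Plane × ℝ} (hG : ContDiffAt ℝ 4 G q)
    (v w : Plane) : ContDiffAt ℝ 1 (horLev G v w) q := by
  have h2 : ContDiffAt ℝ 1 (fderiv ℝ (fderiv ℝ G)) q :=
    (hG.fderiv_right (m := 3) (by norm_num)).fderiv_right (by norm_num)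
  have h3 : ∀ a b : Plane × ℝ, ContDiffAt ℝ 1 (fun q => fderiv ℝ (fderiv ℝ G) q a b) q :=
    fun a b => (h2.clm_apply contDiffAt_const).clm_apply contDiffAt_const
  unfold horLev
  exact ((contDiffAt_ofReal_comp ((h3 _ _).add (h3 _ _))).add
    (contDiffAt_const.mul (contDiffAt_ofReal_comp ((h3 _ _).sub (h3 _ _))))).div_const _

theorem contDiffAt_mixDel {G : Plane × ℝ → ℝ} {q : Plane × ℝ} (hG : ContDiffAt ℝ 4 G q)
    (v : Plane) : ContDiffAt ℝ 1 (mixDel G v) q := by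
  have h2 : ContDiffAt ℝ 1 (fderiv ℝ (fderiv ℝ G)) q :=
    (hG.fderiv_right (m := 3) (by norm_num)).fderiv_right (by norm_num)
  have h3 : ∀ a b : Plane × ℝ, ContDiffAt ℝ 1 (fun q => fderiv ℝ (fderiv ℝ G) q a b) q :=
    fun a b => (h2.clm_apply contDiffAt_const).clm_apply contDiffAt_const
  unfold mixDel
  exact ((contDiffAt_ofReal_comp (h3 _ _)).sub
    (contDiffAt_const.mul (contDiffAt_ofReal_comp (h3 _ _)))).div_const _

/-- The components are continuously differentiable in (u, s); all loss of regularity comes from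
inserting s = |u₀|^{1/β - 1}. This is the origin of the condition α < 1/β - 1 on the Hölder
exponent. -/
theorem contDiffAt_coneCoeff {β : ℝ} {G : Plane × ℝ → ℝ} {p : Plane × ℝ}
    (hG : ContDiffAt ℝ 4 G (unchart p)) (i j : Fin 2) : ContDiffAt ℝ 1 (coneCoeff β G i j) p := by
  have hu : ContDiffAt ℝ 1 unchart p := contDiff_unchart.contDiffAt
  have hA : ∀ i, ContDiffAt ℝ 1 (fun p : Plane × ℝ => (![(p.2 : ℂ) / β, 1] : Fin 2 → ℂ) i) p := by
    intro i
    fin_cases i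
    · exact (contDiffAt_ofReal_comp contDiffAt_snd).div_const _
    · exact contDiffAt_const
  have h0 : ContDiffAt ℝ 1 (fun p : Plane × ℝ => p.1 0) p :=
    (((EuclideanSpace.proj (0 : Fin 2) : Plane →L[ℂ] ℂ).restrictScalars ℝ).contDiff.comp
          contDiff_fst).contDiffAt
  have hS : ContDiffAt ℝ 1 (fun p => horLev G (stdVec i) (stdVec j) (unchart p)) p :=
    (contDiffAt_horLev hG _ _).comp p hu
  have hM : ∀ i, ContDiffAt ℝ 1 (fun p => mixDel G (stdVec i) (unchart p)) p :=
    fun i => (contDiffAt_mixDel hG _).comp p hu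
  have hn : ContDiffAt ℝ 1 (fun p => fderiv ℝ (fderiv ℝ G) (unchart p) (0, 1) (0, 1)) p := by
    have h2 : ContDiffAt ℝ 1 (fderiv ℝ (fderiv ℝ G)) (unchart p) :=
      (hG.fderiv_right (m := 3) (by norm_num)).fderiv_right (by norm_num)
    exact ((h2.comp p hu).clm_apply contDiffAt_const).clm_apply contDiffAt_const
  have hg : ContDiffAt ℝ 1 (fun p => fderiv ℝ G (unchart p) (0, 1)) p := by
    have h2 : ContDiffAt ℝ 1 (fderiv ℝ G) (unchart p) := hG.fderiv_right (by norm_num)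
    exact (h2.comp p hu).clm_apply contDiffAt_const
  unfold coneCoeff
  exact (contDiffAt_const.mul ((((hS.mul ((hA i).mul (hA j))).add
    ((hM i).mul (((hA i).mul h0).mul contDiffAt_const))).add
    ((contDiffAt_conj_comp (hM j)).mul (((hA j).mul (contDiffAt_conj_comp h0)).mul contDiffAt_const))).add
    ((contDiffAt_ofReal_comp ((hn.mul (h0.norm_sq ℝ)).add hg)).mul contDiffAt_const))).sub contDiffAt_const

/-- As |u₀| = |z₁|^β, one has s = |z₁|^{1-β}, so u₀ s gives back z₁ and |u₀|² is the second argument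
of the potential. -/
theorem unchart_coneChart {β : ℝ} (hβ : 0 < β) (y : Plane) (hy : y 0 ≠ 0) :
    unchart (coneChart β y, ‖coneChart β y 0‖ ^ (β⁻¹ - 1)) = (y, ‖y 0‖ ^ (2 * β)) ∧
    ‖coneChart β y 0‖ ^ (β⁻¹ - 1) = ‖y 0‖ ^ (1 - β) := by
  have hr : 0 < ‖y 0‖ := norm_pos_iff.2 hy
  have h0 : ‖coneChart β y 0‖ = ‖y 0‖ ^ β := by
    simp only [coneChart, PiLp.toLp_apply, Matrix.cons_val_zero, norm_mul, Complex.norm_real,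
      Real.norm_of_nonneg (Real.rpow_nonneg hr.le _)]
    rw [← Real.rpow_add_one hr.ne']
    congr 1; ring
  have h1 : ‖coneChart β y 0‖ ^ (β⁻¹ - 1) = ‖y 0‖ ^ (1 - β) := by
    rw [h0, ← Real.rpow_mul hr.le]
    congr 1; field_simp
  refine ⟨?_, h1⟩
  have h2 : ‖coneChart β y 0‖ ^ 2 = ‖y 0‖ ^ (2 * β) := by
    rw [h0, ← Real.rpow_natCast, ← Real.rpow_mul hr.le]
    congr 1; push_cast; ring
  unfold unchart
  rw [h1]
  refine Prod.ext ?_ h2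
  ext i
  fin_cases i
  · have : ((‖y 0‖ ^ (β - 1) : ℝ) : ℂ) * ((‖y 0‖ ^ (1 - β) : ℝ) : ℂ) = 1 := by
      rw [← Complex.ofReal_mul, ← Real.rpow_add hr]; simp
    simp only [coneChart, Fin.zero_eta, PiLp.toLp_apply, Matrix.cons_val_zero]
    linear_combination y 0 * this
  · simp [coneChart]

/-- Off {z₁ = 0} the power z₁^β has a holomorphic branch b with db = β b/z₁ dz₁, so the potential is
the pull-back of `conePot G` by y ↦ (y, b y). The substitution dz₁ = (s/β) ε₁ then removes every
negative power of |z₁|. -/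
theorem hermCoeff_cone {β : ℝ} (hβ : 0 < β) {G : Plane × ℝ → ℝ} {y : Plane} (hy : y 0 ≠ 0)
    (hG : ContDiffAt ℝ 2 G (y, ‖y 0‖ ^ (2 * β))) (i j : Fin 2) :
    hermCoeff ((1 / 2 : ℝ) • iddbar (fun y => G (y, ‖y 0‖ ^ (2 * β))) y) i j =
      ((if i = j then 1 else 0) +
        coneCoeff β G i j (coneChart β y, ‖coneChart β y 0‖ ^ (β⁻¹ - 1))) *
      (frameFactor β y i : ℂ) * (frameFactor β y j : ℂ) := by
  have hpr : AnalyticAt ℂ (fun y : Plane => y 0) y :=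
    (EuclideanSpace.proj (0 : Fin 2) : Plane →L[ℂ] ℂ).analyticAt y
  obtain ⟨b, hb, hb0, hbn, hbd⟩ := exists_branch hpr hy β
  have hpr' : ∀ v : Plane, fderiv ℂ (fun y : Plane => y 0) y v = v 0 := fun v =>
    DFunLike.congr_fun (EuclideanSpace.proj (0 : Fin 2) : Plane →L[ℂ] ℂ).fderiv v
  have hr : 0 < ‖y 0‖ := norm_pos_iff.2 hy
  have hb2 : ∀ᶠ y in 𝓝 y, ‖b y‖ ^ 2 = ‖y 0‖ ^ (2 * β) := by
    filter_upwards [hbn] with y h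
    rw [h, ← Real.rpow_natCast, ← Real.rpow_mul (norm_nonneg _)]
    congr 1; push_cast; ring
  have hb2y := hb2.self_of_nhds
  rw [← hb2y] at hG
  have hι : AnalyticAt ℂ (fun y => (y, b y)) y := analyticAt_id.prod hb
  have heq : (fun y => G (y, ‖y 0‖ ^ (2 * β))) =ᶠ[𝓝 y] fun y => conePot G (y, b y) := by
    filter_upwards [hb2] with y h
    rw [conePot, h]
  have hsm : ContDiffAt ℝ 2 (fun y => G (y, ‖y 0‖ ^ (2 * β))) y :=
    (ContDiffAt.comp y (f := fun y => (y, b y)) (conePot_smooth hG) hι.smoothAt).congr_of_eventuallyEq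
      heq
  have hιd : ∀ v, fderiv ℂ (fun y => (y, b y)) y v = (v, β * b y / y 0 * v 0) := by
    intro v
    rw [HasFDerivAt.fderiv (f := fun y => (y, b y))
      ((hasFDerivAt_id y).prodMk hb.differentiableAt.hasFDerivAt)]
    simp [hbd, hpr']
  obtain ⟨hun, hs⟩ := unchart_coneChart hβ y hy
  rw [hermCoeff_smul, hermCoeff_iddbar hsm, rlev_eventuallyEq heq]
  have hlev := lev_comp (f := fun p => (conePot G p : ℂ)) hι (conePot_smooth hG).ofReal
    (stdVec i) (stdVec j)
  have hrl : rlev (fun y => conePot G (y, b y)) y (stdVec i) (stdVec j) =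
      rlev (conePot G) (y, b y) (stdVec i, β * b y / y 0 * stdVec i 0)
        (stdVec j, β * b y / y 0 * stdVec j 0) := by
    rw [← hιd, ← hιd]; exact hlev
  rw [hrl, rlev_conePot hG, hb2y]
  unfold coneCoeff
  rw [hun]
  dsimp only
  rw [hs]
  set r := ‖y 0‖
  set t := r ^ (β - 1) with ht
  have htt : (t : ℂ) * ((r ^ (1 - β) : ℝ) : ℂ) = 1 := by
    rw [ht, ← Complex.ofReal_mul, ← Real.rpow_add hr]; simp
  have hu0 : coneChart β y 0 = t * y 0 := by simp [coneChart, ht, r]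
  have hβ' : (β : ℂ) ≠ 0 := by exact_mod_cast hβ.ne'
  have hyc : (starRingEnd ℂ) (y 0) ≠ 0 := by simpa using hy
  have hbb : b y * (starRingEnd ℂ) (b y) = t ^ 2 * (y 0 * (starRingEnd ℂ) (y 0)) := by
    rw [Complex.mul_conj', Complex.mul_conj', hbn.self_of_nhds]
    have : r ^ β = t * r := by rw [ht, ← Real.rpow_add_one hr.ne']; congr 1; ring
    change ((r ^ β : ℝ) : ℂ) ^ 2 = t ^ 2 * (r : ℂ) ^ 2
    rw [this]; push_cast; ring
  have hn0 : ‖coneChart β y 0‖ ^ 2 = r ^ (2 * β) := congrArg Prod.snd hun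
  have hAF : ∀ i, (![((r ^ (1 - β) : ℝ) : ℂ) / β, 1] : Fin 2 → ℂ) i * (frameFactor β y i : ℂ) = 1 := by
    intro i
    fin_cases i
    · simp [frameFactor]
      change _ / _ * (_ * (t : ℂ)) = 1
      field_simp
      rw [mul_comm]; exact htt
    · simp [frameFactor]
  have hBF : ∀ i, (![1, 0] : Fin 2 → ℂ) i * (frameFactor β y i : ℂ) =
      stdVec i 0 * (β * t) := by
    intro i
    fin_cases i
    · simp [frameFactor, stdVec]; left; rfl
    · simp [frameFactor, stdVec]
  have hB : ∀ i, stdVec i 0 = (![1, 0] : Fin 2 → ℂ) i := by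
    intro i; fin_cases i <;> simp [stdVec]
  have hBc : ∀ i, (starRingEnd ℂ) (stdVec i 0) = stdVec i 0 := by
    intro i; fin_cases i <;> simp [stdVec]
  have hq1 : ∀ B : ℂ, b y * ((β * (starRingEnd ℂ) (b y)) / (starRingEnd ℂ) (y 0) * B) =
      t * y 0 * (B * (β * t)) := by
    intro B
    field_simp
    linear_combination B * hbb
  have hq2 : ∀ B : ℂ, (starRingEnd ℂ) (b y) * ((β * b y) / y 0 * B) =
      t * (starRingEnd ℂ) (y 0) * (B * (β * t)) := by
    intro B
    field_simp
    linear_combination B * hbb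
  have hq3 : ∀ B B' : ℂ, (β * b y) / y 0 * B * ((β * (starRingEnd ℂ) (b y)) / (starRingEnd ℂ) (y 0) * B') =
      (B * (β * t)) * (B' * (β * t)) := by
    intro B B'
    field_simp
    linear_combination B * B' * hbb
  rw [hu0] at hn0 ⊢
  rw [hn0]
  simp only [map_mul, map_div₀, Complex.conj_ofReal, hBc]
  rw [hq1, hq2, hq3, ← hBF, ← hBF]
  set A := (![((r ^ (1 - β) : ℝ) : ℂ) / β, 1] : Fin 2 → ℂ)
  set B := (![1, 0] : Fin 2 → ℂ)
  set X1 := horLev G (stdVec i) (stdVec j) (y, r ^ (2 * β))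
  set X2 := mixDel G (stdVec i) (y, r ^ (2 * β))
  set X3 := (starRingEnd ℂ) (mixDel G (stdVec j) (y, r ^ (2 * β)))
  have h1 := hAF i
  have h2 := hAF j
  push_cast
  linear_combination (-1 / 2 * X1 * A j * frameFactor β y j - 1 / 2 * X2 * t * y 0 * B j * frameFactor β y j) * h1 +
    (-1 / 2 * X1 - 1 / 2 * X3 * t * (starRingEnd ℂ) (y 0) * B i * frameFactor β y i) * h2

end

/-! ### Strict plurisubharmonicity and curvature near the curve -/

section

theorem horLev_zero {E : Type*} [NormedAddCommGroup E] [NormedSpace ℝ E] [NormedSpace ℂ E]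
    [IsScalarTower ℝ ℂ E] [CompleteSpace E] {G : E × ℝ → ℝ} {z : E} (hG : ContDiffAt ℝ 2 G (z, 0)) (v w : E) :
    horLev G v w (z, 0) = rlev (fun z => G (z, 0)) z v w := by
  have hG' : ContDiffAt ℝ 2 G (z, ‖(0 : ℂ)‖ ^ 2) := by simpa using hG
  have hι : AnalyticAt ℂ (fun z : E => (z, (0 : ℂ))) z := analyticAt_id.prod analyticAt_const
  have h1 : ∀ v, fderiv ℂ (fun z : E => (z, (0 : ℂ))) z v = (v, 0) := by
    intro v
    rw [HasFDerivAt.fderiv (f := fun z : E => (z, (0 : ℂ)))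
      ((hasFDerivAt_id z).prodMk (hasFDerivAt_const 0 z))]
    simp
  have h2 := lev_comp (f := fun p => (conePot G p : ℂ)) hι (conePot_smooth hG').ofReal v w
  have h3 := rlev_conePot hG' v w 0 0
  rw [h1, h1] at h2
  have h4 : (fun y : E => ((conePot G (y, (0 : ℂ)) : ℝ) : ℂ)) = fun y => ((G (y, 0) : ℝ) : ℂ) := by
    ext y; simp [conePot]
  rw [h4] at h2
  change rlev (fun z => G (z, 0)) z v w = rlev (conePot G) (z, 0) (v, 0) (w, 0) at h2
  rw [h2, h3]
  simp

/-- At y = 0 the Levi form is block diagonal: the Levi form of the restriction to ρ = 0, and ∂G/∂ρ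
times |b|². -/
theorem strictPsh_conePot {E : Type*} [NormedAddCommGroup E] [NormedSpace ℝ E] [NormedSpace ℂ E]
    [IsScalarTower ℝ ℂ E] [CompleteSpace E] {G : E × ℝ → ℝ} {z : E} (hG : ContDiffAt ℝ 2 G (z, 0))
    (hpsh : StrictPsh (fun z => G (z, 0)) z) (hρ : 0 < fderiv ℝ G (z, 0) (0, 1)) :
    StrictPsh (conePot G) (z, 0) := by
  rintro ⟨a, b⟩ hab
  have hG' : ContDiffAt ℝ 2 G (z, ‖(0 : ℂ)‖ ^ 2) := by simpa using hG
  rw [rlev_conePot hG']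
  have h0 : ‖(0 : ℂ)‖ ^ 2 = 0 := by simp
  rw [h0, horLev_zero hG]
  have h1 : ((rlev (fun z => G (z, 0)) z a a) + ((fderiv ℝ G (z, 0) (0, 1) : ℝ) : ℂ) *
      (b * (starRingEnd ℂ) b)).re = (rlev (fun z => G (z, 0)) z a a).re +
        fderiv ℝ G (z, 0) (0, 1) * ‖b‖ ^ 2 := by
    rw [Complex.mul_conj', ← Complex.ofReal_pow, ← Complex.ofReal_mul, Complex.add_re,
      Complex.ofReal_re]
  simp only [zero_mul, map_zero, mul_zero, add_zero, zero_add]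
  rw [h1]
  by_cases ha : a = 0
  · have hb : b ≠ 0 := by rintro rfl; exact hab (by simp [ha])
    have h2 : rlev (fun z => G (z, 0)) z a a = 0 := by
      have := lev_real_smul_left (fun z => ((G (z, 0) : ℝ) : ℂ)) z 0 a 0
      rw [zero_smul] at this
      rw [ha] at this ⊢
      simpa [rlev] using this
    rw [h2]
    have : 0 < ‖b‖ := norm_pos_iff.2 hb
    simp; positivity
  · have := hpsh a ha
    positivity

section

variable {f : Plane → ℂ} {p : Plane} {β : ℝ} {κ : Plane → TwoForm} {G : Plane × ℝ → ℝ}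

theorem tendsto_norm_rpow {X : Type*} [TopologicalSpace X] {f : X → ℂ} {x : X}
    (hf : ContinuousAt f x) (h0 : f x = 0) {a : ℝ} (ha : 0 < a) :
    Filter.Tendsto (fun y => ‖f y‖ ^ a) (𝓝 x) (𝓝 0) := by
  have h1 := hf.norm.rpow_const (p := a) (Or.inr ha.le)
  have h2 := h1.tendsto
  simpa [h0, Real.zero_rpow ha.ne'] using h2

/-- Near a smooth point of the curve, a potential `G (x, |f|^(2 β))` is strictly plurisubharmonic and
defines a metric of bisectional curvature bounded above. -/
theorem bisec_le_near_curve (hf : AnalyticAt ℂ f p) (h0 : f p = 0) (hβ : 0 < β)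
    (hG : ContDiffAt ℝ 4 G (p, 0)) (hpsh : StrictPsh (fun y => G (y, 0)) p)
    (hρ : 0 < fderiv ℝ G (p, 0) (0, 1)) :
    ∃ B > 0, ∀ᶠ x in 𝓝 p, f x ≠ 0 → ∀ φ : Plane → ℝ,
      (φ =ᶠ[𝓝 x] fun y => G (y, ‖f y‖ ^ (2 * β))) → StrictPsh φ x ∧
      ∀ κ : Plane → TwoForm, (κ =ᶠ[𝓝 x] fun y => (1 / 2 : ℝ) • iddbar φ y) →
      ∀ v w, hermNormSq (κ x) v = 1 → hermNormSq (κ x) w = 1 → bisec κ x v w ≤ B := by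
  have hG' : ContDiffAt ℝ 4 G (p, ‖(0 : ℂ)‖ ^ 2) := by simpa using hG
  have hA := conePot_smooth hG'
  have hs := strictPsh_conePot (hG.of_le (by norm_num)) hpsh hρ
  -- The ambient potential is smooth enough at (p, 0), so one bound holds on a full neighbourhood of
  -- that point. As |f|^β tends to 0, every point off the curve near p is mapped into it by x ↦ (x,
  -- f^β).
  obtain ⟨B, hB, hcurv⟩ := hs.eventually_curvLE hA
  refine ⟨2 * B, by positivity, ?_⟩
  have hall := (hcurv.and (hs.eventually (hA.of_le (by norm_num)))).and (hA.eventually (by simp))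
  rw [nhds_prod_eq] at hall
  obtain ⟨p1, hp1, p2, hp2, hall⟩ := Filter.eventually_prod_iff.1 hall
  obtain ⟨ε, hε, hp2⟩ := Metric.eventually_nhds_iff.1 hp2
  have ht := tendsto_norm_rpow hf.continuousAt h0 hβ
  filter_upwards [hp1, ht (Iio_mem_nhds hε), hf.eventually_analyticAt] with x hx1 hx2 hfx hne φ hφ
  obtain ⟨b, hb, hb0, hbn, -⟩ := exists_branch hfx hne β
  have hbx : p2 (b x) := hp2 (by rw [dist_zero_right, hbn.self_of_nhds]; exact hx2)
  obtain ⟨⟨hc, hst⟩, hsm⟩ := hall hx1 hbx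
  have hι : AnalyticAt ℂ (fun y => (y, b y)) x := analyticAt_id.prod hb
  have heq : φ =ᶠ[𝓝 x] fun y => conePot G (y, b y) := by
    filter_upwards [hφ, hbn] with y hy h
    rw [hy, conePot]
    dsimp only
    rw [h, ← Real.rpow_natCast, ← Real.rpow_mul (norm_nonneg _)]
    congr 3; push_cast; ring
  have hψ : StrictPsh φ x := by
    refine strictPsh_of_pullback heq hι (hsm.of_le (by norm_num)) hst fun v hv => ?_
    rw [HasFDerivAt.fderiv (f := fun y => (y, b y))
      ((hasFDerivAt_id x).prodMk hb.differentiableAt.hasFDerivAt)] at hv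
    exact congrArg Prod.fst hv
  refine ⟨hψ, fun κ hκ v w hv hw => ?_⟩
  refine bisec_le_of_pullback (r := 1) (m := 0) hκ ?_ hι hsm hψ hc le_rfl hB.le v w hv hw
  simpa using heq

end

end

/-! ### Potentials G(x, |f|^{2β}) have cone singularities -/

section

/-- The factor |y₀|^{β-1} may blow up, but the first component has modulus |y₀|^β. -/
theorem continuousAt_coneChart {β : ℝ} (hβ : 0 < β) : ContinuousAt (coneChart β) 0 := by
  have h1 : ∀ i : Fin 2, ContinuousAt (fun y : Plane => coneChart β y i) 0 := by
    intro i
    have hc : ∀ i : Fin 2, ContinuousAt (fun y : Plane => y i) 0 := fun i =>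
      (EuclideanSpace.proj i : Plane →L[ℂ] ℂ).continuous.continuousAt
    fin_cases i
    · have h2 := tendsto_norm_rpow (hc 0) rfl hβ
      have h3 : coneChart β 0 0 = 0 := by simp [coneChart]
      refine Metric.tendsto_nhds.2 fun ε hε => ?_
      filter_upwards [h2 (Iio_mem_nhds hε)] with y hy
      simp only [Fin.zero_eta]
      rw [h3, dist_zero_right]
      by_cases h0 : y 0 = 0
      · simpa [coneChart, h0] using hε
      · refine lt_of_eq_of_lt ?_ hy
        simp only [coneChart, PiLp.toLp_apply, Matrix.cons_val_zero, norm_mul, Complex.norm_real,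
          Real.norm_of_nonneg (Real.rpow_nonneg (norm_nonneg _) _)]
        rw [← Real.rpow_add_one (norm_ne_zero_iff.2 h0)]
        congr 1; ring
    · simpa [coneChart] using hc 1
  have h2 : ContinuousAt (fun y => WithLp.toLp 2 (fun i => coneChart β y i)) (0 : Plane) :=
    (PiLp.continuous_toLp 2 _).continuousAt.comp (continuousAt_pi.2 h1)
  exact h2

theorem pullback_smul (F : Plane → Plane) (σ : Plane → TwoForm) (a : ℝ) (y : Plane) :
    pullback F (fun x => a • σ x) y = a • pullback F σ y := by
  refine twoForm_ext fun v w => ?_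
  simp [pullback]

variable {f : Plane → ℂ} {p : Plane} {β : ℝ} {κ : Plane → TwoForm} {G : Plane × ℝ → ℝ}

theorem contDiffAt_conePotential {E : Type*} [NormedAddCommGroup E] [NormedSpace ℝ E]
    [NormedSpace ℂ E] [IsScalarTower ℝ ℂ E] {f : E → ℂ} {G : E × ℝ → ℝ} {x : E} {a : ℝ}
    (hf : AnalyticAt ℂ f x) (h0 : f x ≠ 0) {n : ℕ∞ω} (hG : ContDiffAt ℝ n G (x, ‖f x‖ ^ a)) :
    ContDiffAt ℝ n (fun y => G (y, ‖f y‖ ^ a)) x :=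
  ContDiffAt.comp x (f := fun y => (y, ‖f y‖ ^ a)) hG
    (contDiffAt_id.prodMk ((hf.smoothAt.norm ℝ h0).rpow_const_of_ne (norm_ne_zero_iff.2 h0)))

/-- A potential `G (x, |f|^(2 β))` defines a metric with cone singularities along `f = 0`. -/
theorem hasConeFormAt_of_potential {C : Set Plane} (hC : ∀ x, x ∈ C ↔ f x = 0)
    (hf : AnalyticAt ℂ f p) (h0 : f p = 0) (hD : fderiv ℂ f p ≠ 0) (hβ : 0 < β) {α : ℝ≥0}
    (hα0 : 0 < α) (hα1 : α < 1) (hα : (α : ℝ) < β⁻¹ - 1)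
    (hG : ContDiffAt ℝ 4 G (p, 0)) (hpsh : StrictPsh (fun y => G (y, 0)) p)
    (hρ : 0 < fderiv ℝ G (p, 0) (0, 1))
    (hκ : ∀ᶠ x in 𝓝 p, f x ≠ 0 →
      κ x = (1 / 2 : ℝ) • iddbar (fun y => G (y, ‖f y‖ ^ (2 * β))) x) :
    HasConeFormAt C β α κ p := by
  obtain ⟨k, hk, hcoord⟩ := exists_adapted_coordinates hf h0 hD
  set g := fderiv ℝ G (p, 0) (0, 1) with hg
  have hs := hpsh k hk
  set s := (rlev (fun y => G (y, 0)) p k k).re with hsd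
  -- The scalings are fixed so that, in the new coordinates, the ρ-derivative of the potential and
  -- its Levi form along the curve both equal 2 at the point. The factor 1/2 in the metric then
  -- gives exactly the coefficients of the model.
  set l := (g / 2) ^ (1 / (2 * β)) with hl
  have hlpos : 0 < l := by positivity
  have hl2 : l ^ (2 * β) = g / 2 := by
    rw [hl, ← Real.rpow_mul (by positivity)]
    field_simp
    rw [Real.rpow_one]; ring
  set μ := √(s / 2) with hμ
  have hμpos : 0 < μ := Real.sqrt_pos.2 (by positivity)
  have hμ2 : μ ^ 2 = s / 2 := Real.sq_sqrt (by positivity)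
  obtain ⟨ψ, hψ, hψ0, hψ1, hfψ, hφ⟩ := hcoord l μ hlpos hμpos
  -- In the new coordinates f = y₀/l, and l^{2β} = g/2, whence |f|^{2β} = (2/g) |y₀|^{2β}.
  set G' : Plane × ℝ → ℝ := fun q => G (ψ q.1, q.2 * (2 / g)) with hG'
  have hinner : ContDiffAt ℝ 4 (fun q : Plane × ℝ => (ψ q.1, q.2 * (2 / g))) (0, 0) :=
    (ContDiffAt.comp (0, 0) (f := Prod.fst) (hψ.smoothAt (n := 4)) contDiffAt_fst).prodMk
      (contDiffAt_snd.mul contDiffAt_const)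
  have hval : (fun q : Plane × ℝ => (ψ q.1, q.2 * (2 / g))) (0, 0) = (p, 0) := by simp [hψ0]
  have hG'sm : ContDiffAt ℝ 4 G' (0, 0) := by
    refine ContDiffAt.comp (0, 0) (f := fun q : Plane × ℝ => (ψ q.1, q.2 * (2 / g))) ?_ hinner
    have h1 := hG
    rw [← hval] at h1
    exact h1
  have hg' : fderiv ℝ G' (0, 0) (0, 1) = 2 := by
    have h1 : HasFDerivAt (fun q : Plane × ℝ => (ψ q.1, q.2 * (2 / g)))
        ((((fderiv ℂ ψ 0).restrictScalars ℝ).comp (.fst ℝ Plane ℝ)).prod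
          ((2 / g) • .snd ℝ Plane ℝ)) (0, 0) := by
      refine HasFDerivAt.prodMk ?_ ?_
      · exact HasFDerivAt.comp (0, 0) (f := Prod.fst) hψ.hasFDerivAt_real hasFDerivAt_fst
      · simpa [mul_comm] using (hasFDerivAt_snd (𝕜 := ℝ) (E := Plane) (F := ℝ) (p := (0, 0))).const_mul (2 / g)
    have h2 : HasFDerivAt G (fderiv ℝ G (p, 0))
        ((fun q : Plane × ℝ => (ψ q.1, q.2 * (2 / g))) (0, 0)) := by
      rw [hval]
      exact (hG.differentiableAt (by norm_num)).hasFDerivAt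
    rw [HasFDerivAt.fderiv (f := G') (h2.comp (0, 0) h1)]
    have h3 : ((0 : Plane), 2 / g) = (2 / g) • ((0 : Plane), (1 : ℝ)) := by simp
    simp only [ContinuousLinearMap.comp_apply, ContinuousLinearMap.prod_apply]
    simp only [ContinuousLinearMap.coe_fst', ContinuousLinearMap.coe_snd', smul_apply, map_zero,
      smul_eq_mul, mul_one]
    rw [h3, map_smul, smul_eq_mul, ← hg]
    field_simp
  have hS' : horLev G' (stdVec 1) (stdVec 1) (0, 0) = 2 := by
    rw [horLev_zero (hG'sm.of_le (by norm_num))]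
    have h1 : ContDiffAt ℝ 2 (fun y : Plane => G (y, 0)) (ψ 0) := by
      rw [hψ0]
      exact ContDiffAt.comp p (f := fun y : Plane => (y, (0 : ℝ))) (hG.of_le (by norm_num))
        (contDiffAt_id.prodMk contDiffAt_const)
    have h2 := lev_comp (f := fun y : Plane => ((G (y, 0) : ℝ) : ℂ)) hψ h1.ofReal (stdVec 1) (stdVec 1)
    have h3 : (fun z => G' (z, 0)) = fun z => G (ψ z, 0) := by ext z; simp [hG']
    rw [h3]
    change lev _ _ _ _ = _
    rw [h2, hψ1, hψ0, lev_smul_left, lev_smul_right]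
    have h4 : lev (fun y : Plane => ((G (y, 0) : ℝ) : ℂ)) p k k = (s : ℂ) := by
      apply Complex.ext
      · rfl
      · rw [hψ0] at h1
        exact rlev_self_im h1 k
    rw [h4]
    have h5 : (s : ℂ) = 2 * (μ : ℂ) ^ 2 := by
      norm_cast; rw [hμ2]; ring
    have h6 : (μ : ℂ) ≠ 0 := by exact_mod_cast hμpos.ne'
    rw [h5]
    simp
    field_simp
  have hun0 : unchart ((0 : Plane), (0 : ℝ)) = (0, 0) := by
    unfold unchart
    refine Prod.ext ?_ (by simp)
    ext i; fin_cases i <;> simp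
  set e := β⁻¹ - 1 with he
  have hepos : 0 < e := lt_of_le_of_lt α.coe_nonneg hα
  let F : Fin 2 → Fin 2 → Plane → ℂ := fun i j u => coneCoeff β G' i j (u, ‖u 0‖ ^ e)
  have hHol : ∀ i j, HolderNear α (F i j) := by
    intro i j
    have h1 : HolderNear α (fun u : Plane => (u, ‖u 0‖ ^ e)) :=
      (holderNear_clm (ContinuousLinearMap.id ℝ Plane) hα1.le).prodMk
        (holderNear_norm_rpow ((EuclideanSpace.proj (0 : Fin 2) : Plane →L[ℂ] ℂ).restrictScalars ℝ)
          hα0 hα1.le hα.le)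
    refine h1.comp_contDiffAt hα0 (g := coneCoeff β G' i j) (contDiffAt_coneCoeff ?_ i j)
    simp only [PiLp.zero_apply, norm_zero, Real.zero_rpow hepos.ne']
    rw [hun0]; exact hG'sm
  choose N U hU hN using fun i j => (hHol i j).exists_holderOnWith
  have hS : {y : Plane | (∀ i j, coneChart β y ∈ U i j) ∧ AnalyticAt ℂ ψ y ∧ AnalyticAt ℂ f (ψ y) ∧
      f (ψ y) = y 0 / l ∧ (f (ψ y) ≠ 0 →
      κ (ψ y) = (1 / 2 : ℝ) • iddbar (fun y => G (y, ‖f y‖ ^ (2 * β))) (ψ y)) ∧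
      (∀ᶠ y in 𝓝 y, f (ψ y) = y 0 / l) ∧
      ContDiffAt ℝ 4 G' (y, ‖y 0‖ ^ (2 * β)) ∧
      ContDiffAt ℝ 4 G (ψ y, ‖f (ψ y)‖ ^ (2 * β))} ∈ 𝓝 (0 : Plane) := by
    have hc0 : coneChart β 0 = 0 := by
      ext i; fin_cases i <;> simp [coneChart]
    have hψc : Filter.Tendsto ψ (𝓝 0) (𝓝 p) := by
      have := hψ.continuousAt.tendsto; rwa [hψ0] at this
    have hpr : ContinuousAt (fun y : Plane => y 0) 0 :=
      (EuclideanSpace.proj (0 : Fin 2) : Plane →L[ℂ] ℂ).continuous.continuousAt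
    have ht1 : Filter.Tendsto (fun y : Plane => (y, ‖y 0‖ ^ (2 * β))) (𝓝 0) (𝓝 (0, 0)) := by
      rw [nhds_prod_eq]
      exact Filter.tendsto_id.prodMk (tendsto_norm_rpow hpr rfl (by positivity))
    have ht2 : Filter.Tendsto (fun y : Plane => (ψ y, ‖f (ψ y)‖ ^ (2 * β))) (𝓝 0) (𝓝 (p, 0)) := by
      rw [nhds_prod_eq]
      exact hψc.prodMk ((tendsto_norm_rpow hf.continuousAt h0 (by positivity)).comp hψc)
    have hcc : ∀ᶠ y in 𝓝 (0 : Plane), ∀ i j, coneChart β y ∈ U i j := by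
      rw [Filter.eventually_all]; intro i
      rw [Filter.eventually_all]; intro j
      have := (continuousAt_coneChart hβ).tendsto
      rw [hc0] at this
      exact this (hU i j)
    filter_upwards [hcc, hψ.eventually_analyticAt, hψc hf.eventually_analyticAt, hfψ, hψc hκ,
      hfψ.eventually_nhds, ht1 (hG'sm.eventually (by simp)), ht2 (hG.eventually (by simp))]
      with y a1 a2 a3 a4 a5 a6 a7 a8
    exact ⟨a1, a2, a3, a4, a5, a6, a7, a8⟩
  obtain ⟨φ, hps, hφp, hφd, hφsd, hφf, hφS, hφsymm⟩ := hφ _ hS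
  have hl0 : (l : ℂ) ≠ 0 := by exact_mod_cast hlpos.ne'
  refine ⟨φ, hps, hφp, hφd, hφsd, ?_, ∑ i, ∑ j, N i j, F, ?_, ?_, ?_, ?_⟩
  · intro x _
    rw [hC, hφf]
    simp [hl0]
  · rintro i j _ ⟨y, hy, rfl⟩ _ ⟨y', hy', rfl⟩
    refine (hN i j _ ((hφS hy).1 i j) _ ((hφS hy').1 i j)).trans ?_
    gcongr
    exact (Finset.single_le_sum (f := fun j => N i j) (fun _ _ => zero_le) (Finset.mem_univ j)).trans
      (Finset.single_le_sum (f := fun i => ∑ j, N i j) (fun _ _ => zero_le) (Finset.mem_univ i))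
  · intro i j
    simp only [F, coneCoeff, PiLp.zero_apply, norm_zero, Real.zero_rpow hepos.ne', hun0, hg']
    fin_cases i <;> fin_cases j <;> simp [hS']
  -- Each mixed term carries a factor `u 0`, its conjugate, or a positive power of `‖u 0‖`.
  · intro i j hij u _ hu0
    simp only [F, coneCoeff, hu0, norm_zero, Real.zero_rpow hepos.ne']
    fin_cases i <;> fin_cases j <;> simp at hij ⊢
  · intro y hy hy0 i j
    obtain ⟨-, h2, h3, h4, h5, h6, h7, h8⟩ := hφS hy
    have hfne : f (ψ y) ≠ 0 := by rw [h4]; exact div_ne_zero hy0 hl0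
    rw [hφsymm]
    have e1 : pullback ψ κ y = (1 / 2 : ℝ) • iddbar (fun y => G' (y, ‖y 0‖ ^ (2 * β))) y := by
      have a1 : pullback ψ κ y =
          pullback ψ (fun x => (1 / 2 : ℝ) • iddbar (fun y => G (y, ‖f y‖ ^ (2 * β))) x) y := by
        unfold pullback; rw [h5 hfne]
      rw [a1, pullback_smul, pullback_iddbar h2
        (contDiffAt_conePotential h3 hfne (h8.of_le (by norm_num)))]
      congr 1
      refine (iddbar_eventuallyEq ?_).self_of_nhds
      filter_upwards [h6] with z hz
      simp only [hG']
      congr 2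
      rw [hz, norm_div, Complex.norm_real, Real.norm_of_nonneg hlpos.le,
        Real.div_rpow (norm_nonneg _) hlpos.le, hl2]
      field_simp
    rw [e1]
    exact hermCoeff_cone hβ hy0 (h7.of_le (by norm_num)) i j

end

/-! ### Linear forms on the plane and factorization of the leading part -/

section

/-- The functional `wedge q`. -/
def wedgeL (q : Plane) : Plane →L[ℂ] ℂ :=
  q 0 • EuclideanSpace.proj (1 : Fin 2) - q 1 • EuclideanSpace.proj (0 : Fin 2)

@[simp] theorem wedgeL_apply (q x : Plane) : wedgeL q x = wedge q x := by
  simp [wedgeL, wedge]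

theorem wedge_add (q x y : Plane) : wedge q (x + y) = wedge q x + wedge q y := by
  simp [wedge]; ring

theorem wedge_smul (q x : Plane) (a : ℂ) : wedge q (a • x) = a * wedge q x := by
  simp [wedge]; ring

theorem smul_wedge (q x : Plane) (a : ℂ) : wedge (a • q) x = a * wedge q x := by
  simp [wedge]; ring

theorem wedge_self (q : Plane) : wedge q q = 0 := by simp [wedge]; ring

theorem wedge_swap (q x : Plane) : wedge x q = -wedge q x := by simp [wedge]; ring

theorem eq_wedge_smul_add {q e : Plane} (h : wedge q e = 1) (x : Plane) :
    x = wedge x e • q + wedge q x • e := by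
  simp only [wedge] at h ⊢
  ext i
  fin_cases i
  · simp; linear_combination (-x 0) * h
  · simp; linear_combination (-x 1) * h

theorem exists_wedge_eq_one {q : Plane} (hq : q ≠ 0) : ∃ e, wedge q e = 1 := by
  by_cases h0 : q 0 = 0
  · have h1 : q 1 ≠ 0 := by
      intro h1; apply hq; ext i; fin_cases i <;> simp [h0, h1]
    exact ⟨!₂[-(q 1)⁻¹, 0], by simp [wedge, h1]⟩
  · exact ⟨!₂[0, (q 0)⁻¹], by simp [wedge, h0]⟩

theorem wedge_eq_zero_iff {q : Plane} (hq : q ≠ 0) (x : Plane) :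
    wedge q x = 0 ↔ ∃ a : ℂ, x = a • q := by
  constructor
  · intro h
    obtain ⟨e, he⟩ := exists_wedge_eq_one hq
    exact ⟨wedge x e, by simpa [h] using eq_wedge_smul_add he x⟩
  · rintro ⟨a, rfl⟩
    rw [wedge_smul, wedge_self, mul_zero]

theorem eq_zero_of_wedge {q q' x : Plane} (h : wedge q q' ≠ 0) (h1 : wedge q x = 0)
    (h2 : wedge q' x = 0) : x = 0 := by
  simp only [wedge] at h h1 h2
  have e0 : (q 0 * q' 1 - q 1 * q' 0) * x 0 = 0 := by linear_combination q' 0 * h1 - q 0 * h2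
  have e1 : (q 0 * q' 1 - q 1 * q' 0) * x 1 = 0 := by linear_combination q' 1 * h1 - q 1 * h2
  ext i
  fin_cases i
  · simpa [h] using e0
  · simpa [h] using e1

theorem eval_smul_of_homogeneous {p : MvPolynomial (Fin 2) ℂ} {n : ℕ} (hp : p.IsHomogeneous n)
    (a : ℂ) (x : Plane) : MvPolynomial.eval (fun i => (a • x) i) p =
      a ^ n * MvPolynomial.eval (fun i => x i) p := by
  rw [MvPolynomial.eval_eq', MvPolynomial.eval_eq', Finset.mul_sum]
  refine Finset.sum_congr rfl fun s hs => ?_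
  have h1 : ∑ i, s i = n := by
    rw [hp.degree_eq_sum_deg_support hs]
    exact (Finset.sum_subset (Finset.subset_univ _) fun i _ hi => Finsupp.notMem_support_iff.1 hi).symm
  have h2 : ∏ i, (a • x) i ^ s i = a ^ n * ∏ i, x i ^ s i := by
    rw [← h1, ← Finset.prod_pow_eq_pow_sum, ← Finset.prod_mul_distrib]
    exact Finset.prod_congr rfl fun i _ => by simp [mul_pow]
  rw [h2]; ring

/-- The restriction of a polynomial to a line. -/
def linePoly (p : MvPolynomial (Fin 2) ℂ) (e u : Plane) : Polynomial ℂ :=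
  MvPolynomial.aeval (fun i => Polynomial.C (e i) + Polynomial.X * Polynomial.C (u i)) p

theorem eval_linePoly (p : MvPolynomial (Fin 2) ℂ) (e u : Plane) (τ : ℂ) :
    (linePoly p e u).eval τ = MvPolynomial.eval (fun i => (e + τ • u) i) p := by
  have h1 : Polynomial.evalRingHom τ (linePoly p e u) =
      MvPolynomial.eval₂ ((Polynomial.evalRingHom τ).comp (algebraMap ℂ (Polynomial ℂ)))
        (fun i => Polynomial.evalRingHom τ (Polynomial.C (e i) + Polynomial.X * Polynomial.C (u i))) p := by
    rw [linePoly, MvPolynomial.aeval_def, MvPolynomial.hom_eval₂]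
  rw [Polynomial.coe_evalRingHom] at h1
  rw [h1, MvPolynomial.eval, MvPolynomial.coe_eval₂Hom]
  congr 1
  · ext a; simp
  · ext i
    simp only [Polynomial.coe_evalRingHom, Polynomial.eval_add, Polynomial.eval_C,
      Polynomial.eval_mul, Polynomial.eval_X, PiLp.add_apply, PiLp.smul_apply, smul_eq_mul]

/-- On the line through `e` and a general point `y`, the difference of the two sides is a polynomial
of degree at most d in one variable. It vanishes at `e` and at the d intersections with the given
lines, which are d + 1 distinct points. -/
theorem eval_eq_prod {p : MvPolynomial (Fin 2) ℂ} {d : ℕ} (hp : p.IsHomogeneous d)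
    {ℓ : Fin d → Plane} (hℓ : ∀ j k, j ≠ k → wedge (ℓ j) (ℓ k) ≠ 0)
    (hz : ∀ k x, wedge (ℓ k) x = 0 → MvPolynomial.eval (fun i => x i) p = 0)
    {e : Plane} (he : MvPolynomial.eval (fun i => e i) p ≠ 0) (x : Plane) :
    MvPolynomial.eval (fun i => x i) p =
      MvPolynomial.eval (fun i => e i) p / (∏ k, wedge (ℓ k) e) * ∏ k, wedge (ℓ k) x := by
  have hte : ∀ k, wedge (ℓ k) e ≠ 0 := fun k h => he (hz k e h)
  have hpe : ∏ k, wedge (ℓ k) e ≠ 0 := Finset.prod_ne_zero_iff.2 fun k _ => hte k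
  set c := MvPolynomial.eval (fun i => e i) p / (∏ k, wedge (ℓ k) e) with hc
  by_cases hx0 : ∃ k, wedge (ℓ k) x = 0
  · obtain ⟨k, hk⟩ := hx0
    rw [hz k x hk, Finset.prod_eq_zero (Finset.mem_univ k) hk, mul_zero]
  push Not at hx0
  -- The two conditions express general position: y - e lies on none of the given lines, and the
  -- line from e to y misses the origin, so its intersections with the given lines exist and are
  -- distinct.
  have key : ∀ y : Plane, (∀ k, wedge (ℓ k) y ≠ wedge (ℓ k) e) → (∀ a : ℂ, y ≠ a • e) →
      MvPolynomial.eval (fun i => y i) p = c * ∏ k, wedge (ℓ k) y := by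
    intro y hy hye
    set u := y - e with hu
    have htu : ∀ k, wedge (ℓ k) u ≠ 0 := by
      intro k h
      have : wedge (ℓ k) y = wedge (ℓ k) e + wedge (ℓ k) u := by rw [← wedge_add, hu]; simp
      rw [h, add_zero] at this
      exact hy k this
    let r : Polynomial ℂ := linePoly p e u - Polynomial.C c *
      ∏ k, (Polynomial.C (wedge (ℓ k) e) + Polynomial.X * Polynomial.C (wedge (ℓ k) u))
    have hr : ∀ τ, r.eval τ = MvPolynomial.eval (fun i => (e + τ • u) i) p -
        c * ∏ k, wedge (ℓ k) (e + τ • u) := by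
      intro τ
      simp only [r, Polynomial.eval_sub, eval_linePoly, Polynomial.eval_mul, Polynomial.eval_C,
        Polynomial.eval_prod, Polynomial.eval_add, Polynomial.eval_X, wedge_add, wedge_smul]
    have hdeg : r.natDegree ≤ d := by
      refine (Polynomial.natDegree_sub_le _ _).trans (max_le ?_ ?_)
      · refine (MvPolynomial.aeval_natDegree_le (n := 1) p hp.totalDegree_le _ fun i => ?_).trans (by simp)
        compute_degree
      · refine (Polynomial.natDegree_C_mul_le _ _).trans ((Polynomial.natDegree_prod_le _ _).trans ?_)
        refine (Finset.sum_le_card_nsmul _ _ 1 fun k _ => ?_).trans (by simp)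
        compute_degree
    let z : Option (Fin d) → ℂ := fun o => o.elim 0 fun k => -(wedge (ℓ k) e / wedge (ℓ k) u)
    have hzinj : Function.Injective z := by
      have hne : ∀ k, -(wedge (ℓ k) e / wedge (ℓ k) u) ≠ 0 := fun k =>
        neg_ne_zero.2 (div_ne_zero (hte k) (htu k))
      have hzk : ∀ k τ, τ = -(wedge (ℓ k) e / wedge (ℓ k) u) → wedge (ℓ k) (e + τ • u) = 0 := by
        intro k τ h
        have := htu k
        rw [wedge_add, wedge_smul, h]; field_simp; ring
      rintro (_ | j) (_ | k) h
      · rfl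
      · exact absurd h.symm (hne k)
      · exact absurd h (hne j)
      · by_contra hjk
        have hjk' : j ≠ k := fun h => hjk (by rw [h])
        have h3 := eq_zero_of_wedge (hℓ j k hjk') (hzk j _ rfl) (hzk k _ h)
        set τ := -(wedge (ℓ j) e / wedge (ℓ j) u) with hτ
        have hτ0 : τ ≠ 0 := hne j
        refine hye (1 - τ⁻¹) ?_
        have h4 : τ⁻¹ • e + u = 0 := by
          have := congrArg (fun v => τ⁻¹ • v) h3
          simpa [smul_add, smul_smul, hτ0] using this
        have h5 : u = -(τ⁻¹ • e) := (neg_eq_of_add_eq_zero_right h4).symm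
        have h6 : y = e + u := by rw [hu]; simp
        rw [h6, h5, sub_smul, one_smul, sub_eq_add_neg]
    have hr0 : r = 0 := by
      refine Polynomial.eq_zero_of_natDegree_lt_card_of_eval_eq_zero r hzinj ?_ (by simp; omega)
      rintro (_ | k)
      · rw [hr]
        simp only [z, Option.elim, zero_smul, add_zero, hc]
        field_simp; ring
      · have h1 : wedge (ℓ k) (e + z (some k) • u) = 0 := by
          have := htu k
          rw [wedge_add, wedge_smul]; simp only [z, Option.elim]; field_simp; ring
        rw [hr, hz k _ h1, Finset.prod_eq_zero (Finset.mem_univ k) h1]; ring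
    have h1 := hr 1
    rw [hr0, Polynomial.eval_zero] at h1
    have h6 : e + (1 : ℂ) • u = y := by rw [hu]; simp
    rw [h6] at h1
    linear_combination -h1
  have hhom : ∀ (a : ℂ) (y : Plane), ∏ k, wedge (ℓ k) (a • y) = a ^ d * ∏ k, wedge (ℓ k) y := by
    intro a y
    simp only [wedge_smul]
    rw [Finset.prod_mul_distrib]; simp
  by_cases hxe : ∃ a : ℂ, x = a • e
  · obtain ⟨a, rfl⟩ := hxe
    rw [eval_smul_of_homogeneous hp, hhom, hc]
    field_simp
  push Not at hxe
  -- A multiple of x by a scalar outside this finite set is in general position; homogeneity carries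
  -- the identity back to x.
  have hfin : ({0} ∪ Set.range fun k => wedge (ℓ k) e / wedge (ℓ k) x).Finite :=
    (Set.finite_singleton _).union (Set.finite_range _)
  obtain ⟨a, ha⟩ := hfin.infinite_compl.nonempty
  simp only [Set.mem_compl_iff, Set.mem_union, Set.mem_singleton_iff, Set.mem_range, not_or,
    not_exists] at ha
  have h1 := key (a • x) (fun k h => ha.2 k (by rw [← h, wedge_smul, mul_div_assoc, div_self (hx0 k), mul_one]))
    (fun b h => hxe (a⁻¹ * b) (by rw [← smul_smul, ← h, smul_smul, inv_mul_cancel₀ ha.1, one_smul]))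
  rw [eval_smul_of_homogeneous hp, hhom] at h1
  have h2 : a ^ d ≠ 0 := pow_ne_zero _ ha.1
  apply mul_left_cancel₀ h2
  linear_combination h1

/-- The top degree part of the equation of the curve is a product of linear forms. -/
theorem exists_factorization {P : MvPolynomial (Fin 2) ℂ} {d : ℕ} (hd : 2 ≤ d)
    (hdeg : P.totalDegree = d) (hL : HasDistinctAsymptoticLines P d) :
    ∃ (ℓ : Fin d → Plane) (c : ℂ), c ≠ 0 ∧ (∀ j k, j ≠ k → wedge (ℓ j) (ℓ k) ≠ 0) ∧
      (∀ x : Plane, MvPolynomial.eval (fun i => x i) (MvPolynomial.homogeneousComponent d P) =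
        c * ∏ k, wedge (ℓ k) x) := by
  obtain ⟨ℓ, hℓ, hL⟩ := hL
  have hp := MvPolynomial.homogeneousComponent_isHomogeneous d P
  set p := MvPolynomial.homogeneousComponent d P with hpd
  have hℓ0 : ∀ k, ℓ k ≠ 0 := by
    intro k hk
    obtain ⟨j, hj⟩ : ∃ j, j ≠ k := by
      have : Nontrivial (Fin d) := Fin.nontrivial_iff_two_le.2 hd
      exact exists_ne k
    exact hℓ k j hj.symm (by rw [hk]; simp [wedge])
  have hz : ∀ k (x : Plane), wedge (ℓ k) x = 0 → MvPolynomial.eval (fun i => x i) p = 0 := by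
    intro k x hx
    have : x ∈ asymptoticLines P d := by
      rw [hL]; exact Set.mem_iUnion.2 ⟨k, (wedge_eq_zero_iff (hℓ0 k) x).1 hx⟩
    exact this
  have hp0 : p ≠ 0 := by
    intro h0
    have hne : P.support.Nonempty := by
      rw [Finset.nonempty_iff_ne_empty, ne_eq, MvPolynomial.support_eq_empty]
      rintro rfl
      simp at hdeg; omega
    obtain ⟨s, hs, hsd⟩ := Finset.exists_mem_eq_sup P.support hne fun s => s.sum fun _ e => e
    have h1 : s.degree = d := by
      rw [← hdeg, MvPolynomial.totalDegree, hsd]; rfl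
    have h2 : MvPolynomial.coeff s p = MvPolynomial.coeff s P := by
      rw [hpd, MvPolynomial.coeff_homogeneousComponent, if_pos h1]
    rw [h0, MvPolynomial.coeff_zero] at h2
    exact MvPolynomial.mem_support_iff.1 hs h2.symm
  obtain ⟨e, he⟩ : ∃ e : Plane, MvPolynomial.eval (fun i => e i) p ≠ 0 := by
    by_contra! h
    apply hp0
    refine MvPolynomial.funext fun x => ?_
    rw [map_zero]
    exact h (WithLp.toLp 2 x)
  refine ⟨ℓ, _, ?_, hℓ, eval_eq_prod hp hℓ hz he⟩
  exact div_ne_zero he (Finset.prod_ne_zero_iff.2 fun k _ h => he (hz k e h))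

end

/-! ### Local structure of the flat potential -/

section

section HolNorm

variable {E : Type*} [NormedAddCommGroup E] [NormedSpace ℂ E]

/-- Near `x`, the function `f` is the squared norm of a holomorphic function without zeros. -/
def HolNorm (f : E → ℝ) (x : E) : Prop :=
  ∃ g : E → ℂ, AnalyticAt ℂ g x ∧ g x ≠ 0 ∧ ∀ᶠ y in 𝓝 x, f y = ‖g y‖ ^ 2

theorem HolNorm.mul {f g : E → ℝ} {x : E} (hf : HolNorm f x) (hg : HolNorm g x) :
    HolNorm (fun y => f y * g y) x := by
  obtain ⟨u, hu, hu0, huf⟩ := hf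
  obtain ⟨v, hv, hv0, hvg⟩ := hg
  refine ⟨fun y => u y * v y, hu.mul hv, mul_ne_zero hu0 hv0, ?_⟩
  filter_upwards [huf, hvg] with y h1 h2
  rw [h1, h2, norm_mul, mul_pow]

theorem holNorm_norm_rpow {f : E → ℂ} {x : E} (hf : AnalyticAt ℂ f x) (h0 : f x ≠ 0) (a : ℝ) :
    HolNorm (fun y => ‖f y‖ ^ a) x := by
  obtain ⟨g, hg, hg0, hgn, -⟩ := exists_branch hf h0 (a / 2)
  refine ⟨g, hg, hg0, ?_⟩
  filter_upwards [hgn] with y h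
  rw [h, ← Real.rpow_natCast, ← Real.rpow_mul (norm_nonneg _)]
  congr 1; push_cast; ring

theorem holNorm_const {a : ℝ} (ha : 0 < a) (x : E) : HolNorm (fun _ => a) x := by
  refine ⟨fun _ => (√a : ℝ), analyticAt_const, by simpa using (Real.sqrt_pos.2 ha).ne', ?_⟩
  filter_upwards with y
  rw [Complex.norm_real, Real.norm_of_nonneg (Real.sqrt_nonneg _), Real.sq_sqrt ha.le]

theorem holNorm_norm_sq {f : E → ℂ} {x : E} (hf : AnalyticAt ℂ f x) (h0 : f x ≠ 0) :
    HolNorm (fun y => ‖f y‖ ^ 2) x := ⟨f, hf, h0, Filter.Eventually.of_forall fun _ => rfl⟩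

end HolNorm

/-- The affine coordinate `ζ` of the line through `y`, written as `[q + ζ e]`. -/
def lineCoord (q e y : Plane) : ℂ := wedge q y / wedge y e

theorem analyticAt_wedge (q x : Plane) : AnalyticAt ℂ (wedge q) x := by
  have h : wedge q = wedgeL q := by ext y; simp
  rw [h]; exact (wedgeL q).analyticAt x

theorem analyticAt_wedge_left (q x : Plane) : AnalyticAt ℂ (fun y => wedge y q) x := by
  have h : (fun y => wedge y q) = fun y => -wedge q y := by ext y; exact wedge_swap q y
  rw [h]; exact (analyticAt_wedge q x).neg

theorem fderiv_wedge (q x v : Plane) : fderiv ℂ (wedge q) x v = wedge q v := by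
  have h : wedge q = wedgeL q := by ext y; simp
  rw [h, (wedgeL q).fderiv]

theorem fderiv_wedge_left (q x v : Plane) : fderiv ℂ (fun y => wedge y q) x v = wedge v q := by
  have h : (fun y => wedge y q) = fun y => -wedgeL q y := by
    ext y; rw [wedgeL_apply]; exact wedge_swap q y
  rw [h, fderiv_fun_neg]
  simp only [neg_apply, (wedgeL q).fderiv]
  rw [wedgeL_apply]; exact (wedge_swap q v).symm





theorem analyticAt_lineCoord {q e : Plane} (hqe : wedge q e = 1) :
    AnalyticAt ℂ (lineCoord q e) q :=
  (analyticAt_wedge q q).div (analyticAt_wedge_left e q) (by rw [hqe]; exact one_ne_zero)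

theorem lineCoord_self (q e : Plane) : lineCoord q e q = 0 := by
  simp [lineCoord, wedge_self]

theorem fderiv_lineCoord {q e : Plane} (hqe : wedge q e = 1) (v : Plane) :
    fderiv ℂ (lineCoord q e) q v = wedge q v := by
  have h1 := (analyticAt_wedge q q).differentiableAt.hasFDerivAt
  have h2 := (analyticAt_wedge_left e q).differentiableAt.hasFDerivAt
  have h3 := h1.mul ((hasDerivAt_inv (by rw [hqe]; exact one_ne_zero)).comp_hasFDerivAt q h2)
  have h4 : lineCoord q e = wedge q * (Inv.inv ∘ fun y => wedge y e) := by
    ext y; simp [lineCoord, div_eq_mul_inv]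
  rw [h4, h3.fderiv]
  simp [hqe, wedge_self, fderiv_wedge]

theorem eq_smul_lineCoord {q e : Plane} (hqe : wedge q e = 1) {y : Plane} (hy : wedge y e ≠ 0) :
    y = wedge y e • (q + lineCoord q e y • e) := by
  rw [smul_add, smul_smul, lineCoord, mul_div_cancel₀ _ hy]
  exact eq_wedge_smul_add hqe y

theorem eq_zero_of_wedge_left {q e v : Plane} (hqe : wedge q e = 1) (h1 : wedge q v = 0)
    (h2 : wedge v e = 0) : v = 0 := by
  have := eq_wedge_smul_add hqe v
  rwa [h1, h2, zero_smul, zero_smul, add_zero] at this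

/-- A homogeneous function which is given by `|w|^2` on an affine line. -/
theorem exists_homogeneous_extension {q e : Plane} (hqe : wedge q e = 1) {w : ℂ → ℂ}
    (hw : AnalyticAt ℂ w 0) (hw0 : w 0 ≠ 0) {c : ℝ} (hc : c ≠ 0) :
    ∃ W : Plane → ℂ, AnalyticAt ℂ W q ∧ W q ≠ 0 ∧
      (∀ᶠ y in 𝓝 q, ‖W y‖ ^ 2 = ‖wedge y e‖ ^ c * ‖w (lineCoord q e y)‖ ^ 2) ∧
      ∀ v, fderiv ℂ W q v = 0 → wedge q v = 0 → v = 0 := by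
  have hζ := analyticAt_lineCoord hqe
  obtain ⟨S, hS, hS0, hSn, hSd⟩ := exists_branch (analyticAt_wedge_left e q)
    (by rw [hqe]; exact one_ne_zero) (c / 2)
  have hw' : AnalyticAt ℂ (fun y => w (lineCoord q e y)) q :=
    AnalyticAt.fun_comp (g := w) (by rw [lineCoord_self]; exact hw) hζ
  refine ⟨fun y => S y * w (lineCoord q e y), hS.mul hw', ?_, ?_, ?_⟩
  · simp only [lineCoord_self]; exact mul_ne_zero hS0 hw0
  · filter_upwards [hSn] with y hy
    rw [norm_mul, mul_pow, hy, ← Real.rpow_natCast, ← Real.rpow_mul (norm_nonneg _)]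
    congr 2; push_cast; ring
  -- On the kernel of `wedge q` the affine coordinate is stationary, so only the power of `wedge y
  -- e` contributes to dW, and its derivative is nonzero because c ≠ 0.
  · intro v h1 h2
    refine eq_zero_of_wedge_left hqe h2 ?_
    have h3 : fderiv ℂ (fun y => w (lineCoord q e y)) q v = 0 := by
      have a1 : HasFDerivAt w (fderiv ℂ w 0) (lineCoord q e q) := by
        rw [lineCoord_self]; exact hw.differentiableAt.hasFDerivAt
      have a2 := a1.comp q hζ.differentiableAt.hasFDerivAt
      rw [HasFDerivAt.fderiv (f := fun y => w (lineCoord q e y)) a2]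
      simp [fderiv_lineCoord hqe, h2]
    rw [HasFDerivAt.fderiv (f := fun y => S y * w (lineCoord q e y))
      (hS.differentiableAt.hasFDerivAt.mul hw'.differentiableAt.hasFDerivAt)] at h1
    simp only [_root_.add_apply, smul_apply, h3, smul_eq_mul, mul_zero, zero_add, hSd,
      fderiv_wedge_left, hqe, lineCoord_self] at h1
    have hc' : (c : ℂ) ≠ 0 := by exact_mod_cast hc
    simpa [hw0, hS0, hc'] using h1

/-- The local structure of the potential of a flat metric which is homogeneous of degree `c` and has
cone angle `2 π β` along lines spanned by the vectors `ℓ k`. -/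
structure FlatModel {d : ℕ} (β c : ℝ) (ℓ : Fin d → Plane) (F : Plane → ℝ) : Prop where
  homog : ∀ (a : ℂ) (x : Plane), a ≠ 0 → F (a • x) = ‖a‖ ^ c * F x
  off : ∀ x, (∀ k, wedge (ℓ k) x ≠ 0) → ∃ W Z : Plane → ℂ, AnalyticAt ℂ W x ∧ AnalyticAt ℂ Z x ∧
    W x ≠ 0 ∧ (∀ᶠ y in 𝓝 x, F y = ‖W y‖ ^ 2 + ‖Z y‖ ^ 2) ∧
    ∀ v, fderiv ℂ W x v = 0 → fderiv ℂ Z x v = 0 → v = 0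
  on : ∀ k q, q ≠ 0 → wedge (ℓ k) q = 0 → ∃ W b : Plane → ℂ, AnalyticAt ℂ W q ∧ AnalyticAt ℂ b q ∧
    W q ≠ 0 ∧ b q ≠ 0 ∧
    (∀ᶠ y in 𝓝 q, wedge (ℓ k) y ≠ 0 →
      F y = ‖W y‖ ^ 2 + ‖b y‖ ^ 2 * ‖wedge (ℓ k) y‖ ^ (2 * β)) ∧
    ∀ v, fderiv ℂ W q v = 0 → wedge (ℓ k) v = 0 → v = 0

/-- At a regular point h = (1 + |η|²)/|η'|, so the potential is |W|²(1 + |η|²), where |W|² is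
(2/c)|P_d|^{β-1}/|η'| extended homogeneously from an affine line. At a cone point h also contains
|η|^{1-β}, which cancels the singular factor of |P_d|^{β-1}; thus W is again holomorphic without
zeros, and |η|^{2β} supplies the cone term. -/
theorem flatModel_of_spherical {P : MvPolynomial (Fin 2) ℂ} {d : ℕ} (hd : 2 ≤ d) {β : ℝ}
    (hβ : 0 < β) (hβ1 : β < 1) (hc : 0 < coneExp d β) {ℓ : Fin d → Plane} {c₀ : ℂ} (hc₀ : c₀ ≠ 0)
    (hℓ : ∀ j k, j ≠ k → wedge (ℓ j) (ℓ k) ≠ 0)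
    (hP : ∀ x : Plane, MvPolynomial.eval (fun i => x i) (MvPolynomial.homogeneousComponent d P) =
        c₀ * ∏ k, wedge (ℓ k) x) {h : Plane → ℝ}
    (hh : IsSphericalConeMetric (asymptoticLines P d) β h) :
    FlatModel β (coneExp d β) ℓ (flatPotential P d β h) := by
  have hmem : ∀ x, x ∈ asymptoticLines P d ↔ ∃ k, wedge (ℓ k) x = 0 := by
    intro x
    change MvPolynomial.eval (fun i => x i) (MvPolynomial.homogeneousComponent d P) = 0 ↔ _
    rw [hP]
    simp [hc₀, Finset.prod_eq_zero_iff]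
  have hF : ∀ x, flatPotential P d β h x = 2 / coneExp d β * ‖c₀ * ∏ k, wedge (ℓ k) x‖ ^ (β - 1) * h x :=
    fun x => by rw [flatPotential, hP]
  set c := coneExp d β with hcd
  have hhom : ∀ (a : ℂ) (x : Plane), ∏ k, wedge (ℓ k) (a • x) = a ^ d * ∏ k, wedge (ℓ k) x := by
    intro a y
    simp only [wedge_smul]
    rw [Finset.prod_mul_distrib]; simp
  have homog : ∀ (a : ℂ) (x : Plane), a ≠ 0 →
      flatPotential P d β h (a • x) = ‖a‖ ^ c * flatPotential P d β h x := by
    intro a x ha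
    by_cases hx : x ∈ asymptoticLines P d
    · obtain ⟨k, hk⟩ := (hmem x).1 hx
      have h0 : ∏ k, wedge (ℓ k) x = 0 := Finset.prod_eq_zero (Finset.mem_univ k) hk
      rw [hF, hF, hhom, h0]
      -- On the lines the convention 0^(β-1) = 0 makes both sides vanish.
      simp [Real.zero_rpow (by linarith : β - 1 ≠ 0)]
    · have hna : 0 < ‖a‖ := norm_pos_iff.2 ha
      rw [hF, hF, hh.homogeneous a x ha hx, hhom]
      have h1 : c₀ * (a ^ d * ∏ k, wedge (ℓ k) x) = a ^ d * (c₀ * ∏ k, wedge (ℓ k) x) := by ring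
      rw [h1, norm_mul, Real.mul_rpow (norm_nonneg _) (norm_nonneg _), norm_pow]
      have h2 : ‖a‖ ^ c = (‖a‖ ^ d) ^ (β - 1) * ‖a‖ ^ 2 := by
        rw [← Real.rpow_natCast, ← Real.rpow_mul hna.le, ← Real.rpow_natCast, ← Real.rpow_add hna,
          hcd, coneExp]
        congr 1; push_cast; ring
      rw [h2]; ring
  refine ⟨homog, ?_, ?_⟩
  · intro q hq
    have hqL : q ∉ asymptoticLines P d := fun h => by
      obtain ⟨k, hk⟩ := (hmem q).1 h; exact hq k hk
    have hq0 : q ≠ 0 := by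
      rintro rfl
      exact hq ⟨0, by omega⟩ (by simp [wedge])
    obtain ⟨e, hqe⟩ := exists_wedge_eq_one hq0
    obtain ⟨η, hη, hηe⟩ := hh.round q e hqe hqL
    have hη' : deriv η 0 ≠ 0 := by
      intro h0
      have h1 := hηe.self_of_nhds
      simp only [zero_smul, add_zero, h0, norm_zero, zero_div] at h1
      exact (one_div_pos.2 (hh.positive q hqL)).ne' h1
    have hQ : AnalyticAt ℂ (fun ζ : ℂ => c₀ * ∏ k, wedge (ℓ k) (q + ζ • e)) 0 := by
      refine analyticAt_const.mul (Finset.analyticAt_fun_prod _ fun k _ => ?_)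
      exact AnalyticAt.fun_comp (analyticAt_wedge _ _) (analyticAt_line q e 0)
    have hQ0 : (fun ζ : ℂ => c₀ * ∏ k, wedge (ℓ k) (q + ζ • e)) 0 ≠ 0 := by
      simp only [zero_smul, add_zero]
      exact mul_ne_zero hc₀ (Finset.prod_ne_zero_iff.2 fun k _ => hq k)
    obtain ⟨w, hw, hw0, hwe⟩ := ((holNorm_const (x := (0 : ℂ)) (a := 2 / c) (by positivity)).mul
      (holNorm_norm_rpow hQ hQ0 (β - 1))).mul (holNorm_norm_rpow hη.deriv hη' (-1))
    obtain ⟨W, hW, hW0, hWn, hWd⟩ := exists_homogeneous_extension hqe hw hw0 hc.ne'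
    have hζ := analyticAt_lineCoord hqe
    have hηζ : AnalyticAt ℂ (fun y => η (lineCoord q e y)) q :=
      AnalyticAt.fun_comp (g := η) (by rw [lineCoord_self]; exact hη) hζ
    refine ⟨W, fun y => W y * η (lineCoord q e y), hW, hW.mul hηζ, hW0, ?_, ?_⟩
    · have hζt : Filter.Tendsto (lineCoord q e) (𝓝 q) (𝓝 0) := by
        have := hζ.continuousAt.tendsto; rwa [lineCoord_self] at this
      have hs : ∀ᶠ y in 𝓝 q, wedge y e ≠ 0 :=
        (analyticAt_wedge_left e q).continuousAt.eventually_ne (by rw [hqe]; exact one_ne_zero)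
      filter_upwards [hWn, hs, hζt hwe, hζt hηe, hζt (hη.deriv.continuousAt.eventually_ne hη')]
        with y h1 h2 h3 h4 h5
      have h4' : 1 / h (q + lineCoord q e y • e) =
        ‖deriv η (lineCoord q e y)‖ / (1 + ‖η (lineCoord q e y)‖ ^ 2) := h4
      have h5' : deriv η (lineCoord q e y) ≠ 0 := h5
      have h3' : 2 / c * ‖c₀ * ∏ k, wedge (ℓ k) (q + lineCoord q e y • e)‖ ^ (β - 1) *
        ‖deriv η (lineCoord q e y)‖ ^ (-1 : ℝ) = ‖w (lineCoord q e y)‖ ^ 2 := h3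
      have h6 : h (q + lineCoord q e y • e) =
          (1 + ‖η (lineCoord q e y)‖ ^ 2) * ‖deriv η (lineCoord q e y)‖ ^ (-1 : ℝ) := by
        rw [Real.rpow_neg_one, ← one_div_one_div (h _), h4', one_div_div, div_eq_mul_inv]
      conv_lhs => rw [eq_smul_lineCoord hqe h2, homog _ _ h2, hF, h6]
      have h8 : ‖W y * η (lineCoord q e y)‖ ^ 2 = ‖W y‖ ^ 2 * ‖η (lineCoord q e y)‖ ^ 2 := by
        rw [norm_mul, mul_pow]
      rw [h8, h1, ← h3']
      ring
    · intro v h1 h2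
      refine hWd v h1 ?_
      have a1 : HasFDerivAt η (fderiv ℂ η 0) (lineCoord q e q) := by
        rw [lineCoord_self]; exact hη.differentiableAt.hasFDerivAt
      have a2 := a1.comp q hζ.differentiableAt.hasFDerivAt
      rw [HasFDerivAt.fderiv (f := fun y => W y * η (lineCoord q e y))
        (hW.differentiableAt.hasFDerivAt.mul a2)] at h2
      simp only [_root_.add_apply, smul_apply, h1, smul_eq_mul, mul_zero, add_zero,
        ContinuousLinearMap.comp_apply, fderiv_lineCoord hqe] at h2
      have h3 : fderiv ℂ η 0 (wedge q v) = wedge q v * deriv η 0 := by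
        rw [← fderiv_apply_one_eq_deriv, ← smul_eq_mul, ← map_smul]; simp
      rw [h3] at h2
      simpa [hW0, hη'] using h2
  · intro k q hq0 hk
    have hqL : q ∈ asymptoticLines P d := (hmem q).2 ⟨k, hk⟩
    obtain ⟨e, hqe⟩ := exists_wedge_eq_one hq0
    obtain ⟨η, hη, hη0, hη', hηe⟩ := hh.cone q e hqe hqL
    obtain ⟨j, hj⟩ : ∃ j, j ≠ k := by
      have : Nontrivial (Fin d) := Fin.nontrivial_iff_two_le.2 hd
      exact exists_ne k
    set a := wedge (ℓ k) e with ha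
    have hty : ∀ y, wedge (ℓ k) y = wedge q y * a := by
      intro y
      conv_lhs => rw [eq_wedge_smul_add hqe y, wedge_add, wedge_smul, wedge_smul, hk]
      rw [mul_zero, zero_add]
    have ha0 : a ≠ 0 := by
      intro h0
      have := hty (ℓ j)
      rw [h0, mul_zero] at this
      exact hℓ k j hj.symm this
    have hjq : ∀ j, j ≠ k → wedge (ℓ j) q ≠ 0 := fun j hj h0 =>
      hq0 (eq_zero_of_wedge (hℓ j k hj) h0 hk)
    set Q : ℂ → ℂ := fun ζ => c₀ * a * ∏ j ∈ Finset.univ.erase k, wedge (ℓ j) (q + ζ • e) with hQd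
    have hQ : AnalyticAt ℂ Q 0 := by
      refine analyticAt_const.mul (Finset.analyticAt_fun_prod _ fun k _ => ?_)
      exact AnalyticAt.fun_comp (analyticAt_wedge _ _) (analyticAt_line q e 0)
    have hQ0 : Q 0 ≠ 0 := by
      simp only [hQd, zero_smul, add_zero]
      exact mul_ne_zero (mul_ne_zero hc₀ ha0)
        (Finset.prod_ne_zero_iff.2 fun j hj => hjq j (Finset.ne_of_mem_erase hj))
    have hPQ : ∀ ζ : ℂ, c₀ * ∏ k, wedge (ℓ k) (q + ζ • e) = ζ * Q ζ := by
      intro ζ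
      rw [← Finset.mul_prod_erase Finset.univ _ (Finset.mem_univ k)]
      have : wedge (ℓ k) (q + ζ • e) = ζ * a := by rw [wedge_add, wedge_smul, hk, zero_add]
      rw [this, hQd]; ring
    -- The simple zero of η is split off: η = ζ η₁ with η₁ nonzero at 0, so real powers of |η₁| are
    -- squared norms of holomorphic functions.
    set η₁ := dslope η 0 with hη₁
    have hη₁a : AnalyticAt ℂ η₁ 0 := by
      obtain ⟨p, hp⟩ := hη
      exact ⟨_, hp.has_fpower_series_dslope_fslope⟩
    have hη₁0 : η₁ 0 ≠ 0 := by rw [hη₁, dslope_same]; exact hη'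
    have hηη₁ : ∀ ζ, η ζ = ζ * η₁ ζ := by
      intro ζ
      have := sub_smul_dslope η 0 ζ
      rw [hη0, sub_zero, sub_zero, smul_eq_mul] at this
      exact this.symm
    obtain ⟨w, hw, hw0, hwe⟩ := (((holNorm_const (x := (0 : ℂ)) (a := 2 / (c * β)) (by positivity)).mul
      (holNorm_norm_rpow hQ hQ0 (β - 1))).mul (holNorm_norm_rpow hη₁a hη₁0 (1 - β))).mul
      (holNorm_norm_rpow hη.deriv hη' (-1))
    obtain ⟨W, hW, hW0, hWn, hWd⟩ := exists_homogeneous_extension hqe hw hw0 hc.ne'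
    have hζ := analyticAt_lineCoord hqe
    have hη₁ζ : AnalyticAt ℂ (fun y => η₁ (lineCoord q e y)) q :=
      AnalyticAt.fun_comp (g := η₁) (by rw [lineCoord_self]; exact hη₁a) hζ
    -- The equation of the line equals `wedge y e * ζ * a`. The factors with exponent -2β convert
    -- |ζ|^{2β}, coming from |η|^{2β}, into the power of that equation.
    obtain ⟨b, hb, hb0, hbe⟩ := (((holNorm_norm_sq hW hW0).mul (holNorm_norm_rpow hη₁ζ
      (by rw [lineCoord_self]; exact hη₁0) (2 * β))).mul (holNorm_norm_rpow
        (analyticAt_wedge_left e q) (by rw [hqe]; exact one_ne_zero) (-(2 * β)))).mul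
        (holNorm_const (x := q) (a := ‖a‖ ^ (-(2 * β))) (Real.rpow_pos_of_pos (norm_pos_iff.2 ha0) _))
    refine ⟨W, b, hW, hb, hW0, hb0, ?_, ?_⟩
    · have hζt : Filter.Tendsto (lineCoord q e) (𝓝 q) (𝓝 0) := by
        have := hζ.continuousAt.tendsto; rwa [lineCoord_self] at this
      have hs : ∀ᶠ y in 𝓝 q, wedge y e ≠ 0 :=
        (analyticAt_wedge_left e q).continuousAt.eventually_ne (by rw [hqe]; exact one_ne_zero)
      rw [eventually_nhdsWithin_iff] at hηe
      filter_upwards [hWn, hs, hζt hwe, hζt hηe, hζt (hη.deriv.continuousAt.eventually_ne hη'),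
        hbe, hζt (hη₁a.continuousAt.eventually_ne hη₁0)] with y h1 h2 h3 h4 h5 h6 h7 hty0
      set ζ := lineCoord q e y with hζd
      set s := wedge y e with hsd
      have htζ : wedge (ℓ k) y = s * ζ * a := by
        rw [hty, hζd, lineCoord, mul_div_cancel₀ _ h2]
      have hζ0 : ζ ≠ 0 := by rintro h0; rw [htζ, h0] at hty0; simp at hty0
      have h4' : 1 / h (q + ζ • e) =
        β * ‖η ζ‖ ^ (β - 1) * ‖deriv η ζ‖ / (1 + ‖η ζ‖ ^ (2 * β)) := h4 hζ0
      have h5' : deriv η ζ ≠ 0 := h5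
      have h7' : η₁ ζ ≠ 0 := h7
      have h3' : 2 / (c * β) * ‖Q ζ‖ ^ (β - 1) * ‖η₁ ζ‖ ^ (1 - β) *
        ‖deriv η ζ‖ ^ (-1 : ℝ) = ‖w ζ‖ ^ 2 := h3
      have h8 : h (q + ζ • e) = (1 + ‖η ζ‖ ^ (2 * β)) * (β⁻¹ * ‖η ζ‖ ^ (1 - β) * ‖deriv η ζ‖ ^ (-1 : ℝ)) := by
        rw [Real.rpow_neg_one, ← one_div_one_div (h _), h4', one_div_div, div_eq_mul_inv,
          mul_inv, mul_inv, ← Real.rpow_neg (norm_nonneg _), neg_sub]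
      conv_lhs => rw [eq_smul_lineCoord hqe h2, homog _ _ h2, hF, h8, hPQ]
      rw [← h6, h1, ← h3', htζ, hηη₁]
      simp only [norm_mul]
      have ps : 0 < ‖s‖ := norm_pos_iff.2 h2
      have pζ : 0 < ‖ζ‖ := norm_pos_iff.2 hζ0
      have pa : 0 < ‖a‖ := norm_pos_iff.2 ha0
      rw [Real.mul_rpow (by positivity) (by positivity), Real.mul_rpow (by positivity) (by positivity),
        Real.mul_rpow (by positivity) (by positivity), Real.mul_rpow (by positivity) (by positivity),
        Real.mul_rpow (by positivity) (by positivity)]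
      have e1 : ‖ζ‖ ^ (β - 1) * ‖ζ‖ ^ (1 - β) = 1 := by rw [← Real.rpow_add pζ]; simp
      have e2 : ‖s‖ ^ (-(2 * β)) * ‖s‖ ^ (2 * β) = 1 := by rw [← Real.rpow_add ps]; simp
      have e3 : ‖a‖ ^ (-(2 * β)) * ‖a‖ ^ (2 * β) = 1 := by rw [← Real.rpow_add pa]; simp
      set S := ‖s‖ ^ coneExp d β
      set A1 := ‖Q ζ‖ ^ (β - 1)
      set A2 := ‖η₁ ζ‖ ^ (1 - β)
      set A3 := ‖deriv η ζ‖ ^ (-1 : ℝ)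
      set A4 := ‖η₁ ζ‖ ^ (2 * β)
      set A5 := ‖ζ‖ ^ (2 * β)
      have e4 : 2 / (c * β) = 2 / c * β⁻¹ := by field_simp
      rw [e4]
      linear_combination (2 / c * β⁻¹ * S * A1 * A2 * A3 * (1 + A4 * A5)) * e1 -
        (2 / c * β⁻¹ * S * A1 * A2 * A3 * A4 * A5) * (e2 + e3 * ‖s‖ ^ (-(2 * β)) * ‖s‖ ^ (2 * β))
    · intro v h1 h2
      refine hWd v h1 ?_
      rw [hty] at h2
      simpa [ha0] using h2

end

/-! ### Bounds for the flat metric -/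

section

section SumSq

variable {E : Type*} [NormedAddCommGroup E] [NormedSpace ℝ E] [NormedSpace ℂ E]
  [IsScalarTower ℝ ℂ E]

theorem rlev_add {φ ψ : E → ℝ} {x : E} (hφ : ContDiffAt ℝ 2 φ x) (hψ : ContDiffAt ℝ 2 ψ x)
    (v w : E) : rlev (fun y => φ y + ψ y) x v w = rlev φ x v w + rlev ψ x v w := by
  have := lev_add hφ.ofReal hψ.ofReal v w
  simpa [rlev] using this

theorem rlev_const_mul {φ : E → ℝ} {x : E} (hφ : ContDiffAt ℝ 2 φ x) (a : ℝ)
    (v w : E) : rlev (fun y => a * φ y) x v w = a * rlev φ x v w := by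
  have := lev_const_mul hφ.ofReal a v w
  simpa [rlev] using this

theorem rlev_norm_sq {g : E → ℂ} {x : E} (hg : AnalyticAt ℂ g x) (v : E) :
    (rlev (fun y => ‖g y‖ ^ 2) x v v).re = ‖fderiv ℂ g x v‖ ^ 2 := by
  have := lev_norm_sq hg v v
  rw [rlev, this, Complex.mul_conj', ← Complex.ofReal_pow, Complex.ofReal_re]

theorem contDiffAt_norm_sq {g : E → ℂ} {x : E} (hg : AnalyticAt ℂ g x) {n : ℕ∞ω} :
    ContDiffAt ℝ n (fun y => ‖g y‖ ^ 2) x := hg.smoothAt.norm_sq ℝ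

theorem rlev_sum_sq {F : E → ℝ} {W Z : E → ℂ} {x : E} (hW : AnalyticAt ℂ W x)
    (hZ : AnalyticAt ℂ Z x) (hF : ∀ᶠ y in 𝓝 x, F y = ‖W y‖ ^ 2 + ‖Z y‖ ^ 2) (v : E) :
    (rlev F x v v).re = ‖fderiv ℂ W x v‖ ^ 2 + ‖fderiv ℂ Z x v‖ ^ 2 := by
  rw [rlev_eventuallyEq (g := fun y => ‖W y‖ ^ 2 + ‖Z y‖ ^ 2) hF,
    rlev_add (contDiffAt_norm_sq hW) (contDiffAt_norm_sq hZ), Complex.add_re, rlev_norm_sq hW,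
    rlev_norm_sq hZ]

/-- Cauchy–Schwarz for dF = 2 Re(W̄ dW + Z̄ dZ). It means that √F has gradient at most 1 in the
metric, so √F bounds lengths from below. -/
theorem fderiv_sum_sq_le {F : E → ℝ} {W Z : E → ℂ} {x : E} (hW : AnalyticAt ℂ W x)
    (hZ : AnalyticAt ℂ Z x) (hF : ∀ᶠ y in 𝓝 x, F y = ‖W y‖ ^ 2 + ‖Z y‖ ^ 2) (v : E) :
    |fderiv ℝ F x v| ≤ 2 * √(F x) * √((rlev F x v v).re) := by
  rw [rlev_sum_sq hW hZ hF, hF.self_of_nhds]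
  have h1 : HasFDerivAt F _ x := ((hW.hasFDerivAt_real.norm_sq).add
    (hZ.hasFDerivAt_real.norm_sq)).congr_of_eventuallyEq hF
  rw [h1.fderiv]
  set a := fderiv ℂ W x v
  set b := fderiv ℂ Z x v
  have h2 : |inner ℝ (W x) a| ≤ ‖W x‖ * ‖a‖ := abs_real_inner_le_norm _ _
  have h3 : |inner ℝ (Z x) b| ≤ ‖Z x‖ * ‖b‖ := abs_real_inner_le_norm _ _
  have h4 : ‖W x‖ * ‖a‖ + ‖Z x‖ * ‖b‖ ≤ √(‖W x‖ ^ 2 + ‖Z x‖ ^ 2) * √(‖a‖ ^ 2 + ‖b‖ ^ 2) := by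
    rw [← Real.sqrt_mul (by positivity)]
    apply Real.le_sqrt_of_sq_le
    nlinarith [sq_nonneg (‖W x‖ * ‖b‖ - ‖Z x‖ * ‖a‖)]
  have h5 : |inner ℝ (W x) a + inner ℝ (Z x) b| ≤ ‖W x‖ * ‖a‖ + ‖Z x‖ * ‖b‖ :=
    (abs_add_le _ _).trans (add_le_add h2 h3)
  have h6 : ((2 • (innerSL ℝ (W x)).comp ((fderiv ℂ W x).restrictScalars ℝ)) +
      (2 • (innerSL ℝ (Z x)).comp ((fderiv ℂ Z x).restrictScalars ℝ))) v =
      2 * (inner ℝ (W x) a + inner ℝ (Z x) b) := by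
    simp [a, b]; ring
  rw [h6, abs_mul, abs_two, mul_assoc]
  exact mul_le_mul_of_nonneg_left (h5.trans h4) (by norm_num)

end SumSq

variable {d : ℕ} {β c : ℝ} {ℓ : Fin d → Plane} {F : Plane → ℝ}

/-- The complement of the lines spanned by the vectors `ℓ k`. -/
def offLines (ℓ : Fin d → Plane) : Set Plane := {x | ∀ k, wedge (ℓ k) x ≠ 0}

theorem continuous_wedge (q : Plane) : Continuous (wedge q) := by
  have h : wedge q = wedgeL q := by ext y; simp
  rw [h]; exact (wedgeL q).continuous

theorem isOpen_offLines (ℓ : Fin d → Plane) : IsOpen (offLines ℓ) := by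
  have : offLines ℓ = ⋂ k, {x | wedge (ℓ k) x ≠ 0} := by ext x; simp [offLines]
  rw [this]
  exact isOpen_iInter_of_finite fun k => isOpen_ne_fun (continuous_wedge _) continuous_const

theorem smul_mem_offLines {x : Plane} {a : ℂ} (ha : a ≠ 0) :
    a • x ∈ offLines ℓ ↔ x ∈ offLines ℓ := by
  simp [offLines, wedge_smul, ha]

theorem FlatModel.contDiffAt (hF : FlatModel β c ℓ F) {x : Plane} (hx : x ∈ offLines ℓ) {n : ℕ∞ω} :
    ContDiffAt ℝ n F x := by
  obtain ⟨W, Z, hW, hZ, -, h, -⟩ := hF.off x hx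
  exact ((contDiffAt_norm_sq hW).add (contDiffAt_norm_sq hZ)).congr_of_eventuallyEq h

theorem FlatModel.strictPsh (hF : FlatModel β c ℓ F) {x : Plane} (hx : x ∈ offLines ℓ) :
    StrictPsh F x := by
  obtain ⟨W, Z, hW, hZ, -, h, hker⟩ := hF.off x hx
  intro v hv
  rw [rlev_sum_sq hW hZ h]
  by_contra hneg
  have h1 : ‖fderiv ℂ W x v‖ = 0 := by
    nlinarith [sq_nonneg ‖fderiv ℂ W x v‖, sq_nonneg ‖fderiv ℂ Z x v‖]
  have h2 : ‖fderiv ℂ Z x v‖ = 0 := by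
    nlinarith [sq_nonneg ‖fderiv ℂ W x v‖, sq_nonneg ‖fderiv ℂ Z x v‖]
  exact hv (hker v (norm_eq_zero.1 h1) (norm_eq_zero.1 h2))

theorem FlatModel.pos (hF : FlatModel β c ℓ F) {x : Plane} (hx : x ∈ offLines ℓ) : 0 < F x := by
  obtain ⟨W, Z, hW, hZ, hW0, h, -⟩ := hF.off x hx
  rw [h.self_of_nhds]
  have := norm_pos_iff.2 hW0
  positivity

/-- Near a point of a line, the metric is bounded from above and from below. -/
theorem FlatModel.local_bounds (hβ : 0 < β) (hβ1 : β < 1) (hF : FlatModel β c ℓ F) {q : Plane} (hq : q ≠ 0) :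
    ∃ c₁ > 0, ∃ c₂ > 0, ∃ c₀ > 0, ∀ᶠ y in 𝓝 q, y ∈ offLines ℓ → c₁ ≤ F y ∧ F y ≤ c₂ ∧
      ∀ v, c₀ * ‖v‖ ^ 2 ≤ (rlev F y v v).re := by
  by_cases hqo : q ∈ offLines ℓ
  · have hsm : ContDiffAt ℝ 2 F q := hF.contDiffAt hqo
    obtain ⟨c₀, hc₀, hev⟩ := (hF.strictPsh hqo).eventually_bound hsm
    have hpos := hF.pos hqo
    refine ⟨F q / 2, by positivity, 2 * F q, by positivity, c₀, hc₀, ?_⟩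
    filter_upwards [hev, hsm.continuousAt (Ioo_mem_nhds (by linarith : F q / 2 < F q)
      (by linarith : F q < 2 * F q))] with y h1 h2 _
    exact ⟨h2.1.le, h2.2.le, h1⟩
  · obtain ⟨k, hk⟩ : ∃ k, wedge (ℓ k) q = 0 := by simpa [offLines] using hqo
    obtain ⟨W, b, hW, hb, hW0, hb0, hFe, hker⟩ := hF.on k q hq hk
    -- Let τ be a branch of w^β, w the equation of the line. Then d(bτ) = (τ/w)(β b dw + w db),
    -- where the bracket is continuous across the line and |τ/w| = |w|^{β-1} is at least 1 near it.
    -- Dropping this factor bounds the metric below by a continuous form which is positive at q.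
    have hcont : ∀ v ∈ Metric.sphere (0 : Plane) 1, ContinuousAt (fun p : Plane × Plane =>
        ‖fderiv ℂ W p.1 p.2‖ ^ 2 +
        ‖β * b p.1 * wedge (ℓ k) p.2 + wedge (ℓ k) p.1 * fderiv ℂ b p.1 p.2‖ ^ 2) (q, v) := by
      intro v _
      have h1 : ContinuousAt (fun p : Plane × Plane => fderiv ℂ W p.1 p.2) (q, v) :=
        (ContinuousAt.comp (f := Prod.fst) (x := (q, v)) hW.fderiv.continuousAt
          continuousAt_fst).clm_apply continuousAt_snd
      have h2 : ContinuousAt (fun p : Plane × Plane => fderiv ℂ b p.1 p.2) (q, v) :=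
        (ContinuousAt.comp (f := Prod.fst) (x := (q, v)) hb.fderiv.continuousAt
          continuousAt_fst).clm_apply continuousAt_snd
      have h3 : ContinuousAt (fun p : Plane × Plane => b p.1) (q, v) :=
        ContinuousAt.comp (f := Prod.fst) (x := (q, v)) hb.continuousAt continuousAt_fst
      have h4 : ContinuousAt (fun p : Plane × Plane => wedge (ℓ k) p.1) (q, v) :=
        ((continuous_wedge _).comp continuous_fst).continuousAt
      have h5 : ContinuousAt (fun p : Plane × Plane => wedge (ℓ k) p.2) (q, v) :=
        ((continuous_wedge _).comp continuous_snd).continuousAt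
      exact (h1.norm.pow 2).add ((((continuousAt_const.mul h3).mul h5).add (h4.mul h2)).norm.pow 2)
    obtain ⟨c₀, hc₀, hev⟩ := eventually_pos_bound
      (q := fun y v => ‖fderiv ℂ W y v‖ ^ 2 +
        ‖β * b y * wedge (ℓ k) v + wedge (ℓ k) y * fderiv ℂ b y v‖ ^ 2)
      (isCompact_sphere (0 : Plane) 1) hcont (by
      intro v hv
      have hv0 : v ≠ 0 := by rintro rfl; simp at hv
      simp only [hk, zero_mul, add_zero]
      have hβ' : (β : ℂ) ≠ 0 := by exact_mod_cast hβ.ne'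
      by_cases h1 : fderiv ℂ W q v = 0
      · have h2 : wedge (ℓ k) v ≠ 0 := fun h2 => hv0 (hker v h1 h2)
        have h3 : 0 < ‖(β : ℂ) * b q * wedge (ℓ k) v‖ :=
          norm_pos_iff.2 (mul_ne_zero (mul_ne_zero hβ' hb0) h2)
        positivity
      · have := norm_pos_iff.2 h1
        positivity)
    have hμ0 : 0 < ‖W q‖ := norm_pos_iff.2 hW0
    have hcF : ContinuousAt (fun y => ‖W y‖ ^ 2 + ‖b y‖ ^ 2 * ‖wedge (ℓ k) y‖ ^ (2 * β)) q :=
      (hW.continuousAt.norm.pow 2).add ((hb.continuousAt.norm.pow 2).mul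
        ((continuous_wedge _).continuousAt.norm.rpow_const (Or.inr (by positivity))))
    have hval : ‖W q‖ ^ 2 + ‖b q‖ ^ 2 * ‖wedge (ℓ k) q‖ ^ (2 * β) = ‖W q‖ ^ 2 := by
      rw [hk, norm_zero, Real.zero_rpow (by positivity), mul_zero, add_zero]
    have hp2 : 0 < ‖W q‖ ^ 2 := by positivity
    refine ⟨‖W q‖ ^ 2 / 2, by positivity, 2 * ‖W q‖ ^ 2, by positivity, c₀, hc₀, ?_⟩
    have htb : ∀ᶠ y in 𝓝 q, ‖wedge (ℓ k) y‖ < 1 :=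
      (continuous_wedge (ℓ k)).norm.continuousAt (Iio_mem_nhds (by rw [hk]; simp))
    filter_upwards [hev, hFe.eventually_nhds, htb, hW.eventually_analyticAt, hb.eventually_analyticAt,
      hcF (Ioo_mem_nhds (by simp only [hval]; linarith : ‖W q‖ ^ 2 / 2 < _)
      (by simp only [hval]; linarith : _ < 2 * ‖W q‖ ^ 2))] with y h1 h2 h3 h4 h5 h6 hy
    have hty := hy k
    have h6' : _ ∧ _ := h6
    have hFy := h2.self_of_nhds hty
    refine ⟨hFy ▸ h6'.1.le, hFy ▸ h6'.2.le, fun v => ?_⟩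
    obtain ⟨τ, hτ, hτ0, hτn, hτd⟩ := exists_branch (analyticAt_wedge (ℓ k) y) hty β
    have hrep : ∀ᶠ y' in 𝓝 y, F y' = ‖W y'‖ ^ 2 + ‖b y' * τ y'‖ ^ 2 := by
      filter_upwards [h2, hτn, (continuous_wedge (ℓ k)).continuousAt.eventually_ne hty] with y' a1 a2 a3
      rw [a1 a3, norm_mul, mul_pow, a2, ← Real.rpow_natCast (‖_‖ ^ β), ← Real.rpow_mul (norm_nonneg _)]
      congr 3; push_cast; ring
    rw [rlev_sum_sq (Z := fun y => b y * τ y) h4 (h5.mul hτ) hrep]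
    have hd : fderiv ℂ (fun y => b y * τ y) y v = τ y / wedge (ℓ k) y *
        (β * b y * wedge (ℓ k) v + wedge (ℓ k) y * fderiv ℂ b y v) := by
      rw [HasFDerivAt.fderiv (f := fun y => b y * τ y)
        (h5.differentiableAt.hasFDerivAt.mul hτ.differentiableAt.hasFDerivAt)]
      simp only [_root_.add_apply, smul_apply, smul_eq_mul, hτd, fderiv_wedge]
      field_simp
    have hfac : 1 ≤ ‖τ y / wedge (ℓ k) y‖ := by
      have ht0 : 0 < ‖wedge (ℓ k) y‖ := norm_pos_iff.2 hty
      rw [norm_div, hτn.self_of_nhds, one_le_div ht0]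
      calc ‖wedge (ℓ k) y‖ = ‖wedge (ℓ k) y‖ ^ (1 : ℝ) := (Real.rpow_one _).symm
        _ ≤ _ := Real.rpow_le_rpow_of_exponent_ge ht0 h3.le hβ1.le
    by_cases hv : v = 0
    · subst hv; simp
    have hv' : 0 < ‖v‖ := norm_pos_iff.2 hv
    have h7 := h1 ((‖v‖⁻¹ : ℝ) • v) (by simp [norm_smul, hv'.ne'])
    rw [RCLike.real_smul_eq_coe_smul (K := ℂ)] at h7
    simp only [map_smul, wedge_smul, smul_eq_mul] at h7
    have e1 : ∀ A B : ℂ, ‖((‖v‖⁻¹ : ℝ) : ℂ) * A‖ ^ 2 + ‖β * b y * (((‖v‖⁻¹ : ℝ) : ℂ) * wedge (ℓ k) v) +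
        wedge (ℓ k) y * (((‖v‖⁻¹ : ℝ) : ℂ) * B)‖ ^ 2 =
        (‖v‖ ^ 2)⁻¹ * (‖A‖ ^ 2 + ‖β * b y * wedge (ℓ k) v + wedge (ℓ k) y * B‖ ^ 2) := by
      intro A B
      have : β * b y * (((‖v‖⁻¹ : ℝ) : ℂ) * wedge (ℓ k) v) + wedge (ℓ k) y * (((‖v‖⁻¹ : ℝ) : ℂ) * B) =
        ((‖v‖⁻¹ : ℝ) : ℂ) * (β * b y * wedge (ℓ k) v + wedge (ℓ k) y * B) := by ring
      rw [this, norm_mul, norm_mul, Complex.norm_real, norm_inv, norm_norm]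
      ring
    have h8 := h7
    erw [e1] at h8
    rw [inv_mul_eq_div, le_div_iff₀ (by positivity)] at h8
    refine h8.trans ?_
    rw [hd, norm_mul, mul_pow]
    have : 1 ≤ ‖τ y / wedge (ℓ k) y‖ ^ 2 := one_le_pow₀ hfac
    gcongr
    exact le_mul_of_one_le_left (by positivity) this

theorem FlatModel.rlev_smul (hF : FlatModel β c ℓ F) {x : Plane} (hx : x ∈ offLines ℓ) {a : ℝ}
    (ha : 0 < a) (v : Plane) :
    (rlev F ((a : ℂ) • x) v v).re = a ^ (c - 2) * (rlev F x v v).re := by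
  have ha' : (a : ℂ) ≠ 0 := by exact_mod_cast ha.ne'
  have hι : AnalyticAt ℂ (fun y : Plane => (a : ℂ) • y) x :=
    ((a : ℂ) • ContinuousLinearMap.id ℂ Plane).analyticAt x
  have hd : ∀ v, fderiv ℂ (fun y : Plane => (a : ℂ) • y) x v = (a : ℂ) • v := by
    intro v
    have := DFunLike.congr_fun (((a : ℂ) • ContinuousLinearMap.id ℂ Plane).fderiv (x := x)) v
    exact this
  have h1 := lev_comp (f := fun y => (F y : ℂ)) hι
    (hF.contDiffAt ((smul_mem_offLines ha').2 hx) (n := 2)).ofReal v v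
  rw [hd, lev_smul_left, lev_smul_right] at h1
  have h2 : (fun y : Plane => (F ((a : ℂ) • y) : ℂ)) = fun y => ((a ^ c * F y : ℝ) : ℂ) := by
    ext y; rw [hF.homog _ _ ha', Complex.norm_real, Real.norm_of_nonneg ha.le]
  rw [h2] at h1
  have h3 : rlev (fun y => a ^ c * F y) x v v = (a : ℂ) * ((starRingEnd ℂ) (a : ℂ) *
    rlev F ((a : ℂ) • x) v v) := h1
  rw [rlev_const_mul (hF.contDiffAt hx)] at h3
  have h4 := congrArg Complex.re h3
  rw [Complex.conj_ofReal, Complex.re_ofReal_mul, Complex.re_ofReal_mul, Complex.re_ofReal_mul] at h4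
  have h5 : a ^ c = a ^ (c - 2) * a * a := by
    rw [mul_assoc, ← sq, ← Real.rpow_natCast a 2, ← Real.rpow_add ha]
    congr 1; push_cast; ring
  rw [h5] at h4
  apply mul_left_cancel₀ (mul_ne_zero ha.ne' ha.ne')
  linear_combination -h4

/-- The local bounds are made uniform on the compact unit sphere, lines included, and spread by
homogeneity; the Levi form has degree c - 2. -/
theorem FlatModel.bounds (hβ : 0 < β) (hβ1 : β < 1) (hF : FlatModel β c ℓ F) :
    ∃ c₁ > 0, ∃ c₂ > 0, ∃ c₀ > 0, ∀ x ∈ offLines ℓ, x ≠ 0 →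
      c₁ * ‖x‖ ^ c ≤ F x ∧ F x ≤ c₂ * ‖x‖ ^ c ∧
      ∀ v, c₀ * ‖x‖ ^ (c - 2) * ‖v‖ ^ 2 ≤ (rlev F x v v).re := by
  have key : ∃ c₁ > 0, ∃ c₂ > 0, ∃ c₀ > 0, ∀ y ∈ Metric.sphere (0 : Plane) 1, y ∈ offLines ℓ →
      c₁ ≤ F y ∧ F y ≤ c₂ ∧ ∀ v, c₀ * ‖v‖ ^ 2 ≤ (rlev F y v v).re := by
    refine (isCompact_sphere (0 : Plane) 1).induction_on (p := fun S => ∃ c₁ > 0, ∃ c₂ > 0,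
      ∃ c₀ > 0, ∀ y ∈ S, y ∈ offLines ℓ →
      c₁ ≤ F y ∧ F y ≤ c₂ ∧ ∀ v, c₀ * ‖v‖ ^ 2 ≤ (rlev F y v v).re) ?_ ?_ ?_ ?_
    · exact ⟨1, one_pos, 1, one_pos, 1, one_pos, by simp⟩
    · rintro s t hst ⟨c₁, h₁, c₂, h₂, c₀, h₀, h⟩
      exact ⟨c₁, h₁, c₂, h₂, c₀, h₀, fun y hy => h y (hst hy)⟩
    · rintro s t ⟨c₁, h₁, c₂, h₂, c₀, h₀, h⟩ ⟨c₁', h₁', c₂', h₂', c₀', h₀', h'⟩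
      refine ⟨min c₁ c₁', lt_min h₁ h₁', max c₂ c₂', lt_max_of_lt_left h₂, min c₀ c₀',
        lt_min h₀ h₀', ?_⟩
      rintro y (hy | hy) hyo
      · obtain ⟨a1, a2, a3⟩ := h y hy hyo
        refine ⟨(min_le_left _ _).trans a1, a2.trans (le_max_left _ _), fun v => ?_⟩
        exact (mul_le_mul_of_nonneg_right (min_le_left _ _) (by positivity)).trans (a3 v)
      · obtain ⟨a1, a2, a3⟩ := h' y hy hyo
        refine ⟨(min_le_right _ _).trans a1, a2.trans (le_max_right _ _), fun v => ?_⟩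
        exact (mul_le_mul_of_nonneg_right (min_le_right _ _) (by positivity)).trans (a3 v)
    · intro q hq
      have hq0 : q ≠ 0 := by rintro rfl; simp at hq
      obtain ⟨c₁, h₁, c₂, h₂, c₀, h₀, h⟩ := hF.local_bounds hβ hβ1 hq0
      exact ⟨_, mem_nhdsWithin_of_mem_nhds h, c₁, h₁, c₂, h₂, c₀, h₀, fun y hy => hy⟩
  obtain ⟨c₁, h₁, c₂, h₂, c₀, h₀, h⟩ := key
  refine ⟨c₁, h₁, c₂, h₂, c₀, h₀, fun x hx hx0 => ?_⟩
  have hn : 0 < ‖x‖ := norm_pos_iff.2 hx0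
  have hn' : (‖x‖ : ℂ) ≠ 0 := by exact_mod_cast hn.ne'
  set y : Plane := ((‖x‖ : ℂ)⁻¹) • x with hy
  have hxy : x = (‖x‖ : ℂ) • y := by rw [hy, smul_smul, mul_inv_cancel₀ hn', one_smul]
  have hyo : y ∈ offLines ℓ := (smul_mem_offLines (inv_ne_zero hn')).2 hx
  obtain ⟨a1, a2, a3⟩ := h y (by simp [hy, norm_smul, hn.ne']) hyo
  have hFx : F x = ‖x‖ ^ c * F y := by
    conv_lhs => rw [hxy, hF.homog _ _ hn']
    simp
  refine ⟨?_, ?_, fun v => ?_⟩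
  · rw [hFx, mul_comm]; gcongr
  · rw [hFx, mul_comm c₂]; gcongr
  · have := hF.rlev_smul hyo hn v
    rw [← hxy] at this
    rw [this, mul_comm c₀, mul_assoc]
    gcongr
    exact a3 v

end

/-! ### The distance to the vertex of the flat cone -/

section

theorem vecNorm_half_iddbar {φ : Plane → ℝ} {x : Plane} (h : ContDiffAt ℝ 2 φ x) (v : Plane) :
    vecNorm ((1 / 2 : ℝ) • iddbar φ x) v = √((rlev φ x v v).re) := by
  have h1 : ((1 / 2 : ℝ) • iddbar φ x) ![v, Complex.I • v] = (1 / 2 : ℝ) * iddbar φ x ![v, Complex.I • v] := by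
    simp
  rw [vecNorm, h1, iddbar_I_eq_re h]
  congr 1; ring

variable {d : ℕ} {β c : ℝ} {ℓ : Fin d → Plane} {F : Plane → ℝ}

theorem ne_zero_of_mem_offLines (hd : 0 < d) {x : Plane} (hx : x ∈ offLines ℓ) : x ≠ 0 := by
  rintro rfl
  exact hx ⟨0, hd⟩ (by simp [wedge])

/-- Along the complex line through x the potential is F(x) times the squared norm of a branch of (1
+ ζ)^{c/2}, whose derivative at 0 has modulus c/2. -/
theorem FlatModel.rlev_radial (hF : FlatModel β c ℓ F) {x : Plane} (hx : x ∈ offLines ℓ) :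
    (rlev F x x x).re = (c / 2) ^ 2 * F x := by
  have hι : AnalyticAt ℂ (fun ζ : ℂ => x + ζ • x) 0 := analyticAt_line x x 0
  have h0 : x + (0 : ℂ) • x = x := by simp
  have hone : AnalyticAt ℂ (fun ζ : ℂ => 1 + ζ) 0 := analyticAt_const.add analyticAt_id
  obtain ⟨g, hg, hg0, hgn, hgd⟩ := exists_branch hone (by simp) (c / 2)
  have h1 := lev_comp (f := fun y => (F y : ℂ)) (ι := fun ζ : ℂ => x + ζ • x) (x := 0) hι
    (by rw [h0]; exact (hF.contDiffAt hx).ofReal) 1 1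
  rw [fderiv_line, one_smul, h0] at h1
  have h2 : (fun ζ : ℂ => F (x + ζ • x)) =ᶠ[𝓝 0] fun ζ => F x * ‖g ζ‖ ^ 2 := by
    filter_upwards [hgn, hone.continuousAt.eventually_ne (y := 0) (by simp)] with ζ a1 a2
    have e : x + ζ • x = (1 + ζ) • x := by rw [add_smul, one_smul]
    rw [e, hF.homog _ _ a2, a1, ← Real.rpow_natCast, ← Real.rpow_mul (norm_nonneg _)]
    rw [mul_comm]; congr 2; push_cast; ring
  have h3 : rlev (fun ζ : ℂ => F (x + ζ • x)) 0 1 1 = rlev F x x x := h1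
  rw [← h3, rlev_eventuallyEq h2, rlev_const_mul (contDiffAt_norm_sq hg), Complex.re_ofReal_mul,
    rlev_norm_sq hg, hgd]
  have h4 : fderiv ℂ (fun ζ : ℂ => 1 + ζ) 0 1 = 1 := by
    have : HasFDerivAt (fun ζ : ℂ => 1 + ζ) (ContinuousLinearMap.id ℂ ℂ) 0 :=
      (hasFDerivAt_id (0 : ℂ)).const_add 1
    rw [this.fderiv]; simp
  have h5 : ‖g 0‖ = 1 := by rw [hgn.self_of_nhds]; simp
  rw [h4]
  simp [h5, div_pow]
  ring

/-- The function √F increases along the curve at most as fast as arc length. The curve is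
differentiable only after time 0, so the comparison is made on [ε, 1]; the bound F ≤ c₂|x|^c shows
that √F tends to 0 at the vertex. -/
theorem FlatModel.sqrt_le_length (hd : 0 < d) (hβ : 0 < β) (hβ1 : β < 1) (hc : 0 < c)
    (hF : FlatModel β c ℓ F) {y : Plane} {γ : ℝ → Plane} (hγ : IsCurveFromZero (offLines ℓ) y γ) :
    ENNReal.ofReal (√(F y)) ≤ ∫⁻ t in Set.Ioo (0 : ℝ) 1,
      ENNReal.ofReal (vecNorm ((1 / 2 : ℝ) • iddbar F (γ t)) (deriv γ t)) := by
  obtain ⟨hγc, hγ0, hγ1, hγd, hγU⟩ := hγ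
  set f : ℝ → ℝ := fun t => √(F (γ t)) with hf
  have hfd : ContDiffOn ℝ 1 f (Set.Ioc 0 1) := by
    intro t ht
    have h1 : ContDiffAt ℝ 1 (fun x => √(F x)) (γ t) :=
      (hF.contDiffAt (hγU t ht)).sqrt (hF.pos (hγU t ht)).ne'
    exact h1.comp_contDiffWithinAt t (hγd t ht)
  have hder : ∀ t ∈ Set.Ioo (0 : ℝ) 1,
      ‖deriv f t‖ₑ ≤ ENNReal.ofReal (vecNorm ((1 / 2 : ℝ) • iddbar F (γ t)) (deriv γ t)) := by
    intro t ht
    have ht' : t ∈ Set.Ioc (0 : ℝ) 1 := ⟨ht.1, ht.2.le⟩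
    have hU := hγU t ht'
    have hγt : HasDerivAt γ (deriv γ t) t :=
      (((hγd t ht').contDiffAt (Ioc_mem_nhds ht.1 ht.2)).differentiableAt (by norm_num)).hasDerivAt
    have hFd : HasFDerivAt F (fderiv ℝ F (γ t)) (γ t) :=
      ((hF.contDiffAt hU (n := 1)).differentiableAt (by norm_num)).hasFDerivAt
    have hpos := hF.pos hU
    have h2 : HasDerivAt f _ t := (hFd.comp_hasDerivAt t hγt).sqrt hpos.ne'
    obtain ⟨W, Z, hW, hZ, -, hWZ, -⟩ := hF.off _ hU
    rw [vecNorm_half_iddbar (hF.contDiffAt hU), h2.deriv, Real.enorm_eq_ofReal_abs]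
    apply ENNReal.ofReal_le_ofReal
    have h3 := fderiv_sum_sq_le hW hZ hWZ (deriv γ t)
    have h4 : 0 < √(F (γ t)) := Real.sqrt_pos.2 hpos
    rw [abs_div, div_le_iff₀ (by simp only [Function.comp]; positivity)]
    have h5 : |2 * √((F ∘ γ) t)| = 2 * √(F (γ t)) := abs_of_pos (by simp only [Function.comp]; positivity)
    rw [h5]
    linarith
  obtain ⟨c₁, -, c₂, hc₂, c₀, -, hb⟩ := hF.bounds hβ hβ1
  have hlim : Filter.Tendsto (fun ε => ENNReal.ofReal (f 1 - f ε)) (𝓝[>] 0)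
      (𝓝 (ENNReal.ofReal (√(F y)))) := by
    have h1 : Filter.Tendsto (fun ε => √(c₂ * ‖γ ε‖ ^ c)) (𝓝[>] 0) (𝓝 0) := by
      have a1 : Filter.Tendsto γ (𝓝[>] 0) (𝓝 0) := by
        have := (hγc 0 (by simp)).mono_left (nhdsWithin_mono 0 (Set.Ioc_subset_Icc_self (a := (0 : ℝ)) (b := 1)))
        rw [hγ0, nhdsWithin_Ioc_eq_nhdsGT one_pos] at this
        exact this
      have a2 : ContinuousAt (fun x : Plane => √(c₂ * ‖x‖ ^ c)) 0 :=
        (continuousAt_const.mul (continuous_norm.continuousAt.rpow_const (Or.inr hc.le))).sqrt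
      have a3 := a2.tendsto.comp a1
      simpa [Real.zero_rpow hc.ne', Function.comp_def] using a3
    have h2 : Filter.Tendsto f (𝓝[>] 0) (𝓝 0) := by
      refine squeeze_zero' (Filter.Eventually.of_forall fun _ => Real.sqrt_nonneg _) ?_ h1
      filter_upwards [Ioc_mem_nhdsGT (one_pos : (0 : ℝ) < 1)] with ε hε
      exact Real.sqrt_le_sqrt (hb _ (hγU ε hε) (ne_zero_of_mem_offLines hd (hγU ε hε))).2.1
    have h3 := (ENNReal.continuous_ofReal.tendsto _).comp ((tendsto_const_nhds (x := f 1)).sub h2)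
    simp only [sub_zero] at h3
    have h4 : f 1 = √(F y) := by simp [hf, hγ1]
    rw [h4] at h3
    simpa [Function.comp_def, h4] using h3
  refine le_of_tendsto hlim ?_
  filter_upwards [Ioc_mem_nhdsGT (one_pos : (0 : ℝ) < 1)] with ε hε
  have h1 := enorm_sub_le_lintegral_deriv_of_contDiffOn_Icc (f := f)
    (hfd.mono fun t ht => ⟨hε.1.trans_le ht.1, ht.2⟩) hε.2
  calc ENNReal.ofReal (f 1 - f ε) ≤ ‖f 1 - f ε‖ₑ := by
        rw [Real.enorm_eq_ofReal_abs]; exact ENNReal.ofReal_le_ofReal (le_abs_self _)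
    _ ≤ _ := h1
    _ = ∫⁻ t in Set.Ioo ε 1, ‖deriv f t‖ₑ := by rw [MeasureTheory.restrict_Ioo_eq_restrict_Icc]
    _ ≤ ∫⁻ t in Set.Ioo (0 : ℝ) 1, ‖deriv f t‖ₑ :=
        MeasureTheory.lintegral_mono_set (Set.Ioo_subset_Ioo_left hε.1.le)
    _ ≤ _ := MeasureTheory.setLIntegral_mono' measurableSet_Ioo hder

theorem real_smul_eq (a : ℝ) (v : Plane) : a • v = (a : ℂ) • v :=
  RCLike.real_smul_eq_coe_smul (K := ℂ) a v

/-- The exponent 2/c gives F(γ t) = t² F(y), so the radial ray is run through with constant speed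
√F(y). -/
theorem FlatModel.exists_curve (hc : 0 < c) (hF : FlatModel β c ℓ F) {y : Plane}
    (hy : y ∈ offLines ℓ) :
    ∃ γ : ℝ → Plane, IsCurveFromZero (offLines ℓ) y γ ∧ ∫⁻ t in Set.Ioo (0 : ℝ) 1,
      ENNReal.ofReal (vecNorm ((1 / 2 : ℝ) • iddbar F (γ t)) (deriv γ t)) =
      ENNReal.ofReal (√(F y)) := by
  set γ : ℝ → Plane := fun t => t ^ (2 / c) • y with hγ
  have hsm : ∀ t : ℝ, t ^ (2 / c) • y = ((t ^ (2 / c) : ℝ) : ℂ) • y := fun t =>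
    real_smul_eq _ _
  have hγo : ∀ t : ℝ, 0 < t → γ t ∈ offLines ℓ := by
    intro t ht
    simp only [hγ, hsm]
    exact (smul_mem_offLines (by exact_mod_cast (Real.rpow_pos_of_pos ht _).ne')).2 hy
  have hγcurve : IsCurveFromZero (offLines ℓ) y γ := by
    refine ⟨?_, ?_, by simp [hγ], ?_, fun t ht => hγo t ht.1⟩
    · exact ((Real.continuous_rpow_const (by positivity)).smul continuous_const).continuousOn
    · simp [hγ, Real.zero_rpow (by positivity : 2 / c ≠ 0)]
    · intro t ht
      exact ((Real.contDiffAt_rpow_const_of_ne ht.1.ne').smul contDiffAt_const).contDiffWithinAt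
  refine ⟨γ, hγcurve, ?_⟩
  · have h1 : ∀ t ∈ Set.Ioo (0 : ℝ) 1,
        ENNReal.ofReal (vecNorm ((1 / 2 : ℝ) • iddbar F (γ t)) (deriv γ t)) =
        ENNReal.ofReal (√(F y)) := by
      intro t ht
      have hd1 : deriv γ t = (((2 / c) * t⁻¹ : ℝ) : ℂ) • γ t := by
        have := ((Real.hasDerivAt_rpow_const (x := t) (p := 2 / c) (Or.inl ht.1.ne')).smul_const y).deriv
        rw [hγ, this, Real.rpow_sub_one ht.1.ne', ← real_smul_eq]
        change _ = _ • t ^ (2 / c) • y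
        rw [smul_smul]
        congr 1; ring
      rw [vecNorm_half_iddbar (hF.contDiffAt (hγo t ht.1)), hd1]
      have h2 : (rlev F (γ t) ((((2 / c) * t⁻¹ : ℝ) : ℂ) • γ t) ((((2 / c) * t⁻¹ : ℝ) : ℂ) • γ t)).re =
          ((2 / c) * t⁻¹) ^ 2 * (rlev F (γ t) (γ t) (γ t)).re := by
        rw [rlev, lev_smul_left, lev_smul_right, Complex.conj_ofReal, Complex.re_ofReal_mul,
          Complex.re_ofReal_mul]
        rw [rlev]; ring
      rw [h2, hF.rlev_radial (hγo t ht.1)]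
      have h3 : F (γ t) = t ^ 2 * F y := by
        have hp := Real.rpow_pos_of_pos ht.1 (2 / c)
        simp only [hγ, hsm]
        rw [hF.homog _ _ (by exact_mod_cast hp.ne'), Complex.norm_real, Real.norm_of_nonneg hp.le,
          ← Real.rpow_mul ht.1.le, div_mul_cancel₀ _ hc.ne']
        norm_num
      rw [h3]
      congr 2
      have := ht.1.ne'
      field_simp
    rw [MeasureTheory.setLIntegral_congr_fun measurableSet_Ioo h1]
    simp

/-- The distance to the vertex of the cone. -/
theorem FlatModel.distZero_eq (hd : 0 < d) (hβ : 0 < β) (hβ1 : β < 1) (hc : 0 < c)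
    (hF : FlatModel β c ℓ F) {y : Plane} (hy : y ∈ offLines ℓ) {κ : Plane → TwoForm}
    (hκ : ∀ x, κ x = (1 / 2 : ℝ) • iddbar F x) :
    distZero κ (offLines ℓ) y = √(F y) := by
  obtain ⟨γ, hγcurve, hlen⟩ := hF.exists_curve hc hy
  obtain rfl : κ = fun x => (1 / 2 : ℝ) • iddbar F x := funext hκ
  have h1 := iInf_le (fun γ : {γ : ℝ → Plane // IsCurveFromZero (offLines ℓ) y γ} =>
    ∫⁻ t in Set.Ioo (0 : ℝ) 1,
      ENNReal.ofReal (vecNorm ((1 / 2 : ℝ) • iddbar F (γ.1 t)) (deriv γ.1 t))) ⟨γ, hγcurve⟩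
  have h2 := le_iInf fun γ : {γ : ℝ → Plane // IsCurveFromZero (offLines ℓ) y γ} =>
    hF.sqrt_le_length hd hβ hβ1 hc γ.2
  have h3 := le_antisymm (h1.trans hlen.le) h2
  unfold distZero
  rw [h3, ENNReal.toReal_ofReal (Real.sqrt_nonneg _)]

end

/-! ### The curve, its asymptotic cones, and the shift onto the lines -/

section

/-- An affine curve of degree `d` with `d` distinct asymptotic lines spanned by the vectors `ℓ k`,
together with transversal vectors `e k` and an opening `M` of the cones `M |wedge (ℓ k) y|² ≤ 2 |y|²`
around these lines. -/
structure AsymCurve (d : ℕ) where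
  P : MvPolynomial (Fin 2) ℂ
  c₀ : ℂ
  ℓ : Fin d → Plane
  e : Fin d → Plane
  M : ℝ
  two_le : 2 ≤ d
  totalDegree_eq : P.totalDegree = d
  c₀_ne : c₀ ≠ 0
  wedge_ne : ∀ j k, j ≠ k → wedge (ℓ j) (ℓ k) ≠ 0
  wedge_e : ∀ k, wedge (ℓ k) (e k) = 1
  top_eq : ∀ x : Plane, MvPolynomial.eval (fun i => x i) (MvPolynomial.homogeneousComponent d P) =
    c₀ * ∏ k, wedge (ℓ k) x
  M_pos : 0 < M
  cone : ∀ k (y : Plane), y ≠ 0 → M * ‖wedge (ℓ k) y‖ ^ 2 ≤ 2 * ‖y‖ ^ 2 →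
    wedge y (e k) ≠ 0 ∧ ∀ j, j ≠ k → 2 * ‖y‖ ^ 2 < M * ‖wedge (ℓ j) y‖ ^ 2

theorem wedge_smul_eq (q q' x : Plane) :
    wedge q q' • x = wedge x q' • q + wedge q x • q' := by
  ext i
  fin_cases i <;> simp [wedge] <;> ring

theorem norm_sq_le_of_wedge {q q' : Plane} (h : wedge q q' ≠ 0) :
    ∃ C > 0, ∀ x, ‖x‖ ^ 2 ≤ C * (‖wedge q x‖ ^ 2 + ‖wedge q' x‖ ^ 2) := by
  have hn : 0 < ‖wedge q q'‖ := norm_pos_iff.2 h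
  refine ⟨2 * (‖q‖ ^ 2 + ‖q'‖ ^ 2 + 1) / ‖wedge q q'‖ ^ 2, by positivity, fun x => ?_⟩
  have h1 : ‖wedge q q'‖ * ‖x‖ ≤ ‖wedge q' x‖ * ‖q‖ + ‖wedge q x‖ * ‖q'‖ := by
    rw [← norm_smul, wedge_smul_eq, wedge_swap q' x]
    refine (norm_add_le _ _).trans ?_
    rw [norm_smul, norm_smul, norm_neg]
  rw [div_mul_eq_mul_div, le_div_iff₀ (by positivity)]
  have h2 : (‖wedge q q'‖ * ‖x‖) ^ 2 ≤ (‖wedge q' x‖ * ‖q‖ + ‖wedge q x‖ * ‖q'‖) ^ 2 :=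
    pow_le_pow_left₀ (by positivity) h1 2
  nlinarith [sq_nonneg (‖wedge q' x‖ * ‖q'‖ - ‖wedge q x‖ * ‖q‖), sq_nonneg ‖wedge q x‖,
    sq_nonneg ‖wedge q' x‖, sq_nonneg (‖wedge q' x‖ * ‖q‖ - ‖wedge q x‖ * ‖q'‖),
    sq_nonneg (‖wedge q x‖ * ‖q‖), sq_nonneg (‖wedge q' x‖ * ‖q'‖),
    sq_nonneg (‖wedge q x‖ * ‖q'‖), sq_nonneg (‖wedge q' x‖ * ‖q‖)]

theorem exists_asymCurve {P : MvPolynomial (Fin 2) ℂ} {d : ℕ} (hd : 2 ≤ d)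
    (hdeg : P.totalDegree = d) (hL : HasDistinctAsymptoticLines P d) :
    ∃ A : AsymCurve d, A.P = P := by
  obtain ⟨ℓ, c₀, hc₀, hℓ, htop⟩ := exists_factorization hd hdeg hL
  have hℓ0 : ∀ k, ℓ k ≠ 0 := by
    intro k hk
    obtain ⟨j, hj⟩ : ∃ j, j ≠ k := by
      have : Nontrivial (Fin d) := Fin.nontrivial_iff_two_le.2 hd
      exact exists_ne k
    exact hℓ k j hj.symm (by rw [hk]; simp [wedge])
  choose e he using fun k => exists_wedge_eq_one (hℓ0 k)
  have h1 : ∀ᶠ M : ℝ in Filter.atTop, ∀ k (y : Plane), y ≠ 0 →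
      M * ‖wedge (ℓ k) y‖ ^ 2 ≤ 2 * ‖y‖ ^ 2 → wedge y (e k) ≠ 0 := by
    rw [Filter.eventually_all]; intro k
    obtain ⟨C, hC, h⟩ := norm_sq_le_of_wedge (q := ℓ k) (q' := e k) (by rw [he]; exact one_ne_zero)
    filter_upwards [Filter.eventually_gt_atTop (2 * C), Filter.eventually_gt_atTop 0] with M hM hM0 y hy hle h0
    have h2 := h y
    rw [wedge_swap y (e k), h0, neg_zero, norm_zero] at h2
    have h3 : 0 < ‖y‖ ^ 2 := by have := norm_pos_iff.2 hy; positivity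
    nlinarith
  have h2 : ∀ᶠ M : ℝ in Filter.atTop, ∀ k j, j ≠ k → ∀ (y : Plane), y ≠ 0 →
      M * ‖wedge (ℓ k) y‖ ^ 2 ≤ 2 * ‖y‖ ^ 2 → 2 * ‖y‖ ^ 2 < M * ‖wedge (ℓ j) y‖ ^ 2 := by
    rw [Filter.eventually_all]; intro k
    rw [Filter.eventually_all]; intro j
    by_cases hjk : j = k
    · simp [hjk]
    obtain ⟨C, hC, h⟩ := norm_sq_le_of_wedge (hℓ j k hjk)
    -- A point of both cones would satisfy |y|² ≤ C(2 + 2)|y|²/M, which is impossible for M > 4C.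
    filter_upwards [Filter.eventually_gt_atTop (4 * C), Filter.eventually_gt_atTop 0] with M hM hM0 _ y hy hle
    by_contra! hle'
    have h2 := h y
    have h3 : 0 < ‖y‖ ^ 2 := by have := norm_pos_iff.2 hy; positivity
    nlinarith
  obtain ⟨M, hM1, hM2, hM0⟩ := (h1.and (h2.and (Filter.eventually_gt_atTop 0))).exists
  exact ⟨⟨P, c₀, ℓ, e, M, hd, hdeg, hc₀, hℓ, he, htop, hM0,
    fun k y hy h => ⟨hM1 k y hy h, fun j hj => hM2 k j hj y hy h⟩⟩, rfl⟩

namespace AsymCurve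

variable {d : ℕ} (A : AsymCurve d)

/-- The equation of the curve. -/
def eqn (x : Plane) : ℂ := MvPolynomial.eval (fun i => x i) A.P

/-- The homogenization of the terms of lower degree. -/
def low (p : ℂ × Plane) : ℂ := ∑ j ∈ Finset.range d, p.1 ^ (d - 1 - j) *
  MvPolynomial.eval (fun i => p.2 i) (MvPolynomial.homogeneousComponent j A.P)

/-- The quotient of the leading part by the equation of a line. -/
def cofactor (k : Fin d) (y : Plane) : ℂ := A.c₀ * ∏ j ∈ Finset.univ.erase k, wedge (A.ℓ j) y

/-- A cutoff function supported in a cone around a line. -/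
def cut (k : Fin d) (y : Plane) : ℝ :=
  Real.smoothTransition (2 - A.M * ‖wedge (A.ℓ k) y‖ ^ 2 / ‖y‖ ^ 2)

/-- A vector field which moves the curve to its asymptotic lines. -/
def shift (p : ℂ × Plane) : Plane :=
  ∑ k, ((A.cut k p.2 : ℂ) * (A.low p / A.cofactor k p.2)) • A.e k

/-- A function of degree `c - 1` which is strictly plurisubharmonic transversally to the lines. -/
def transv (c : ℝ) (y : Plane) : ℝ :=
  ∑ k, A.cut k y * (‖wedge y (A.e k)‖ ^ (c - 3) * ‖wedge (A.ℓ k) y‖ ^ 2)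

theorem eqn_eq (x : Plane) : A.eqn x = A.c₀ * ∏ k, wedge (A.ℓ k) x + A.low (1, x) := by
  have h1 := MvPolynomial.sum_homogeneousComponent A.P
  rw [A.totalDegree_eq, Finset.sum_range_succ] at h1
  have h2 := congrArg (MvPolynomial.eval fun i => x i) h1
  rw [map_add, map_sum, A.top_eq] at h2
  rw [eqn, ← h2, add_comm]
  simp [low]

theorem mul_cofactor (k : Fin d) (y : Plane) :
    wedge (A.ℓ k) y * A.cofactor k y = A.c₀ * ∏ k, wedge (A.ℓ k) y := by
  rw [← Finset.mul_prod_erase Finset.univ _ (Finset.mem_univ k), cofactor]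
  ring

theorem analyticAt_eval (p : MvPolynomial (Fin 2) ℂ) (x : Plane) :
    AnalyticAt ℂ (fun x : Plane => MvPolynomial.eval (fun i => x i) p) x := by
  induction p using MvPolynomial.induction_on with
  | C a => simpa using analyticAt_const
  | add p q hp hq => simpa using! hp.add hq
  | mul_X p i hp =>
    simpa using! hp.mul ((EuclideanSpace.proj i : Plane →L[ℂ] ℂ).analyticAt x)

theorem analyticAt_eqn (x : Plane) : AnalyticAt ℂ A.eqn x := analyticAt_eval _ x

theorem analyticAt_low (p : ℂ × Plane) : AnalyticAt ℂ A.low p := by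
  refine Finset.analyticAt_fun_sum _ fun j _ => ?_
  exact (analyticAt_fst.pow _).mul ((analyticAt_eval _ p.2).comp (f := Prod.snd) analyticAt_snd)

theorem analyticAt_cofactor (k : Fin d) (y : Plane) : AnalyticAt ℂ (A.cofactor k) y :=
  analyticAt_const.mul (Finset.analyticAt_fun_prod _ fun _ _ => analyticAt_wedge _ _)

theorem low_smul (a : ℂ) (p : ℂ × Plane) : A.low (a • p) = a ^ (d - 1) * A.low p := by
  simp only [low, Finset.mul_sum]
  refine Finset.sum_congr rfl fun j hj => ?_
  have hj' := Finset.mem_range.1 hj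
  have h1 := eval_smul_of_homogeneous
    (MvPolynomial.homogeneousComponent_isHomogeneous j A.P) a p.2
  have h2 : a ^ (d - 1) = a ^ (d - 1 - j) * a ^ j := by rw [← pow_add]; congr 1; omega
  rw [Prod.smul_snd, h1, Prod.smul_fst, smul_eq_mul, mul_pow, h2]
  ring

theorem cofactor_smul (k : Fin d) (a : ℂ) (y : Plane) :
    A.cofactor k (a • y) = a ^ (d - 1) * A.cofactor k y := by
  simp only [cofactor, wedge_smul]
  rw [Finset.prod_mul_distrib, Finset.prod_const, Finset.card_erase_of_mem (Finset.mem_univ k)]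
  simp; ring

theorem cut_smul (k : Fin d) {a : ℂ} (ha : a ≠ 0) (y : Plane) : A.cut k (a • y) = A.cut k y := by
  have h1 : ‖a‖ ≠ 0 := norm_ne_zero_iff.2 ha
  simp only [cut, wedge_smul, norm_smul, norm_mul, mul_pow]
  congr 2
  rw [mul_left_comm, mul_div_mul_left _ _ (pow_ne_zero 2 h1)]

/-- Numerator and denominator both have degree d - 1. Hence the shift at (1, x) equals the shift at
(1/r, x/r), which is smooth down to parameter 0: every decay estimate becomes a bound on a compact
set. -/
theorem shift_smul {a : ℂ} (ha : a ≠ 0) (p : ℂ × Plane) : A.shift (a • p) = A.shift p := by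
  simp only [shift, Prod.smul_snd, A.cut_smul _ ha, A.low_smul, A.cofactor_smul]
  refine Finset.sum_congr rfl fun k _ => ?_
  rw [mul_div_mul_left _ _ (pow_ne_zero _ ha)]

/-- The degree is one less than that of the flat potential, so this correction is of relative size
1/|y|, exactly the order allowed for the error. -/
theorem transv_smul {c a : ℝ} (ha : 0 < a) (y : Plane) :
    A.transv c ((a : ℂ) • y) = a ^ (c - 1) * A.transv c y := by
  have ha' : (a : ℂ) ≠ 0 := by exact_mod_cast ha.ne'
  simp only [transv, Finset.mul_sum]
  refine Finset.sum_congr rfl fun k _ => ?_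
  rw [A.cut_smul _ ha', smul_wedge, wedge_smul, norm_mul, norm_mul, Complex.norm_real,
    Real.norm_of_nonneg ha.le, Real.mul_rpow ha.le (norm_nonneg _), mul_pow]
  have : a ^ (c - 1) = a ^ (c - 3) * a ^ 2 := by
    rw [← Real.rpow_natCast a 2, ← Real.rpow_add ha]; congr 1; push_cast; ring
  rw [this]; ring

theorem cut_eq_one {k : Fin d} {y : Plane} (hy : y ≠ 0)
    (h : A.M * ‖wedge (A.ℓ k) y‖ ^ 2 ≤ ‖y‖ ^ 2) : A.cut k y = 1 := by
  have hn : 0 < ‖y‖ := norm_pos_iff.2 hy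
  apply Real.smoothTransition.one_of_one_le
  have : A.M * ‖wedge (A.ℓ k) y‖ ^ 2 / ‖y‖ ^ 2 ≤ 1 := (div_le_one (by positivity)).2 h
  linarith

theorem cut_eq_zero {k : Fin d} {y : Plane} (hy : y ≠ 0)
    (h : 2 * ‖y‖ ^ 2 ≤ A.M * ‖wedge (A.ℓ k) y‖ ^ 2) : A.cut k y = 0 := by
  have hn : 0 < ‖y‖ := norm_pos_iff.2 hy
  apply Real.smoothTransition.zero_of_nonpos
  have : 2 ≤ A.M * ‖wedge (A.ℓ k) y‖ ^ 2 / ‖y‖ ^ 2 := (le_div_iff₀ (by positivity)).2 h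
  linarith

theorem cut_nonneg (k : Fin d) (y : Plane) : 0 ≤ A.cut k y := Real.smoothTransition.nonneg _

theorem transv_nonneg (c : ℝ) (y : Plane) : 0 ≤ A.transv c y :=
  Finset.sum_nonneg fun k _ => mul_nonneg (A.cut_nonneg k y) (by positivity)

theorem contDiffAt_cut (k : Fin d) {y : Plane} (hy : y ≠ 0) :
    ContDiffAt ℝ ∞ (A.cut k) y := by
  have h1 : ContDiffAt ℝ ∞ (fun y : Plane =>
      2 - A.M * ‖wedge (A.ℓ k) y‖ ^ 2 / ‖y‖ ^ 2) y :=
    contDiffAt_const.sub ((contDiffAt_const.mul ((analyticAt_wedge _ y).smoothAt.norm_sq ℝ)).div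
      (contDiffAt_id.norm_sq ℝ) (by have := norm_pos_iff.2 hy; positivity))
  have h2 : ContDiff ℝ ∞ Real.smoothTransition := Real.smoothTransition.contDiff
  exact h2.contDiffAt.comp y h1

theorem cofactor_ne_zero {k : Fin d} {y : Plane} (hy : y ≠ 0)
    (h : A.M * ‖wedge (A.ℓ k) y‖ ^ 2 ≤ 2 * ‖y‖ ^ 2) : A.cofactor k y ≠ 0 := by
  refine mul_ne_zero A.c₀_ne (Finset.prod_ne_zero_iff.2 fun j hj h0 => ?_)
  have := (A.cone k y hy h).2 j (Finset.ne_of_mem_erase hj)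
  rw [h0, norm_zero] at this
  have := norm_nonneg y
  nlinarith

theorem cut_eventually_eq_zero {k : Fin d} {y : Plane} (hy : y ≠ 0)
    (h : 2 * ‖y‖ ^ 2 < A.M * ‖wedge (A.ℓ k) y‖ ^ 2) : ∀ᶠ y' in 𝓝 y, A.cut k y' = 0 := by
  have h1 : Continuous fun y : Plane => 2 * ‖y‖ ^ 2 := by fun_prop
  have h2 : Continuous fun y : Plane => A.M * ‖wedge (A.ℓ k) y‖ ^ 2 :=
    continuous_const.mul ((continuous_wedge _).norm.pow 2)
  filter_upwards [h1.continuousAt.eventually_lt h2.continuousAt h, continuousAt_id.eventually_ne hy]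
    with y' a b
  exact A.cut_eq_zero b a.le

/-- Each summand is a cutoff times a quotient of polynomials, and the denominator has no zero on the
support of the cutoff; elsewhere the summand vanishes locally. -/
theorem contDiffAt_shift {p : ℂ × Plane} (hp : p.2 ≠ 0) :
    ContDiffAt ℝ ∞ A.shift p := by
  unfold shift
  refine ContDiffAt.sum fun k _ => ?_
  by_cases h : A.M * ‖wedge (A.ℓ k) p.2‖ ^ 2 ≤ 2 * ‖p.2‖ ^ 2
  · refine ContDiffAt.smul (𝕜' := ℂ) (ContDiffAt.mul ?_ ?_) (contDiffAt_const (c := A.e k))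
    · exact contDiffAt_ofReal_comp ((A.contDiffAt_cut k hp).comp p contDiffAt_snd)
    · exact ((A.analyticAt_low p).div ((A.analyticAt_cofactor k p.2).comp (f := Prod.snd) analyticAt_snd)
        (A.cofactor_ne_zero hp h)).smoothAt
  · have h0 := (continuousAt_snd (p := p)).eventually (A.cut_eventually_eq_zero hp (not_le.1 h))
    refine contDiffAt_const (c := 0) |>.congr_of_eventuallyEq ?_
    filter_upwards [h0] with p' h'
    simp [h']

theorem contDiffAt_transv (c : ℝ) {y : Plane} (hy : y ≠ 0) :
    ContDiffAt ℝ ∞ (A.transv c) y := by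
  unfold transv
  refine ContDiffAt.sum fun k _ => ?_
  by_cases h : A.M * ‖wedge (A.ℓ k) y‖ ^ 2 ≤ 2 * ‖y‖ ^ 2
  · have h0 := (A.cone k y hy h).1
    refine (A.contDiffAt_cut k hy).mul (ContDiffAt.mul ?_ ?_)
    · exact ((analyticAt_wedge_left _ y).smoothAt.norm ℝ h0).rpow_const_of_ne
        (norm_ne_zero_iff.2 h0)
    · exact (analyticAt_wedge _ y).smoothAt.norm_sq ℝ
  · refine contDiffAt_const (c := 0) |>.congr_of_eventuallyEq ?_
    filter_upwards [A.cut_eventually_eq_zero hy (not_le.1 h)] with y' h'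
    simp [h']

/-- The open cone around a line in which the cutoff function is equal to one. -/
def inner (k : Fin d) : Set Plane := {y | A.M * ‖wedge (A.ℓ k) y‖ ^ 2 < ‖y‖ ^ 2}

theorem ne_zero_of_mem_inner {k : Fin d} {y : Plane} (hy : y ∈ A.inner k) : y ≠ 0 := by
  rintro rfl
  simp [inner, wedge] at hy

theorem cut_of_mem_inner {k : Fin d} {y : Plane} (hy : y ∈ A.inner k) (j : Fin d) :
    A.cut j y = if j = k then 1 else 0 := by
  have h0 := A.ne_zero_of_mem_inner hy
  have hy' : A.M * ‖wedge (A.ℓ k) y‖ ^ 2 < ‖y‖ ^ 2 := hy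
  split_ifs with h
  · rw [h]; exact A.cut_eq_one h0 hy'.le
  · refine A.cut_eq_zero h0 ((A.cone k y h0 ?_).2 j h).le
    nlinarith [sq_nonneg ‖y‖]

theorem cone_of_mem_inner {k : Fin d} {y : Plane} (hy : y ∈ A.inner k) :
    A.cofactor k y ≠ 0 ∧ wedge y (A.e k) ≠ 0 ∧ ∀ j, j ≠ k → wedge (A.ℓ j) y ≠ 0 := by
  have h0 := A.ne_zero_of_mem_inner hy
  have hy' : A.M * ‖wedge (A.ℓ k) y‖ ^ 2 < ‖y‖ ^ 2 := hy
  have h1 : A.M * ‖wedge (A.ℓ k) y‖ ^ 2 ≤ 2 * ‖y‖ ^ 2 := by nlinarith [sq_nonneg ‖y‖]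
  refine ⟨A.cofactor_ne_zero h0 h1, (A.cone k y h0 h1).1, fun j hj h => ?_⟩
  have := (A.cone k y h0 h1).2 j hj
  rw [h, norm_zero] at this
  nlinarith [sq_nonneg ‖y‖]

theorem shift_of_mem_inner {k : Fin d} {p : ℂ × Plane} (hp : p.2 ∈ A.inner k) :
    A.shift p = (A.low p / A.cofactor k p.2) • A.e k := by
  simp only [shift, A.cut_of_mem_inner hp]
  rw [Finset.sum_eq_single k]
  · simp
  · intro j _ hj; simp [hj]
  · simp

theorem transv_of_mem_inner {k : Fin d} {y : Plane} (hy : y ∈ A.inner k) (c : ℝ) :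
    A.transv c y = ‖wedge y (A.e k)‖ ^ (c - 3) * ‖wedge (A.ℓ k) y‖ ^ 2 := by
  simp only [transv, A.cut_of_mem_inner hy]
  rw [Finset.sum_eq_single k]
  · simp
  · intro j _ hj; simp [hj]
  · simp

/-- Since `wedge (ℓ k) (e k) = 1`, adding (low/cofactor) e_k turns the linear form w into (w ·
cofactor + low)/cofactor, and the numerator is P. Thus points of the curve move onto the line, while
the complementary coordinate `wedge · (e k)` is unaffected. -/
theorem wedge_add_shift {k : Fin d} {x : Plane} (hx : x ∈ A.inner k) :
    wedge (A.ℓ k) (x + A.shift (1, x)) = A.eqn x / A.cofactor k x ∧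
    wedge (x + A.shift (1, x)) (A.e k) = wedge x (A.e k) := by
  have h0 := (A.cone_of_mem_inner hx).1
  rw [A.shift_of_mem_inner (p := (1, x)) hx]
  constructor
  · rw [wedge_add, wedge_smul, A.wedge_e, A.eqn_eq, ← A.mul_cofactor k]
    field_simp
  · rw [wedge_swap, wedge_add, wedge_smul, wedge_self, wedge_swap (A.e k) x, mul_zero, add_zero]

end AsymCurve

end

/-! ### Decay of the shift and the global diffeomorphism -/

section

theorem norm_iteratedFDeriv_comp_clm_le {E F G : Type*} [NormedAddCommGroup E] [NormedSpace ℝ E]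
    [NormedAddCommGroup F] [NormedSpace ℝ F] [NormedAddCommGroup G] [NormedSpace ℝ G]
    {f : E → F} {s : Set E} (hs : IsOpen s) (hf : ContDiffOn ℝ ∞ f s) (g : G →L[ℝ] E) {x : G}
    (hx : g x ∈ s) (j : ℕ) :
    ‖iteratedFDeriv ℝ j (f ∘ g) x‖ ≤ ‖iteratedFDeriv ℝ j f (g x)‖ * ‖g‖ ^ j := by
  have hs' : IsOpen (g ⁻¹' s) := hs.preimage g.continuous
  have h := g.iteratedFDerivWithin_comp_right hf hs.uniqueDiffOn hs'.uniqueDiffOn hx (i := j)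
    (by exact_mod_cast le_top)
  rw [iteratedFDerivWithin_of_isOpen j hs' hx, iteratedFDerivWithin_of_isOpen j hs hx] at h
  rw [h]
  refine (ContinuousMultilinearMap.norm_compContinuousLinearMap_le _ _).trans (le_of_eq ?_)
  simp

theorem exists_bound_of_continuousOn {E F : Type*} [TopologicalSpace E] [NormedAddCommGroup F]
    {f : E → F} {K : Set E} (hK : IsCompact K) (hf : ∀ x ∈ K, ContinuousAt f x) :
    ∃ C > 0, ∀ x ∈ K, ‖f x‖ ≤ C := by
  obtain ⟨C, hC⟩ := hK.exists_bound_of_continuousOn (f := f)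
    fun x hx => (hf x hx).continuousWithinAt
  exact ⟨max C 1, by positivity, fun x hx => (hC x hx).trans (le_max_left _ _)⟩

/-- A radial cutoff function, vanishing on the unit ball. -/
def radialCut (y : Plane) : ℝ := Real.smoothTransition (‖y‖ ^ 2 - 1)

theorem contDiff_radialCut : ContDiff ℝ ∞ radialCut :=
  Real.smoothTransition.contDiff.comp ((contDiff_id.norm_sq ℝ).sub contDiff_const)

theorem radialCut_eq_zero {y : Plane} (h : ‖y‖ ≤ 1) : radialCut y = 0 :=
  Real.smoothTransition.zero_of_nonpos (by nlinarith [norm_nonneg y])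

theorem radialCut_eq_one {y : Plane} (h : 2 ≤ ‖y‖) : radialCut y = 1 :=
  Real.smoothTransition.one_of_one_le (by nlinarith)

theorem norm_radialCut_le (y : Plane) : ‖radialCut y‖ ≤ 1 := by
  rw [Real.norm_of_nonneg (show 0 ≤ radialCut y from Real.smoothTransition.nonneg _)]
  exact Real.smoothTransition.le_one _

theorem exists_norm_fderiv_radialCut_le : ∃ C > 0, ∀ y, ‖fderiv ℝ radialCut y‖ ≤ C := by
  obtain ⟨C, hC, h⟩ := exists_bound_of_continuousOn (isCompact_closedBall (0 : Plane) 2)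
    (f := fderiv ℝ radialCut)
    fun x _ => (contDiff_radialCut.continuous_fderiv (by simp)).continuousAt
  refine ⟨C, hC, fun y => ?_⟩
  by_cases hy : ‖y‖ ≤ 2
  · exact h y (by simpa using hy)
  · have : radialCut =ᶠ[𝓝 y] fun _ => 1 := by
      filter_upwards [continuous_norm.continuousAt.eventually (lt_mem_nhds (not_le.1 hy))]
        with z hz
      exact radialCut_eq_one hz.le
    rw [this.fderiv_eq]
    simp [hC.le]

namespace AsymCurve

variable {d : ℕ} (A : AsymCurve d)

theorem isOpen_snd_ne_zero : IsOpen {p : ℂ × Plane | p.2 ≠ 0} :=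
  isOpen_ne.preimage continuous_snd

theorem isCompact_ball_sphere :
    IsCompact (Metric.closedBall (0 : ℂ) 1 ×ˢ Metric.sphere (0 : Plane) 1) :=
  (isCompact_closedBall _ _).prod (isCompact_sphere _ _)

theorem shift_one_eq {a : ℝ} (ha : 0 < a) (y : Plane) :
    A.shift (1, y) = A.shift (((a⁻¹ : ℝ) : ℂ), ((a⁻¹ : ℝ) : ℂ) • y) := by
  have ha' : ((a⁻¹ : ℝ) : ℂ) ≠ 0 := by exact_mod_cast (inv_pos.2 ha).ne'
  rw [← A.shift_smul ha' (1, y)]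
  simp

theorem contDiffAt_shift_one {x : Plane} (hx : x ≠ 0) :
    ContDiffAt ℝ ∞ (fun y => A.shift (1, y)) x :=
  ContDiffAt.comp x (g := A.shift) (f := fun y : Plane => ((1 : ℂ), y))
    (A.contDiffAt_shift (p := ((1 : ℂ), x)) hx) (contDiffAt_const.prodMk contDiffAt_id)

theorem scaled_mem {x : Plane} (hx : 1 ≤ ‖x‖) :
    (((‖x‖⁻¹ : ℝ) : ℂ), ((‖x‖⁻¹ : ℝ) : ℂ) • x) ∈
      Metric.closedBall (0 : ℂ) 1 ×ˢ Metric.sphere (0 : Plane) 1 := by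
  have h0 : 0 < ‖x‖ := by linarith
  simp only [Set.mem_prod, Metric.mem_closedBall, dist_zero_right, mem_sphere_iff_norm, sub_zero,
    norm_smul, Complex.norm_real, norm_inv, norm_norm]
  exact ⟨inv_le_one_of_one_le₀ hx, inv_mul_cancel₀ h0.ne'⟩

/-- By homogeneity the function is the two-variable shift composed with an affine map whose linear
part has norm at most 1/|x|. Each derivative gains that factor, and derivatives of the two-variable
shift are bounded on a compact set. -/
theorem exists_shift_decay (j : ℕ) : ∃ C > 0, ∀ x : Plane, 1 ≤ ‖x‖ →
    ‖x‖ ^ j * ‖iteratedFDeriv ℝ j (fun y => A.shift (1, y)) x‖ ≤ C := by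
  obtain ⟨C, hC, h⟩ := exists_bound_of_continuousOn isCompact_ball_sphere
    (f := iteratedFDeriv ℝ j A.shift) fun p hp =>
      (A.contDiffAt_shift (p := p) (by
        have := hp.2
        rintro h0
        rw [h0] at this
        simp at this)).continuousAt_iteratedFDeriv (by exact_mod_cast le_top)
  refine ⟨C, hC, fun x hx => ?_⟩
  have h0 : 0 < ‖x‖ := by linarith
  set a : ℝ := ‖x‖⁻¹ with ha
  have ha0 : 0 < a := inv_pos.2 h0
  let g : Plane →L[ℝ] ℂ × Plane :=
    (ContinuousLinearMap.inr ℝ ℂ Plane).comp (a • ContinuousLinearMap.id ℝ Plane)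
  have hg : ∀ y, g y = (0, (a : ℂ) • y) := fun y => by
    rw [← real_smul_eq]
    rfl
  have hgn : ‖g‖ ≤ a := by
    refine ContinuousLinearMap.opNorm_le_bound _ ha0.le fun y => ?_
    rw [hg, Prod.norm_def]
    simp [norm_smul, abs_of_pos ha0, mul_nonneg ha0.le]
  have heq : (fun y => A.shift (1, y)) = (fun p => A.shift (p + ((a : ℂ), 0))) ∘ g := by
    funext y
    rw [Function.comp_apply, hg, A.shift_one_eq h0]
    simp [ha]
  have hsm : ContDiffOn ℝ ∞ (fun p => A.shift (p + ((a : ℂ), 0))) {p : ℂ × Plane | p.2 ≠ 0} := by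
    intro p hp
    refine ContDiffAt.contDiffWithinAt ?_
    exact ContDiffAt.comp p (g := A.shift) (f := fun p : ℂ × Plane => p + ((a : ℂ), 0))
      (A.contDiffAt_shift (p := p + ((a : ℂ), 0)) (by simpa using hp))
      (contDiffAt_id.add contDiffAt_const)
  have hgx : g x ∈ {p : ℂ × Plane | p.2 ≠ 0} := by
    rw [hg]
    have hx0 : x ≠ 0 := norm_pos_iff.1 h0
    simp [hx0, ha0.ne']
  have h1 := norm_iteratedFDeriv_comp_clm_le isOpen_snd_ne_zero hsm g hgx j
  rw [← heq, iteratedFDeriv_comp_add_right] at h1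
  have h2 : g x + ((a : ℂ), 0) = ((a : ℂ), (a : ℂ) • x) := by rw [hg]; simp
  rw [h2] at h1
  have h3 := h _ (scaled_mem hx)
  calc ‖x‖ ^ j * ‖iteratedFDeriv ℝ j (fun y => A.shift (1, y)) x‖
      ≤ ‖x‖ ^ j * (C * a ^ j) := by
        gcongr
        exact h1.trans (by gcongr)
    _ = C := by
        rw [ha, mul_left_comm, ← mul_pow, mul_inv_cancel₀ h0.ne', one_pow, mul_one]

/-- The shift, cut off near the origin. -/
def cutShift (R : ℝ) (x : Plane) : Plane := radialCut (R⁻¹ • x) • A.shift (1, x)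

theorem cutShift_eq_zero {R : ℝ} (hR : 0 < R) {x : Plane} (hx : ‖x‖ ≤ R) :
    A.cutShift R x = 0 := by
  rw [cutShift, radialCut_eq_zero, zero_smul]
  rw [norm_smul, Real.norm_of_nonneg (inv_pos.2 hR).le, inv_mul_le_iff₀ hR]
  simpa using hx

theorem cutShift_eq {R : ℝ} (hR : 0 < R) {x : Plane} (hx : 2 * R ≤ ‖x‖) :
    A.cutShift R x = A.shift (1, x) := by
  rw [cutShift, radialCut_eq_one, one_smul]
  rw [norm_smul, Real.norm_of_nonneg (inv_pos.2 hR).le, le_inv_mul_iff₀ hR]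
  linarith

theorem cutShift_eventually_eq_zero {R : ℝ} (hR : 0 < R) {x : Plane} (hx : ‖x‖ < R) :
    A.cutShift R =ᶠ[𝓝 x] fun _ => 0 := by
  filter_upwards [continuous_norm.continuousAt.eventually (gt_mem_nhds hx)] with z hz
  exact A.cutShift_eq_zero hR hz.le

theorem contDiff_cutShift {R : ℝ} (hR : 0 < R) : ContDiff ℝ ∞ (A.cutShift R) := by
  rw [contDiff_iff_contDiffAt]
  intro x
  by_cases hx : x = 0
  · exact contDiffAt_const.congr_of_eventuallyEq
      (A.cutShift_eventually_eq_zero hR (x := x) (by simpa [hx] using hR))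
  · exact (contDiff_radialCut.comp (contDiff_const_smul R⁻¹)).contDiffAt.smul
      (A.contDiffAt_shift_one hx)

/-- Where the cutoff is nonzero, |x| ≥ R: the derivative of the shift is at most C₁/R there, and
differentiating the cutoff costs C₂/R. The constant does not depend on R, so a large R gives a small
derivative. -/
theorem exists_norm_fderiv_cutShift_le :
    ∃ C > 0, ∀ R, 1 ≤ R → ∀ x, ‖A.cutShift R x‖ ≤ C ∧ ‖fderiv ℝ (A.cutShift R) x‖ ≤ C / R := by
  obtain ⟨C₀, hC₀, h0⟩ := A.exists_shift_decay 0
  obtain ⟨C₁, hC₁, h1⟩ := A.exists_shift_decay 1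
  obtain ⟨C₂, hC₂, h2⟩ := exists_norm_fderiv_radialCut_le
  refine ⟨C₀ + C₁ + C₂ * C₀, by positivity, fun R hR x => ?_⟩
  have hR0 : 0 < R := by linarith
  rcases lt_or_ge ‖x‖ R with hx | hx
  · rw [(A.cutShift_eventually_eq_zero hR0 hx).fderiv_eq, A.cutShift_eq_zero hR0 hx.le]
    simp only [norm_zero, fderiv_fun_const, Pi.zero_apply]
    constructor <;> positivity
  have hx1 : 1 ≤ ‖x‖ := hR.trans hx
  have hx0 : x ≠ 0 := norm_pos_iff.1 (by linarith)
  have h0' := h0 x hx1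
  have h1' := h1 x hx1
  rw [norm_iteratedFDeriv_zero, pow_zero, one_mul] at h0'
  rw [norm_iteratedFDeriv_one, pow_one] at h1'
  have hb : ‖fderiv ℝ (fun y => A.shift (1, y)) x‖ ≤ C₁ / R := by
    rw [le_div_iff₀ hR0]
    nlinarith [norm_nonneg (fderiv ℝ (fun y => A.shift (1, y)) x)]
  have hc := norm_radialCut_le (R⁻¹ • x)
  constructor
  · rw [cutShift, norm_smul]
    calc _ ≤ 1 * C₀ := by gcongr
      _ ≤ _ := by nlinarith [mul_pos hC₂ hC₀]
  · have hd1 : HasFDerivAt (fun x : Plane => radialCut (R⁻¹ • x))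
        ((fderiv ℝ radialCut (R⁻¹ • x)).comp (R⁻¹ • ContinuousLinearMap.id ℝ Plane)) x :=
      HasFDerivAt.comp x (contDiff_radialCut.differentiable (by simp) _).hasFDerivAt
        ((hasFDerivAt_id x).const_smul R⁻¹)
    have hd2 := ((A.contDiffAt_shift_one hx0).differentiableAt (by simp)).hasFDerivAt
    have hd := hd1.smul hd2
    rw [show A.cutShift R = (fun x => radialCut (R⁻¹ • x)) • fun x => A.shift (1, x) from rfl,
      hd.fderiv]
    refine (norm_add_le _ _).trans ?_
    rw [norm_smul, ContinuousLinearMap.norm_smulRight_apply]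
    have h3 : ‖(fderiv ℝ radialCut (R⁻¹ • x)).comp (R⁻¹ • ContinuousLinearMap.id ℝ Plane)‖ ≤
        C₂ * R⁻¹ := by
      refine (ContinuousLinearMap.opNorm_comp_le _ _).trans ?_
      gcongr
      · exact h2 _
      · rw [norm_smul, Real.norm_of_nonneg (inv_pos.2 hR0).le]
        exact mul_le_of_le_one_right (inv_pos.2 hR0).le ContinuousLinearMap.norm_id_le
    calc _ ≤ 1 * (C₁ / R) + C₂ * R⁻¹ * C₀ := by gcongr
      _ = (C₁ + C₂ * C₀) / R := by field_simp
      _ ≤ _ := by gcongr; linarith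

/-- With R = 2C + 1 the cut-off shift is a contraction of ratio 1/2. The identity plus such a
contraction is a homeomorphism, its derivative is invertible everywhere, and its inverse is
therefore smooth. -/
theorem exists_diffeo : ∃ R, 1 ≤ R ∧ ∃ H : Plane ≃ₘ^∞⟮𝓘(ℝ, Plane), 𝓘(ℝ, Plane)⟯ Plane,
    (∀ x, H x = x + A.cutShift R x) ∧
    (∃ C, ∀ x, ‖H x - x‖ ≤ C) ∧
    ∀ x, ‖fderiv ℝ (A.cutShift R) x‖ ≤ 1 / 2 := by
  obtain ⟨C, hC, h⟩ := A.exists_norm_fderiv_cutShift_le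
  set R := 2 * C + 1 with hRdef
  have hR : 1 ≤ R := by linarith
  have hR0 : 0 < R := by linarith
  have hV := A.contDiff_cutShift hR0
  have hb : ∀ x, ‖fderiv ℝ (A.cutShift R) x‖ ≤ 1 / 2 := fun x =>
    (h R hR x).2.trans (by rw [div_le_iff₀ hR0]; linarith)
  have hlip : LipschitzWith (1 / 2) (A.cutShift R) :=
    lipschitzWith_of_nnnorm_fderiv_le (hV.differentiable (by simp)) fun x => by
      have := hb x
      rw [← NNReal.coe_le_coe]
      simpa using this
  let f : Plane → Plane := fun x => x + A.cutShift R x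
  have hap : ApproximatesLinearOn f
      ((ContinuousLinearEquiv.refl ℝ Plane : Plane ≃L[ℝ] Plane) : Plane →L[ℝ] Plane)
      Set.univ (1 / 2) := by
    intro x _ y _
    have := hlip.dist_le_mul x y
    rw [dist_eq_norm, dist_eq_norm] at this
    refine le_trans (le_of_eq ?_) this
    congr 1
    simp only [f, ContinuousLinearEquiv.coe_coe, ContinuousLinearEquiv.coe_refl', id]
    abel
  have hN : (1 / 2 : ℝ≥0) < ‖((ContinuousLinearEquiv.refl ℝ Plane).symm : Plane →L[ℝ] Plane)‖₊⁻¹ := by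
    have : ‖((ContinuousLinearEquiv.refl ℝ Plane).symm : Plane →L[ℝ] Plane)‖₊ = 1 := by
      simp
    rw [this, inv_one]
    exact NNReal.half_lt_self one_ne_zero
  let e : Plane ≃ₜ Plane := hap.toHomeomorph f (Or.inr hN)
  have he : (e : Plane → Plane) = f := rfl
  have hf : ContDiff ℝ ∞ f := contDiff_id.add hV
  have hinv : ∀ x, ∃ f' : Plane ≃L[ℝ] Plane, HasFDerivAt e (f' : Plane →L[ℝ] Plane) x := by
    intro x
    have h1 : HasFDerivAt f (ContinuousLinearMap.id ℝ Plane + fderiv ℝ (A.cutShift R) x) x :=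
      (hasFDerivAt_id x).add (hV.differentiable (by simp) x).hasFDerivAt
    have hu : IsUnit (ContinuousLinearMap.id ℝ Plane + fderiv ℝ (A.cutShift R) x) := by
      have := (Units.oneSub (-(fderiv ℝ (A.cutShift R) x)) (by
        rw [norm_neg]; exact (hb x).trans_lt (by norm_num))).isUnit
      simpa [Units.oneSub, sub_neg_eq_add] using! this
    obtain ⟨u, hu⟩ := hu
    refine ⟨ContinuousLinearEquiv.ofUnit u, ?_⟩
    rw [he]
    convert h1 using 1
    exact hu
  choose f' hf' using hinv
  have hs : ContDiff ℝ ∞ e.symm := e.contDiff_symm hf' hf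
  refine ⟨R, hR, ⟨e.toEquiv, hf.contMDiff, hs.contMDiff⟩, fun x => rfl, ⟨C, fun x => ?_⟩, hb⟩
  have : ‖A.cutShift R x‖ ≤ C := (h R hR x).1
  refine le_trans (le_of_eq ?_) this
  congr 1
  exact add_sub_cancel_left _ _

end AsymCurve

end

/-! ### Straightening of the curve outside a ball -/

section

/-- A diffeomorphism which straightens an affine curve to its asymptotic lines outside of the ball
of radius `R`. -/
structure Straightening {d : ℕ} (A : AsymCurve d) where
  H : Plane ≃ₘ^∞⟮𝓘(ℝ, Plane), 𝓘(ℝ, Plane)⟯ Plane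
  R : ℝ
  one_le : 1 ≤ R
  eq_shift : ∀ x, R < ‖x‖ → H x = x + A.shift (1, x)
  norm_fderiv_sub_le : ∀ x, ‖fderiv ℝ H x - ContinuousLinearMap.id ℝ Plane‖ ≤ 1 / 2
  norm_le : ∀ x, R < ‖x‖ → ‖H x‖ ≤ 2 * ‖x‖
  le_norm : ∀ x, R < ‖x‖ → ‖x‖ ≤ 2 * ‖H x‖
  mem_inner : ∀ x k, R < ‖x‖ → 4 * A.M * ‖wedge (A.ℓ k) x‖ ^ 2 < ‖x‖ ^ 2 → H x ∈ A.inner k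
  near_of_eqn : ∀ x, R < ‖x‖ → A.eqn x = 0 → ∃ k, 4 * A.M * ‖wedge (A.ℓ k) x‖ ^ 2 < ‖x‖ ^ 2

theorem exists_norm_wedge_le (q : Plane) : ∃ C > 0, ∀ x, ‖wedge q x‖ ≤ C * ‖x‖ :=
  ⟨‖wedgeL q‖ + 1, by positivity, fun x => by
    have := (wedgeL q).le_opNorm x
    rw [wedgeL_apply] at this
    nlinarith [norm_nonneg x]⟩

theorem iteratedFDeriv_id_eq_zero {j : ℕ} (hj : 2 ≤ j) (x : Plane) :
    iteratedFDeriv ℝ j (fun y : Plane => y) x = 0 := by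
  obtain ⟨n, rfl⟩ : ∃ n, j = n + 1 := ⟨j - 1, by omega⟩
  rw [← norm_eq_zero, ← norm_iteratedFDeriv_fderiv]
  have : fderiv ℝ (fun y : Plane => y) = fun _ => ContinuousLinearMap.id ℝ Plane := by
    funext y; exact fderiv_fun_id
  rw [this, iteratedFDeriv_const_of_ne (by omega)]
  simp

namespace AsymCurve

variable {d : ℕ} (A : AsymCurve d)

theorem exists_norm_low_le : ∃ C > 0, ∀ x : Plane, 1 ≤ ‖x‖ →
    ‖A.low (1, x)‖ ≤ C * ‖x‖ ^ (d - 1) := by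
  obtain ⟨C, hC, h⟩ := exists_bound_of_continuousOn isCompact_ball_sphere
    (f := A.low) fun p _ => (A.analyticAt_low p).continuousAt
  refine ⟨C, hC, fun x hx => ?_⟩
  have h0 : 0 < ‖x‖ := by linarith
  have h1 := h _ (scaled_mem hx)
  have h2 : ((1 : ℂ), x) = ((‖x‖ : ℝ) : ℂ) • (((‖x‖⁻¹ : ℝ) : ℂ), ((‖x‖⁻¹ : ℝ) : ℂ) • x) := by
    have : ((‖x‖ : ℝ) : ℂ) ≠ 0 := by exact_mod_cast h0.ne'
    simp [this]
  rw [h2, A.low_smul, norm_mul, norm_pow, Complex.norm_real, norm_norm, mul_comm]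
  gcongr

/-- Outside all thin cones the leading part of P is of order |x|^d, while the remaining terms are
O(|x|^{d-1}). -/
theorem exists_near_of_eqn : ∃ R, ∀ x : Plane, R < ‖x‖ → A.eqn x = 0 →
    ∃ k, 4 * A.M * ‖wedge (A.ℓ k) x‖ ^ 2 < ‖x‖ ^ 2 := by
  obtain ⟨C, hC, h⟩ := A.exists_norm_low_le
  set s := 2 * √A.M with hs
  have hs0 : 0 < s := by have := Real.sqrt_pos.2 A.M_pos; positivity
  have hs2 : s ^ 2 = 4 * A.M := by rw [hs, mul_pow, Real.sq_sqrt A.M_pos.le]; ring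
  have hc : 0 < ‖A.c₀‖ := norm_pos_iff.2 A.c₀_ne
  refine ⟨max 1 (C * s ^ d / ‖A.c₀‖), fun x hx h0 => ?_⟩
  have hx1 : 1 < ‖x‖ := (le_max_left _ _).trans_lt hx
  have hx2 := (div_lt_iff₀ hc).1 ((le_max_right _ _).trans_lt hx)
  have hx0 : 0 < ‖x‖ := by linarith
  by_contra! hcon
  have h1 : ∀ k, ‖x‖ ≤ s * ‖wedge (A.ℓ k) x‖ := fun k => by
    refine le_of_sq_le_sq ?_ (by positivity)
    rw [mul_pow, hs2]
    exact hcon k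
  have h2 : ‖x‖ ^ d ≤ s ^ d * ∏ k, ‖wedge (A.ℓ k) x‖ := by
    have := Finset.prod_le_prod (s := Finset.univ) (fun k _ => norm_nonneg x) fun k _ => h1 k
    simpa [Finset.prod_mul_distrib] using this
  rw [A.eqn_eq] at h0
  have h3 : ‖A.c₀‖ * ∏ k, ‖wedge (A.ℓ k) x‖ ≤ C * ‖x‖ ^ (d - 1) := by
    rw [← norm_prod, ← norm_mul, eq_neg_of_add_eq_zero_left h0, norm_neg]
    exact h x hx1.le
  have h4 : ‖x‖ ^ d = ‖x‖ ^ (d - 1) * ‖x‖ := by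
    rw [← pow_succ]; congr 1; have := A.two_le; omega
  have h5 : 0 < ‖x‖ ^ (d - 1) := by positivity
  have h6 : ‖A.c₀‖ * ‖x‖ ^ d ≤ s ^ d * (C * ‖x‖ ^ (d - 1)) := by
    calc _ ≤ ‖A.c₀‖ * (s ^ d * ∏ k, ‖wedge (A.ℓ k) x‖) := by gcongr
      _ = s ^ d * (‖A.c₀‖ * ∏ k, ‖wedge (A.ℓ k) x‖) := by ring
      _ ≤ _ := by gcongr
  rw [h4] at h6
  nlinarith

/-- The factor 4 leaves room between the two cones, whose width grows linearly with |x|, so a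
displacement of bounded length cannot leave the larger one far out. -/
theorem exists_mem_inner {C : ℝ} : ∃ R, ∀ x y : Plane, ∀ k, R < ‖x‖ → ‖y - x‖ ≤ C →
    4 * A.M * ‖wedge (A.ℓ k) x‖ ^ 2 < ‖x‖ ^ 2 → y ∈ A.inner k := by
  set s := √A.M with hs
  have hs0 : 0 < s := Real.sqrt_pos.2 A.M_pos
  have hs2 : s ^ 2 = A.M := Real.sq_sqrt A.M_pos.le
  choose K hK hKle using fun k => exists_norm_wedge_le (A.ℓ k)
  refine ⟨2 * (C + ∑ k, s * (K k * C)), fun x y k hx hy hk => ?_⟩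
  have hC : 0 ≤ C := (norm_nonneg _).trans hy
  have h1 : s * (K k * C) ≤ ∑ k, s * (K k * C) :=
    Finset.single_le_sum (f := fun k => s * (K k * C)) (fun j _ => by have := hK j; positivity)
      (Finset.mem_univ k)
  have h2 : 2 * s * ‖wedge (A.ℓ k) x‖ < ‖x‖ := by
    refine lt_of_pow_lt_pow_left₀ 2 (norm_nonneg _) ?_
    rw [mul_pow, mul_pow, hs2]
    linarith
  have h3 : ‖wedge (A.ℓ k) y‖ ≤ ‖wedge (A.ℓ k) x‖ + K k * C := by
    have : y = x + (y - x) := by abel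
    rw [this, wedge_add]
    refine (norm_add_le _ _).trans ?_
    gcongr
    refine (hKle k _).trans ?_
    have := hK k
    gcongr
  have h4 : ‖x‖ - C ≤ ‖y‖ := by
    have : ‖x‖ ≤ ‖y‖ + ‖y - x‖ := by
      have := norm_sub_le y (y - x)
      simpa using this
    linarith
  change A.M * ‖wedge (A.ℓ k) y‖ ^ 2 < ‖y‖ ^ 2
  rw [← hs2, ← mul_pow]
  refine pow_lt_pow_left₀ ?_ (by positivity) two_ne_zero
  have : s * ‖wedge (A.ℓ k) y‖ ≤ s * (‖wedge (A.ℓ k) x‖ + K k * C) := by gcongr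
  nlinarith

theorem mem_asymptoticLines_iff (x : Plane) :
    x ∈ asymptoticLines A.P d ↔ ∃ k, wedge (A.ℓ k) x = 0 := by
  change MvPolynomial.eval (fun i => x i) (MvPolynomial.homogeneousComponent d A.P) = 0 ↔ _
  rw [A.top_eq, mul_eq_zero, Finset.prod_eq_zero_iff]
  simp [A.c₀_ne]

theorem mem_curve_iff (x : Plane) : x ∈ curve A.P ↔ A.eqn x = 0 := Iff.rfl

theorem exists_cutShift_decay {R : ℝ} (hR : 1 ≤ R) (j : ℕ) : ∃ C, ∀ x : Plane,
    ‖x‖ ^ j * ‖iteratedFDeriv ℝ j (A.cutShift R) x‖ ≤ C := by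
  have hR0 : 0 < R := by linarith
  obtain ⟨C, hC, h⟩ := A.exists_shift_decay j
  obtain ⟨C', hC', h'⟩ := exists_bound_of_continuousOn
    (isCompact_closedBall (0 : Plane) (2 * R)) (f := fun x => ‖x‖ ^ j *
      ‖iteratedFDeriv ℝ j (A.cutShift R) x‖) fun x _ => by
      have : ContinuousAt (iteratedFDeriv ℝ j (A.cutShift R)) x :=
        (A.contDiff_cutShift hR0).contDiffAt.continuousAt_iteratedFDeriv (by exact_mod_cast le_top)
      exact (continuous_norm.continuousAt.pow j).mul this.norm
  refine ⟨C + C', fun x => ?_⟩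
  rcases le_or_gt ‖x‖ (2 * R) with hx | hx
  · have := h' x (by simpa using hx)
    rw [Real.norm_of_nonneg (by positivity)] at this
    linarith
  · have : A.cutShift R =ᶠ[𝓝 x] fun y => A.shift (1, y) := by
      filter_upwards [continuous_norm.continuousAt.eventually (lt_mem_nhds hx)] with z hz
      exact A.cutShift_eq hR0 hz.le
    rw [(this.iteratedFDeriv ℝ j).eq_of_nhds]
    have := h x (by linarith)
    linarith

theorem exists_straightening :
    ∃ S : Straightening A, IsAsymptoticDiffeo (curve A.P) (asymptoticLines A.P d) S.H := by
  obtain ⟨R₀, hR₀, H, hH, ⟨C, hC⟩, hD⟩ := A.exists_diffeo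
  have hR0 : 0 < R₀ := by linarith
  have hsm := A.contDiff_cutShift hR0
  obtain ⟨R₁, h1⟩ := A.exists_near_of_eqn
  obtain ⟨R₂, h2⟩ := A.exists_mem_inner (C := C)
  -- Beyond 2R₀ the cutoff equals 1, and beyond 2C the displacement is at most half of |x|, which
  -- makes |x| and |H x| comparable with constant 2.
  set R := max (max (2 * R₀) (2 * C)) (max R₁ R₂) with hR
  have hRR₀ : 2 * R₀ ≤ R := (le_max_left _ _).trans (le_max_left _ _)
  have hRC : 2 * C ≤ R := (le_max_right _ _).trans (le_max_left _ _)
  have hRR₁ : R₁ ≤ R := (le_max_left _ _).trans (le_max_right _ _)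
  have hRR₂ : R₂ ≤ R := (le_max_right _ _).trans (le_max_right _ _)
  have hfun : (H : Plane → Plane) = fun x => x + A.cutShift R₀ x := funext hH
  have hfd : ∀ x, fderiv ℝ H x - ContinuousLinearMap.id ℝ Plane = fderiv ℝ (A.cutShift R₀) x := by
    intro x
    have h3 : HasFDerivAt (fun x => x + A.cutShift R₀ x)
        (ContinuousLinearMap.id ℝ Plane + fderiv ℝ (A.cutShift R₀) x) x :=
      (hasFDerivAt_id x).add (hsm.differentiable (by simp) x).hasFDerivAt
    rw [hfun, h3.fderiv, add_sub_cancel_left]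
  have heq : ∀ x, R < ‖x‖ → H x = x + A.shift (1, x) := fun x hx => by
    rw [hH, A.cutShift_eq hR0 (by linarith)]
  have hup : ∀ x, ‖H x‖ ≤ ‖x‖ + C := fun x => by
    have := norm_add_le x (H x - x)
    rw [add_sub_cancel] at this
    linarith [hC x]
  have hlow : ∀ x, ‖x‖ ≤ ‖H x‖ + C := fun x => by
    have := norm_sub_le (H x) (H x - x)
    rw [sub_sub_cancel] at this
    linarith [hC x]
  let S : Straightening A :=
    { H := H
      R := R
      one_le := by linarith
      eq_shift := heq
      norm_fderiv_sub_le := fun x => by rw [hfd]; exact hD x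
      norm_le := fun x hx => by linarith [hup x]
      le_norm := fun x hx => by linarith [hlow x]
      mem_inner := fun x k hx hk => h2 x (H x) k (hRR₂.trans_lt hx) (hC x) hk
      near_of_eqn := fun x hx h0 => h1 x (hRR₁.trans_lt hx) h0 }
  refine ⟨S, ⟨Metric.closedBall 0 R, isCompact_closedBall _ _, fun x hx => ?_⟩, ?_⟩
  · have hx' : R < ‖x‖ := by simpa using hx.2
    have h0 : A.eqn x = 0 := hx.1
    obtain ⟨k, hk⟩ := S.near_of_eqn x hx' h0
    rw [A.mem_asymptoticLines_iff]
    refine ⟨k, ?_⟩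
    have hin : x ∈ A.inner k := by
      change A.M * ‖wedge (A.ℓ k) x‖ ^ 2 < ‖x‖ ^ 2
      have := A.M_pos
      nlinarith [mul_nonneg this.le (sq_nonneg ‖wedge (A.ℓ k) x‖)]
    rw [S.eq_shift x hx', (A.wedge_add_shift hin).1, h0, zero_div]
  · choose D hDle using fun j => A.exists_cutShift_decay hR₀ j
    -- Order 0 bounds the displacement itself. For higher orders the bounds of the cut-off shift
    -- suffice, because the identity has been subtracted at order 1 and has no derivatives of order
    -- at least 2.
    refine ⟨fun j => if j = 0 then C else D j, fun x => ⟨by simpa using hC x, ?_, fun j hj => ?_⟩⟩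
    · change ‖x‖ * ‖fderiv ℝ H x - ContinuousLinearMap.id ℝ Plane‖ ≤ _
      have := hDle 1 x
      rw [norm_iteratedFDeriv_one, pow_one] at this
      rw [hfd]
      simpa using this
    · have : iteratedFDeriv ℝ j H x = iteratedFDeriv ℝ j (A.cutShift R₀) x := by
        rw [hfun, fun_iteratedFDeriv_add_apply (f := fun y : Plane => y) contDiffAt_id
          (hsm.contDiffAt.of_le (by exact_mod_cast le_top)), iteratedFDeriv_id_eq_zero hj, zero_add]
      change ‖x‖ ^ j * ‖iteratedFDeriv ℝ j H x‖ ≤ _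
      rw [this]
      have hj0 : j ≠ 0 := by omega
      simpa [hj0] using hDle j x

end AsymCurve

end

/-! ### Regularized maximum and the interior potential -/

section

/-- A convex smooth function which vanishes for `t ≤ 0` and has slope one for `t ≥ 1`. -/
def ramp (t : ℝ) : ℝ := ∫ s in (0 : ℝ)..t, Real.smoothTransition s

theorem hasDerivAt_ramp (t : ℝ) : HasDerivAt ramp (Real.smoothTransition t) t :=
  (Real.smoothTransition.continuous).integral_hasStrictDerivAt 0 t |>.hasDerivAt

theorem deriv_ramp : deriv ramp = Real.smoothTransition :=
  funext fun t => (hasDerivAt_ramp t).deriv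

theorem contDiff_ramp : ContDiff ℝ ∞ ramp := by
  rw [contDiff_infty_iff_deriv, deriv_ramp]
  exact ⟨fun t => (hasDerivAt_ramp t).differentiableAt, Real.smoothTransition.contDiff⟩

theorem ramp_of_nonpos {t : ℝ} (ht : t ≤ 0) : ramp t = 0 := by
  rw [ramp, intervalIntegral.integral_congr (g := fun _ => (0 : ℝ))]
  · simp
  · intro s hs
    rw [Set.uIcc_of_ge ht] at hs
    exact Real.smoothTransition.zero_of_nonpos hs.2

theorem ramp_of_one_le {t : ℝ} (ht : 1 ≤ t) : ramp t = t + (ramp 1 - 1) := by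
  have h : ramp t = ramp 1 + ∫ s in (1 : ℝ)..t, Real.smoothTransition s :=
    (intervalIntegral.integral_add_adjacent_intervals
      (Real.smoothTransition.continuous.intervalIntegrable _ _)
      (Real.smoothTransition.continuous.intervalIntegrable _ _)).symm
  rw [h, intervalIntegral.integral_congr (g := fun _ => (1 : ℝ))]
  · simp; ring
  · intro s hs
    rw [Set.uIcc_of_le ht] at hs
    exact Real.smoothTransition.one_of_one_le hs.1

theorem two_le_infty : (2 : ℕ∞ω) ≤ ((⊤ : ℕ∞) : ℕ∞ω) := WithTop.coe_le_coe.2 (le_top : (2 : ℕ∞) ≤ ⊤)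

theorem four_le_infty : (4 : ℕ∞ω) ≤ ((⊤ : ℕ∞) : ℕ∞ω) := WithTop.coe_le_coe.2 (le_top : (4 : ℕ∞) ≤ ⊤)

/-- The function equal to `V` where `U ≤ V`, and to `U` up to a constant where `V + 1 ≤ U`. -/
def glue {E : Type*} (V U : E → ℝ) (x : E) : ℝ := V x + ramp (U x - V x)

theorem contDiffAt_glue {E : Type*} [NormedAddCommGroup E] [NormedSpace ℝ E] {V U : E → ℝ} {x : E} {n : ℕ∞} (hV : ContDiffAt ℝ n V x)
    (hU : ContDiffAt ℝ n U x) : ContDiffAt ℝ n (glue V U) x :=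
  hV.add ((contDiff_ramp.contDiffAt.of_le (by exact_mod_cast le_top)).comp x (hU.sub hV))

section Levi

variable {E : Type*} [NormedAddCommGroup E] [NormedSpace ℝ E] [NormedSpace ℂ E]
  [IsScalarTower ℝ ℂ E]

theorem rlev_sub {φ ψ : E → ℝ} {x : E} (hφ : ContDiffAt ℝ 2 φ x) (hψ : ContDiffAt ℝ 2 ψ x)
    (v w : E) : rlev (fun y => φ y - ψ y) x v w = rlev φ x v w - rlev ψ x v w := by
  have := rlev_add hφ (hψ.neg) v w
  have h2 := rlev_const_mul hψ (-1) v w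
  simp only [neg_mul, one_mul, Complex.ofReal_neg, Complex.ofReal_one] at h2
  have h3 : rlev (fun y => φ y + -ψ y) x v w = rlev φ x v w + rlev (fun y => -ψ y) x v w := this
  rw [h2] at h3
  simpa only [sub_eq_add_neg] using h3

theorem rlev_comp_real_self {φ : E → ℝ} {θ : ℝ → ℝ} {x : E} (h : ContDiffAt ℝ 2 φ x)
    (hθ : ContDiffAt ℝ 2 θ (φ x)) (v : E) :
    (rlev (fun y => θ (φ y)) x v v).re = deriv θ (φ x) * (rlev φ x v v).re +
      deriv (deriv θ) (φ x) * ‖del (fun y => (φ y : ℂ)) x v‖ ^ 2 := by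
  rw [rlev_comp_real h hθ, delBar_ofReal (h.differentiableAt (by simp)), Complex.mul_conj',
    ← Complex.ofReal_pow, Complex.add_re, Complex.re_ofReal_mul, Complex.re_ofReal_mul,
    Complex.ofReal_re]

/-- If s in [0, 1] is the slope of the ramp, the Levi form is (1 - s) times that of V plus s times
that of U, plus a nonnegative multiple of |∂(U - V)|² coming from convexity. -/
theorem strictPsh_glue {V U : E → ℝ} {x : E} (hV : ContDiffAt ℝ 2 V x)
    (hU : ContDiffAt ℝ 2 U x) (hVp : StrictPsh V x) (hUp : StrictPsh U x) :
    StrictPsh (glue V U) x := by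
  intro v hv
  have hd : ContDiffAt ℝ 2 (fun y => U y - V y) x := hU.sub hV
  have hr2 : ContDiff ℝ 2 ramp := by exact_mod_cast contDiff_infty.1 contDiff_ramp 2
  have hr : ContDiffAt ℝ 2 ramp (U x - V x) := hr2.contDiffAt
  have hrd : ContDiffAt ℝ 2 (fun y => ramp (U y - V y)) x := hr2.contDiffAt.comp x hd
  have h1 : rlev (glue V U) x v v = rlev V x v v + rlev (fun y => ramp (U y - V y)) x v v :=
    rlev_add hV hrd v v
  have h2 := rlev_comp_real_self hd hr v
  have h3 : (rlev (fun y => U y - V y) x v v).re = (rlev U x v v).re - (rlev V x v v).re := by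
    rw [rlev_sub hU hV, Complex.sub_re]
  rw [h3, deriv_ramp] at h2
  rw [h1, Complex.add_re, h2]
  have key : ∀ s a b k : ℝ, 0 ≤ s → s ≤ 1 → 0 < a → 0 < b → 0 ≤ k →
      0 < a + (s * (b - a) + k) := by
    intro s a b k hs0 hs1 ha hb hk
    rcases hs0.eq_or_lt with h | h
    · rw [← h]; linarith
    · nlinarith [mul_pos h hb, mul_nonneg (sub_nonneg.2 hs1) ha.le]
  have hm : 0 ≤ deriv Real.smoothTransition (U x - V x) :=
    Real.smoothTransition.monotone.deriv_nonneg
  exact key _ _ _ _ (Real.smoothTransition.nonneg _) (Real.smoothTransition.le_one _)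
    (hVp v hv) (hUp v hv) (mul_nonneg hm (sq_nonneg _))

theorem rlev_const_add {φ : E → ℝ} {x : E} (hφ : ContDiffAt ℝ 2 φ x) (m : ℝ) (v w : E) :
    rlev (fun y => φ y + m) x v w = rlev φ x v w := by
  have h0 : rlev (fun _ : E => m) x v w = 0 := by
    simp [rlev, lev, hess, fderiv_fun_const]
  have := rlev_add hφ (contDiffAt_const (c := m)) v w
  rw [this, h0, add_zero]

theorem del_norm_sq {g : E → ℂ} {x : E} (hg : AnalyticAt ℂ g x) (v : E) :
    del (fun y => ((‖g y‖ ^ 2 : ℝ) : ℂ)) x v = fderiv ℂ g x v * (starRingEnd ℂ) (g x) := by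
  have h0 : (fun y => ((‖g y‖ ^ 2 : ℝ) : ℂ)) = fun y => g y * (starRingEnd ℂ) (g y) := by
    ext y; rw [Complex.mul_conj, Complex.normSq_eq_norm_sq]
  have h1 : DifferentiableAt ℝ g x := hg.hasFDerivAt_real.differentiableAt
  have h2 : DifferentiableAt ℝ (fun y => (starRingEnd ℂ) (g y)) x :=
    (hg.smoothAt (n := 1)).conj.differentiableAt (by simp)
  have h3 := delBar_analytic hg v
  have h4 := del_conj h1 v
  rw [h3, map_zero] at h4
  have h5 : ∀ u, fderiv ℝ (fun y => g y * (starRingEnd ℂ) (g y)) x u =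
      g x * fderiv ℝ (fun y => (starRingEnd ℂ) (g y)) x u +
        (starRingEnd ℂ) (g x) * fderiv ℝ g x u := by
    intro u
    rw [fderiv_fun_mul h1 h2]
    simp
  rw [h0, ← del_analytic hg v, del, h5, h5]
  have h6 : del g x v * (starRingEnd ℂ) (g x) = del g x v * (starRingEnd ℂ) (g x) +
    g x * del (fun y => (starRingEnd ℂ) (g y)) x v := by rw [h4]; ring
  rw [h6, del, del]
  ring

theorem del_add {f g : E → ℂ} {x : E} (hf : DifferentiableAt ℝ f x) (hg : DifferentiableAt ℝ g x)
    (v : E) : del (fun y => f y + g y) x v = del f x v + del g x v := by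
  simp only [del, fderiv_fun_add hf hg, _root_.add_apply]
  ring

end Levi

/-- The squared norm on `ℂ³`. -/
def sqSum (e : ℂ × ℂ × ℂ) : ℝ := ‖e.1‖ ^ 2 + ‖e.2.1‖ ^ 2 + ‖e.2.2‖ ^ 2

theorem analyticAt_coord₁ (e : ℂ × ℂ × ℂ) : AnalyticAt ℂ (fun e : ℂ × ℂ × ℂ => e.1) e :=
  analyticAt_fst
theorem analyticAt_coord₂ (e : ℂ × ℂ × ℂ) : AnalyticAt ℂ (fun e : ℂ × ℂ × ℂ => e.2.1) e :=
  (ContinuousLinearMap.fst ℂ ℂ ℂ ∘L ContinuousLinearMap.snd ℂ ℂ (ℂ × ℂ)).analyticAt e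
theorem analyticAt_coord₃ (e : ℂ × ℂ × ℂ) : AnalyticAt ℂ (fun e : ℂ × ℂ × ℂ => e.2.2) e :=
  (ContinuousLinearMap.snd ℂ ℂ ℂ ∘L ContinuousLinearMap.snd ℂ ℂ (ℂ × ℂ)).analyticAt e

theorem fderiv_coord₁ (e v : ℂ × ℂ × ℂ) : fderiv ℂ (fun e : ℂ × ℂ × ℂ => e.1) e v = v.1 := by
  rw [fderiv_fst]; rfl
theorem fderiv_coord₂ (e v : ℂ × ℂ × ℂ) : fderiv ℂ (fun e : ℂ × ℂ × ℂ => e.2.1) e v = v.2.1 :=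
  congrArg (fun L => L v)
    (ContinuousLinearMap.fst ℂ ℂ ℂ ∘L ContinuousLinearMap.snd ℂ ℂ (ℂ × ℂ)).fderiv
theorem fderiv_coord₃ (e v : ℂ × ℂ × ℂ) : fderiv ℂ (fun e : ℂ × ℂ × ℂ => e.2.2) e v = v.2.2 :=
  congrArg (fun L => L v)
    (ContinuousLinearMap.snd ℂ ℂ ℂ ∘L ContinuousLinearMap.snd ℂ ℂ (ℂ × ℂ)).fderiv

theorem contDiffAt_sqSum (e : ℂ × ℂ × ℂ) {n : ℕ∞ω} : ContDiffAt ℝ n sqSum e :=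
  ((contDiffAt_norm_sq (analyticAt_coord₁ e)).add (contDiffAt_norm_sq (analyticAt_coord₂ e))).add
    (contDiffAt_norm_sq (analyticAt_coord₃ e))

theorem rlev_sqSum (e v w : ℂ × ℂ × ℂ) : rlev sqSum e v w = v.1 * (starRingEnd ℂ) w.1 +
    v.2.1 * (starRingEnd ℂ) w.2.1 + v.2.2 * (starRingEnd ℂ) w.2.2 := by
  have h1 := analyticAt_coord₁ e
  have h2 := analyticAt_coord₂ e
  have h3 := analyticAt_coord₃ e
  have key : rlev sqSum e v w = _ := rlev_add
    ((contDiffAt_norm_sq h1).add (contDiffAt_norm_sq h2)) (contDiffAt_norm_sq h3) v w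
  rw [key, show rlev (fun y : ℂ × ℂ × ℂ => ‖y.1‖ ^ 2 + ‖y.2.1‖ ^ 2) e v w = _ from
    rlev_add (contDiffAt_norm_sq h1) (contDiffAt_norm_sq h2) v w]
  simp only [rlev]
  rw [lev_norm_sq h1, lev_norm_sq h2, lev_norm_sq h3]
  simp only [fderiv_coord₁, fderiv_coord₂, fderiv_coord₃]

theorem rlev_sqSum_self (e v : ℂ × ℂ × ℂ) : rlev sqSum e v v = (sqSum v : ℝ) := by
  rw [rlev_sqSum, Complex.mul_conj', Complex.mul_conj', Complex.mul_conj', sqSum]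
  push_cast; rfl

theorem sqSum_nonneg (v : ℂ × ℂ × ℂ) : 0 ≤ sqSum v := by unfold sqSum; positivity

theorem sqSum_pos {v : ℂ × ℂ × ℂ} (hv : v ≠ 0) : 0 < sqSum v := by
  refine lt_of_le_of_ne (sqSum_nonneg v) fun h => hv ?_
  have h1 := sq_nonneg ‖v.1‖
  have h2 := sq_nonneg ‖v.2.1‖
  have h3 := sq_nonneg ‖v.2.2‖
  rw [sqSum] at h
  have e1 : ‖v.1‖ ^ 2 = 0 := by linarith
  have e2 : ‖v.2.1‖ ^ 2 = 0 := by linarith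
  have e3 : ‖v.2.2‖ ^ 2 = 0 := by linarith
  simp only [ne_eq, OfNat.ofNat_ne_zero, not_false_eq_true, pow_eq_zero_iff, norm_eq_zero] at e1 e2 e3
  exact Prod.ext e1 (Prod.ext e2 e3)

theorem strictPsh_sqSum (e : ℂ × ℂ × ℂ) : StrictPsh sqSum e := fun v hv => by
  rw [rlev_sqSum_self, Complex.ofReal_re]
  exact sqSum_pos hv

/-- In flat space the length of a vector does not depend on its base point, so the Levi form on the
tangent bundle is just |σ|². -/
theorem curvLE_sqSum (e : ℂ × ℂ × ℂ) : CurvLE sqSum e 0 := by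
  intro ξ τ σ
  have h0 : tangentNorm sqSum = fun p => ((sqSum p.2 : ℝ) : ℂ) := by
    funext p
    rw [tangentNorm, rlev_sqSum_self]
  have h1 := lev_comp (f := fun e => ((sqSum e : ℝ) : ℂ)) (ι := Prod.snd) (x := (e, ξ))
    analyticAt_snd (contDiffAt_sqSum ξ).ofReal (τ, σ) (τ, σ)
  rw [h0, h1, fderiv_snd]
  have h2 := rlev_sqSum_self ξ σ
  rw [rlev] at h2
  change _ ≤ (lev (fun e => ((sqSum e : ℝ) : ℂ)) ξ σ σ).re
  rw [h2, Complex.ofReal_re]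
  have := sqSum_nonneg σ
  simpa using this

theorem norm_del_sqSum_le (e v : ℂ × ℂ × ℂ) :
    ‖del (fun y => ((1 + sqSum y : ℝ) : ℂ)) e v‖ ^ 2 ≤ sqSum e * sqSum v := by
  have h1 := analyticAt_coord₁ e
  have h2 := analyticAt_coord₂ e
  have h3 := analyticAt_coord₃ e
  have d1 : DifferentiableAt ℝ (fun y : ℂ × ℂ × ℂ => ((‖y.1‖ ^ 2 : ℝ) : ℂ)) e :=
    (contDiffAt_norm_sq (n := 1) h1).ofReal.differentiableAt (by simp)
  have d2 : DifferentiableAt ℝ (fun y : ℂ × ℂ × ℂ => ((‖y.2.1‖ ^ 2 : ℝ) : ℂ)) e :=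
    (contDiffAt_norm_sq (n := 1) h2).ofReal.differentiableAt (by simp)
  have d3 : DifferentiableAt ℝ (fun y : ℂ × ℂ × ℂ => ((‖y.2.2‖ ^ 2 : ℝ) : ℂ)) e :=
    (contDiffAt_norm_sq (n := 1) h3).ofReal.differentiableAt (by simp)
  have hf : (fun y : ℂ × ℂ × ℂ => ((1 + sqSum y : ℝ) : ℂ)) = fun y => 1 +
      (((‖y.1‖ ^ 2 : ℝ) : ℂ) + ((‖y.2.1‖ ^ 2 : ℝ) : ℂ) + ((‖y.2.2‖ ^ 2 : ℝ) : ℂ)) := by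
    funext y; simp [sqSum]
  have h0 : del (fun y : ℂ × ℂ × ℂ => ((1 + sqSum y : ℝ) : ℂ)) e v =
      v.1 * (starRingEnd ℂ) e.1 + v.2.1 * (starRingEnd ℂ) e.2.1 +
        v.2.2 * (starRingEnd ℂ) e.2.2 := by
    rw [hf, del_add (by fun_prop) ((d1.fun_add d2).fun_add d3), del_add (d1.fun_add d2) d3, del_add d1 d2,
      del_norm_sq h1, del_norm_sq h2, del_norm_sq h3, fderiv_coord₁, fderiv_coord₂, fderiv_coord₃]
    simp [del]
  rw [h0]
  have h4 : ‖v.1 * (starRingEnd ℂ) e.1 + v.2.1 * (starRingEnd ℂ) e.2.1 +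
      v.2.2 * (starRingEnd ℂ) e.2.2‖ ≤ ‖v.1‖ * ‖e.1‖ + ‖v.2.1‖ * ‖e.2.1‖ + ‖v.2.2‖ * ‖e.2.2‖ := by
    refine (norm_add₃_le).trans (le_of_eq ?_)
    simp
  refine (pow_le_pow_left₀ (norm_nonneg _) h4 2).trans ?_
  unfold sqSum
  nlinarith [sq_nonneg (‖v.1‖ * ‖e.2.1‖ - ‖v.2.1‖ * ‖e.1‖),
    sq_nonneg (‖v.1‖ * ‖e.2.2‖ - ‖v.2.2‖ * ‖e.1‖),
    sq_nonneg (‖v.2.1‖ * ‖e.2.2‖ - ‖v.2.2‖ * ‖e.2.1‖)]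

/-- The potential of the Fubini-Study metric. -/
def logSum (e : ℂ × ℂ × ℂ) : ℝ := Real.log (1 + sqSum e)

theorem contDiffAt_logSum (e : ℂ × ℂ × ℂ) {n : ℕ∞ω} : ContDiffAt ℝ n logSum e :=
  (contDiffAt_const.add (contDiffAt_sqSum e)).log (by have := sqSum_nonneg e; positivity)

/-- With S the squared norm, Cauchy–Schwarz gives |∂S(v)|² ≤ S |v|², which bounds the Levi form of
log(1 + S) below by |v|²/(1 + S)². -/
theorem strictPsh_logSum (e : ℂ × ℂ × ℂ) : StrictPsh logSum e := by
  intro v hv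
  have hs := sqSum_nonneg e
  have hs1 : 0 < 1 + sqSum e := by linarith
  have hc : ContDiffAt ℝ 2 (fun y => 1 + sqSum y) e := contDiffAt_const.add (contDiffAt_sqSum e)
  have h1 : (rlev logSum e v v).re = _ := rlev_comp_real_self hc
    (Real.contDiffAt_log.2 hs1.ne') v
  have h2 : rlev (fun y => 1 + sqSum y) e v v = (sqSum v : ℝ) := by
    rw [← rlev_sqSum_self e v, ← rlev_const_add (contDiffAt_sqSum e) 1]
    simp only [add_comm]
  have h3 : deriv (deriv Real.log) (1 + sqSum e) = -((1 + sqSum e) ^ 2)⁻¹ := by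
    rw [Real.deriv_log', deriv_inv]
  rw [h1, h2, h3, Real.deriv_log, Complex.ofReal_re]
  have h4 := norm_del_sqSum_le e v
  have h5 := sqSum_pos hv
  have h6 : ((1 + sqSum e) ^ 2)⁻¹ * ‖del (fun y => ((1 + sqSum y : ℝ) : ℂ)) e v‖ ^ 2 ≤
      ((1 + sqSum e) ^ 2)⁻¹ * (sqSum e * sqSum v) := by gcongr
  have h7 : (1 + sqSum e)⁻¹ * sqSum v - ((1 + sqSum e) ^ 2)⁻¹ * (sqSum e * sqSum v) =
      ((1 + sqSum e) ^ 2)⁻¹ * sqSum v := by field_simp; ring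
  have h8 : 0 < ((1 + sqSum e) ^ 2)⁻¹ * sqSum v := by positivity
  linarith

theorem plane_norm_sq (x : Plane) : ‖x‖ ^ 2 = ‖x 0‖ ^ 2 + ‖x 1‖ ^ 2 := by
  rw [EuclideanSpace.norm_sq_eq, Fin.sum_univ_two]

/-- The embedding of the plane into `ℂ³` as the graph of `f`. -/
def graph₃ (f : Plane → ℂ) (x : Plane) : ℂ × ℂ × ℂ := (x 0, x 1, f x)

theorem analyticAt_graph₃ {f : Plane → ℂ} {x : Plane} (hf : AnalyticAt ℂ f x) :
    AnalyticAt ℂ (graph₃ f) x :=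
  ((EuclideanSpace.proj 0 : Plane →L[ℂ] ℂ).analyticAt x).prod
    (((EuclideanSpace.proj 1 : Plane →L[ℂ] ℂ).analyticAt x).prod hf)

theorem fderiv_graph₃ {f : Plane → ℂ} {x : Plane} (hf : AnalyticAt ℂ f x) (v : Plane) :
    fderiv ℂ (graph₃ f) x v = (v 0, v 1, fderiv ℂ f x v) := by
  have h : HasFDerivAt (graph₃ f) ((EuclideanSpace.proj 0 : Plane →L[ℂ] ℂ).prod
      ((EuclideanSpace.proj 1 : Plane →L[ℂ] ℂ).prod (fderiv ℂ f x))) x :=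
    (EuclideanSpace.proj 0 : Plane →L[ℂ] ℂ).hasFDerivAt.prodMk
      ((EuclideanSpace.proj 1 : Plane →L[ℂ] ℂ).hasFDerivAt.prodMk
        hf.differentiableAt.hasFDerivAt)
  rw [h.fderiv]; rfl

theorem fderiv_graph₃_injective {f : Plane → ℂ} {x : Plane} (hf : AnalyticAt ℂ f x) (v : Plane)
    (h : fderiv ℂ (graph₃ f) x v = 0) : v = 0 := by
  rw [fderiv_graph₃ hf] at h
  rw [plane_eq v, (Prod.mk.inj h).1, (Prod.mk.inj (Prod.mk.inj h).2).1]
  simp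

/-- A potential defined in the interior, as a function of the point and of `|f|^{2β}`. -/
def basePot (m : ℝ) (p : Plane × ℝ) : ℝ := Real.log (1 + ‖p.1‖ ^ 2 + p.2) + m

theorem contDiffAt_basePot (m : ℝ) {p : Plane × ℝ} (hp : 0 ≤ p.2) {n : ℕ∞ω} :
    ContDiffAt ℝ n (basePot m) p := by
  refine ContDiffAt.add (ContDiffAt.log ?_ (by positivity)) contDiffAt_const
  exact (contDiffAt_const.add (contDiffAt_fst.norm_sq ℝ)).add contDiffAt_snd

theorem basePot_eq (m : ℝ) (x : Plane) (a : ℂ) :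
    basePot m (x, ‖a‖ ^ 2) = logSum (x 0, x 1, a) + m := by
  simp only [basePot, logSum, sqSum, plane_norm_sq]
  congr 2; ring

/-- Up to a constant this is the Fubini–Study potential pulled back by the graph of f, which is an
immersion. Taking for f a branch of P^β gives the interior cone potential. -/
theorem strictPsh_logSum_graph {f : Plane → ℂ} {x : Plane} (hf : AnalyticAt ℂ f x) (m : ℝ) :
    StrictPsh (fun y => basePot m (y, ‖f y‖ ^ 2)) x := by
  have h1 : StrictPsh (fun y => logSum (graph₃ f y)) x :=
    strictPsh_of_pullback Filter.EventuallyEq.rfl (analyticAt_graph₃ hf) (contDiffAt_logSum _)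
      (strictPsh_logSum _) (fderiv_graph₃_injective hf)
  have h2 : ContDiffAt ℝ 2 (fun y => logSum (graph₃ f y)) x :=
    ContDiffAt.comp x (g := logSum) (contDiffAt_logSum _) (analyticAt_graph₃ hf).smoothAt
  intro v hv
  have h3 : (fun y => basePot m (y, ‖f y‖ ^ 2)) = fun y => logSum (graph₃ f y) + m := by
    funext y; exact basePot_eq m y (f y)
  rw [h3, rlev_const_add h2]
  exact h1 v hv

theorem strictPsh_basePot_zero (m : ℝ) (x : Plane) : StrictPsh (fun y => basePot m (y, 0)) x := by
  simpa using strictPsh_logSum_graph (f := fun _ => 0) (x := x) analyticAt_const m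

theorem strictPsh_basePot {f : Plane → ℂ} {x : Plane} (hf : AnalyticAt ℂ f x) (h0 : f x ≠ 0)
    (β m : ℝ) : StrictPsh (fun y => basePot m (y, ‖f y‖ ^ (2 * β))) x := by
  obtain ⟨g, hg, -, hgf, -⟩ := exists_branch hf h0 β
  have h1 := strictPsh_logSum_graph hg m
  have h2 : (fun y => basePot m (y, ‖f y‖ ^ (2 * β))) =ᶠ[𝓝 x]
      fun y => basePot m (y, ‖g y‖ ^ 2) := by
    filter_upwards [hgf] with y hy
    rw [hy, ← Real.rpow_natCast, ← Real.rpow_mul (norm_nonneg _)]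
    congr 3
    push_cast; ring
  intro v hv
  rw [rlev_eventuallyEq h2]
  exact h1 v hv

theorem fderiv_basePot_pos (m : ℝ) (x : Plane) : 0 < fderiv ℝ (basePot m) (x, 0) (0, 1) := by
  have h1 : HasFDerivAt (basePot m) (fderiv ℝ (basePot m) (x, 0)) (x, 0) :=
    ((contDiffAt_basePot m (p := (x, 0)) le_rfl (n := 1)).differentiableAt (by simp)).hasFDerivAt
  have h2 : HasDerivAt (fun t : ℝ => (x, t)) ((0 : Plane), (1 : ℝ)) 0 :=
    (hasDerivAt_const _ _).prodMk (hasDerivAt_id _)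
  have h3 := h1.comp_hasDerivAt (0 : ℝ) h2
  have h4 : HasDerivAt (basePot m ∘ fun t => (x, t)) (1 / (1 + ‖x‖ ^ 2 + 0)) 0 :=
    (((hasDerivAt_id (0 : ℝ)).const_add (1 + ‖x‖ ^ 2)).log (by simp; positivity)).add_const m
  rw [h3.unique h4]
  positivity

end

/-! ### The potential near infinity and its expansion at the curve -/

section

theorem eventually_norm_lt {x : Plane} {R : ℝ} (hx : R < ‖x‖) : ∀ᶠ y in 𝓝 x, R < ‖y‖ :=
  continuous_norm.continuousAt.eventually (lt_mem_nhds hx)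

namespace Straightening

variable {d : ℕ} {A : AsymCurve d} (S : Straightening A)

/-- The part near a line of the region where the curve is straightened. -/
def near (k : Fin d) : Set Plane :=
  {x | S.R < ‖x‖ ∧ 4 * A.M * ‖wedge (A.ℓ k) x‖ ^ 2 < ‖x‖ ^ 2}

theorem isOpen_near (k : Fin d) : IsOpen (S.near k) := by
  have h1 : Continuous fun y : Plane => ‖y‖ ^ 2 := by fun_prop
  have h2 : Continuous fun y : Plane => 4 * A.M * ‖wedge (A.ℓ k) y‖ ^ 2 :=
    continuous_const.mul ((continuous_wedge _).norm.pow 2)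
  exact (isOpen_lt continuous_const continuous_norm).inter (isOpen_lt h2 h1)

theorem near_subset_inner {k : Fin d} {x : Plane} (hx : x ∈ S.near k) : x ∈ A.inner k := by
  change A.M * ‖wedge (A.ℓ k) x‖ ^ 2 < ‖x‖ ^ 2
  have h1 := A.M_pos
  have h2 := hx.2
  nlinarith [mul_nonneg h1.le (sq_nonneg ‖wedge (A.ℓ k) x‖)]

theorem H_mem_inner {k : Fin d} {x : Plane} (hx : x ∈ S.near k) : S.H x ∈ A.inner k :=
  S.mem_inner x k hx.1 hx.2

theorem contDiff_H : ContDiff ℝ ∞ S.H := contMDiff_iff_contDiff.1 S.H.contMDiff_toFun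

theorem contDiff_H_symm : ContDiff ℝ ∞ S.H.symm := contMDiff_iff_contDiff.1 S.H.symm.contMDiff_toFun

theorem hasFDerivAt_H (x : Plane) : HasFDerivAt S.H (fderiv ℝ S.H x) x :=
  (S.contDiff_H.differentiable (by simp) x).hasFDerivAt

theorem norm_le_fderiv_H (x v : Plane) : ‖v‖ ≤ 2 * ‖fderiv ℝ S.H x v‖ := by
  have h1 := (fderiv ℝ S.H x - ContinuousLinearMap.id ℝ Plane).le_of_opNorm_le
    (S.norm_fderiv_sub_le x) v
  have h2 : ‖v‖ ≤ ‖fderiv ℝ S.H x v‖ + ‖(fderiv ℝ S.H x - ContinuousLinearMap.id ℝ Plane) v‖ := by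
    have := norm_sub_le (fderiv ℝ S.H x v) ((fderiv ℝ S.H x - ContinuousLinearMap.id ℝ Plane) v)
    simpa using this
  linarith

theorem fderiv_H_symm (y v : Plane) :
    fderiv ℝ S.H (S.H.symm y) (fderiv ℝ S.H.symm y v) = v := by
  have h1 : HasFDerivAt S.H.symm (fderiv ℝ S.H.symm y) y :=
    (S.contDiff_H_symm.differentiable (by simp) y).hasFDerivAt
  have h2 := (S.hasFDerivAt_H (S.H.symm y)).comp y h1
  have h3 : (S.H ∘ S.H.symm : Plane → Plane) = id := funext fun y => S.H.apply_symm_apply y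
  rw [h3] at h2
  exact congrArg (fun L => L v) (h2.unique (hasFDerivAt_id y))

theorem wedge_H {k : Fin d} {x : Plane} (hx : x ∈ S.near k) :
    wedge (A.ℓ k) (S.H x) = A.eqn x / A.cofactor k x ∧
      wedge (S.H x) (A.e k) = wedge x (A.e k) := by
  rw [S.eq_shift x hx.1]
  exact A.wedge_add_shift (S.near_subset_inner hx)

/-- In the cone around a line one cutoff is 1 and the others are 0, so H is the identity plus a
quotient of polynomials. -/
theorem analyticAt_H {k : Fin d} {x : Plane} (hx : x ∈ S.near k) : AnalyticAt ℂ S.H x := by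
  have hc := (A.cone_of_mem_inner (S.near_subset_inner hx)).1
  have h1 : AnalyticAt ℂ (fun y : Plane => A.low (1, y)) x :=
    AnalyticAt.fun_comp (g := A.low) (f := fun y : Plane => ((1 : ℂ), y))
      (A.analyticAt_low _) (analyticAt_const.prod analyticAt_id)
  have h2 : AnalyticAt ℂ (fun y => y + (A.low (1, y) / A.cofactor k y) • A.e k) x :=
    analyticAt_id.add ((h1.div (A.analyticAt_cofactor k x) hc).smul analyticAt_const)
  refine h2.congr ?_
  filter_upwards [(S.isOpen_near k).mem_nhds hx] with y hy
  rw [S.eq_shift y hy.1, A.shift_of_mem_inner (p := (1, y)) (S.near_subset_inner hy)]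

theorem fderiv_H {k : Fin d} {x : Plane} (hx : x ∈ S.near k) (v : Plane) :
    fderiv ℂ S.H x v = fderiv ℝ S.H x v := by
  rw [(S.analyticAt_H hx).fderiv_real]; rfl

theorem fderiv_H_injective {k : Fin d} {x : Plane} (hx : x ∈ S.near k) {v : Plane}
    (h : fderiv ℂ S.H x v = 0) : v = 0 := by
  have := S.norm_le_fderiv_H x v
  rw [← S.fderiv_H hx, h, norm_zero, mul_zero] at this
  exact norm_le_zero_iff.1 this

theorem H_mem_offLines {k : Fin d} {x : Plane} (hx : x ∈ S.near k) (h0 : A.eqn x ≠ 0) :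
    S.H x ∈ offLines A.ℓ := by
  intro j
  by_cases hj : j = k
  · rw [hj, (S.wedge_H hx).1]
    exact div_ne_zero h0 (A.cone_of_mem_inner (S.near_subset_inner hx)).1
  · exact (A.cone_of_mem_inner (S.H_mem_inner hx)).2.2 j hj

/-- The potential near infinity. -/
def outer (c : ℝ) (F : Plane → ℝ) (x : Plane) : ℝ := F (S.H x) + A.transv c (S.H x)

variable {β c : ℝ} {F : Plane → ℝ}

theorem contDiffAt_outer (hF : FlatModel β c A.ℓ F) {x : Plane} (hx : S.H x ∈ offLines A.ℓ) :
    ContDiffAt ℝ ∞ (S.outer c F) x := by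
  have h0 : S.H x ≠ 0 := ne_zero_of_mem_offLines (by have := A.two_le; omega) hx
  have h1 : ContDiffAt ℝ ∞ F (S.H x) := hF.contDiffAt hx
  exact (h1.comp x S.contDiff_H.contDiffAt).add
    ((A.contDiffAt_transv c h0).comp x S.contDiff_H.contDiffAt)

/-- Near the curve at infinity, `transv` is the squared norm of a holomorphic function. -/
theorem exists_transv_root (c : ℝ) {k : Fin d} {x : Plane} (hx : x ∈ S.near k) :
    ∃ g : Plane → ℂ, AnalyticAt ℂ g x ∧ g x ≠ 0 ∧
      ∀ᶠ y in 𝓝 x, A.transv c (S.H y) = ‖g y * wedge (A.ℓ k) (S.H y)‖ ^ 2 := by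
  have hw := (A.cone_of_mem_inner (S.near_subset_inner hx)).2.1
  obtain ⟨g, hg, hg0, hgn, -⟩ := exists_branch (analyticAt_wedge_left (A.e k) x) hw ((c - 3) / 2)
  refine ⟨g, hg, hg0, ?_⟩
  filter_upwards [hgn, (S.isOpen_near k).mem_nhds hx] with y hy hyn
  rw [A.transv_of_mem_inner (S.H_mem_inner hyn), (S.wedge_H hyn).2, norm_mul, mul_pow, hy,
    ← Real.rpow_natCast (‖wedge y (A.e k)‖ ^ ((c - 3) / 2)), ← Real.rpow_mul (norm_nonneg _)]
  congr 2
  push_cast; ring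

theorem analyticAt_wedge_H {k : Fin d} {x : Plane} (hx : x ∈ S.near k) :
    AnalyticAt ℂ (fun y => wedge (A.ℓ k) (S.H y)) x :=
  AnalyticAt.fun_comp (g := wedge (A.ℓ k)) (analyticAt_wedge _ _) (S.analyticAt_H hx)

theorem fderiv_comp_H {k : Fin d} {x : Plane} (hx : x ∈ S.near k) {W : Plane → ℂ}
    (hW : AnalyticAt ℂ W (S.H x)) (v : Plane) :
    fderiv ℂ (fun y => W (S.H y)) x v = fderiv ℂ W (S.H x) (fderiv ℂ S.H x v) := by
  have := hW.differentiableAt.hasFDerivAt.comp x (S.analyticAt_H hx).differentiableAt.hasFDerivAt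
  rw [HasFDerivAt.fderiv (f := fun y => W (S.H y)) this]; rfl

/-- Near the curve at infinity, the potential is the pull-back of the squared norm by a holomorphic
immersion. -/
theorem exists_outer_eq_sqSum (hF : FlatModel β c A.ℓ F) {k : Fin d} {x : Plane}
    (hx : x ∈ S.near k) (h0 : A.eqn x ≠ 0) :
    ∃ ι : Plane → ℂ × ℂ × ℂ, AnalyticAt ℂ ι x ∧
      (S.outer c F =ᶠ[𝓝 x] fun y => sqSum (ι y)) ∧ ∀ v, fderiv ℂ ι x v = 0 → v = 0 := by
  obtain ⟨W, Z, hW, hZ, -, hWZ, hinj⟩ := hF.off (S.H x) (S.H_mem_offLines hx h0)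
  obtain ⟨g, hg, -, hgT⟩ := S.exists_transv_root c hx
  have hH := S.analyticAt_H hx
  have aW : AnalyticAt ℂ (fun y => W (S.H y)) x := AnalyticAt.fun_comp (g := W) hW hH
  have aZ : AnalyticAt ℂ (fun y => Z (S.H y)) x := AnalyticAt.fun_comp (g := Z) hZ hH
  have aT : AnalyticAt ℂ (fun y => g y * wedge (A.ℓ k) (S.H y)) x :=
    hg.mul (S.analyticAt_wedge_H hx)
  -- The three squares of the potential are the squared coordinates of this map; its first two
  -- components already form an immersion.
  refine ⟨fun y => (W (S.H y), Z (S.H y), g y * wedge (A.ℓ k) (S.H y)), aW.prod (aZ.prod aT), ?_,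
    fun v hv => ?_⟩
  · filter_upwards [hgT, hH.continuousAt.eventually hWZ] with y h1 h2
    rw [outer, h1, h2, sqSum]
  · have hd : HasFDerivAt (fun y => (W (S.H y), Z (S.H y), g y * wedge (A.ℓ k) (S.H y))) _ x :=
      aW.differentiableAt.hasFDerivAt.prodMk
        (aZ.differentiableAt.hasFDerivAt.prodMk aT.differentiableAt.hasFDerivAt)
    rw [hd.fderiv] at hv
    have h1 : fderiv ℂ (fun y => W (S.H y)) x v = 0 := congrArg Prod.fst hv
    have h2 : fderiv ℂ (fun y => Z (S.H y)) x v = 0 := congrArg (fun q => q.2.1) hv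
    rw [S.fderiv_comp_H hx hW] at h1
    rw [S.fderiv_comp_H hx hZ] at h2
    exact S.fderiv_H_injective hx (hinj _ h1 h2)

theorem strictPsh_outer_near (hF : FlatModel β c A.ℓ F) {k : Fin d} {x : Plane}
    (hx : x ∈ S.near k) (h0 : A.eqn x ≠ 0) : StrictPsh (S.outer c F) x := by
  obtain ⟨ι, hι, h, hinj⟩ := S.exists_outer_eq_sqSum hF hx h0
  exact strictPsh_of_pullback h hι (contDiffAt_sqSum _) (strictPsh_sqSum _) hinj

/-- The metric is induced from flat ℂ³ by a holomorphic immersion. This makes the bound uniform on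
an unbounded set that also accumulates at the curve, where compactness would not help. -/
theorem bisec_le_near_infinity (hF : FlatModel β c A.ℓ F) {k : Fin d} {x : Plane}
    (hx : x ∈ S.near k) (h0 : A.eqn x ≠ 0) {φ : Plane → ℝ} {m : ℝ} {κ : Plane → TwoForm}
    (hφ : φ =ᶠ[𝓝 x] fun y => S.outer c F y + m)
    (hκ : κ =ᶠ[𝓝 x] fun y => (1 / 2 : ℝ) • iddbar φ y) {v w : Plane}
    (hv : hermNormSq (κ x) v = 1) (hw : hermNormSq (κ x) w = 1) : bisec κ x v w ≤ 0 := by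
  obtain ⟨ι, hι, h, hinj⟩ := S.exists_outer_eq_sqSum hF hx h0
  have h1 : φ =ᶠ[𝓝 x] fun y => 1 * sqSum (ι y) + m := by
    filter_upwards [hφ, h] with y h1 h2
    rw [h1, h2, one_mul]
  have hpsh : StrictPsh φ x := by
    intro v hv
    rw [rlev_eventuallyEq hφ, rlev_const_add (S.contDiffAt_outer hF (S.H_mem_offLines hx h0)
      |>.of_le two_le_infty)]
    exact S.strictPsh_outer_near hF hx h0 v hv
  have := bisec_le_of_pullback hκ h1 hι (contDiffAt_sqSum _) hpsh (curvLE_sqSum _) le_rfl le_rfl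
    v w hv hw
  simpa using this

/-- The expansion of the potential at a point of the curve near infinity. -/
theorem exists_outer_expansion (hF : FlatModel β c A.ℓ F) {k : Fin d} {p : Plane}
    (hp : p ∈ S.near k) (h0 : A.eqn p = 0) :
    ∃ U V : Plane → ℝ, ContDiffAt ℝ ∞ U p ∧ ContDiffAt ℝ ∞ V p ∧ StrictPsh U p ∧ 0 < V p ∧
      ∀ᶠ x in 𝓝 p, A.eqn x ≠ 0 → S.outer c F x = U x + V x * ‖A.eqn x‖ ^ (2 * β) := by
  have hcone := A.cone_of_mem_inner (S.near_subset_inner hp)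
  have hw0 : wedge (A.ℓ k) (S.H p) = 0 := by rw [(S.wedge_H hp).1, h0, zero_div]
  have hq : S.H p ≠ 0 := A.ne_zero_of_mem_inner (S.H_mem_inner hp)
  obtain ⟨W, b, hW, hb, hW0, hb0, hWb, hinj⟩ := hF.on k (S.H p) hq hw0
  obtain ⟨g, hg, hg0, hgT⟩ := S.exists_transv_root c hp
  have hH := S.analyticAt_H hp
  have aW : AnalyticAt ℂ (fun y => W (S.H y)) p := AnalyticAt.fun_comp (g := W) hW hH
  have ab : AnalyticAt ℂ (fun y => b (S.H y)) p := AnalyticAt.fun_comp (g := b) hb hH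
  have aw := S.analyticAt_wedge_H hp
  have aT : AnalyticAt ℂ (fun y => g y * wedge (A.ℓ k) (S.H y)) p := hg.mul aw
  -- The square of g w is the transversal correction: without it the slice potential |W|² would have
  -- a Levi form of rank one. At p the derivative of g w is g dw, and dW, dw have no common kernel.
  -- The factor of |P|^{2β} comes from w(H y) = P/cofactor.
  refine ⟨fun y => ‖W (S.H y)‖ ^ 2 + ‖g y * wedge (A.ℓ k) (S.H y)‖ ^ 2,
    fun y => ‖b (S.H y)‖ ^ 2 * ‖A.cofactor k y‖ ^ (-(2 * β)),
    (contDiffAt_norm_sq aW).add (contDiffAt_norm_sq aT),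
    (contDiffAt_norm_sq ab).mul ?_, ?_, ?_, ?_⟩
  · exact ((A.analyticAt_cofactor k p).smoothAt.norm ℝ hcone.1).rpow_const_of_ne
      (norm_ne_zero_iff.2 hcone.1)
  · intro v hv
    rw [rlev_sum_sq aW aT (Filter.Eventually.of_forall fun _ => rfl)]
    by_contra! hle
    have h1 : fderiv ℂ (fun y => W (S.H y)) p v = 0 := by
      have : ‖fderiv ℂ (fun y => W (S.H y)) p v‖ ^ 2 ≤ 0 := by
        nlinarith [sq_nonneg ‖fderiv ℂ (fun y => g y * wedge (A.ℓ k) (S.H y)) p v‖]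
      exact norm_eq_zero.1 (pow_eq_zero_iff two_ne_zero |>.1 (le_antisymm this (sq_nonneg _)))
    have h2 : fderiv ℂ (fun y => g y * wedge (A.ℓ k) (S.H y)) p v = 0 := by
      have : ‖fderiv ℂ (fun y => g y * wedge (A.ℓ k) (S.H y)) p v‖ ^ 2 ≤ 0 := by
        nlinarith [sq_nonneg ‖fderiv ℂ (fun y => W (S.H y)) p v‖]
      exact norm_eq_zero.1 (pow_eq_zero_iff two_ne_zero |>.1 (le_antisymm this (sq_nonneg _)))
    rw [fderiv_fun_mul hg.differentiableAt aw.differentiableAt] at h2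
    simp only [_root_.add_apply, _root_.smul_apply, smul_eq_mul, hw0, zero_mul, add_zero,
      mul_eq_zero, hg0, false_or] at h2
    rw [S.fderiv_comp_H hp hW] at h1
    rw [S.fderiv_comp_H hp (analyticAt_wedge _ _), fderiv_wedge] at h2
    exact hv (S.fderiv_H_injective hp (hinj _ h1 h2))
  · have h1 : 0 < ‖b (S.H p)‖ := norm_pos_iff.2 hb0
    have h2 : 0 < ‖A.cofactor k p‖ := norm_pos_iff.2 hcone.1
    positivity
  · filter_upwards [hgT, hH.continuousAt.eventually hWb, (S.isOpen_near k).mem_nhds hp]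
      with y h1 h2 h3 h4
    have hc := (A.cone_of_mem_inner (S.near_subset_inner h3)).1
    have hw := (S.wedge_H h3).1
    have h5 : ‖wedge (A.ℓ k) (S.H y)‖ ^ (2 * β) =
        ‖A.cofactor k y‖ ^ (-(2 * β)) * ‖A.eqn y‖ ^ (2 * β) := by
      rw [hw, norm_div, Real.div_rpow (norm_nonneg _) (norm_nonneg _),
        Real.rpow_neg (norm_nonneg _), div_eq_inv_mul]
    rw [outer, h1, h2 (by rw [hw]; exact div_ne_zero h4 hc), h5]
    ring

/-- A function of the point and of `|f|^{2β}` which describes the glued potential at the curve. -/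
def gluedModel (m : ℝ) (U V : Plane → ℝ) (q : Plane × ℝ) : ℝ :=
  glue (basePot m) (fun q => U q.1 + V q.1 * q.2) q

theorem contDiffAt_gluedModel (m : ℝ) {U V : Plane → ℝ} {p : Plane} (hU : ContDiffAt ℝ ∞ U p)
    (hV : ContDiffAt ℝ ∞ V p) : ContDiffAt ℝ ∞ (gluedModel m U V) (p, 0) := by
  have h1 : ContDiffAt ℝ ∞ (fun q : Plane × ℝ => U q.1 + V q.1 * q.2) (p, 0) :=
    (ContDiffAt.comp (p, (0 : ℝ)) (g := U) hU contDiffAt_fst).add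
      ((ContDiffAt.comp (p, (0 : ℝ)) (g := V) hV contDiffAt_fst).mul contDiffAt_snd)
  exact contDiffAt_glue (n := ⊤) (contDiffAt_basePot m (p := (p, 0)) le_rfl) h1

theorem strictPsh_gluedModel (m : ℝ) {U : Plane → ℝ} (V : Plane → ℝ) {p : Plane}
    (hU : ContDiffAt ℝ ∞ U p) (hpsh : StrictPsh U p) :
    StrictPsh (fun y => gluedModel m U V (y, 0)) p := by
  have h1 : (fun y => gluedModel m U V (y, 0)) = glue (fun y => basePot m (y, 0)) U := by
    funext y; simp [gluedModel, glue]
  rw [h1]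
  refine strictPsh_glue ?_ (hU.of_le two_le_infty) (strictPsh_basePot_zero m p) hpsh
  exact ContDiffAt.comp p (g := basePot m) (f := fun y : Plane => (y, (0 : ℝ)))
    (contDiffAt_basePot m (p := (p, 0)) le_rfl)
    (contDiffAt_id.prodMk contDiffAt_const)

/-- The derivative is a convex combination, with weight the slope of the ramp, of V(p) and the
positive derivative of the interior potential. -/
theorem fderiv_gluedModel_pos (m : ℝ) {U V : Plane → ℝ} {p : Plane} (hU : ContDiffAt ℝ ∞ U p)
    (hV : ContDiffAt ℝ ∞ V p) (hpos : 0 < V p) :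
    0 < fderiv ℝ (gluedModel m U V) (p, 0) (0, 1) := by
  have h1 : HasFDerivAt (gluedModel m U V) (fderiv ℝ (gluedModel m U V) (p, 0)) (p, 0) :=
    ((contDiffAt_gluedModel m hU hV).differentiableAt (by simp)).hasFDerivAt
  have h2 : HasDerivAt (fun t : ℝ => (p, t)) ((0 : Plane), (1 : ℝ)) 0 :=
    (hasDerivAt_const _ _).prodMk (hasDerivAt_id _)
  have h3 := h1.comp_hasDerivAt (0 : ℝ) h2
  have h4 : HasFDerivAt (basePot m) (fderiv ℝ (basePot m) (p, 0)) (p, 0) :=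
    ((contDiffAt_basePot m (p := (p, 0)) le_rfl (n := 1)).differentiableAt (by simp)).hasFDerivAt
  have h5 := h4.comp_hasDerivAt (0 : ℝ) h2
  have h6 : HasDerivAt (fun t : ℝ => U p + V p * t) (V p) 0 := by
    simpa using ((hasDerivAt_id (0 : ℝ)).const_mul (V p)).const_add (U p)
  have h7 := h5.add ((hasDerivAt_ramp _).comp (0 : ℝ) (h6.sub h5))
  have h8 := h3.unique h7
  rw [h8]
  have h9 := fderiv_basePot_pos m p
  have hs0 := Real.smoothTransition.nonneg
    (((fun t : ℝ => U p + V p * t) - basePot m ∘ fun t => (p, t)) 0)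
  have hs1 := Real.smoothTransition.le_one
    (((fun t : ℝ => U p + V p * t) - basePot m ∘ fun t => (p, t)) 0)
  rcases hs0.eq_or_lt with h | h
  · rw [← h]; linarith
  · nlinarith [mul_pos h hpos, mul_nonneg (sub_nonneg.2 hs1) h9.le]

end Straightening

end

/-! ### The rescaled potential as a smooth family down to parameter zero -/

section

/-- Compactness for a property that is local in both variables and monotone in the constant:
finitely many local constants are replaced by their maximum. -/
theorem exists_uniform_bound {X Y : Type*} [TopologicalSpace X] [TopologicalSpace Y]
    {K : Set Y} (hK : IsCompact K) {x₀ : X} {p : ℝ → X × Y → Prop}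
    (hmono : ∀ B B' q, B ≤ B' → p B q → p B' q)
    (h : ∀ y ∈ K, ∃ B, ∀ᶠ q in 𝓝 (x₀, y), p B q) :
    ∃ B, ∀ᶠ x in 𝓝 x₀, ∀ y ∈ K, p B (x, y) := by
  refine hK.induction_on (p := fun s => ∃ B, ∀ᶠ x in 𝓝 x₀, ∀ y ∈ s, p B (x, y))
    ⟨0, by simp⟩ ?_ ?_ ?_
  · rintro s t hst ⟨B, hB⟩
    exact ⟨B, hB.mono fun x hx y hy => hx y (hst hy)⟩
  · rintro s t ⟨B, hB⟩ ⟨B', hB'⟩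
    refine ⟨max B B', ?_⟩
    filter_upwards [hB, hB'] with x h1 h2 y hy
    rcases hy with hy | hy
    · exact hmono _ _ _ (le_max_left _ _) (h1 y hy)
    · exact hmono _ _ _ (le_max_right _ _) (h2 y hy)
  · intro y hy
    obtain ⟨B, hB⟩ := h y hy
    rw [nhds_prod_eq, Filter.eventually_prod_iff] at hB
    obtain ⟨pa, ha, pb, hb, hab⟩ := hB
    exact ⟨{y | pb y}, mem_nhdsWithin_of_mem_nhds hb, B, ha.mono fun x hx y hy => hab hx hy⟩

section Slices

variable {φ : ℂ × Plane → ℝ} {ε : ℂ} {y : Plane}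

theorem analyticAt_slice (ε : ℂ) (y : Plane) : AnalyticAt ℂ (fun z : Plane => (ε, z)) y :=
  analyticAt_const.prod analyticAt_id

theorem fderiv_slice (ε : ℂ) (y v : Plane) :
    fderiv ℂ (fun z : Plane => (ε, z)) y v = (0, v) := by
  have h : HasFDerivAt (fun z : Plane => (ε, z)) _ y :=
    (hasFDerivAt_const ε y).prodMk (hasFDerivAt_id (𝕜 := ℂ) y)
  rw [h.fderiv]; rfl

theorem rlev_slice (hφ : ContDiffAt ℝ 2 φ (ε, y)) (v w : Plane) :
    rlev (fun z => φ (ε, z)) y v w = rlev φ (ε, y) (0, v) (0, w) := by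
  have := lev_comp (f := fun q => (φ q : ℂ)) (analyticAt_slice ε y) hφ.ofReal v w
  rw [fderiv_slice, fderiv_slice] at this
  exact this

/-- A function which is strictly plurisubharmonic on a slice becomes strictly plurisubharmonic
after adding a multiple of the squared norm of the parameter. -/
theorem exists_strictPsh_add (hφ : ContDiffAt ℝ 2 φ (ε, y))
    (h : StrictPsh (fun z => φ (ε, z)) y) :
    ∃ K : ℝ, StrictPsh (fun q => φ q + K * ‖q.1‖ ^ 2) (ε, y) := by
  have hs : ContDiffAt ℝ 2 (fun z => φ (ε, z)) y :=
    ContDiffAt.comp y (g := φ) hφ (analyticAt_slice ε y).smoothAt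
  obtain ⟨a, ha, hab⟩ := h.eventually_bound hs
  have hb := hab.self_of_nhds
  set C := ‖fderiv ℝ (fderiv ℝ fun q => (φ q : ℂ)) (ε, y)‖ with hC
  have hC0 : 0 ≤ C := by positivity
  -- The terms C and C²/a absorb the parameter direction and, after completing the square, the mixed
  -- terms; the summand 1 makes the inequality strict when the parameter component is nonzero.
  refine ⟨C + C ^ 2 / a + 1, fun q hq => ?_⟩
  set K := C + C ^ 2 / a + 1 with hK
  obtain ⟨e, v⟩ := q
  have hn : ContDiffAt ℝ 2 (fun q : ℂ × Plane => ‖q.1‖ ^ 2) (ε, y) :=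
    contDiffAt_norm_sq (E := ℂ × Plane) (g := fun q => q.1) analyticAt_fst
  have hkn : ContDiffAt ℝ 2 (fun q : ℂ × Plane => K * ‖q.1‖ ^ 2) (ε, y) := contDiffAt_const.mul hn
  have e1 : (rlev (fun q : ℂ × Plane => ‖q.1‖ ^ 2) (ε, y) (e, v) (e, v)).re = ‖e‖ ^ 2 := by
    rw [rlev_norm_sq (g := fun q : ℂ × Plane => q.1) analyticAt_fst, fderiv_fst]
    rfl
  rw [rlev_add hφ hkn, rlev_const_mul hn, Complex.add_re, Complex.re_ofReal_mul, e1]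
  have e2 : ((e, v) : ℂ × Plane) = (e, 0) + (0, v) := by simp
  have e3 : rlev φ (ε, y) (e, v) (e, v) = rlev φ (ε, y) (e, 0) (e, 0) +
      rlev φ (ε, y) (e, 0) (0, v) + (rlev φ (ε, y) (0, v) (e, 0) + rlev φ (ε, y) (0, v) (0, v)) := by
    rw [e2]
    simp only [rlev, lev_add_left, lev_add_right]
    ring
  have n1 : ‖((e, 0) : ℂ × Plane)‖ = ‖e‖ := by simp [Prod.norm_def]
  have n2 : ‖((0, v) : ℂ × Plane)‖ = ‖v‖ := by simp [Prod.norm_def]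
  have b1 : -(C * ‖e‖ * ‖e‖) ≤ (rlev φ (ε, y) (e, 0) (e, 0)).re := by
    have := (Complex.abs_re_le_norm _).trans (norm_lev_le (fun q => (φ q : ℂ)) (ε, y) (e, 0) (e, 0))
    rw [n1] at this
    exact (abs_le.1 this).1
  have b2 : -(C * ‖e‖ * ‖v‖) ≤ (rlev φ (ε, y) (e, 0) (0, v)).re := by
    have := (Complex.abs_re_le_norm _).trans (norm_lev_le (fun q => (φ q : ℂ)) (ε, y) (e, 0) (0, v))
    rw [n1, n2] at this
    exact (abs_le.1 this).1
  have b3 : -(C * ‖v‖ * ‖e‖) ≤ (rlev φ (ε, y) (0, v) (e, 0)).re := by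
    have := (Complex.abs_re_le_norm _).trans (norm_lev_le (fun q => (φ q : ℂ)) (ε, y) (0, v) (e, 0))
    rw [n1, n2] at this
    exact (abs_le.1 this).1
  have b4 := hb v
  rw [rlev_slice hφ] at b4
  have b5 : 0 ≤ a * ‖v‖ ^ 2 - 2 * C * ‖e‖ * ‖v‖ + C ^ 2 / a * ‖e‖ ^ 2 := by
    have : a * ‖v‖ ^ 2 - 2 * C * ‖e‖ * ‖v‖ + C ^ 2 / a * ‖e‖ ^ 2 =
      (a * ‖v‖ - C * ‖e‖) ^ 2 / a := by field_simp; ring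
    rw [this]; positivity
  rw [e3]
  simp only [Complex.add_re]
  by_cases he : e = 0
  · have hv : v ≠ 0 := fun hv => hq (by rw [he, hv]; rfl)
    have hv' : 0 < a * ‖v‖ ^ 2 := by have := norm_pos_iff.2 hv; positivity
    rw [he] at b1 b2 b3 ⊢
    simp only [norm_zero, mul_zero, zero_mul, neg_zero] at b1 b2 b3 ⊢
    linarith
  · have he' : 0 < ‖e‖ ^ 2 := by have := norm_pos_iff.2 he; positivity
    rw [hK]
    nlinarith

end Slices

/-- Substitution of a linear map into both arguments of a bilinear map. -/
def bilinSubst {E G : Type*} [NormedAddCommGroup E] [NormedSpace ℝ E] [NormedAddCommGroup G]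
    [NormedSpace ℝ G] (D : E →L[ℝ] E →L[ℝ] ℂ) (L : G →L[ℝ] E) : G →L[ℝ] G →L[ℝ] ℂ :=
  ((ContinuousLinearMap.compL ℝ G E ℂ).flip L).comp (D.comp L)

theorem bilinSubst_apply {E G : Type*} [NormedAddCommGroup E] [NormedSpace ℝ E]
    [NormedAddCommGroup G] [NormedSpace ℝ G] (D : E →L[ℝ] E →L[ℝ] ℂ) (L : G →L[ℝ] E) (v w : G) :
    bilinSubst D L v w = D (L v) (L w) := rfl

theorem _root_.ContDiffAt.bilinSubst {X E G : Type*} [NormedAddCommGroup X] [NormedSpace ℝ X]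
    [NormedAddCommGroup E] [NormedSpace ℝ E] [NormedAddCommGroup G]
    [NormedSpace ℝ G] {D : X → E →L[ℝ] E →L[ℝ] ℂ} {L : X → G →L[ℝ] E} {x : X} {n : ℕ∞ω}
    (hD : ContDiffAt ℝ n D x) (hL : ContDiffAt ℝ n L x) :
    ContDiffAt ℝ n (fun x => ConeMetrics.bilinSubst (D x) (L x)) x := by
  have h1 : ContDiffAt ℝ n (fun x => (ContinuousLinearMap.compL ℝ G E ℂ).flip (L x)) x :=
    contDiffAt_const.clm_apply hL
  exact h1.clm_comp (hD.clm_comp hL)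

/-- A continuously differentiable function which vanishes on a slice is bounded by a multiple of the
parameter. -/
theorem eventually_norm_le_of_slice_eq_zero {G : Type*} [NormedAddCommGroup G] [NormedSpace ℝ G]
    {f : ℂ × Plane → G} {y : Plane} (hf : ContDiffAt ℝ 1 f (0, y))
    (h0 : ∀ᶠ z in 𝓝 y, f (0, z) = 0) :
    ∃ B : ℝ, ∀ᶠ q in 𝓝 ((0 : ℂ), y), ‖f q‖ ≤ B * ‖q.1‖ := by
  obtain ⟨K, t, ht, hK⟩ := hf.exists_lipschitzOnWith
  have hc : ContinuousAt (fun q : ℂ × Plane => ((0 : ℂ), q.2)) (0, y) := by fun_prop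
  refine ⟨K, ?_⟩
  filter_upwards [ht, hc.preimage_mem_nhds ht,
    (continuousAt_snd (p := ((0 : ℂ), y))).eventually h0] with q h1 h2 h3
  have := hK.dist_le_mul q h1 (0, q.2) h2
  rw [h3, dist_zero_right, dist_eq_norm] at this
  have h4 : q - (0, q.2) = (q.1, 0) := by ext <;> simp
  rw [h4] at this
  simpa [Prod.norm_def] using this

namespace AsymCurve

variable {d : ℕ} (A : AsymCurve d) {β c : ℝ} {F : Plane → ℝ}

/-- The rescaled shift. -/
def deform (q : ℂ × Plane) : Plane := q.2 + q.1 • A.shift q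

theorem deform_zero (y : Plane) : A.deform (0, y) = y := by simp [deform]

theorem contDiffAt_deform {q : ℂ × Plane} (hq : q.2 ≠ 0) : ContDiffAt ℝ ∞ A.deform q :=
  contDiffAt_snd.add (ContDiffAt.smul (𝕜' := ℂ) contDiffAt_fst (A.contDiffAt_shift hq))

/-- The rescaled potential. -/
def model (c : ℝ) (F : Plane → ℝ) (q : ℂ × Plane) : ℝ :=
  F (A.deform q) + q.1.re * A.transv c (A.deform q)

theorem model_zero (c : ℝ) (F : Plane → ℝ) (y : Plane) : A.model c F (0, y) = F y := by
  simp [model, deform_zero]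

theorem contDiffAt_model (hF : FlatModel β c A.ℓ F) {q : ℂ × Plane} (hq : q.2 ≠ 0)
    (hd : A.deform q ∈ offLines A.ℓ) : ContDiffAt ℝ ∞ (A.model c F) q := by
  have h0 : A.deform q ≠ 0 := ne_zero_of_mem_offLines (by have := A.two_le; omega) hd
  have h1 : ContDiffAt ℝ ∞ F (A.deform q) := hF.contDiffAt hd
  have h2 : ContDiffAt ℝ ∞ (fun q : ℂ × Plane => q.1.re) q :=
    (Complex.reCLM.contDiff.contDiffAt).comp q contDiffAt_fst
  exact (h1.comp q (A.contDiffAt_deform hq)).add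
    (h2.mul ((A.contDiffAt_transv c h0).comp q (A.contDiffAt_deform hq)))

/-- The part of the unit sphere away from the lines. -/
def farSphere : Set Plane := {y | ‖y‖ = 1 ∧ ∀ k, 1 ≤ 4 * A.M * ‖wedge (A.ℓ k) y‖ ^ 2}

theorem isCompact_farSphere : IsCompact A.farSphere := by
  refine (isCompact_sphere (0 : Plane) 1).of_isClosed_subset ?_ fun y hy => by simpa using hy.1
  have h2 : ∀ k, Continuous fun y : Plane => 4 * A.M * ‖wedge (A.ℓ k) y‖ ^ 2 := fun k =>
    continuous_const.mul ((continuous_wedge _).norm.pow 2)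
  refine (isClosed_eq continuous_norm continuous_const).inter ?_
  have : {y : Plane | ∀ k, 1 ≤ 4 * A.M * ‖wedge (A.ℓ k) y‖ ^ 2} =
      ⋂ k, {y | 1 ≤ 4 * A.M * ‖wedge (A.ℓ k) y‖ ^ 2} := by ext; simp
  change IsClosed {y : Plane | ∀ k, 1 ≤ 4 * A.M * ‖wedge (A.ℓ k) y‖ ^ 2}
  rw [this]
  exact isClosed_iInter fun k => isClosed_le continuous_const (h2 k)

theorem mem_offLines_of_mem_farSphere {y : Plane} (hy : y ∈ A.farSphere) : y ∈ offLines A.ℓ := by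
  intro k h0
  have := hy.2 k
  rw [h0] at this
  norm_num at this

theorem ne_zero_of_mem_farSphere {y : Plane} (hy : y ∈ A.farSphere) : y ≠ 0 := by
  rintro rfl
  simpa using hy.1

theorem eventually_deform_mem {y : Plane} (hy : y ∈ A.farSphere) :
    ∀ᶠ q in 𝓝 ((0 : ℂ), y), q.2 ≠ 0 ∧ A.deform q ∈ offLines A.ℓ := by
  have h0 := A.ne_zero_of_mem_farSphere hy
  have h1 : ContinuousAt A.deform (0, y) := (A.contDiffAt_deform (q := (0, y)) h0).continuousAt
  have h2 : A.deform (0, y) ∈ offLines A.ℓ := by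
    rw [A.deform_zero]; exact A.mem_offLines_of_mem_farSphere hy
  exact ((continuousAt_snd (p := ((0 : ℂ), y))).eventually_ne h0).and
    (h1.eventually ((isOpen_offLines A.ℓ).mem_nhds h2))

/-- The regularized rescaled potential is strictly plurisubharmonic, with bounded curvature,
uniformly away from the lines. -/
theorem exists_model_curvLE (hF : FlatModel β c A.ℓ F) :
    ∃ B, ∀ᶠ ε in 𝓝 (0 : ℂ), ∀ y ∈ A.farSphere, y ≠ 0 ∧ A.deform (ε, y) ∈ offLines A.ℓ ∧
      ∃ K B' : ℝ, 0 ≤ B' ∧ B' ≤ B ∧ StrictPsh (fun q => A.model c F q + K * ‖q.1‖ ^ 2) (ε, y) ∧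
        CurvLE (fun q => A.model c F q + K * ‖q.1‖ ^ 2) (ε, y) B' := by
  refine exists_uniform_bound (p := fun B q => q.2 ≠ 0 ∧ A.deform q ∈ offLines A.ℓ ∧
    ∃ K B' : ℝ, 0 ≤ B' ∧ B' ≤ B ∧ StrictPsh (fun q => A.model c F q + K * ‖q.1‖ ^ 2) q ∧
        CurvLE (fun q => A.model c F q + K * ‖q.1‖ ^ 2) q B') A.isCompact_farSphere ?_ ?_
  · rintro B B' q hB ⟨h1, h2, K, B'', h3, h4, h5⟩
    exact ⟨h1, h2, K, B'', h3, h4.trans hB, h5⟩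
  · intro y hy
    have hm := A.eventually_deform_mem hy
    have hsm : ContDiffAt ℝ ∞ (A.model c F) (0, y) :=
      A.contDiffAt_model hF hm.self_of_nhds.1 hm.self_of_nhds.2
    have hslice : StrictPsh (fun z => A.model c F (0, z)) y := by
      have : (fun z => A.model c F (0, z)) = F := funext (A.model_zero c F)
      rw [this]
      exact hF.strictPsh (A.mem_offLines_of_mem_farSphere hy)
    -- At parameter 0 the slice is the flat potential itself. The added multiple of |ε|² gives
    -- positivity in the parameter direction and is constant on slices, so the induced metrics do
    -- not change.
    obtain ⟨K, hK⟩ := exists_strictPsh_add (hsm.of_le two_le_infty) hslice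
    have hsm4 : ContDiffAt ℝ 4 (fun q => A.model c F q + K * ‖q.1‖ ^ 2) (0, y) :=
      (hsm.of_le four_le_infty).add (contDiffAt_const.mul
        (contDiffAt_norm_sq (E := ℂ × Plane) (g := fun q => q.1) analyticAt_fst))
    obtain ⟨B, hB, hcurv⟩ := hK.eventually_curvLE hsm4
    refine ⟨B, ?_⟩
    filter_upwards [hm, hK.eventually (hsm4.of_le (by norm_num)), hcurv] with q h1 h2 h3
    exact ⟨h1.1, h1.2, K, B, hB.le, le_rfl, h2, h3⟩

/-- The difference between the Levi form of the rescaled potential and the flat one. -/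
def defect (c : ℝ) (F : Plane → ℝ) (q : ℂ × Plane) : Plane →L[ℝ] Plane →L[ℝ] ℂ :=
  bilinSubst (levCLM (A.model c F) q) (ContinuousLinearMap.inr ℝ ℂ Plane) -
    bilinSubst (levCLM F (A.deform q))
      ((fderiv ℝ A.deform q).comp (ContinuousLinearMap.inr ℝ ℂ Plane))

theorem defect_apply (c : ℝ) (F : Plane → ℝ) (q : ℂ × Plane) (a b : Plane) :
    A.defect c F q a b = rlev (A.model c F) q (0, a) (0, b) -
      rlev F (A.deform q) (fderiv ℝ A.deform q (0, a)) (fderiv ℝ A.deform q (0, b)) := by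
  simp only [defect, _root_.sub_apply, bilinSubst_apply, levCLM_apply]
  rfl

/-- The defect is continuously differentiable in (ε, y). It vanishes for ε = 0, where the
deformation is the identity and the potential is F, so it is O(|ε|) locally, and uniformly on the
compact set. -/
theorem exists_defect_le (hF : FlatModel β c A.ℓ F) :
    ∃ B, ∀ᶠ ε in 𝓝 (0 : ℂ), ∀ y ∈ A.farSphere, ‖A.defect c F (ε, y)‖ ≤ B * ‖ε‖ := by
  refine exists_uniform_bound (p := fun B q => ‖A.defect c F q‖ ≤ B * ‖q.1‖)
    A.isCompact_farSphere ?_ ?_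
  · intro B B' q hB h
    exact h.trans (by gcongr)
  · intro y hy
    have hm := A.eventually_deform_mem hy
    have h0 := A.ne_zero_of_mem_farSphere hy
    have hy' := A.mem_offLines_of_mem_farSphere hy
    refine eventually_norm_le_of_slice_eq_zero (f := A.defect c F) ?_ ?_
    · have hsm : ContDiffAt ℝ 4 (A.model c F) (0, y) :=
        (A.contDiffAt_model hF hm.self_of_nhds.1 hm.self_of_nhds.2).of_le four_le_infty
      have hdf : ContDiffAt ℝ 4 A.deform (0, y) :=
        (A.contDiffAt_deform (q := (0, y)) h0).of_le four_le_infty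
      have hF4 : ContDiffAt ℝ 4 F (A.deform (0, y)) := by
        rw [A.deform_zero]; exact hF.contDiffAt hy'
      have h1 : ContDiffAt ℝ 1 (levCLM (A.model c F)) (0, y) :=
        contDiffAt_levCLM hsm (by norm_num)
      have h2 : ContDiffAt ℝ 1 (fun q => levCLM F (A.deform q)) (0, y) :=
        ContDiffAt.comp (0, y) (g := levCLM F) (contDiffAt_levCLM hF4 (by norm_num))
          (hdf.of_le (by norm_num))
      have h3 : ContDiffAt ℝ 1 (fderiv ℝ A.deform) (0, y) := hdf.fderiv_right (by norm_num)
      have h4 : ContDiffAt ℝ 1 (fun q => bilinSubst (levCLM (A.model c F) q)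
          (ContinuousLinearMap.inr ℝ ℂ Plane)) (0, y) := h1.bilinSubst contDiffAt_const
      have h5 : ContDiffAt ℝ 1 (fun q => (fderiv ℝ A.deform q).comp
          (ContinuousLinearMap.inr ℝ ℂ Plane)) (0, y) := h3.clm_comp contDiffAt_const
      exact h4.sub (h2.bilinSubst h5)
    · filter_upwards [(isOpen_offLines A.ℓ).mem_nhds hy', isOpen_ne.mem_nhds h0] with z hz hz0
      have hzd : A.deform (0, z) ∈ offLines A.ℓ := by rw [A.deform_zero]; exact hz
      have hsm : ContDiffAt ℝ 2 (A.model c F) (0, z) :=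
        (A.contDiffAt_model hF (q := (0, z)) hz0 hzd).of_le two_le_infty
      have hd : ∀ a, fderiv ℝ A.deform (0, z) (0, a) = a := by
        intro a
        have h1 : HasFDerivAt A.deform (fderiv ℝ A.deform (0, z)) (0, z) :=
          ((A.contDiffAt_deform (q := (0, z)) hz0).differentiableAt (by simp)).hasFDerivAt
        have h2 : HasFDerivAt (fun z : Plane => ((0 : ℂ), z)) _ z :=
          (hasFDerivAt_const (0 : ℂ) z).prodMk (hasFDerivAt_id (𝕜 := ℝ) z)
        have h3 := h1.comp z h2
        have h4 : (A.deform ∘ fun z : Plane => ((0 : ℂ), z)) = id := funext A.deform_zero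
        rw [h4] at h3
        exact congrArg (fun L => L a) (h3.unique (hasFDerivAt_id z))
      refine ContinuousLinearMap.ext fun a => ContinuousLinearMap.ext fun b => ?_
      rw [A.defect_apply, hd, hd, A.deform_zero, ← rlev_slice hsm]
      have : (fun z => A.model c F (0, z)) = F := funext (A.model_zero c F)
      rw [this, sub_self]
      rfl

end AsymCurve

end

/-! ### Estimates at infinity by rescaling -/

section

theorem analyticAt_const_smul (a : ℂ) (x : Plane) : AnalyticAt ℂ (fun y : Plane => a • y) x :=
  (a • ContinuousLinearMap.id ℂ Plane).analyticAt x

theorem fderiv_const_smul_id (a : ℂ) (x v : Plane) :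
    fderiv ℂ (fun y : Plane => a • y) x v = a • v :=
  DFunLike.congr_fun ((a • ContinuousLinearMap.id ℂ Plane).fderiv (x := x)) v

/-- The Levi form of a homogeneous function is homogeneous. -/
theorem rlev_smul_of_homogeneous {φ : Plane → ℝ} {s a : ℝ} (ha : 0 < a)
    (hφ : ∀ y, φ ((a : ℂ) • y) = a ^ s * φ y) {x : Plane} (h1 : ContDiffAt ℝ 2 φ x)
    (h2 : ContDiffAt ℝ 2 φ ((a : ℂ) • x)) (v w : Plane) :
    rlev φ ((a : ℂ) • x) v w = (a ^ (s - 2) : ℝ) * rlev φ x v w := by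
  have ha' : (a : ℂ) ≠ 0 := by exact_mod_cast ha.ne'
  have h3 : rlev (fun y => φ ((a : ℂ) • y)) x v w = _ :=
    lev_comp (f := fun y => (φ y : ℂ)) (analyticAt_const_smul (a : ℂ) x) h2.ofReal v w
  rw [fderiv_const_smul_id, fderiv_const_smul_id, lev_smul_left, lev_smul_right,
    Complex.conj_ofReal, funext hφ, rlev_const_mul h1] at h3
  have h5 : a ^ s = a ^ (s - 2) * a * a := by
    rw [mul_assoc, ← sq, ← Real.rpow_natCast a 2, ← Real.rpow_add ha]
    congr 1; push_cast; ring
  rw [h5] at h3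
  apply mul_left_cancel₀ (mul_ne_zero ha' ha')
  simp only [rlev] at h3 ⊢
  push_cast at h3 ⊢
  linear_combination -h3

/-- Rescaling of the plane, together with the parameter. -/
def rescale (r : ℝ) (x : Plane) : ℂ × Plane := (((r⁻¹ : ℝ) : ℂ), ((r⁻¹ : ℝ) : ℂ) • x)

theorem analyticAt_rescale (r : ℝ) (x : Plane) : AnalyticAt ℂ (rescale r) x :=
  analyticAt_const.prod (analyticAt_const_smul _ x)

theorem fderiv_rescale (r : ℝ) (x v : Plane) :
    fderiv ℂ (rescale r) x v = (0, ((r⁻¹ : ℝ) : ℂ) • v) := by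
  have h : HasFDerivAt (rescale r) _ x := (hasFDerivAt_const ((r⁻¹ : ℝ) : ℂ) x).prodMk
    (analyticAt_const_smul ((r⁻¹ : ℝ) : ℂ) x).differentiableAt.hasFDerivAt
  rw [h.fderiv]
  exact Prod.ext rfl (fderiv_const_smul_id _ x v)

theorem fderiv_rescale_injective {r : ℝ} (hr : 0 < r) {x v : Plane}
    (h : fderiv ℂ (rescale r) x v = 0) : v = 0 := by
  rw [fderiv_rescale] at h
  have h1 : ((r⁻¹ : ℝ) : ℂ) ≠ 0 := by exact_mod_cast (inv_pos.2 hr).ne'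
  exact (smul_eq_zero.1 (Prod.mk.inj h).2).resolve_left h1

namespace Straightening

variable {d : ℕ} {A : AsymCurve d} (S : Straightening A) {β c : ℝ} {F : Plane → ℝ}

theorem H_eq_deform {r : ℝ} (hr : 0 < r) {x : Plane} (hx : S.R < ‖x‖) :
    S.H x = (r : ℂ) • A.deform (rescale r x) := by
  have hr' : (r : ℂ) ≠ 0 := by exact_mod_cast hr.ne'
  rw [S.eq_shift x hx, A.shift_one_eq hr, AsymCurve.deform, rescale, smul_add, smul_smul, smul_smul]
  simp [hr']

theorem H_mem_offLines_iff {r : ℝ} (hr : 0 < r) {x : Plane} (hx : S.R < ‖x‖) :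
    S.H x ∈ offLines A.ℓ ↔ A.deform (rescale r x) ∈ offLines A.ℓ := by
  rw [S.H_eq_deform hr hx, smul_mem_offLines (by exact_mod_cast hr.ne')]

/-- The transversal term has degree one less than F, so pulling out r^c leaves a factor 1/r, which
is the real part of the parameter. -/
theorem outer_eq_model (hF : FlatModel β c A.ℓ F) {r : ℝ} (hr : 0 < r) {x : Plane}
    (hx : S.R < ‖x‖) : S.outer c F x = r ^ c * A.model c F (rescale r x) := by
  have hr' : (r : ℂ) ≠ 0 := by exact_mod_cast hr.ne'
  rw [outer, S.H_eq_deform hr hx, hF.homog _ _ hr', A.transv_smul hr, Complex.norm_real,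
    Real.norm_of_nonneg hr.le, AsymCurve.model, Real.rpow_sub_one hr.ne']
  simp only [rescale, Complex.ofReal_re]
  ring

theorem rescale_mem_farSphere {x : Plane} (hx : S.R < ‖x‖) (hn : ∀ k, x ∉ S.near k) :
    (rescale ‖x‖ x).2 ∈ A.farSphere := by
  have h0 : 0 < ‖x‖ := by linarith [S.one_le]
  refine ⟨?_, fun k => ?_⟩
  · simp [rescale, norm_smul, h0.ne']
  · have h1 : ‖x‖ ^ 2 ≤ 4 * A.M * ‖wedge (A.ℓ k) x‖ ^ 2 := not_lt.1 fun h => hn k ⟨hx, h⟩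
    simp only [rescale, wedge_smul, norm_mul, Complex.norm_real, norm_inv, norm_norm]
    rw [mul_pow, inv_pow, mul_left_comm, ← div_eq_inv_mul, one_le_div (by positivity)]
    exact h1

theorem norm_rescale_fst (x : Plane) : ‖(rescale ‖x‖ x).1‖ = ‖x‖⁻¹ := by
  simp [rescale]

theorem exists_of_eventually_zero {p : ℂ → Prop} (h : ∀ᶠ ε in 𝓝 0, p ε) :
    ∃ R, S.R ≤ R ∧ ∀ x : Plane, R < ‖x‖ → p (rescale ‖x‖ x).1 := by
  obtain ⟨δ, hδ, hp⟩ := Metric.eventually_nhds_iff.1 h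
  refine ⟨max S.R δ⁻¹, le_max_left _ _, fun x hx => hp ?_⟩
  have h1 : δ⁻¹ < ‖x‖ := (le_max_right _ _).trans_lt hx
  rw [dist_zero_right, norm_rescale_fst]
  exact inv_lt_of_inv_lt₀ hδ h1

/-- Away from the lines, near infinity, the potential is strictly plurisubharmonic and defines a
metric of bisectional curvature bounded above. -/
theorem exists_far_bound (hF : FlatModel β c A.ℓ F) (hc : 0 ≤ c) :
    ∃ R, S.R ≤ R ∧ ∃ B, ∀ x, R < ‖x‖ → (∀ k, x ∉ S.near k) →
      S.H x ∈ offLines A.ℓ ∧ StrictPsh (S.outer c F) x ∧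
      ∀ (φ : Plane → ℝ) (m : ℝ) (κ : Plane → TwoForm),
        (φ =ᶠ[𝓝 x] fun y => S.outer c F y + m) →
        (κ =ᶠ[𝓝 x] fun y => (1 / 2 : ℝ) • iddbar φ y) → ∀ v w,
        hermNormSq (κ x) v = 1 → hermNormSq (κ x) w = 1 → bisec κ x v w ≤ B := by
  obtain ⟨B, hB⟩ := A.exists_model_curvLE hF
  obtain ⟨R, hR, h⟩ := S.exists_of_eventually_zero hB
  refine ⟨R, hR, 2 * B, fun x hx hn => ?_⟩
  have hxR : S.R < ‖x‖ := hR.trans_lt hx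
  have h0 : 0 < ‖x‖ := by linarith [S.one_le]
  obtain ⟨hy0, hoff, K, B', hB'0, hB'B, hpsh, hcurv⟩ :=
    h x hx _ (S.rescale_mem_farSphere hxR hn)
  set r := ‖x‖ with hr
  change A.deform (rescale r x) ∈ offLines A.ℓ at hoff
  change StrictPsh _ (rescale r x) at hpsh
  change CurvLE _ (rescale r x) B' at hcurv
  have hHx : S.H x ∈ offLines A.ℓ := (S.H_mem_offLines_iff h0 hxR).2 hoff
  set M : ℂ × Plane → ℝ := fun q => A.model c F q + K * ‖q.1‖ ^ 2 with hM
  have hM4 : ContDiffAt ℝ 4 M (rescale r x) :=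
    ((A.contDiffAt_model hF hy0 hoff).of_le four_le_infty).add (contDiffAt_const.mul
      (contDiffAt_norm_sq (E := ℂ × Plane) (g := fun q => q.1) analyticAt_fst))
  -- For fixed r the rescaling has constant parameter, so the regularizing term contributes only a
  -- constant, and the potential is r^c times an ambient one with r^c ≥ 1.
  have houter : ∀ᶠ y in 𝓝 x, S.outer c F y =
      r ^ c * M (rescale r y) + -(r ^ c * (K * ‖((r⁻¹ : ℝ) : ℂ)‖ ^ 2)) := by
    filter_upwards [eventually_norm_lt hxR] with y hy
    rw [S.outer_eq_model hF h0 hy, hM]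
    simp only [rescale]
    ring
  have hrc : 1 ≤ r ^ c := Real.one_le_rpow (by linarith [S.one_le]) hc
  have houter2 : ContDiffAt ℝ 2 (S.outer c F) x := (S.contDiffAt_outer hF hHx).of_le two_le_infty
  have hpull : StrictPsh (fun y => M (rescale r y)) x :=
    strictPsh_of_pullback Filter.EventuallyEq.rfl (analyticAt_rescale r x)
      (hM4.of_le (by norm_num)) hpsh fun v hv => fderiv_rescale_injective h0 hv
  have hpull2 : ContDiffAt ℝ 2 (fun y => M (rescale r y)) x :=
    ContDiffAt.comp x (g := M) (hM4.of_le (by norm_num)) (analyticAt_rescale r x).smoothAt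
  have hpshO : StrictPsh (S.outer c F) x := by
    intro v hv
    rw [rlev_eventuallyEq houter, rlev_const_add (contDiffAt_const.mul hpull2),
      rlev_const_mul hpull2, Complex.re_ofReal_mul]
    exact mul_pos (by linarith) (hpull v hv)
  refine ⟨hHx, hpshO, fun φ m κ hφ hκ v w hv hw => ?_⟩
  have hpshφ : StrictPsh φ x := by
    intro v hv
    rw [rlev_eventuallyEq hφ, rlev_const_add houter2]
    exact hpshO v hv
  have hφ' : φ =ᶠ[𝓝 x] fun y => r ^ c * M (rescale r y) +
      (-(r ^ c * (K * ‖((r⁻¹ : ℝ) : ℂ)‖ ^ 2)) + m) := by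
    filter_upwards [hφ, houter] with y h1 h2
    rw [h1, h2]; ring
  have := bisec_le_of_pullback hκ hφ' (analyticAt_rescale r x) hM4 hpshφ hcurv hrc hB'0 v w hv hw
  linarith

/-- The difference between the Levi form of the potential and the pull-back of the flat one. -/
def leviDefect (c : ℝ) (F : Plane → ℝ) (x a b : Plane) : ℂ :=
  rlev (S.outer c F) x a b - rlev F (S.H x) (fderiv ℝ S.H x a) (fderiv ℝ S.H x b)

theorem leviDefect_eq (hF : FlatModel β c A.ℓ F) {x : Plane} (hx : S.R < ‖x‖)
    (hH : S.H x ∈ offLines A.ℓ) (a b : Plane) :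
    S.leviDefect c F x a b = (‖x‖ ^ (c - 2) : ℝ) * A.defect c F (rescale ‖x‖ x) a b := by
  have h0 : 0 < ‖x‖ := by linarith [S.one_le]
  set r := ‖x‖ with hr
  have hr' : (r : ℂ) ≠ 0 := by exact_mod_cast h0.ne'
  have hoff := (S.H_mem_offLines_iff h0 hx).1 hH
  have hx0 : (rescale r x).2 ≠ 0 := by
    have : x ≠ 0 := norm_pos_iff.1 h0
    simp [rescale, this, h0.ne']
  have hm2 : ContDiffAt ℝ 2 (A.model c F) (rescale r x) :=
    (A.contDiffAt_model hF hx0 hoff).of_le two_le_infty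
  have e1 : rlev (S.outer c F) x a b =
      (r ^ (c - 2) : ℝ) * rlev (A.model c F) (rescale r x) (0, a) (0, b) := by
    have hev : S.outer c F =ᶠ[𝓝 x] fun y => r ^ c * A.model c F (rescale r y) := by
      filter_upwards [eventually_norm_lt hx] with y hy
      exact S.outer_eq_model hF h0 hy
    have hpull2 : ContDiffAt ℝ 2 (fun y => A.model c F (rescale r y)) x :=
      ContDiffAt.comp x (g := A.model c F) hm2 (analyticAt_rescale r x).smoothAt
    rw [rlev_eventuallyEq hev, rlev_const_mul hpull2]
    have h3 : rlev (fun y => A.model c F (rescale r y)) x a b = _ :=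
      lev_comp (f := fun y => (A.model c F y : ℂ)) (analyticAt_rescale r x) hm2.ofReal a b
    have e : ∀ v : Plane, ((0 : ℂ), ((r⁻¹ : ℝ) : ℂ) • v) = ((r⁻¹ : ℝ) : ℂ) • ((0 : ℂ), v) := by
      intro v; simp
    rw [fderiv_rescale, fderiv_rescale, e, e, lev_smul_left, lev_smul_right,
      Complex.conj_ofReal] at h3
    have h5 : r ^ c = r ^ (c - 2) * r * r := by
      rw [mul_assoc, ← sq, ← Real.rpow_natCast r 2, ← Real.rpow_add h0]
      congr 1; push_cast; ring
    rw [h3, h5, rlev]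
    push_cast
    field_simp
  have e2 : ∀ v, fderiv ℝ S.H x v = fderiv ℝ A.deform (rescale r x) (0, v) := by
    intro v
    have hd : HasFDerivAt A.deform (fderiv ℝ A.deform (rescale r x)) (rescale r x) :=
      ((A.contDiffAt_deform hx0).differentiableAt (by simp)).hasFDerivAt
    have h1 := (hd.comp x (analyticAt_rescale r x).hasFDerivAt_real).const_smul r
    have h2 : HasFDerivAt S.H _ x := h1.congr_of_eventuallyEq (by
      filter_upwards [eventually_norm_lt hx] with y hy
      rw [S.H_eq_deform h0 hy]
      exact (real_smul_eq r _).symm)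
    rw [h2.fderiv]
    change r • fderiv ℝ A.deform (rescale r x) (fderiv ℂ (rescale r) x v) = _
    have e : ((0 : ℂ), ((r⁻¹ : ℝ) : ℂ) • v) = r⁻¹ • ((0 : ℂ), v) := by
      rw [← real_smul_eq]; simp
    rw [fderiv_rescale, e, map_smul, smul_smul, mul_inv_cancel₀ h0.ne', one_smul]
  have e3 : ∀ u u', rlev F (S.H x) u u' =
      (r ^ (c - 2) : ℝ) * rlev F (A.deform (rescale r x)) u u' := by
    intro u u'
    have h1 := hH
    rw [S.H_eq_deform h0 hx] at h1 ⊢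
    refine rlev_smul_of_homogeneous h0 (fun y => ?_) (hF.contDiffAt hoff) (hF.contDiffAt h1) u u'
    rw [hF.homog _ _ hr', Complex.norm_real, Real.norm_of_nonneg h0.le]
  rw [leviDefect, e1, e3, e2, e2, A.defect_apply]
  ring

/-- The Levi form of a function of degree c - 1 has degree c - 3; the constant is its maximum over
the unit sphere. -/
theorem exists_transv_rlev_le (A : AsymCurve d) (c : ℝ) : ∃ C > 0, ∀ y : Plane, y ≠ 0 →
    ∀ u u', ‖rlev (A.transv c) y u u'‖ ≤ C * ‖y‖ ^ (c - 3) * ‖u‖ * ‖u'‖ := by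
  have hne : ∀ y ∈ Metric.sphere (0 : Plane) 1, y ≠ 0 := by
    rintro y hy rfl
    simp at hy
  obtain ⟨C, hC, h⟩ := exists_bound_of_continuousOn (isCompact_sphere (0 : Plane) 1)
    (f := levCLM (A.transv c)) fun y hy =>
      (contDiffAt_levCLM (m := 0) ((A.contDiffAt_transv c (hne y hy)).of_le two_le_infty)
        (by norm_num)).continuousAt
  refine ⟨C, hC, fun y hy u u' => ?_⟩
  have h0 : 0 < ‖y‖ := norm_pos_iff.2 hy
  have hz : ((‖y‖⁻¹ : ℝ) : ℂ) • y ∈ Metric.sphere (0 : Plane) 1 := by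
    simp [norm_smul, h0.ne']
  set z := ((‖y‖⁻¹ : ℝ) : ℂ) • y with hzdef
  have hyz : y = ((‖y‖ : ℝ) : ℂ) • z := by
    have : ((‖y‖ : ℝ) : ℂ) ≠ 0 := by exact_mod_cast h0.ne'
    rw [hzdef, smul_smul]
    simp [this]
  have h1 : rlev (A.transv c) y u u' = (‖y‖ ^ (c - 3) : ℝ) * rlev (A.transv c) z u u' := by
    have hs := rlev_smul_of_homogeneous (φ := A.transv c) (s := c - 1) h0
      (fun y' => A.transv_smul h0 y')
      ((A.contDiffAt_transv c (hne z hz)).of_le two_le_infty)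
      (by rw [← hyz]; exact (A.contDiffAt_transv c hy).of_le two_le_infty) u u'
    rw [← hyz] at hs
    rw [hs]
    congr 3
    ring
  rw [h1, norm_mul, Complex.norm_real, Real.norm_of_nonneg (by positivity), ← levCLM_apply]
  have h2 := (levCLM (A.transv c) z).le_of_opNorm₂_le_of_le (h z hz) (le_refl ‖u‖) (le_refl ‖u'‖)
  calc _ ≤ ‖y‖ ^ (c - 3) * (C * ‖u‖ * ‖u'‖) := by gcongr
    _ = _ := by ring

/-- Near a line H is holomorphic, so the flat potential is pulled back without error and only the
transversal term is left. -/
theorem leviDefect_near (hF : FlatModel β c A.ℓ F) {k : Fin d} {x : Plane} (hx : x ∈ S.near k)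
    (hH : S.H x ∈ offLines A.ℓ) (a b : Plane) : S.leviDefect c F x a b =
      rlev (A.transv c) (S.H x) (fderiv ℝ S.H x a) (fderiv ℝ S.H x b) := by
  have h0 : S.H x ≠ 0 := A.ne_zero_of_mem_inner (S.H_mem_inner hx)
  have hF2 : ContDiffAt ℝ 2 F (S.H x) := hF.contDiffAt hH
  have hT2 : ContDiffAt ℝ 2 (A.transv c) (S.H x) :=
    (A.contDiffAt_transv c h0).of_le two_le_infty
  have h1 : rlev (S.outer c F) x a b = _ := lev_comp
    (f := fun y => ((F y + A.transv c y : ℝ) : ℂ)) (S.analyticAt_H hx) (hF2.add hT2).ofReal a b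
  have h2 := rlev_add hF2 hT2 (fderiv ℂ S.H x a) (fderiv ℂ S.H x b)
  rw [rlev] at h2
  rw [leviDefect, h1, h2, ← S.fderiv_H hx, ← S.fderiv_H hx]
  ring

/-- Away from the lines the defect is r^{c-2} by scaling times O(1/r); near a line it is the Levi
form of the transversal term. Both regions give degree c - 3. -/
theorem exists_leviDefect_le (hF : FlatModel β c A.ℓ F) (hc : c ≤ 3) :
    ∃ R, S.R ≤ R ∧ ∃ C > 0, ∀ x, R < ‖x‖ → S.H x ∈ offLines A.ℓ → ∀ a b,
      ‖S.leviDefect c F x a b‖ ≤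
        C * ‖S.H x‖ ^ (c - 3) * ‖fderiv ℝ S.H x a‖ * ‖fderiv ℝ S.H x b‖ := by
  obtain ⟨B, hB⟩ := A.exists_defect_le hF
  obtain ⟨R, hR, h⟩ := S.exists_of_eventually_zero hB
  obtain ⟨C, hC, hT⟩ := exists_transv_rlev_le A c
  -- The 4 comes from |v| ≤ 2|DH v| for each of the two vectors. The power of 1/2 comes from |H x| ≤
  -- 2|x| and the exponent c - 3 ≤ 0.
  refine ⟨R, hR, C + |B| * (2⁻¹ : ℝ) ^ (c - 3) * 4, by positivity, fun x hx hH a b => ?_⟩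
  have hxR : S.R < ‖x‖ := hR.trans_lt hx
  have h0 : 0 < ‖x‖ := by linarith [S.one_le]
  have hH0 : 0 < ‖S.H x‖ := by linarith [S.le_norm x hxR]
  set D := (2⁻¹ : ℝ) ^ (c - 3)
  have hD : 0 ≤ D := by positivity
  by_cases hn : ∀ k, x ∉ S.near k
  · have h1 := h x hx _ (S.rescale_mem_farSphere hxR hn)
    change ‖A.defect c F (rescale ‖x‖ x)‖ ≤ B * ‖(rescale ‖x‖ x).1‖ at h1
    rw [norm_rescale_fst] at h1
    have h1' : ‖A.defect c F (rescale ‖x‖ x)‖ ≤ |B| * ‖x‖⁻¹ := h1.trans (by gcongr; exact le_abs_self B)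
    have h2 := (A.defect c F (rescale ‖x‖ x)).le_of_opNorm₂_le_of_le h1' (S.norm_le_fderiv_H x a)
      (S.norm_le_fderiv_H x b)
    rw [S.leviDefect_eq hF hxR hH, norm_mul, Complex.norm_real, Real.norm_of_nonneg (by positivity)]
    have h3 : ‖x‖ ^ (c - 2) * ‖x‖⁻¹ = ‖x‖ ^ (c - 3) := by
      rw [← Real.rpow_neg_one, ← Real.rpow_add h0]; congr 1; ring
    have h4 : ‖x‖ ^ (c - 3) ≤ D * ‖S.H x‖ ^ (c - 3) := by
      rw [← Real.mul_rpow (by norm_num) (norm_nonneg _)]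
      refine Real.rpow_le_rpow_of_nonpos (by positivity) ?_ (by linarith)
      linarith [S.norm_le x hxR]
    calc _ ≤ ‖x‖ ^ (c - 2) * (|B| * ‖x‖⁻¹ * (2 * ‖fderiv ℝ S.H x a‖) * (2 * ‖fderiv ℝ S.H x b‖)) := by
          gcongr
      _ = |B| * 4 * (‖x‖ ^ (c - 2) * ‖x‖⁻¹) * ‖fderiv ℝ S.H x a‖ * ‖fderiv ℝ S.H x b‖ := by ring
      _ ≤ |B| * 4 * (D * ‖S.H x‖ ^ (c - 3)) * ‖fderiv ℝ S.H x a‖ * ‖fderiv ℝ S.H x b‖ := by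
          rw [h3]; gcongr
      _ = |B| * D * 4 * ‖S.H x‖ ^ (c - 3) * ‖fderiv ℝ S.H x a‖ * ‖fderiv ℝ S.H x b‖ := by ring
      _ ≤ _ := by gcongr; linarith
  · push Not at hn
    obtain ⟨k, hk⟩ := hn
    rw [S.leviDefect_near hF hk hH]
    refine (hT (S.H x) (norm_pos_iff.1 hH0) _ _).trans ?_
    gcongr
    have : 0 ≤ |B| * D * 4 := by positivity
    linarith

end Straightening

end

/-! ### The global potential and its curvature bound -/

section

theorem hasFDerivAt_eval (p : MvPolynomial (Fin 2) ℂ) (x : Plane) :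
    HasFDerivAt (𝕜 := ℂ) (fun x : Plane => MvPolynomial.eval (fun i => x i) p)
      (∑ i, MvPolynomial.eval (fun k => x k) (MvPolynomial.pderiv i p) •
        (EuclideanSpace.proj i : Plane →L[ℂ] ℂ)) x := by
  induction p using MvPolynomial.induction_on with
  | C a =>
    simp only [MvPolynomial.eval_C]
    refine (hasFDerivAt_const (𝕜 := ℂ) a x).congr_fderiv ?_
    ext v
    simp
  | add p q hp hq =>
    have := hp.add hq
    simp only [map_add]
    refine HasFDerivAt.congr_fderiv this ?_
    rw [← Finset.sum_add_distrib]
    exact Finset.sum_congr rfl fun i _ => (add_smul _ _ _).symm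
  | mul_X p i hp =>
    have h := hp.mul ((EuclideanSpace.proj i : Plane →L[ℂ] ℂ).hasFDerivAt (x := x))
    simp only [map_mul, MvPolynomial.eval_X]
    refine h.congr_fderiv ?_
    ext v
    fin_cases i <;>
      simp [Fin.sum_univ_two, MvPolynomial.pderiv_X] <;> ring

namespace AsymCurve

variable {d : ℕ} (A : AsymCurve d)

theorem fderiv_eqn_ne_zero (hC : IsSmoothCurve A.P) {p : Plane} (hp : A.eqn p = 0) :
    fderiv ℂ A.eqn p ≠ 0 := by
  obtain ⟨i, hi⟩ := hC p hp
  intro h0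
  have h1 : HasFDerivAt A.eqn _ p := hasFDerivAt_eval A.P p
  rw [h1.fderiv] at h0
  have h2 := congrArg (fun L => L (stdVec i)) h0
  apply hi
  fin_cases i <;> simpa [Fin.sum_univ_two, stdVec] using h2

theorem eqn_eventually_ne {x : Plane} (hx : A.eqn x ≠ 0) : ∀ᶠ y in 𝓝 x, A.eqn y ≠ 0 :=
  (A.analyticAt_eqn x).continuousAt.eventually_ne hx

theorem exists_norm_eqn_le : ∃ C > 0, ∀ x : Plane, 1 ≤ ‖x‖ → ‖A.eqn x‖ ≤ C * ‖x‖ ^ d := by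
  obtain ⟨C, hC, h⟩ := A.exists_norm_low_le
  choose K hK hKle using fun k => exists_norm_wedge_le (A.ℓ k)
  have hP : 0 ≤ ∏ k, K k := Finset.prod_nonneg fun k _ => (hK k).le
  refine ⟨‖A.c₀‖ * ∏ k, K k + C, by positivity, fun x hx => ?_⟩
  rw [A.eqn_eq]
  refine (norm_add_le _ _).trans ?_
  rw [norm_mul, norm_prod, add_mul]
  have h1 : ∏ k, ‖wedge (A.ℓ k) x‖ ≤ (∏ k, K k) * ‖x‖ ^ d := by
    refine (Finset.prod_le_prod (fun k _ => norm_nonneg _) fun k _ => hKle k x).trans ?_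
    rw [Finset.prod_mul_distrib, Finset.prod_const, Finset.card_univ, Fintype.card_fin]
  have h2 : ‖A.low (1, x)‖ ≤ C * ‖x‖ ^ d := (h x hx).trans (by gcongr; omega)
  have h3 : ‖A.c₀‖ * ∏ k, ‖wedge (A.ℓ k) x‖ ≤ ‖A.c₀‖ * ((∏ k, K k) * ‖x‖ ^ d) := by gcongr
  linarith

/-- The interior potential. -/
def tame (m β : ℝ) (x : Plane) : ℝ := basePot m (x, ‖A.eqn x‖ ^ (2 * β))

theorem contDiffAt_tame (m β : ℝ) {x : Plane} (hx : A.eqn x ≠ 0) {n : ℕ∞ω} :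
    ContDiffAt ℝ n (A.tame m β) x :=
  contDiffAt_conePotential (A.analyticAt_eqn x) hx
    (contDiffAt_basePot m (p := (x, ‖A.eqn x‖ ^ (2 * β))) (by positivity))

theorem le_tame (m β : ℝ) (x : Plane) : m ≤ A.tame m β x := by
  have : 0 ≤ Real.log (1 + ‖x‖ ^ 2 + ‖A.eqn x‖ ^ (2 * β)) :=
    Real.log_nonneg (by have : 0 ≤ ‖x‖ ^ 2 + ‖A.eqn x‖ ^ (2 * β) := by positivity
                        linarith)
  simp only [tame, basePot]
  linarith

/-- As 2β ≤ 2, the argument of the logarithm is at most a multiple of |x|^{2d}. Hence the interior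
potential grows logarithmically and is overtaken by any positive power of |x|. -/
theorem exists_tame_le (m : ℝ) {β : ℝ} (hβ : 0 < β) (hβ1 : β < 1) : ∃ C, ∀ x : Plane, 1 ≤ ‖x‖ →
    A.tame m β x ≤ C + 2 * d * Real.log ‖x‖ := by
  obtain ⟨C, hC, h⟩ := A.exists_norm_eqn_le
  refine ⟨Real.log (3 + C ^ 2) + m, fun x hx => ?_⟩
  have h0 : 0 < ‖x‖ := by linarith
  have h1 : ‖A.eqn x‖ ^ (2 * β) ≤ 1 + ‖A.eqn x‖ ^ 2 := by
    rcases le_total ‖A.eqn x‖ 1 with h1 | h1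
    · have := Real.rpow_le_one (norm_nonneg _) h1 (by positivity : 0 ≤ 2 * β)
      nlinarith [sq_nonneg ‖A.eqn x‖]
    · have := Real.rpow_le_rpow_of_exponent_le h1 (by push_cast; linarith : 2 * β ≤ (2 : ℕ))
      rw [Real.rpow_natCast] at this
      linarith
  have h2 : ‖A.eqn x‖ ^ 2 ≤ C ^ 2 * ‖x‖ ^ (2 * d) := by
    rw [mul_comm 2 d, pow_mul, ← mul_pow]
    exact pow_le_pow_left₀ (norm_nonneg _) (h x hx) 2
  have h3 : ‖x‖ ^ 2 ≤ ‖x‖ ^ (2 * d) := pow_le_pow_right₀ hx (by have := A.two_le; omega)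
  have h4 : 1 ≤ ‖x‖ ^ (2 * d) := one_le_pow₀ hx
  have h5 : 1 + ‖x‖ ^ 2 + ‖A.eqn x‖ ^ (2 * β) ≤ (3 + C ^ 2) * ‖x‖ ^ (2 * d) := by nlinarith
  have h6 : Real.log (1 + ‖x‖ ^ 2 + ‖A.eqn x‖ ^ (2 * β)) ≤
      Real.log (3 + C ^ 2) + 2 * d * Real.log ‖x‖ := by
    refine (Real.log_le_log (by positivity) h5).trans (le_of_eq ?_)
    rw [Real.log_mul (by positivity) (by positivity), Real.log_pow]
    push_cast; ring
  simp only [tame, basePot]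
  linarith

end AsymCurve

theorem exists_log_le_rpow {a b c e : ℝ} (hc : 0 < c) (he : 0 < e) :
    ∃ R, ∀ t, R < t → a + b * Real.log t ≤ e * t ^ c := by
  have h1 := (isLittleO_log_rpow_atTop hc).bound (by positivity : 0 < e / (2 * (|b| + 1)))
  have h2 := ((tendsto_rpow_atTop hc).eventually_ge_atTop (2 * |a| / e))
  obtain ⟨R, hR⟩ := (h1.and (h2.and (Filter.eventually_gt_atTop 0))).exists_forall_of_atTop
  refine ⟨R, fun t ht => ?_⟩
  obtain ⟨h3, h4, h5⟩ := hR t ht.le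
  rw [Real.norm_eq_abs, Real.norm_of_nonneg (by positivity)] at h3
  have h6 : b * Real.log t ≤ |b| * |Real.log t| := by
    rw [← abs_mul]; exact le_abs_self _
  have h7 : |b| * |Real.log t| ≤ e / 2 * t ^ c := by
    have h8 : |b| * (e / (2 * (|b| + 1)) * t ^ c) ≤ e / 2 * t ^ c := by
      have : |b| * (e / (2 * (|b| + 1)) * t ^ c) = (|b| / (|b| + 1)) * (e / 2 * t ^ c) := by
        field_simp
      rw [this]
      refine mul_le_of_le_one_left (by positivity) ((div_le_one (by positivity)).2 (by linarith))
    exact (mul_le_mul_of_nonneg_left h3 (abs_nonneg b)).trans h8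
  have h8 : |a| ≤ e / 2 * t ^ c := by
    rw [div_le_iff₀ he] at h4
    linarith
  have := le_abs_self a
  linarith

namespace Straightening

variable {d : ℕ} {A : AsymCurve d} (S : Straightening A) {β c : ℝ} {F : Plane → ℝ}

/-- This provides the constant to be added to the interior potential so that it dominates the outer
one on a shell. The flat part is bounded by homogeneity even close to the lines, and the transversal
part by continuity. -/
theorem exists_outer_le (hF : FlatModel β c A.ℓ F) (hβ : 0 < β) (hβ1 : β < 1) (hc : 0 ≤ c)
    {R : ℝ} (hR : S.R < R) : ∃ m, 0 ≤ m ∧ ∀ x, R ≤ ‖x‖ → ‖x‖ ≤ R + 1 → S.H x ∈ offLines A.ℓ →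
      S.outer c F x ≤ m := by
  obtain ⟨c₁, hc₁, c₂, hc₂, c₀, hc₀, hb⟩ := hF.bounds hβ hβ1
  have hne : ∀ x, R ≤ ‖x‖ → S.H x ≠ 0 := fun x hx => by
    have h1 := S.le_norm x (hR.trans_le hx)
    have h2 := S.one_le
    exact norm_pos_iff.1 (by linarith)
  have hK : IsCompact (Metric.closedBall (0 : Plane) (R + 1) ∩ {x | R ≤ ‖x‖}) :=
    (isCompact_closedBall _ _).inter_right (isClosed_le continuous_const continuous_norm)
  obtain ⟨C, hC, hT⟩ := exists_bound_of_continuousOn hK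
    (f := fun x => A.transv c (S.H x)) fun x hx =>
      ContinuousAt.comp (g := A.transv c) (A.contDiffAt_transv c (hne x hx.2)).continuousAt
        S.contDiff_H.continuous.continuousAt
  have hR0 : 0 < R := by linarith [S.one_le]
  refine ⟨c₂ * (2 * (R + 1)) ^ c + C, by positivity, fun x h1 h2 h3 => ?_⟩
  have h4 := (hb _ h3 (hne x h1)).2.1
  have h5 : c₂ * ‖S.H x‖ ^ c ≤ c₂ * (2 * (R + 1)) ^ c := by
    gcongr
    linarith [S.norm_le x (hR.trans_le h1)]
  have h6 := (le_abs_self _).trans (hT x ⟨by simpa using h2, h1⟩)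
  rw [outer]
  linarith

theorem exists_tame_le_outer (hF : FlatModel β c A.ℓ F) (hβ : 0 < β) (hβ1 : β < 1) (hc : 0 < c)
    (m : ℝ) : ∃ R, ∀ x, R < ‖x‖ → S.H x ∈ offLines A.ℓ → A.tame m β x + 1 ≤ S.outer c F x := by
  obtain ⟨c₁, hc₁, c₂, hc₂, c₀, hc₀, hb⟩ := hF.bounds hβ hβ1
  obtain ⟨C, hC⟩ := A.exists_tame_le m hβ hβ1
  obtain ⟨R, hR⟩ := exists_log_le_rpow (a := C + 1) (b := 2 * d) hc
    (by positivity : 0 < c₁ * (2⁻¹ : ℝ) ^ c)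
  refine ⟨max R S.R, fun x hx hH => ?_⟩
  have hxR : S.R < ‖x‖ := (le_max_right _ _).trans_lt hx
  have h1 := S.le_norm x hxR
  have h0 := S.one_le
  have hne : S.H x ≠ 0 := norm_pos_iff.1 (by linarith)
  have h2 := (hb _ hH hne).1
  have h3 := hR ‖x‖ ((le_max_left _ _).trans_lt hx)
  have h4 := hC x (by linarith)
  have h5 : c₁ * (2⁻¹ : ℝ) ^ c * ‖x‖ ^ c ≤ c₁ * ‖S.H x‖ ^ c := by
    rw [mul_assoc, ← Real.mul_rpow (by norm_num) (norm_nonneg _)]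
    gcongr
    linarith
  have h6 := A.transv_nonneg c (S.H x)
  rw [outer]
  linarith

/-- A global potential, which is the interior one on a compact set and the exterior one at infinity. -/
theorem exists_potential (hF : FlatModel β c A.ℓ F) (hβ : 0 < β) (hβ1 : β < 1) (hc : 0 < c)
    {R : ℝ} (hR : S.R < R) (hout : ∀ x, R ≤ ‖x‖ → A.eqn x ≠ 0 →
      S.H x ∈ offLines A.ℓ ∧ StrictPsh (S.outer c F) x) :
    ∃ φ : Plane → ℝ,
      (∀ x, A.eqn x ≠ 0 → ContDiffAt ℝ ∞ φ x ∧ StrictPsh φ x) ∧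
      (∀ p, A.eqn p = 0 → ∃ G : Plane × ℝ → ℝ, ContDiffAt ℝ 4 G (p, 0) ∧
        StrictPsh (fun y => G (y, 0)) p ∧ 0 < fderiv ℝ G (p, 0) (0, 1) ∧
        ∀ᶠ x in 𝓝 p, A.eqn x ≠ 0 → φ x = G (x, ‖A.eqn x‖ ^ (2 * β))) ∧
      ∃ R' m : ℝ, ∀ x, R' < ‖x‖ → A.eqn x ≠ 0 → φ x = S.outer c F x + m := by
  classical
  obtain ⟨m, hm0, hm⟩ := S.exists_outer_le hF hβ hβ1 hc.le hR
  obtain ⟨R', hR'⟩ := S.exists_tame_le_outer hF hβ hβ1 hc m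
  -- On the shell R ≤ |x| ≤ R + 1 the outer potential is at most m, hence at most the interior one,
  -- and the ramp vanishes. So the two formulas agree there, and the outer potential is never used
  -- where it is not controlled.
  set φ : Plane → ℝ := fun x => if ‖x‖ < R + 1 then A.tame m β x
    else glue (A.tame m β) (S.outer c F) x with hφ
  have hin : ∀ x, ‖x‖ < R + 1 → φ x = A.tame m β x := fun x hx => if_pos hx
  have hglue : ∀ x, R ≤ ‖x‖ → A.eqn x ≠ 0 → φ x = glue (A.tame m β) (S.outer c F) x := by
    intro x hx h0
    by_cases h : ‖x‖ < R + 1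
    · rw [hin x h, glue, ramp_of_nonpos, add_zero]
      linarith [hm x hx h.le (hout x hx h0).1, A.le_tame m β x]
    · exact if_neg h
  have hball : ∀ x : Plane, ‖x‖ < R + 1 → ∀ᶠ y : Plane in 𝓝 x, ‖y‖ < R + 1 := fun x hx =>
    continuous_norm.continuousAt.eventually (gt_mem_nhds hx)
  refine ⟨φ, fun x h0 => ?_, fun p h0 => ?_, max R R', ramp 1 - 1, fun x hx h0 => ?_⟩
  · rcases lt_or_ge ‖x‖ (R + 1) with hx | hx
    · have he : φ =ᶠ[𝓝 x] A.tame m β := (hball x hx).mono hin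
      refine ⟨(A.contDiffAt_tame m β h0).congr_of_eventuallyEq he, fun v hv => ?_⟩
      rw [rlev_eventuallyEq he]
      exact strictPsh_basePot (A.analyticAt_eqn x) h0 β m v hv
    · have hRx : R < ‖x‖ := by linarith
      have he : φ =ᶠ[𝓝 x] glue (A.tame m β) (S.outer c F) := by
        filter_upwards [eventually_norm_lt hRx, A.eqn_eventually_ne h0] with y h1 h2
        exact hglue y h1.le h2
      obtain ⟨h1, h2⟩ := hout x hRx.le h0
      have h3 := S.contDiffAt_outer hF h1
      refine ⟨(contDiffAt_glue (n := ⊤) (A.contDiffAt_tame m β h0) h3).congr_of_eventuallyEq he,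
        fun v hv => ?_⟩
      rw [rlev_eventuallyEq he]
      exact strictPsh_glue (A.contDiffAt_tame m β h0) (h3.of_le two_le_infty)
        (strictPsh_basePot (A.analyticAt_eqn x) h0 β m) h2 v hv
  · rcases lt_or_ge ‖p‖ (R + 1) with hp | hp
    · exact ⟨basePot m, contDiffAt_basePot m le_rfl, strictPsh_basePot_zero m p,
        fderiv_basePot_pos m p, (hball p hp).mono fun x hx _ => hin x hx⟩
    · have hRp : R < ‖p‖ := by linarith
      obtain ⟨k, hk⟩ := S.near_of_eqn p (hR.trans hRp) h0
      obtain ⟨U, V, hU, hV, hUp, hVp, hUV⟩ := S.exists_outer_expansion hF ⟨hR.trans hRp, hk⟩ h0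
      -- At a curve point both the interior and the outer potential are smooth functions of x and
      -- |P|^{2β}, hence so is their regularized maximum.
      refine ⟨gluedModel m U V, (contDiffAt_gluedModel m hU hV).of_le four_le_infty,
        strictPsh_gluedModel m V hU hUp, fderiv_gluedModel_pos m hU hV hVp, ?_⟩
      filter_upwards [eventually_norm_lt hRp, hUV] with x h1 h2 h3
      rw [hglue x h1.le h3, gluedModel, glue, glue, h2 h3]
      rfl
  · have hx1 := (le_max_left _ _).trans_lt hx
    have h1 := hR' x ((le_max_right _ _).trans_lt hx) (hout x hx1.le h0).1
    rw [hglue x hx1.le h0, glue, ramp_of_one_le (by linarith)]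
    ring

/-- The metric defined by the global potential has bisectional curvature bounded above. -/
theorem exists_bisec_bound (hF : FlatModel β c A.ℓ F) (hβ : 0 < β) {φ : Plane → ℝ}
    (hsm : ∀ x, A.eqn x ≠ 0 → ContDiffAt ℝ ∞ φ x ∧ StrictPsh φ x)
    (hcurve : ∀ p, A.eqn p = 0 → ∃ G : Plane × ℝ → ℝ, ContDiffAt ℝ 4 G (p, 0) ∧
        StrictPsh (fun y => G (y, 0)) p ∧ 0 < fderiv ℝ G (p, 0) (0, 1) ∧
        ∀ᶠ x in 𝓝 p, A.eqn x ≠ 0 → φ x = G (x, ‖A.eqn x‖ ^ (2 * β)))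
    {R m B₁ : ℝ} (hinf : ∀ x, R < ‖x‖ → A.eqn x ≠ 0 → φ x = S.outer c F x + m)
    (hfar : ∀ x, R < ‖x‖ → (∀ k, x ∉ S.near k) → ∀ (φ : Plane → ℝ) (m : ℝ) (κ : Plane → TwoForm),
        (φ =ᶠ[𝓝 x] fun y => S.outer c F y + m) →
        (κ =ᶠ[𝓝 x] fun y => (1 / 2 : ℝ) • iddbar φ y) → ∀ v w,
        hermNormSq (κ x) v = 1 → hermNormSq (κ x) w = 1 → bisec κ x v w ≤ B₁) :
    ∃ B, 0 < B ∧ BisecLE (fun x => (1 / 2 : ℝ) • iddbar φ x) (curve A.P)ᶜ B := by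
  set κ : Plane → TwoForm := fun x => (1 / 2 : ℝ) • iddbar φ x with hκ
  let p : ℝ → Unit × Plane → Prop := fun B q => A.eqn q.2 ≠ 0 → ∀ v w,
    hermNormSq (κ q.2) v = 1 → hermNormSq (κ q.2) w = 1 → bisec κ q.2 v w ≤ B
  -- The parameter space is a point, so this is plain compactness of the closed ball, for which
  -- local bounds at and off the curve are enough.
  obtain ⟨B, hB⟩ : ∃ B, ∀ᶠ u in 𝓝 (), ∀ y ∈ Metric.closedBall (0 : Plane) R, p B (u, y) := by
    refine exists_uniform_bound (isCompact_closedBall _ _)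
      (fun B B' q hBB h h0 v w hv hw => (h h0 v w hv hw).trans hBB) fun y _ => ?_
    suffices h : ∃ B, ∀ᶠ x in 𝓝 y, p B ((), x) by
      obtain ⟨B, hB⟩ := h
      exact ⟨B, (continuousAt_snd (p := ((), y))).eventually hB⟩
    by_cases h0 : A.eqn y = 0
    · obtain ⟨G, hG, hG0, hGρ, hφG⟩ := hcurve y h0
      obtain ⟨B, hB, hb⟩ := bisec_le_near_curve (A.analyticAt_eqn y) h0 hβ hG hG0 hGρ
      refine ⟨B, ?_⟩
      filter_upwards [hb, hφG.eventually_nhds] with x h1 h2 h3 v w hv hw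
      have h4 : φ =ᶠ[𝓝 x] fun y => G (y, ‖A.eqn y‖ ^ (2 * β)) := by
        filter_upwards [h2, A.eqn_eventually_ne h3] with z h5 h6
        exact h5 h6
      exact (h1 h3 φ h4).2 κ Filter.EventuallyEq.rfl v w hv hw
    · have h4 : ContDiffAt ℝ 4 φ y := (hsm y h0).1.of_le four_le_infty
      obtain ⟨B, hB, hb⟩ := (hsm y h0).2.eventually_curvLE h4
      refine ⟨2 * B, ?_⟩
      filter_upwards [hb] with x h1 h3 v w hv hw
      -- Off the curve φ is its own ambient potential, with the identity as immersion.
      exact bisec_le_of_pullback (A := φ) (ι := fun y => y) (r := 1) (m := 0)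
        Filter.EventuallyEq.rfl (Filter.Eventually.of_forall fun y => by simp) analyticAt_id
        ((hsm x h3).1.of_le four_le_infty) (hsm x h3).2 h1 le_rfl hB.le v w hv hw
  have hB' := hB.self_of_nhds
  refine ⟨max B (max B₁ 0) + 1, by positivity, fun x hx v w hv hw => ?_⟩
  have h0 : A.eqn x ≠ 0 := hx
  have m1 := le_max_left B (max B₁ 0)
  have m2 := (le_max_left B₁ 0).trans (le_max_right B (max B₁ 0))
  have m3 := (le_max_right B₁ 0).trans (le_max_right B (max B₁ 0))
  rcases le_or_gt ‖x‖ R with hxR | hxR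
  · have := hB' x (by simpa using hxR) h0 v w hv hw
    linarith
  · have hev : φ =ᶠ[𝓝 x] fun y => S.outer c F y + m := by
      filter_upwards [eventually_norm_lt hxR, A.eqn_eventually_ne h0] with y h1 h2
      exact hinf y h1 h2
    by_cases hn : ∀ k, x ∉ S.near k
    · have := hfar x hxR hn φ m κ hev Filter.EventuallyEq.rfl v w hv hw
      linarith
    · push Not at hn
      obtain ⟨k, hk⟩ := hn
      have := S.bisec_le_near_infinity hF hk h0 hev Filter.EventuallyEq.rfl hv hw
      linarith

end Straightening

end

/-! ### Asymptotics of the metric and conclusion -/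

section

theorem asymptoticLines_compl {d : ℕ} (A : AsymCurve d) :
    (asymptoticLines A.P d)ᶜ = offLines A.ℓ := by
  ext x
  rw [Set.mem_compl_iff, A.mem_asymptoticLines_iff]
  simp [offLines]

namespace Straightening

variable {d : ℕ} {A : AsymCurve d} (S : Straightening A) {β c : ℝ} {F : Plane → ℝ}

/-- At infinity the push-forward of the metric is asymptotic to the flat one. -/
theorem exists_decay (hF : FlatModel β c A.ℓ F) (hβ : 0 < β) (hβ1 : β < 1) (hc : 0 < c)
    (hc3 : c ≤ 3) {φ : Plane → ℝ} {R m : ℝ}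
    (hinf : ∀ x, R < ‖x‖ → A.eqn x ≠ 0 → φ x = S.outer c F x + m)
    (hne : ∀ x, R < ‖x‖ → S.H x ∈ offLines A.ℓ → A.eqn x ≠ 0) :
    ∃ (C : ℝ) (K : Set Plane), IsCompact K ∧ ∀ y, y ∉ K → y ∈ offLines A.ℓ → ∀ v w : Plane,
      |(pullback S.H.symm (fun x => (1 / 2 : ℝ) • iddbar φ x) y - (1 / 2 : ℝ) • iddbar F y) ![v, w]| ≤
        C * √(F y) ^ (-2 / c) * vecNorm ((1 / 2 : ℝ) • iddbar F y) v *
          vecNorm ((1 / 2 : ℝ) • iddbar F y) w := by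
  obtain ⟨R₁, hR₁, C, hC, hD⟩ := S.exists_leviDefect_le hF hc3
  obtain ⟨c₁, hc₁, c₂, hc₂, c₀, hc₀, hb⟩ := hF.bounds hβ hβ1
  set Q := max R R₁
  -- The factor 1/c₀ converts |y|^{c-2}|v||w| into flat lengths, and c₂^{1/c} converts 1/|y| into
  -- (√F)^{-2/c}. The compact set is the image of a ball, so that the preimage of y lies far out.
  refine ⟨C / c₀ * c₂ ^ (1 / c), S.H '' Metric.closedBall 0 Q,
    (isCompact_closedBall _ _).image S.contDiff_H.continuous, fun y hyK hy v w => ?_⟩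
  set x := S.H.symm y with hx
  have hHx : S.H x = y := S.H.apply_symm_apply y
  have hxQ : Q < ‖x‖ := by
    by_contra! h
    exact hyK ⟨x, by simpa using h, hHx⟩
  have hxR := (le_max_left _ _).trans_lt hxQ
  have hxR₁ := (le_max_right _ _).trans_lt hxQ
  have hHo : S.H x ∈ offLines A.ℓ := by rw [hHx]; exact hy
  have h0 := hne x hxR hHo
  have hy0 : y ≠ 0 := ne_zero_of_mem_offLines (by have := A.two_le; omega) hy
  have hyn : 0 < ‖y‖ := norm_pos_iff.2 hy0
  have hF2 : ContDiffAt ℝ 2 F y := hF.contDiffAt hy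
  have hev : φ =ᶠ[𝓝 x] fun y => S.outer c F y + m := by
    filter_upwards [eventually_norm_lt hxR, A.eqn_eventually_ne h0] with z h1 h2
    exact hinf z h1 h2
  have ho2 : ContDiffAt ℝ 2 (S.outer c F) x := (S.contDiffAt_outer hF hHo).of_le two_le_infty
  have hφ2 : ContDiffAt ℝ 2 φ x := (ho2.add contDiffAt_const).congr_of_eventuallyEq hev
  have hφl : ∀ a b, rlev φ x a b = rlev (S.outer c F) x a b := fun a b => by
    rw [rlev_eventuallyEq hev, rlev_const_add ho2]
  set a := fderiv ℝ S.H.symm y v with ha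
  set b := fderiv ℝ S.H.symm y w with hbdef
  have ea : fderiv ℝ S.H x a = v := S.fderiv_H_symm y v
  have eb : fderiv ℝ S.H x b = w := S.fderiv_H_symm y w
  have herr : (pullback S.H.symm (fun x => (1 / 2 : ℝ) • iddbar φ x) y -
      (1 / 2 : ℝ) • iddbar F y) ![v, w] = -(S.leviDefect c F x a b).im := by
    have h1 : (pullback S.H.symm (fun x => (1 / 2 : ℝ) • iddbar φ x) y -
      (1 / 2 : ℝ) • iddbar F y) ![v, w] =
      (1 / 2 : ℝ) * iddbar φ x ![a, b] - (1 / 2 : ℝ) * iddbar F y ![v, w] := by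
      change pullback S.H.symm (fun x => (1 / 2 : ℝ) • iddbar φ x) y ![v, w] - _ = _
      rw [pullback_apply]
      rfl
    rw [h1, iddbar_eq_im hφ2, iddbar_eq_im hF2, hφl, leviDefect, ea, eb, hHx, Complex.sub_im]
    ring
  have h1 := hD x hxR₁ hHo a b
  rw [ea, eb, hHx] at h1
  have hlow : ∀ u, √c₀ * ‖y‖ ^ ((c - 2) / 2) * ‖u‖ ≤ vecNorm ((1 / 2 : ℝ) • iddbar F y) u := by
    intro u
    rw [vecNorm_half_iddbar hF2]
    apply Real.le_sqrt_of_sq_le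
    refine le_trans (le_of_eq ?_) ((hb y hy hy0).2.2 u)
    rw [mul_pow, mul_pow, Real.sq_sqrt hc₀.le, ← Real.rpow_natCast (‖y‖ ^ ((c - 2) / 2)),
      ← Real.rpow_mul hyn.le]
    congr 3
    push_cast; ring
  have hdist : ‖y‖⁻¹ ≤ c₂ ^ (1 / c) * √(F y) ^ (-2 / c) := by
    have hFpos := hF.pos hy
    have e1 : √(F y) ^ (-2 / c) = F y ^ (-(1 / c)) := by
      rw [Real.sqrt_eq_rpow, ← Real.rpow_mul hFpos.le]
      congr 1; ring
    have e2 : (c₂ * ‖y‖ ^ c) ^ (-(1 / c)) ≤ F y ^ (-(1 / c)) :=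
      Real.rpow_le_rpow_of_nonpos hFpos (hb y hy hy0).2.1 (by
        have : 0 < 1 / c := by positivity
        linarith)
    rw [Real.mul_rpow hc₂.le (by positivity), ← Real.rpow_mul hyn.le] at e2
    have e3 : c * -(1 / c) = -1 := by field_simp
    rw [e3, Real.rpow_neg_one, Real.rpow_neg hc₂.le] at e2
    rw [e1]
    have e4 : 0 < c₂ ^ (1 / c) := by positivity
    calc ‖y‖⁻¹ = c₂ ^ (1 / c) * ((c₂ ^ (1 / c))⁻¹ * ‖y‖⁻¹) := by field_simp
      _ ≤ _ := by gcongr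
  rw [herr, abs_neg]
  refine (Complex.abs_im_le_norm _).trans (h1.trans ?_)
  set s := ‖y‖ ^ ((c - 2) / 2) with hs
  have hs0 : 0 < s := by positivity
  have e5 : ‖y‖ ^ (c - 3) = ‖y‖⁻¹ * (s * s) := by
    rw [hs, ← Real.rpow_neg_one, ← Real.rpow_add hyn, ← Real.rpow_add hyn]
    congr 1; ring
  have e6 : √c₀ * √c₀ = c₀ := Real.mul_self_sqrt hc₀.le
  have hvn : 0 ≤ vecNorm ((1 / 2 : ℝ) • iddbar F y) v := Real.sqrt_nonneg _
  calc C * ‖y‖ ^ (c - 3) * ‖v‖ * ‖w‖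
      = C / c₀ * ‖y‖⁻¹ * ((√c₀ * s * ‖v‖) * (√c₀ * s * ‖w‖)) := by
        have : (√c₀ * s * ‖v‖) * (√c₀ * s * ‖w‖) = (√c₀ * √c₀) * (s * s) * ‖v‖ * ‖w‖ := by ring
        rw [this, e6, e5]
        field_simp
    _ ≤ C / c₀ * (c₂ ^ (1 / c) * √(F y) ^ (-2 / c)) *
        (vecNorm ((1 / 2 : ℝ) • iddbar F y) v * vecNorm ((1 / 2 : ℝ) • iddbar F y) w) := by
        gcongr
        · exact hlow v
        · exact hlow w
    _ = _ := by ring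

end Straightening

/-- For an affine curve with distinct asymptotic lines, and a homogeneous flat potential with cone
singularities along these lines, there is a metric with cone singularities along the curve, with
bisectional curvature bounded above, which is asymptotic to the flat metric. -/
theorem exists_reference_metric {d : ℕ} (A : AsymCurve d) (hC : IsSmoothCurve A.P) {β c : ℝ}
    {F : Plane → ℝ} (hF : FlatModel β c A.ℓ F) (hβ : 0 < β) (hβ1 : β < 1) (hc : 0 < c)
    (hc3 : c ≤ 3) :
    ∃ (H : Plane ≃ₘ^∞⟮𝓘(ℝ, Plane), 𝓘(ℝ, Plane)⟯ Plane) (κ : Plane → TwoForm),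
      IsAsymptoticDiffeo (curve A.P) (asymptoticLines A.P d) H ∧
      IsKahlerWithConeSingularities (curve A.P) β κ ∧
      (∃ (C : ℝ) (K : Set Plane), IsCompact K ∧ ∀ y, y ∉ K → y ∈ offLines A.ℓ → ∀ v w : Plane,
        |(pullback H.symm κ y - (1 / 2 : ℝ) • iddbar F y) ![v, w]| ≤
          C * √(F y) ^ (-2 / c) * vecNorm ((1 / 2 : ℝ) • iddbar F y) v *
            vecNorm ((1 / 2 : ℝ) • iddbar F y) w) ∧
      ∃ B : ℝ, 0 < B ∧ BisecLE κ (curve A.P)ᶜ B := by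
  obtain ⟨S, hS⟩ := A.exists_straightening
  obtain ⟨R, hR, B, hfar⟩ := S.exists_far_bound hF hc.le
  have hout : ∀ x, R + 1 ≤ ‖x‖ → A.eqn x ≠ 0 →
      S.H x ∈ offLines A.ℓ ∧ StrictPsh (S.outer c F) x := by
    intro x hx h0
    by_cases hn : ∀ k, x ∉ S.near k
    · have h1 := hfar x (by linarith) hn
      exact ⟨h1.1, h1.2.1⟩
    · push Not at hn
      obtain ⟨k, hk⟩ := hn
      exact ⟨S.H_mem_offLines hk h0, S.strictPsh_outer_near hF hk h0⟩
  obtain ⟨φ, hsm, hcurve, R', m, hinf⟩ :=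
    S.exists_potential hF hβ hβ1 hc (R := R + 1) (by linarith) hout
  set Q := max R R'
  have hQR : R ≤ Q := le_max_left _ _
  have hinf' : ∀ x, Q < ‖x‖ → A.eqn x ≠ 0 → φ x = S.outer c F x + m := fun x hx =>
    hinf x ((le_max_right _ _).trans_lt hx)
  refine ⟨S.H, fun x => (1 / 2 : ℝ) • iddbar φ x, hS, ⟨?_, ?_⟩, ?_, ?_⟩
  · exact isKahlerOn_iddbar (fun x hx => (hsm x hx).1) fun x hx => (hsm x hx).2
  · intro α hα0 hα1 hα p hp
    obtain ⟨G, hG, hG0, hGρ, hφG⟩ := hcurve p hp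
    refine hasConeFormAt_of_potential (f := A.eqn) A.mem_curve_iff (A.analyticAt_eqn p) hp
      (A.fderiv_eqn_ne_zero hC hp) hβ hα0 hα1 hα hG hG0 hGρ ?_
    filter_upwards [hφG.eventually_nhds] with x h1 h2
    have h3 : φ =ᶠ[𝓝 x] fun y => G (y, ‖A.eqn y‖ ^ (2 * β)) := by
      filter_upwards [h1, A.eqn_eventually_ne h2] with z h5 h6
      exact h5 h6
    rw [(iddbar_eventuallyEq h3).eq_of_nhds]
  -- A far point of the curve is mapped onto a line, so a point with image off the lines is off the
  -- curve.
  · refine S.exists_decay hF hβ hβ1 hc hc3 hinf' fun x hx hH h0 => ?_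
    have hxS : S.R < ‖x‖ := by linarith
    obtain ⟨k, hk⟩ := S.near_of_eqn x hxS h0
    refine hH k ?_
    rw [(S.wedge_H (k := k) ⟨hxS, hk⟩).1, h0, zero_div]
  · exact S.exists_bisec_bound hF hβ hsm hcurve hinf' fun x hx hn =>
      (hfar x (hQR.trans_lt hx) hn).2.2

end

end ConeMetrics

end

theorem proposition3p1 (d : ℕ) (hd : 2 ≤ d) (P : MvPolynomial (Fin 2) ℂ)
    (hdeg : P.totalDegree = d) (hC : IsSmoothCurve P) (hL : HasDistinctAsymptoticLines P d)
    (β : ℝ) (hβ : ((d : ℝ) - 2) / d < β) (hβ' : β < 1)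
    (h : Plane → ℝ) (hh : IsSphericalConeMetric (asymptoticLines P d) β h) :
    ∃ (H : Plane ≃ₘ^∞⟮𝓘(ℝ, Plane), 𝓘(ℝ, Plane)⟯ Plane) (κ κref : Plane → TwoForm),
      IsAsymptoticDiffeo (curve P) (asymptoticLines P d) H ∧
      IsKahlerWithConeSingularities (curve P) β κ ∧
      IsKahlerWithConeSingularities (curve P) β κref ∧
      -- the decay `|(H⁻¹)^* κ - κ_F|_{g_F} = O (r^{-2/c})`
      (∃ (A : ℝ) (K : Set Plane), IsCompact K ∧ ∀ y, y ∉ K → y ∉ asymptoticLines P d →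
        ∀ v w : Plane,
          |(pullback H.symm κ y - flatForm P d β h y) ![v, w]| ≤
            A * distZero (flatForm P d β h) (asymptoticLines P d)ᶜ y ^ (-2 / coneExp d β) *
              vecNorm (flatForm P d β h y) v * vecNorm (flatForm P d β h y) w) ∧
      (∃ B : ℝ, 0 < B ∧ BisecLE κref (curve P)ᶜ B) ∧
      (∃ Q : ℝ, 0 < Q ∧ ∀ x, x ∉ curve P → ∀ v : Plane,
        Q⁻¹ * κref x ![v, Complex.I • v] ≤ κ x ![v, Complex.I • v] ∧
        κ x ![v, Complex.I • v] ≤ Q * κref x ![v, Complex.I • v]) := by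
  have hd0 : (0 : ℝ) < d := by positivity
  have hd2 : (2 : ℝ) ≤ d := by exact_mod_cast hd
  have hβ0 : 0 < β := lt_of_le_of_lt (div_nonneg (by linarith) hd0.le) hβ
  have hβd : (d : ℝ) - 2 < β * d := (div_lt_iff₀ hd0).1 hβ
  have hc : 0 < coneExp d β := by unfold coneExp; linarith
  -- In fact c < 2 because β < 1; the decay estimate needs only that the exponent c - 3 is not
  -- positive.
  have hc3 : coneExp d β ≤ 3 := by unfold coneExp; nlinarith
  obtain ⟨A, rfl⟩ := exists_asymCurve hd hdeg hL
  have hF := flatModel_of_spherical hd hβ0 hβ' hc A.c₀_ne A.wedge_ne A.top_eq hh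
  obtain ⟨H, κ, hH, hκ, ⟨C, K, hK, hdecay⟩, hB⟩ :=
    exists_reference_metric A hC hF hβ0 hβ' hc hc3
  -- The metric κ is its own reference metric, with comparison constant 1.
  refine ⟨H, κ, κ, hH, hκ, hκ, ⟨C, K, hK, fun y hyK hyL v w => ?_⟩, hB, 1, one_pos,
    fun x _ v => by simp⟩
  have hy : y ∈ offLines A.ℓ := by rw [← asymptoticLines_compl]; exact hyL
  have hdist : distZero (flatForm A.P d β h) (offLines A.ℓ) y = √(flatPotential A.P d β h y) :=
    hF.distZero_eq (by omega) hβ0 hβ' hc hy fun x => rfl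
  rw [asymptoticLines_compl, hdist]
  exact hdecay y hyK hy v w
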